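/- Let $\pi$ be a group and $w:\pi\to\{\pm1\}$ a homomorphism. **Diagrams.** A \emph{Gauss diagram on $\pi$} of degree $n$ is an oriented circle with $2n$ marked points joined in pairs by $n$ abstract oriented arrows, each with a sign $\pm1$, and with an element of $\pi$ on each of the $2n$ edges of the circle (for $n=0$: a single conjugacy class of $\pi$), up to orientation-preserving homeomorphism. An \emph{arrow diagram} is a Gauss diagram whose signs are forgotten. The group $\operatorname{Aut}$ of symmetries of a diagram is the group of rotations of the $2n$ points that preserve a given representative (trivial for $n=0$). Removing arrows from a Gauss diagram gives a \emph{subdiagram}; edges that merge are decorated with the product of their decorations (up to conjugacy if no arrow is left), and $I(G)$ is the formal sum of all $2^n$ subdiagrams of $G$. \emph{Series} are formal, possibly infinite, $\mathbb Q$-linear combinations of diagrams of bounded degree, and $\langle D,D'\rangle=|\operatorname{Aut}(D)|$ if $D=D'$ and $0$ otherwise. **Moves.** An $\mathrm R_1$-move removes (or adds) an arrow whose two ends bound an edge decorated by $1$. An $\mathrm R_2$-move removes (or adds) two arrows of opposite signs whose tails bound an edge decorated by $1$ and whose heads bound an edge decorated by $1$. In both, edges merge by multiplication. For an edge $e$ bounded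 by the ends of two different arrows let $\mathrm w(e)$ be the product of the signs of these arrows, $\uparrow(e)$ the number of arrowheads at the ends of $e$, and $\varepsilon(e)=\eta(e)(-1)^{\uparrow(e)}$ with $\eta(e)=1$ if the two arrows cross and $-1$ otherwise. An $\mathrm R_3$-move exchanges the two ends of each of three disjoint edges decorated by $1$ that are bounded by the ends of three arrows, any two of the edges being joined by one of the arrows, provided that $\mathrm w(e)\varepsilon(e)$ is the same for the three edges and that the three values $\uparrow(e)$ are pairwise different. A \emph{$w$-move} chooses an arrow and $g\in\pi$; at each of the two ends of the arrow it multiplies the decoration of the incoming edge on the right by $g$ and that of the outgoing edge on the left by $g^{-1}$, and it reverses the arrow (keeping its sign) if and only if $w(g)=-1$. Two Gauss diagrams have the same \emph{virtual knot type} on $(\pi,w)$ if they are related by $\mathrm R$-moves and $w$-moves. **Arrow diagram formulas.** For an arrow diagram $A$ let $S(A)=\sum_G \operatorname{sign}(G)\frac{|\operatorname{Aut}(A)|}{|\operatorname{Aut}(G)|}\,G$, where $G$ runs over the Gauss diagrams with underlying arrow diagram $A$ and $\operatorname{sign}(G)$ is the product of all the signs of $G$; extend $S$ componentwise to series. A series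 $\mathcal A$ of arrow diagrams is an \emph{arrow diagram formula} if $G\mapsto\langle S(\mathcal A),I(G)\rangle$ is an invariant of virtual knot types on $(\pi,w)$. **$w$-orbits.** A $w$-orbit is an equivalence class of (arrow, based, degenerate) diagrams under $w$-moves; $\operatorname{Aut}$ of a $w$-orbit $\alpha$ is the group of rotations that preserve the class under $w$-moves of a given representative. Let $\mathrm S_{aw}^a(\alpha)=\sum_{A\in\alpha}\frac{|\operatorname{Aut}(\alpha)|}{|\operatorname{Aut}(A)|}A$, extended componentwise to series, and let $\mathrm T_{aw}^a$ send an arrow diagram to its $w$-orbit, extended linearly. A \emph{based} diagram is an arrow diagram with a distinguished edge, the base edge; it is \emph{nice} if the base edge is decorated by $1$ and bounded by the ends of two different arrows. A \emph{degenerate} diagram is the result of shrinking to a point an edge bounded by the ends of two different arrows; the $w$-moves of a degenerate diagram are as above, the two arrows that meet at the degenerate point being conjugated (and reversed if $w(g)=-1$) simultaneously by one element $g$ at their three end points. For a based $w$-orbit $\beta$, let $\delta_w(\beta)=0$ if $\beta$ contains no nice diagram (that is, if the base edge is bounded by the two ends of one arrow, or if there is no arrow); otherwise let $\delta_w(\beta)$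 be $\varepsilon$ of the base edge of a nice diagram in $\beta$ times the $w$-orbit of the degenerate diagram obtained by shrinking that edge. For a $w$-orbit $\alpha$ let $d_w(\alpha)=\sum_e\delta_w([A,e])$, where $A$ is a representative of $\alpha$ and $e$ runs over all the edges of $A$; extend $d_w$ componentwise to series. The \emph{triangle relations} are $D=E+F$ and $D'=E'+F'$, where the diagrams in a relation coincide except for the two arrows that meet at the degenerate point; these have the same three end points $x,y,z$ in all of them and are $x\to y,\ x\to z$ in $D$; $x\to y\to z$ in $E$; $x\to z\to y$ in $F$; and the same with all these arrows reversed in $D',E',F'$. **Theorem.** A series $\mathcal A$ of arrow diagrams on $\pi$ is an arrow diagram formula if and only if there is a series $\mathcal A_w$ of $w$-orbits of arrow diagrams such that 1. $\mathrm S_{aw}^a(\mathcal A_w)=\mathcal A$; 2. $d_w(\mathcal A_w)=0$ in the space of series of $w$-orbits of degenerate diagrams modulo the formal (possibly infinite) linear combinations of triangle relations; 3. $\langle\mathcal A_w,\mathrm T_{aw}^a(A)\rangle=0$ for each arrow diagram $A$ that has an arrow whose two ends bound an edge decorated by $1$ (the relations $\mathrm{AP}_1$), and for each arrow diagram $A$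 that has two arrows whose tails bound an edge decorated by $1$ and whose heads bound an edge decorated by $1$ (the relations $\mathrm{AP}_2^{(n-2),2}$). -/

import Mathlib

namespace GaussTheory

/-! ### Decorated circles -/

/-- `N` points on an oriented circle, numbered cyclically, with abstract oriented arrows
between them (`arr i j`: there is an arrow with tail `i` and head `j`), and a decoration in the
group `π` of each of the `N` edges: `mark i` decorates the edge that goes from the point `i` to
the next point `finRotate N i`.  When there is no point at all, the decoration of the circle is
`free`, an element of `π` up to conjugacy (for `N ≠ 0` the field `free` carries no data). -/
@[ext] structure Circ (π : Type*) [Group π] (N : ℕ) where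
  arr : Fin N → Fin N → Prop
  mark : Fin N → π
  free : N = 0 → ConjClasses π

/-- The group `ℤ/N` of rotations of the `N` points (the trivial group for `N = 0`). -/
abbrev Rot (N : ℕ) : Subgroup (Equiv.Perm (Fin N)) := Subgroup.zpowers (finRotate N)

namespace Circ

variable {π : Type*} [Group π] {N : ℕ}

/-- The points `i` and `j` are the two ends of an arrow. -/
def inc (X : Circ π N) (i j : Fin N) : Prop := X.arr i j ∨ X.arr j i

/-- Renumbering of the points; it is only used for rotations `σ ∈ Rot N`. -/
instance : MulAction (Equiv.Perm (Fin N)) (Circ π N) where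
  smul σ X := ⟨fun i j => X.arr (σ⁻¹ i) (σ⁻¹ j), fun i => X.mark (σ⁻¹ i), X.free⟩
  one_smul _ := rfl
  mul_smul _ _ _ := rfl

theorem smul_def (σ : Equiv.Perm (Fin N)) (X : Circ π N) :
    σ • X = ⟨fun i j => X.arr (σ⁻¹ i) (σ⁻¹ j), fun i => X.mark (σ⁻¹ i), X.free⟩ := rfl

/-- No arrow is a loop or has an opposite arrow. -/
def Asymm (X : Circ π N) : Prop := ∀ i j, X.arr i j → ¬ X.arr j i

/-- Each point is an end of exactly one arrow. -/
def IsArrow (X : Circ π N) : Prop := X.Asymm ∧ ∀ i, ∃! j, X.inc i j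

/-- Each point is an end of exactly one arrow, except for one point `c` (the degenerate point)
at which exactly two arrows meet. -/
def IsDeg (X : Circ π N) : Prop :=
  X.Asymm ∧ ∃ c, (∀ i, i ≠ c → ∃! j, X.inc i j) ∧
    ∃ j k, j ≠ k ∧ ∀ l, X.inc c l ↔ l = j ∨ l = k

theorem IsArrow.smul {X : Circ π N} (h : X.IsArrow) (σ : Equiv.Perm (Fin N)) :
    (σ • X).IsArrow := by
  refine ⟨fun i j => h.1 _ _, fun i => ?_⟩
  obtain ⟨j, hj, hu⟩ := h.2 (σ⁻¹ i)
  refine ⟨σ j, ?_, fun k hk => ?_⟩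
  · simpa [inc, smul_def] using hj
  · have := hu (σ⁻¹ k) hk
    rw [← this]; simp

theorem IsDeg.smul {X : Circ π N} (h : X.IsDeg) (σ : Equiv.Perm (Fin N)) :
    (σ • X).IsDeg := by
  obtain ⟨h1, c, h2, j, k, hjk, h3⟩ := h
  refine ⟨fun i j => h1 _ _, σ c, fun i hi => ?_, σ j, σ k, by simpa using hjk, fun l => ?_⟩
  · obtain ⟨j, hj, hu⟩ := h2 (σ⁻¹ i) (by rintro rfl; simp at hi)
    refine ⟨σ j, ?_, fun k hk => ?_⟩
    · simpa [inc, smul_def] using hj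
    · have := hu (σ⁻¹ k) hk
      rw [← this]; simp
  · have := h3 (σ⁻¹ l)
    rw [Equiv.Perm.inv_eq_iff_eq, Equiv.Perm.inv_eq_iff_eq] at this
    simpa [inc, smul_def] using this

/-! ### Conjugacy moves -/

/-- Conjugation at every point `i` by `g i`: the decoration of the edge that arrives at `i` is
multiplied on the right by `g i`, that of the edge that leaves `i` is multiplied on the left by
`(g i)⁻¹`, and the arrows at `i` are reversed if and only if `w (g i) = -1`.  It is only used
for maps `g` that are constant along the arrows. -/
def conj (w : π →* ℤˣ) (g : Fin N → π) (X : Circ π N) : Circ π N where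
  arr i j := if w (g i) = 1 then X.arr i j else X.arr j i
  mark i := (g i)⁻¹ * X.mark i * g (finRotate N i)
  free := X.free

/-- Equivalence under `w`-moves.  A `w`-move conjugates at the ends of one arrow (at the three
points of the two arrows that meet, if these meet at a degenerate point) by one element of `π`.
Moves on different arrows commute and moves on one arrow compose, so a sequence of
`w`-moves amounts to one conjugation by a map `g` that is constant along the arrows. -/
def WEquiv (w : π →* ℤˣ) (X Y : Circ π N) : Prop :=
  ∃ g : Fin N → π, (∀ i j, X.arr i j → g i = g j) ∧ Y = X.conj w g

theorem WEquiv.refl (w : π →* ℤˣ) (X : Circ π N) : WEquiv w X X :=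
  ⟨fun _ => 1, fun _ _ _ => rfl, by ext <;> simp [conj]⟩

theorem WEquiv.symm {w : π →* ℤˣ} {X Y : Circ π N} (h : WEquiv w X Y) : WEquiv w Y X := by
  obtain ⟨g, hg, rfl⟩ := h
  refine ⟨fun i => (g i)⁻¹, fun i j hij => ?_, ?_⟩
  · simp only [conj] at hij
    split_ifs at hij
    · exact congrArg _ (hg _ _ hij)
    · exact congrArg _ (hg _ _ hij).symm
  · ext i j
    · simp only [conj, map_inv, inv_eq_one]
      constructor
      · intro h
        have := hg _ _ h
        simp only [← this]
        split_ifs <;> exact h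
      · intro h
        by_cases h1 : w (g i) = 1
        · simpa [h1] using h
        · rw [if_neg h1] at h
          split_ifs at h with h2
          · rw [hg _ _ h] at h2
            exact absurd h2 h1
          · exact h
    · simp [conj, mul_assoc]
    · rfl

theorem WEquiv.trans {w : π →* ℤˣ} {X Y Z : Circ π N} (h : WEquiv w X Y) (h' : WEquiv w Y Z) :
    WEquiv w X Z := by
  obtain ⟨g, hg, rfl⟩ := h
  obtain ⟨k, hk, rfl⟩ := h'
  have hk' : ∀ i j, X.arr i j → k i = k j := by
    intro i j hij
    have hij' := hg _ _ hij
    by_cases h1 : w (g i) = 1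
    · exact hk i j (by simpa [conj, h1] using hij)
    · exact (hk j i (by simpa [conj, ← hij', h1] using hij)).symm
  refine ⟨fun i => g i * k i, fun i j hij => congrArg₂ _ (hg _ _ hij) (hk' _ _ hij), ?_⟩
  ext i j
  · have hne : (-1 : ℤˣ) ≠ 1 := by decide
    by_cases e : g i = g j
    · rcases Int.units_eq_one_or (w (k i)) with h2 | h2 <;>
        rcases Int.units_eq_one_or (w (g j)) with h1 | h1 <;> simp [conj, e, h1, h2, hne]
    · have e1 : ¬ X.arr i j := fun h => e (hg _ _ h)
      have e2 : ¬ X.arr j i := fun h => e (hg _ _ h).symm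
      simp [conj, e1, e2]
  · simp [conj, mul_assoc]
  · rfl

theorem rot_comm (ρ : Rot N) (i : Fin N) :
    (ρ : Equiv.Perm (Fin N))⁻¹ (finRotate N i) = finRotate N ((ρ : Equiv.Perm (Fin N))⁻¹ i) := by
  obtain ⟨σ, k, rfl⟩ := ρ
  have : Commute ((finRotate N ^ k)⁻¹) (finRotate N) :=
    ((Commute.refl (finRotate N)).zpow_left k).inv_left
  exact congrArg (fun τ : Equiv.Perm (Fin N) => τ i) this.eq

theorem WEquiv.smul {w : π →* ℤˣ} {X Y : Circ π N} (h : WEquiv w X Y) (ρ : Rot N) :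
    WEquiv w ((ρ : Equiv.Perm (Fin N)) • X) ((ρ : Equiv.Perm (Fin N)) • Y) := by
  obtain ⟨g, hg, rfl⟩ := h
  refine ⟨fun i => g ((ρ : Equiv.Perm (Fin N))⁻¹ i), fun i j hij => hg _ _ hij, ?_⟩
  ext i j
  · rfl
  · simp only [smul_def, conj, rot_comm]
  · rfl

/-! ### The sign of an edge -/

/-- The point `i` is an arrowhead. -/
def IsHead (X : Circ π N) (i : Fin N) : Prop := ∃ j, X.arr j i

/-- The chords `{a, a'}` and `{b, b'}` cross each other: exactly one of `b`, `b'` lies strictly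
between `a` and `a'`. -/
def Crosses (a a' b b' : Fin N) : Prop :=
  Xor (min a a' < b ∧ b < max a a') (min a a' < b' ∧ b' < max a a')

open scoped Classical in
/-- `η(e)` for the edge `e` from the point `e` to the next one: `1` if the two arrows that bound
it cross each other, `-1` otherwise. -/
noncomputable def eta (X : Circ π N) (e : Fin N) : ℤˣ :=
  if ∃ a b, X.inc e a ∧ X.inc (finRotate N e) b ∧ Crosses e a (finRotate N e) b then 1 else -1

open scoped Classical in
/-- The number of arrowheads at the boundary of the edge `e`. -/
noncomputable def up (X : Circ π N) (e : Fin N) : ℕ :=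
  (if X.IsHead e then 1 else 0) + (if X.IsHead (finRotate N e) then 1 else 0)

/-- `ε(e) = η(e) (-1)^{↑(e)}`. -/
noncomputable def eps (X : Circ π N) (e : Fin N) : ℤˣ := X.eta e * (-1) ^ X.up e

end Circ

/-! ### Gauss diagrams and arrow diagrams -/

section Diagrams

variable (π : Type*) [Group π]

/-- Rigid arrow diagrams on `π` with `N` arrow ends (hence of degree `N / 2`). -/
abbrev ArrowRigid (N : ℕ) := {X : Circ π N // X.IsArrow}

/-- Rigid degenerate arrow diagrams on `π` with `N` points (hence of degree `(N + 1) / 2`). -/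
abbrev DegRigid (N : ℕ) := {X : Circ π N // X.IsDeg}

/-- Rigid Gauss diagrams on `π` with `N` arrow ends: each arrow also has a sign, which is
recorded at both of its ends. -/
@[ext] structure GaussRigid (N : ℕ) where
  circ : Circ π N
  isArrow : circ.IsArrow
  sign : Fin N → ℤˣ
  sign_eq : ∀ i j, circ.arr i j → sign i = sign j

variable {π}

instance (N : ℕ) : MulAction (Rot N) (ArrowRigid π N) where
  smul ρ A := ⟨(ρ : Equiv.Perm (Fin N)) • A.1, A.2.smul _⟩
  one_smul _ := rfl
  mul_smul _ _ _ := rfl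

instance (N : ℕ) : MulAction (Rot N) (DegRigid π N) where
  smul ρ A := ⟨(ρ : Equiv.Perm (Fin N)) • A.1, A.2.smul _⟩
  one_smul _ := rfl
  mul_smul _ _ _ := rfl

instance (N : ℕ) : MulAction (Rot N) (GaussRigid π N) where
  smul ρ G := ⟨(ρ : Equiv.Perm (Fin N)) • G.circ, G.isArrow.smul _,
    fun i => G.sign ((ρ : Equiv.Perm (Fin N))⁻¹ i), fun _ _ h => G.sign_eq _ _ h⟩
  one_smul _ := rfl
  mul_smul _ _ _ := rfl

/-- The rigid arrow diagram that underlies a rigid Gauss diagram. -/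
def GaussRigid.toArrow {N : ℕ} (G : GaussRigid π N) : ArrowRigid π N := ⟨G.circ, G.isArrow⟩

variable (π) in
/-- Gauss diagrams on `π`: rigid Gauss diagrams up to rotation. -/
abbrev GaussDiagram := Σ N : ℕ, MulAction.orbitRel.Quotient (Rot N) (GaussRigid π N)

variable (π) in
/-- Arrow diagrams on `π`: rigid arrow diagrams up to rotation. -/
abbrev ArrowDiagram := Σ N : ℕ, MulAction.orbitRel.Quotient (Rot N) (ArrowRigid π N)

/-- Equivalence of rigid arrow diagrams under `w`-moves. -/
def arrowSetoid (w : π →* ℤˣ) (N : ℕ) : Setoid (ArrowRigid π N) where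
  r A B := Circ.WEquiv w A.1 B.1
  iseqv := ⟨fun A => .refl w A.1, fun h => h.symm, fun h h' => h.trans h'⟩

/-- Equivalence of rigid degenerate arrow diagrams under `w`-moves. -/
def degSetoid (w : π →* ℤˣ) (N : ℕ) : Setoid (DegRigid π N) where
  r A B := Circ.WEquiv w A.1 B.1
  iseqv := ⟨fun A => .refl w A.1, fun h => h.symm, fun h h' => h.trans h'⟩

/-- Rigid arrow diagrams up to `w`-moves. -/
def WArrowRigid (w : π →* ℤˣ) (N : ℕ) := Quotient (arrowSetoid w N)

/-- Rigid degenerate arrow diagrams up to `w`-moves. -/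
def WDegRigid (w : π →* ℤˣ) (N : ℕ) := Quotient (degSetoid w N)

instance (w : π →* ℤˣ) (N : ℕ) : MulAction (Rot N) (WArrowRigid w N) where
  smul ρ := Quotient.map (fun A => ρ • A) fun _ _ h => h.smul ρ
  one_smul a := Quotient.inductionOn a fun _ => rfl
  mul_smul _ _ a := Quotient.inductionOn a fun _ => rfl

instance (w : π →* ℤˣ) (N : ℕ) : MulAction (Rot N) (WDegRigid w N) where
  smul ρ := Quotient.map (fun A => ρ • A) fun _ _ h => h.smul ρ
  one_smul a := Quotient.inductionOn a fun _ => rfl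
  mul_smul _ _ a := Quotient.inductionOn a fun _ => rfl

/-- `w`-orbits of arrow diagrams. -/
abbrev WArrowDiagram (w : π →* ℤˣ) :=
  Σ N : ℕ, MulAction.orbitRel.Quotient (Rot N) (WArrowRigid w N)

/-- `w`-orbits of degenerate arrow diagrams. -/
abbrev WDegDiagram (w : π →* ℤˣ) :=
  Σ N : ℕ, MulAction.orbitRel.Quotient (Rot N) (WDegRigid w N)

/-- `w`-orbits of based arrow diagrams.  A based arrow diagram is represented by its unique rigid
representative in which the base edge is the one that goes from the last point to the first one
(the whole circle, if there is no arrow), so it is not subject to rotations. -/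
abbrev WBasedDiagram (w : π →* ℤˣ) := Σ N : ℕ, WArrowRigid w N

/-- The Gauss diagram of a rigid one. -/
def GaussRigid.diagram {N : ℕ} (G : GaussRigid π N) : GaussDiagram π := ⟨N, Quotient.mk'' G⟩

/-- The arrow diagram of a rigid one. -/
def arrowDiagram {N : ℕ} (A : ArrowRigid π N) : ArrowDiagram π := ⟨N, Quotient.mk'' A⟩

/-- The `w`-orbit of a rigid arrow diagram. -/
def wArrowDiagram (w : π →* ℤˣ) {N : ℕ} (A : ArrowRigid π N) : WArrowDiagram w :=
  ⟨N, Quotient.mk'' (Quotient.mk (arrowSetoid w N) A)⟩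

/-- The `w`-orbit of a rigid degenerate arrow diagram. -/
def wDegDiagram (w : π →* ℤˣ) {N : ℕ} (D : DegRigid π N) : WDegDiagram w :=
  ⟨N, Quotient.mk'' (Quotient.mk (degSetoid w N) D)⟩

/-- The order of the group of symmetries of a diagram: the number of rotations that fix a rigid
representative. -/
noncomputable def aut {X : ℕ → Type*} [∀ N, MulAction (Rot N) (X N)]
    (D : Σ N : ℕ, MulAction.orbitRel.Quotient (Rot N) (X N)) : ℕ :=
  Quotient.liftOn' D.2 (fun x => Nat.card (MulAction.stabilizer (Rot D.1) x)) fun _ _ h =>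
    Nat.card_congr (MulAction.stabilizerEquivStabilizerOfOrbitRel h).toEquiv

/-- `T_a`: forget the signs. -/
def forgetSigns (G : GaussDiagram π) : ArrowDiagram π :=
  ⟨G.1, Quotient.map' GaussRigid.toArrow (by rintro _ B ⟨ρ, rfl⟩; exact ⟨ρ, rfl⟩) G.2⟩

/-- `T_aw^a`: the `w`-orbit of an arrow diagram. -/
def wOrbit (w : π →* ℤˣ) (A : ArrowDiagram π) : WArrowDiagram w :=
  ⟨A.1, Quotient.map' (Quotient.mk (arrowSetoid w A.1))
    (by rintro _ B ⟨ρ, rfl⟩; exact ⟨ρ, rfl⟩) A.2⟩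

open scoped Classical in
/-- The product of the signs of all arrows of a rigid Gauss diagram. -/
noncomputable def GaussRigid.totalSign {N : ℕ} (G : GaussRigid π N) : ℤˣ :=
  ∏ i, if ∃ j, G.circ.arr i j then G.sign i else 1

/-- The product of the signs of all arrows of a Gauss diagram. -/
noncomputable def totalSign (G : GaussDiagram π) : ℤˣ :=
  Quotient.liftOn' G.2 GaussRigid.totalSign (by
    classical
    rintro _ B ⟨ρ, rfl⟩
    refine Fintype.prod_equiv ((ρ : Equiv.Perm (Fin G.1))⁻¹) _ _ fun i => ?_
    refine if_congr ?_ rfl rfl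
    exact ⟨fun ⟨j, h⟩ => ⟨_, h⟩, fun ⟨j, h⟩ => ⟨(ρ : Equiv.Perm (Fin G.1)) j, by
      change B.circ.arr _ ((ρ : Equiv.Perm (Fin G.1))⁻¹ _)
      simpa using h⟩⟩)

end Diagrams

/-! ### Subdiagrams -/

namespace GaussRigid

variable {π : Type*} [Group π] {N : ℕ}

/-- The decoration that is left when all arrows are removed. -/
def freeMark (G : GaussRigid π N) : ConjClasses π :=
  if h : N = 0 then G.circ.free h else ConjClasses.mk (List.ofFn G.circ.mark).prod

/-- A set of arrows, given by the set of the ends of its elements. -/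
abbrev ArrowSet (G : GaussRigid π N) :=
  {K : Finset (Fin N) // ∀ i j, G.circ.inc i j → i ∈ K → j ∈ K}

/-- The product of the decorations of `l` consecutive edges, starting at the point `i`. -/
def arcProd (G : GaussRigid π N) (i : Fin N) (l : ℕ) : π :=
  ((List.range l).map fun t => G.circ.mark ((finRotate N)^[t] i)).prod

/-- The subdiagram that keeps the arrows in `K` and loses the others: the edges that merge are
decorated with the product of their decorations. -/
def sub (G : GaussRigid π N) (K : G.ArrowSet) : GaussRigid π K.1.card where
  circ :=
    { arr := fun i j => G.circ.arr (K.1.orderEmbOfFin rfl i) (K.1.orderEmbOfFin rfl j)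
      mark := fun i => G.arcProd (K.1.orderEmbOfFin rfl i)
        (K.1.orderEmbOfFin rfl (finRotate _ i) - K.1.orderEmbOfFin rfl i : Fin N).val
      free := fun _ => G.freeMark }
  isArrow := by
    refine ⟨fun i j => G.isArrow.1 _ _, fun i => ?_⟩
    obtain ⟨j, hj, hu⟩ := G.isArrow.2 (K.1.orderEmbOfFin rfl i)
    have hjK : j ∈ K.1 := K.2 _ _ hj (K.1.orderEmbOfFin_mem rfl i)
    obtain ⟨k, hk⟩ : j ∈ Set.range (K.1.orderEmbOfFin rfl) := by
      rw [Finset.range_orderEmbOfFin]; exact hjK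
    subst hk
    exact ⟨k, hj, fun l hl => (K.1.orderEmbOfFin rfl).injective (hu _ hl)⟩
  sign i := G.sign (K.1.orderEmbOfFin rfl i)
  sign_eq _ _ h := G.sign_eq _ _ h

open scoped Classical in
/-- The formal sum `I(G)` of all subdiagrams of `G`. -/
noncomputable def subdiagramSum (G : GaussRigid π N) : GaussDiagram π →₀ ℚ :=
  ∑ K : G.ArrowSet, Finsupp.single (G.sub K).diagram 1

/-! ### Virtual knot types -/

/-- There is an arrow from one of the ends of the edge `i` to one of the ends of the edge `j`, or
the other way round. -/
def Linked (G : GaussRigid π N) (i j : Fin N) : Prop :=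
  ∃ a b, (a = i ∨ a = finRotate N i) ∧ (b = j ∨ b = finRotate N j) ∧ G.circ.inc a b

/-- `w(e) ε(e)`, where `w(e)` is the product of the signs of the arrows that bound `e`. -/
noncomputable def edgeSign (G : GaussRigid π N) (e : Fin N) : ℤˣ :=
  G.sign e * G.sign (finRotate N e) * G.circ.eps e

/-- The exchange of the two ends of the edge `e`. -/
def flip (e : Fin N) : Equiv.Perm (Fin N) := Equiv.swap e (finRotate N e)

end GaussRigid

/-- Two rigid Gauss diagrams that represent the same Gauss diagram, or that differ by a
Reidemeister move or by `w`-moves. -/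
inductive Move {π : Type*} [Group π] (w : π →* ℤˣ) :
    (Σ N : ℕ, GaussRigid π N) → (Σ N : ℕ, GaussRigid π N) → Prop
  | rotation {N : ℕ} (G : GaussRigid π N) (ρ : Rot N) : Move w ⟨N, G⟩ ⟨N, ρ • G⟩
  | conjugacy {N : ℕ} (G G' : GaussRigid π N) (h : Circ.WEquiv w G.circ G'.circ)
      (hs : G'.sign = G.sign) : Move w ⟨N, G⟩ ⟨N, G'⟩
  /-- Removal of an isolated arrow that surrounds an edge `i` with decoration `1`. -/
  | r1 {N : ℕ} (G : GaussRigid π N) (i : Fin N) (h : G.circ.inc i (finRotate N i))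
      (hi : G.circ.mark i = 1) (K : G.ArrowSet)
      (hK : ∀ a, a ∈ K.1 ↔ a ≠ i ∧ a ≠ finRotate N i) :
      Move w ⟨N, G⟩ ⟨K.1.card, G.sub K⟩
  /-- Removal of two arrows with opposite signs, whose tails bound an edge `i` with decoration `1`
  and whose heads bound an edge `j` with decoration `1`. -/
  | r2 {N : ℕ} (G : GaussRigid π N) (i j : Fin N)
      (h : (G.circ.arr i j ∧ G.circ.arr (finRotate N i) (finRotate N j)) ∨
        (G.circ.arr i (finRotate N j) ∧ G.circ.arr (finRotate N i) j))
      (hi : G.circ.mark i = 1) (hj : G.circ.mark j = 1)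
      (hs : G.sign (finRotate N i) = -G.sign i) (K : G.ArrowSet)
      (hK : ∀ a, a ∈ K.1 ↔ a ≠ i ∧ a ≠ finRotate N i ∧ a ≠ j ∧ a ≠ finRotate N j) :
      Move w ⟨N, G⟩ ⟨K.1.card, G.sub K⟩
  /-- Three edges `i`, `j`, `k` with decoration `1` are bounded by the ends of three arrows, any
  two of the edges being joined by an arrow; the ends of each of the edges are exchanged. -/
  | r3 {N : ℕ} (G G' : GaussRigid π N) (i j k : Fin N)
      (hd : [i, finRotate N i, j, finRotate N j, k, finRotate N k].Nodup)
      (hi : G.circ.mark i = 1) (hj : G.circ.mark j = 1) (hk : G.circ.mark k = 1)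
      (hij : G.Linked i j) (hjk : G.Linked j k) (hik : G.Linked i k)
      (hs : G.edgeSign i = G.edgeSign j ∧ G.edgeSign j = G.edgeSign k)
      (hu : G.circ.up i ≠ G.circ.up j ∧ G.circ.up j ≠ G.circ.up k ∧ G.circ.up i ≠ G.circ.up k)
      (hm : G'.circ.mark = G.circ.mark)
      (τ : Equiv.Perm (Fin N)) (hτ : τ = GaussRigid.flip i * GaussRigid.flip j * GaussRigid.flip k)
      (ha : ∀ a b, G'.circ.arr a b ↔ G.circ.arr (τ a) (τ b))
      (hsg : ∀ a, G'.sign a = G.sign (τ a)) : Move w ⟨N, G⟩ ⟨N, G'⟩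

/-- Two rigid Gauss diagrams represent the same virtual knot type on `(π, w)`. -/
def SameVirtualKnotType {π : Type*} [Group π] (w : π →* ℤˣ) :
    (Σ N : ℕ, GaussRigid π N) → (Σ N : ℕ, GaussRigid π N) → Prop :=
  Relation.EqvGen (Move w)

/-! ### Formal series -/

section Series

/-- Formal series of bounded degree. -/
def series {X : Type*} (deg : X → ℕ) : Submodule ℚ (X → ℚ) where
  carrier := {φ | ∃ n, ∀ x, n < deg x → φ x = 0}
  zero_mem' := ⟨0, fun _ _ => rfl⟩
  add_mem' := by
    rintro φ ψ ⟨n, hn⟩ ⟨m, hm⟩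
    refine ⟨max n m, fun x hx => ?_⟩
    simp [hn x (lt_of_le_of_lt (le_max_left _ _) hx), hm x (lt_of_le_of_lt (le_max_right _ _) hx)]
  smul_mem' := by
    rintro c φ ⟨n, hn⟩
    exact ⟨n, fun x hx => by simp [hn x hx]⟩

/-- The normalized pairing of a formal series with a finite combination of diagrams, for which
`⟨D, D⟩ = |Aut D|` and different diagrams are orthogonal. -/
noncomputable def pair {X : ℕ → Type*} [∀ N, MulAction (Rot N) (X N)]
    (φ : (Σ N : ℕ, MulAction.orbitRel.Quotient (Rot N) (X N)) → ℚ)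
    (r : (Σ N : ℕ, MulAction.orbitRel.Quotient (Rot N) (X N)) →₀ ℚ) : ℚ :=
  r.sum fun D c => (aut D : ℚ) * φ D * c

variable {π : Type*} [Group π]

variable (π) in
/-- Gauss series. -/
abbrev GaussSeries := series (fun G : GaussDiagram π => G.1 / 2)

variable (π) in
/-- Arrow diagram series. -/
abbrev ArrowSeries := series (fun A : ArrowDiagram π => A.1 / 2)

/-- Series of `w`-orbits of arrow diagrams. -/
abbrev WArrowSeries (w : π →* ℤˣ) := series (fun α : WArrowDiagram w => α.1 / 2)

/-- Series of `w`-orbits of degenerate arrow diagrams. -/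
abbrev WDegSeries (w : π →* ℤˣ) := series (fun D : WDegDiagram w => (D.1 + 1) / 2)

/-- The twisted symmetry-preserving map `S` from arrow diagram series to Gauss series,
`A ↦ ∑_{T_a(G) = A} sign(G) (|Aut A| / |Aut G|) G`. -/
noncomputable def twistedS : ArrowSeries π →ₗ[ℚ] GaussSeries π where
  toFun φ := ⟨fun G => ((totalSign G : ℤ) : ℚ) *
      ((aut (forgetSigns G) : ℚ) / (aut G : ℚ)) * φ.1 (forgetSigns G), by
    obtain ⟨n, hn⟩ := φ.2
    exact ⟨n, fun G hG => by simp only [hn (forgetSigns G) hG, mul_zero]⟩⟩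
  map_add' φ ψ := by ext G; exact mul_add _ _ _
  map_smul' c φ := by ext G; exact mul_left_comm _ _ _

/-- The symmetry-preserving map `S_aw^a`, `α ↦ ∑_{A ∈ α} (|Aut α| / |Aut A|) A`. -/
noncomputable def wS (w : π →* ℤˣ) : WArrowSeries w →ₗ[ℚ] ArrowSeries π where
  toFun φ := ⟨fun A => ((aut (wOrbit w A) : ℚ) / (aut A : ℚ)) * φ.1 (wOrbit w A), by
    obtain ⟨n, hn⟩ := φ.2
    exact ⟨n, fun A hA => by simp only [hn (wOrbit w A) hA, mul_zero]⟩⟩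
  map_add' φ ψ := by ext A; exact mul_add _ _ _
  map_smul' c φ := by ext A; exact mul_left_comm _ _ _

/-- `𝒜` is an arrow diagram formula on `(π, w)`: the map `G ↦ ⟨S(𝒜), I(G)⟩` is an invariant of
virtual knot types. -/
def IsArrowDiagramFormula (w : π →* ℤˣ) (𝒜 : ArrowSeries π) : Prop :=
  ∀ G G' : Σ N : ℕ, GaussRigid π N, SameVirtualKnotType w G G' →
    pair (twistedS 𝒜).1 G.2.subdiagramSum = pair (twistedS 𝒜).1 G'.2.subdiagramSum

/-! ### The relations `AP₁` and `AP₂^{(n-2),2}` -/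

variable (π) in
/-- The `AP₁` relators: the arrow diagrams with an isolated arrow that surrounds an edge with
decoration `1`. -/
def AP1 : Set (ArrowDiagram π →₀ ℚ) :=
  {r | ∃ (N : ℕ) (A : ArrowRigid π N) (i : Fin N), A.1.inc i (finRotate N i) ∧ A.1.mark i = 1 ∧
    r = Finsupp.single (arrowDiagram A) 1}

variable (π) in
/-- The `AP₂^{(n-2),2}` relators: the arrow diagrams with two arrows whose tails bound an edge
with decoration `1` and whose heads bound an edge with decoration `1`. -/
def AP2 : Set (ArrowDiagram π →₀ ℚ) :=
  {r | ∃ (N : ℕ) (A : ArrowRigid π N) (i j : Fin N),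
    ((A.1.arr i j ∧ A.1.arr (finRotate N i) (finRotate N j)) ∨
      (A.1.arr i (finRotate N j) ∧ A.1.arr (finRotate N i) j)) ∧
    A.1.mark i = 1 ∧ A.1.mark j = 1 ∧ r = Finsupp.single (arrowDiagram A) 1}

/-- `T_aw^a` on finite combinations of arrow diagrams. -/
noncomputable def wT (w : π →* ℤˣ) : (ArrowDiagram π →₀ ℚ) →ₗ[ℚ] (WArrowDiagram w →₀ ℚ) :=
  Finsupp.lmapDomain ℚ ℚ (wOrbit w)

/-! ### Componentwise extension to formal series -/

/-- Componentwise extension of `f` to formal series: `∑ φ(x) x ↦ ∑ φ(x) f(x)`.  It makes sense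
because only finitely many of the `f x` involve a given `y`. -/
noncomputable def extend {X Y : Type*} (f : X → Y →₀ ℚ) (hf : ∀ y, {x | f x y ≠ 0}.Finite) :
    (X → ℚ) →ₗ[ℚ] (Y → ℚ) where
  toFun φ y := ∑ᶠ x, φ x * f x y
  map_add' φ ψ := by
    ext y
    simp only [Pi.add_apply, add_mul]
    exact finsum_add_distrib ((hf y).subset fun x hx => right_ne_zero_of_mul hx)
      ((hf y).subset fun x hx => right_ne_zero_of_mul hx)
  map_smul' c φ := by
    ext y
    simp only [Pi.smul_apply, smul_eq_mul, mul_assoc, RingHom.id_apply]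
    exact (mul_finsum _ _).symm

/-- The extension to formal series of bounded degree of a map `f` that preserves the degree. -/
noncomputable def extendSeries {X Y : Type*} {dX : X → ℕ} {dY : Y → ℕ} (f : X → Y →₀ ℚ)
    (hf : ∀ y, {x | f x y ≠ 0}.Finite) (hd : ∀ x y, f x y ≠ 0 → dX x = dY y) :
    series dX →ₗ[ℚ] series dY :=
  (extend f hf).restrict fun φ ⟨n, hn⟩ => ⟨n, fun y hy => by
    refine finsum_eq_zero_of_forall_eq_zero fun x => ?_
    by_cases h : f x y = 0
    · rw [h, mul_zero]
    · rw [hn x (by rw [hd x y h]; exact hy), zero_mul]⟩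

/-! ### The map `•` -/

/-- Series of `w`-orbits of based arrow diagrams. -/
abbrev WBasedSeries (w : π →* ℤˣ) := series (fun b : WBasedDiagram w => b.1 / 2)

open scoped Classical in
/-- The sum of all based `w`-orbits that one can form by choosing a base edge in a `w`-orbit. -/
noncomputable def wBullet (w : π →* ℤˣ) (α : WArrowDiagram w) : WBasedDiagram w →₀ ℚ :=
  Quotient.liftOn' α.2
    (fun A => ∑ ρ : Rot α.1, Finsupp.single (⟨α.1, ρ • A⟩ : WBasedDiagram w) (1 : ℚ)) (by
    rintro _ B ⟨σ, rfl⟩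
    refine Fintype.sum_equiv (Equiv.mulRight σ) _ _ fun ρ => ?_
    simp only [Equiv.coe_mulRight, mul_smul])

theorem wBullet_ne_zero {w : π →* ℤˣ} {α : WArrowDiagram w} {b : WBasedDiagram w}
    (h : wBullet w α b ≠ 0) : α = ⟨b.1, Quotient.mk'' b.2⟩ := by
  classical
  obtain ⟨N, q⟩ := α
  induction q using Quotient.inductionOn' with
  | h A =>
    change (∑ ρ : Rot N, Finsupp.single (⟨N, ρ • A⟩ : WBasedDiagram w) (1 : ℚ)) b ≠ 0 at h
    rw [Finsupp.finsetSum_apply] at h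
    obtain ⟨ρ, -, hρ⟩ := Finset.exists_ne_zero_of_sum_ne_zero h
    have : (⟨N, ρ • A⟩ : WBasedDiagram w) = b := by
      by_contra hne
      exact hρ (Finsupp.single_eq_of_ne' hne)
    subst this
    congr 1
    exact Quotient.sound' ⟨ρ⁻¹, inv_smul_smul ρ A⟩

/-- The map `•` on series of `w`-orbits. -/
noncomputable def wBulletSeries (w : π →* ℤˣ) : WArrowSeries w →ₗ[ℚ] WBasedSeries w :=
  extendSeries (wBullet w)
    (fun b => (Set.finite_singleton (⟨b.1, Quotient.mk'' b.2⟩ : WArrowDiagram w)).subset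
      fun _ h => wBullet_ne_zero h)
    fun _ _ h => by rw [wBullet_ne_zero h]

/-! ### The map `δ_w` -/

/-- The last point and the first one are identified. -/
def glue {K : ℕ} (a : Fin (K + 2)) : Fin (K + 1) :=
  if h : a = Fin.last (K + 1) then 0 else a.castPred h

theorem glue_last {K : ℕ} : glue (Fin.last (K + 1)) = 0 := by simp [glue]

theorem glue_castSucc {K : ℕ} (i : Fin (K + 1)) : glue i.castSucc = i := by
  simp [glue, Fin.castSucc_ne_last]

theorem glue_zero {K : ℕ} : glue (0 : Fin (K + 2)) = 0 := glue_castSucc 0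

theorem glue_eq {K : ℕ} {a b : Fin (K + 2)} (h : glue a = glue b) :
    a = b ∨ (a = Fin.last _ ∧ b = 0) ∨ (a = 0 ∧ b = Fin.last _) := by
  induction a using Fin.lastCases with
  | last =>
    induction b using Fin.lastCases with
    | last => exact .inl rfl
    | cast b =>
      rw [glue_last, glue_castSucc] at h
      subst h
      exact .inr (.inl ⟨rfl, rfl⟩)
  | cast a =>
    induction b using Fin.lastCases with
    | last =>
      rw [glue_last, glue_castSucc] at h
      subst h
      exact .inr (.inr ⟨rfl, rfl⟩)
    | cast b =>
      rw [glue_castSucc, glue_castSucc] at h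
      exact .inl (by rw [h])

theorem glue_rotate {K : ℕ} (i : Fin (K + 1)) :
    glue (finRotate _ i.castSucc) = finRotate _ i := by
  induction i using Fin.lastCases with
  | last =>
    rw [finRotate_last, finRotate_apply]
    simpa using glue_last
  | cast i =>
    rw [finRotate_apply, finRotate_apply]
    have h1 : (i.castSucc.castSucc + 1 : Fin (_ + 2)) = i.succ.castSucc := by ext; simp
    have h2 : (i.castSucc + 1 : Fin (_ + 1)) = i.succ := by ext; simp
    rw [h1, h2, glue_castSucc]

/-- The result of shrinking the base edge, which goes from the last point to the first one. -/
def Circ.shrink {K : ℕ} (X : Circ π (K + 2)) : Circ π (K + 1) where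
  arr i j := ∃ a b, glue a = i ∧ glue b = j ∧ X.arr a b
  mark i := X.mark i.castSucc
  free h := absurd h (Nat.succ_ne_zero K)

/-- The base edge is decorated by `1` and is bounded by the ends of two different arrows. -/
def Circ.Nice {K : ℕ} (X : Circ π (K + 2)) : Prop :=
  X.mark (Fin.last _) = 1 ∧ ¬ X.inc (Fin.last _) 0

theorem Circ.inc_shrink {K : ℕ} {X : Circ π (K + 2)} {i j : Fin (K + 1)} :
    X.shrink.inc i j ↔ ∃ a b, glue a = i ∧ glue b = j ∧ X.inc a b := by
  constructor
  · rintro (⟨a, b, h1, h2, h⟩ | ⟨a, b, h1, h2, h⟩)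
    · exact ⟨a, b, h1, h2, .inl h⟩
    · exact ⟨b, a, h2, h1, .inr h⟩
  · rintro ⟨a, b, h1, h2, h | h⟩
    · exact .inl ⟨a, b, h1, h2, h⟩
    · exact .inr ⟨b, a, h2, h1, h⟩

theorem Circ.IsArrow.shrink {K : ℕ} {X : Circ π (K + 2)} (h : X.IsArrow) (hn : X.Nice) :
    X.shrink.IsDeg := by
  choose p hp hu using h.2
  have hsymm : ∀ {a b}, X.inc a b → X.inc b a := fun h => h.symm
  have hpp : ∀ a b, X.inc a b → b = p a := fun a b hab => hu a b hab
  have hinj : ∀ {a a' b}, X.inc a b → X.inc a' b → a = a' := fun h1 h2 => by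
    rw [hpp _ _ (hsymm h1), hpp _ _ (hsymm h2)]
  have hirr : ∀ a, ¬ X.inc a a := fun a ha => by
    rcases ha with ha | ha <;> exact h.1 _ _ ha ha
  have hl0 : ¬ X.inc 0 (Fin.last _) := fun h => hn.2 (hsymm h)
  refine ⟨?_, 0, ?_, glue (p 0), glue (p (Fin.last _)), ?_, ?_⟩
  · rintro i j ⟨a, b, rfl, rfl, hab⟩ ⟨b', a', hb, ha, hab'⟩
    rcases glue_eq ha with rfl | ⟨rfl, rfl⟩ | ⟨rfl, rfl⟩
    · have := hinj (hsymm (.inl hab)) (.inl hab')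
      subst this
      exact h.1 _ _ hab hab'
    · rcases glue_eq hb with rfl | ⟨rfl, rfl⟩ | ⟨rfl, rfl⟩
      · exact absurd (hinj (.inl hab) (.inr hab')) (by simp [Fin.ext_iff])
      · exact hirr _ (.inl hab)
      · exact hn.2 (.inr hab)
    · rcases glue_eq hb with rfl | ⟨rfl, rfl⟩ | ⟨rfl, rfl⟩
      · exact absurd (hinj (.inl hab) (.inr hab')) (by simp [Fin.ext_iff])
      · exact hn.2 (.inl hab)
      · exact hirr _ (.inl hab)
  · intro i hi
    refine ⟨glue (p i.castSucc), inc_shrink.2 ⟨_, _, glue_castSucc i, rfl, hp _⟩, ?_⟩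
    intro j hj
    obtain ⟨a, b, ha, rfl, hab⟩ := inc_shrink.1 hj
    rw [← glue_castSucc i] at ha
    rcases glue_eq ha with rfl | ⟨rfl, h0⟩ | ⟨rfl, h0⟩
    · rw [hpp _ _ hab]
    · exact absurd (by rw [← glue_castSucc i, h0, glue_zero]) hi
    · exact absurd (by rw [← glue_castSucc i, h0, glue_last]) hi
  · intro hg
    have h0 := hp 0
    have h1 := hp (Fin.last _)
    rcases glue_eq hg with h2 | ⟨h2, h3⟩ | ⟨h2, h3⟩
    · rw [h2] at h0
      exact absurd (hinj h0 h1) (by simp [Fin.ext_iff])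
    · rw [h2] at h0; exact hl0 h0
    · rw [h2] at h0; exact hirr _ h0
  · intro l
    rw [inc_shrink]
    constructor
    · rintro ⟨a, b, ha, rfl, hab⟩
      rw [← glue_zero] at ha
      rcases glue_eq ha with rfl | ⟨rfl, -⟩ | ⟨rfl, h0⟩
      · exact .inl (by rw [hpp _ _ hab])
      · exact .inr (by rw [hpp _ _ hab])
      · exact .inl (by rw [hpp _ _ hab])
    · rintro (rfl | rfl)
      · exact ⟨0, _, glue_zero, rfl, hp _⟩
      · exact ⟨_, _, glue_last, rfl, hp _⟩

/-- The degenerate diagram that results from shrinking the base edge of a nice based diagram. -/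
def ArrowRigid.shrink {K : ℕ} (A : ArrowRigid π (K + 2)) (h : A.1.Nice) : DegRigid π (K + 1) :=
  ⟨A.1.shrink, A.2.shrink h⟩

open scoped Classical in
/-- `δ_w` on based `w`-orbits: pick a nice based diagram in the orbit, if there is one, shrink its
base edge to a point, and multiply the `w`-orbit of the result by the sign `ε` of the base edge.
If there is no nice diagram in the orbit, that is, if the base edge is not bounded by the ends of
two different arrows, then the result is `0`. -/
noncomputable def deltaW (w : π →* ℤˣ) : WBasedDiagram w → (WDegDiagram w →₀ ℚ)
  | ⟨K + 2, b⟩ =>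
    if h : ∃ A : ArrowRigid π (K + 2), Quotient.mk (arrowSetoid w _) A = b ∧ A.1.Nice then
      Finsupp.single (wDegDiagram w (ArrowRigid.shrink h.choose h.choose_spec.2))
        ((h.choose.1.eps (Fin.last _) : ℤ) : ℚ)
    else 0
  | ⟨1, _⟩ => 0
  | ⟨0, _⟩ => 0

theorem deltaW_ne_zero {w : π →* ℤˣ} {b : WBasedDiagram w} {D : WDegDiagram w}
    (h : deltaW w b D ≠ 0) : ∃ (K : ℕ) (A : ArrowRigid π (K + 2)) (hA : A.1.Nice),
      b = ⟨K + 2, Quotient.mk (arrowSetoid w _) A⟩ ∧ D = wDegDiagram w (A.shrink hA) := by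
  obtain ⟨_ | _ | K, b⟩ := b
  · exact absurd rfl h
  · exact absurd rfl h
  · by_cases hb : ∃ A : ArrowRigid π (K + 2), Quotient.mk (arrowSetoid w _) A = b ∧ A.1.Nice
    · rw [deltaW, dif_pos hb] at h
      refine ⟨K, hb.choose, hb.choose_spec.2, by rw [hb.choose_spec.1], ?_⟩
      by_contra hne
      exact h (Finsupp.single_eq_of_ne hne)
    · rw [deltaW, dif_neg hb] at h
      exact absurd rfl h

theorem wDegDiagram_eq {w : π →* ℤˣ} {N : ℕ} {D E : DegRigid π N}
    (h : wDegDiagram w D = wDegDiagram w E) :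
    ∃ ρ : Rot N, Circ.WEquiv w D.1 ((ρ : Equiv.Perm (Fin N)) • E.1) := by
  have h1 : (Quotient.mk'' (Quotient.mk (degSetoid w N) D) :
      MulAction.orbitRel.Quotient (Rot N) (WDegRigid w N)) = Quotient.mk'' ⟦E⟧ :=
    eq_of_heq (Sigma.mk.inj h).2
  obtain ⟨ρ, hρ⟩ := Quotient.exact' h1
  have h2 : Quotient.mk (degSetoid w N) (ρ • E) = Quotient.mk (degSetoid w N) D := hρ
  exact ⟨ρ, (degSetoid w N).symm (Quotient.exact h2)⟩

theorem Circ.inc_conj {N : ℕ} {X : Circ π N} {w : π →* ℤˣ} {g : Fin N → π}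
    (hg : ∀ i j, X.arr i j → g i = g j) (i j : Fin N) : (X.conj w g).inc i j ↔ X.inc i j := by
  by_cases e : g i = g j
  · by_cases h : w (g j) = 1 <;> simp [inc, conj, e, h, or_comm]
  · have e1 : ¬ X.arr i j := fun h => e (hg _ _ h)
    have e2 : ¬ X.arr j i := fun h => e (hg _ _ h).symm
    simp [inc, conj, e1, e2]

theorem Circ.Asymm.conj {N : ℕ} {X : Circ π N} (h : X.Asymm) {w : π →* ℤˣ} {g : Fin N → π}
    (hg : ∀ i j, X.arr i j → g i = g j) : (X.conj w g).Asymm := by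
  intro i j
  by_cases e : g i = g j
  · by_cases h1 : w (g j) = 1
    · simpa [Circ.conj, e, h1] using h i j
    · simpa [Circ.conj, e, h1] using h j i
  · have e1 : ¬ X.arr i j := fun h => e (hg _ _ h)
    have e2 : ¬ X.arr j i := fun h => e (hg _ _ h).symm
    simp [Circ.conj, e1, e2]

theorem Circ.IsArrow.conj {N : ℕ} {X : Circ π N} (h : X.IsArrow) {w : π →* ℤˣ}
    {g : Fin N → π} (hg : ∀ i j, X.arr i j → g i = g j) : (X.conj w g).IsArrow :=
  ⟨h.1.conj hg, by simpa only [inc_conj hg] using h.2⟩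

theorem Circ.IsDeg.conj {N : ℕ} {X : Circ π N} (h : X.IsDeg) {w : π →* ℤˣ}
    {g : Fin N → π} (hg : ∀ i j, X.arr i j → g i = g j) : (X.conj w g).IsDeg :=
  ⟨h.1.conj hg, by simpa only [inc_conj hg] using h.2⟩

theorem Circ.finite_mark {N : ℕ} (hN : N ≠ 0) (m : Fin N → π) :
    {X : Circ π N | X.mark = m}.Finite := by
  refine Set.Finite.of_finite_image (f := Circ.arr) (Set.toFinite _) ?_
  intro X hX Y hY h
  ext1
  · exact h
  · exact (hX : X.mark = m).trans (hY : Y.mark = m).symm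
  · exact funext fun h => absurd h hN

theorem deltaW_finite (w : π →* ℤˣ) (D : WDegDiagram w) : {b | deltaW w b D ≠ 0}.Finite := by
  by_cases hD : ∃ (K : ℕ) (A : ArrowRigid π (K + 2)) (hA : A.1.Nice),
    D = wDegDiagram w (A.shrink hA)
  · obtain ⟨K, A₀, hA₀, rfl⟩ := hD
    set E := A₀.shrink hA₀ with hE
    have hfin : (⋃ ρ : Rot (K + 1), {A : ArrowRigid π (K + 2) | A.1.mark =
        Fin.snoc (α := fun _ => π) ((ρ : Equiv.Perm (Fin (K + 1))) • E.1).mark 1}).Finite :=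
      Set.finite_iUnion fun ρ =>
        (Circ.finite_mark (Nat.succ_ne_zero _) _).preimage Subtype.val_injective.injOn
    refine (hfin.image fun A => (⟨K + 2, Quotient.mk (arrowSetoid w _) A⟩ :
      WBasedDiagram w)).subset fun b hb => ?_
    obtain ⟨L, A, hA, rfl, h⟩ := deltaW_ne_zero hb
    obtain rfl : K = L := by
      have := congrArg Sigma.fst h
      simpa [wDegDiagram] using this
    obtain ⟨ρ, g, hg, hgE⟩ := wDegDiagram_eq h.symm
    have hgA : ∀ i j, A.1.arr i j → g (glue i) = g (glue j) := fun i j hij =>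
      hg _ _ ⟨i, j, rfl, rfl, hij⟩
    refine ⟨⟨A.1.conj w fun i => g (glue i), A.2.conj hgA⟩, Set.mem_iUnion.2 ⟨ρ, ?_⟩, ?_⟩
    · rw [Set.mem_ofPred_eq, hgE]
      funext i
      induction i using Fin.lastCases with
      | last =>
        simp [Circ.conj, hA.1, glue_last, glue_zero]
      | cast i =>
        rw [Fin.snoc_castSucc]
        change (g (glue i.castSucc))⁻¹ * _ * g (glue (finRotate (K + 2) i.castSucc)) = _
        rw [glue_rotate, glue_castSucc]
        rfl
    · refine congrArg (fun x => (⟨K + 2, x⟩ : WBasedDiagram w)) ?_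
      exact Quotient.sound ((arrowSetoid w _).symm
        (⟨fun i => g (glue i), hgA, rfl⟩ : Circ.WEquiv w A.1 _))
  · convert Set.finite_empty
    rw [Set.eq_empty_iff_forall_notMem]
    intro b hb
    obtain ⟨K, A, hA, -, h⟩ := deltaW_ne_zero hb
    exact hD ⟨K, A, hA, h⟩

/-- The map `δ_w` on series of `w`-orbits. -/
noncomputable def deltaWSeries (w : π →* ℤˣ) : WBasedSeries w →ₗ[ℚ] WDegSeries w :=
  extendSeries (deltaW w) (deltaW_finite w) fun _ _ h => by
    obtain ⟨K, A, hA, rfl, rfl⟩ := deltaW_ne_zero h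
    rfl

/-- The map `d_w` on series of `w`-orbits. -/
noncomputable def dW (w : π →* ℤˣ) : WArrowSeries w →ₗ[ℚ] WDegSeries w :=
  deltaWSeries w ∘ₗ wBulletSeries w

/-! ### The triangle relations -/

/-- `D` is a non monotonic degenerate diagram, and `E`, `F` are the two monotonic diagrams in the
triangle relation `D = E + F`.  The three diagrams only differ by the two arrows that meet at the
degenerate point; the three ends of these, `x`, `y`, `z`, are the same in the three diagrams.
Either the two arrows are `x → y`, `x → z` in `D`, `x → y → z` in `E`, `x → z → y` in `F`, or
all of these arrows are reversed. -/
def IsTriangle {N : ℕ} (D E F : DegRigid π N) : Prop :=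
  (E.1.mark = D.1.mark ∧ F.1.mark = D.1.mark) ∧
  ∃ x y z : Fin N,
    (∀ i j, ¬ ((i = x ∨ i = y ∨ i = z) ∧ (j = x ∨ j = y ∨ j = z)) →
      ((E.1.arr i j ↔ D.1.arr i j) ∧ (F.1.arr i j ↔ D.1.arr i j))) ∧
    (((D.1.arr x y ∧ D.1.arr x z) ∧ (E.1.arr x y ∧ E.1.arr y z) ∧ (F.1.arr x z ∧ F.1.arr z y)) ∨
     ((D.1.arr y x ∧ D.1.arr z x) ∧ (E.1.arr y x ∧ E.1.arr z y) ∧ (F.1.arr z x ∧ F.1.arr y z)))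

/-- The triangle relators, for `w`-orbits of degenerate diagrams. -/
def triangleRelators (w : π →* ℤˣ) : Set (WDegDiagram w →₀ ℚ) :=
  {r | ∃ (N : ℕ) (D E F : DegRigid π N), IsTriangle D E F ∧
    r = Finsupp.single (wDegDiagram w D) 1 - Finsupp.single (wDegDiagram w E) 1
      - Finsupp.single (wDegDiagram w F) 1}

theorem IsTriangle.smul {N : ℕ} {D E F : DegRigid π N} (h : IsTriangle D E F) (ρ : Rot N) :
    IsTriangle (ρ • D) (ρ • E) (ρ • F) := by
  obtain ⟨⟨h1, h2⟩, x, y, z, h3, h4⟩ := h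
  have hm : ∀ A B : DegRigid π N, A.1.mark = B.1.mark → (ρ • A).1.mark = (ρ • B).1.mark :=
    fun A B e => funext fun i => congrFun e _
  have ha : ∀ (A : DegRigid π N) i j,
      (ρ • A).1.arr ((ρ : Equiv.Perm (Fin N)) i) ((ρ : Equiv.Perm (Fin N)) j) ↔ A.1.arr i j := by
    intro A i j
    change A.1.arr ((ρ : Equiv.Perm (Fin N))⁻¹ _) ((ρ : Equiv.Perm (Fin N))⁻¹ _) ↔ _
    simp
  refine ⟨⟨hm _ _ h1, hm _ _ h2⟩, (ρ : Equiv.Perm (Fin N)) x, (ρ : Equiv.Perm (Fin N)) y,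
    (ρ : Equiv.Perm (Fin N)) z, fun i j hij => ?_, by simpa only [ha] using h4⟩
  obtain ⟨i, rfl⟩ := (ρ : Equiv.Perm (Fin N)).surjective i
  obtain ⟨j, rfl⟩ := (ρ : Equiv.Perm (Fin N)).surjective j
  simp only [ha]
  exact h3 i j (by simpa only [EmbeddingLike.apply_eq_iff_eq] using hij)

/-- A map is constant along the arrows of one diagram of a triangle relation if and only if it is
so for the others. -/
theorem IsTriangle.const {N : ℕ} {D E F : DegRigid π N} (h : IsTriangle D E F) (g : Fin N → π) :
    ((∀ i j, E.1.arr i j → g i = g j) ↔ ∀ i j, D.1.arr i j → g i = g j) ∧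
    ((∀ i j, F.1.arr i j → g i = g j) ↔ ∀ i j, D.1.arr i j → g i = g j) := by
  obtain ⟨-, x, y, z, h3, h4⟩ := h
  have key : ∀ A : DegRigid π N,
      (∀ i j, ¬ ((i = x ∨ i = y ∨ i = z) ∧ (j = x ∨ j = y ∨ j = z)) →
        (A.1.arr i j ↔ D.1.arr i j)) →
      ((∀ i j, A.1.arr i j → g i = g j) → g x = g y ∧ g x = g z) →
      ((∀ i j, A.1.arr i j → g i = g j) ↔ (g x = g y ∧ g x = g z) ∧
        ∀ i j, ¬ ((i = x ∨ i = y ∨ i = z) ∧ (j = x ∨ j = y ∨ j = z)) →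
          D.1.arr i j → g i = g j) := by
    intro A hA hA'
    constructor
    · intro hh
      exact ⟨hA' hh, fun i j hij hD => hh i j ((hA i j hij).2 hD)⟩
    · rintro ⟨⟨e1, e2⟩, hh⟩ i j hij
      by_cases hc : (i = x ∨ i = y ∨ i = z) ∧ (j = x ∨ j = y ∨ j = z)
      · rcases hc with ⟨rfl | rfl | rfl, rfl | rfl | rfl⟩ <;> simp_all
      · exact hh i j hc ((hA i j hc).1 hij)
  have kD := key D (fun _ _ _ => Iff.rfl) (fun hh => by
    rcases h4 with ⟨⟨a, b⟩, -⟩ | ⟨⟨a, b⟩, -⟩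
    · exact ⟨hh _ _ a, hh _ _ b⟩
    · exact ⟨(hh _ _ a).symm, (hh _ _ b).symm⟩)
  have kE := key E (fun i j hij => (h3 i j hij).1) (fun hh => by
    rcases h4 with ⟨-, ⟨a, b⟩, -⟩ | ⟨-, ⟨a, b⟩, -⟩
    · exact ⟨hh _ _ a, (hh _ _ a).trans (hh _ _ b)⟩
    · exact ⟨(hh _ _ a).symm, ((hh _ _ b).trans (hh _ _ a)).symm⟩)
  have kF := key F (fun i j hij => (h3 i j hij).2) (fun hh => by
    rcases h4 with ⟨-, -, a, b⟩ | ⟨-, -, a, b⟩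
    · exact ⟨(hh _ _ a).trans (hh _ _ b), hh _ _ a⟩
    · exact ⟨((hh _ _ b).trans (hh _ _ a)).symm, (hh _ _ a).symm⟩)
  exact ⟨kE.trans kD.symm, kF.trans kD.symm⟩

/-- Conjugation of a rigid degenerate diagram. -/
def DegRigid.conj {N : ℕ} (D : DegRigid π N) (w : π →* ℤˣ) (g : Fin N → π)
    (hg : ∀ i j, D.1.arr i j → g i = g j) : DegRigid π N := ⟨D.1.conj w g, D.2.conj hg⟩

theorem wDegDiagram_conj {w : π →* ℤˣ} {N : ℕ} (D : DegRigid π N) (g : Fin N → π)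
    (hg : ∀ i j, D.1.arr i j → g i = g j) : wDegDiagram w (D.conj w g hg) = wDegDiagram w D := by
  have : Quotient.mk (degSetoid w N) (D.conj w g hg) = Quotient.mk (degSetoid w N) D :=
    Quotient.sound ((degSetoid w N).symm (⟨g, hg, rfl⟩ : Circ.WEquiv w D.1 _))
  simp only [wDegDiagram, this]

theorem wDegDiagram_smul {w : π →* ℤˣ} {N : ℕ} (D : DegRigid π N) (ρ : Rot N) :
    wDegDiagram w (ρ • D) = wDegDiagram w D :=
  congrArg (Sigma.mk N) (Quotient.sound' ⟨ρ, rfl⟩)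

theorem IsTriangle.conj {w : π →* ℤˣ} {N : ℕ} {D E F : DegRigid π N} (h : IsTriangle D E F)
    {g : Fin N → π} (hD : ∀ i j, D.1.arr i j → g i = g j) (hE : ∀ i j, E.1.arr i j → g i = g j)
    (hF : ∀ i j, F.1.arr i j → g i = g j) :
    IsTriangle (D.conj w g hD) (E.conj w g hE) (F.conj w g hF) := by
  obtain ⟨⟨h1, h2⟩, x, y, z, h3, h4⟩ := h
  have hm : ∀ A B : Circ π N, A.mark = B.mark → (A.conj w g).mark = (B.conj w g).mark :=
    fun A B e => by simp only [Circ.conj, e]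
  have e : g y = g x ∧ g z = g x := by
    rcases h4 with ⟨⟨a, b⟩, -⟩ | ⟨⟨a, b⟩, -⟩
    · exact ⟨(hD _ _ a).symm, (hD _ _ b).symm⟩
    · exact ⟨hD _ _ a, hD _ _ b⟩
  refine ⟨⟨hm _ _ h1, hm _ _ h2⟩, x, y, z, fun i j hij => ?_, ?_⟩
  · have h5 := h3 i j hij
    have h6 := h3 j i fun hji => hij hji.symm
    simp only [DegRigid.conj, Circ.conj]
    split_ifs
    · exact h5
    · exact h6
  · simp only [DegRigid.conj, Circ.conj, e.1, e.2]
    split_ifs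
    · exact h4
    · exact h4.symm

theorem triangleRelators_finite (w : π →* ℤˣ) (X : WDegDiagram w) :
    {r : triangleRelators w | r.1 X ≠ 0}.Finite := by
  classical
  obtain ⟨N, q⟩ := X
  induction q using Quotient.inductionOn' with
  | h q =>
  induction q using Quotient.inductionOn with
  | h X =>
  by_cases hN : N = 0
  · subst hN
    exact (X.2.2.choose : Fin 0).elim0
  set rel : DegRigid π N × DegRigid π N × DegRigid π N → (WDegDiagram w →₀ ℚ) := fun t =>
    Finsupp.single (wDegDiagram w t.1) 1 - Finsupp.single (wDegDiagram w t.2.1) 1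
      - Finsupp.single (wDegDiagram w t.2.2) 1 with hrel
  have hfin : {D : DegRigid π N | D.1.mark = X.1.mark}.Finite :=
    (Circ.finite_mark hN X.1.mark).preimage Subtype.val_injective.injOn
  refine Set.Finite.of_finite_image (f := Subtype.val) ?_ Subtype.val_injective.injOn
  refine ((hfin.prod (hfin.prod hfin)).image rel).subset ?_
  rintro _ ⟨⟨r, M, D, E, F, hT, rfl⟩, hr, rfl⟩
  -- the triangle can be moved so that a given one of its diagrams, if equivalent to `X`, is `X`
  have key : ∀ A : DegRigid π M, (A = D ∨ A = E ∨ A = F) → wDegDiagram w A = wDegDiagram w X →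
      (Finsupp.single (wDegDiagram w D) 1 - Finsupp.single (wDegDiagram w E) 1
        - Finsupp.single (wDegDiagram w F) 1 : WDegDiagram w →₀ ℚ) ∈
      rel '' ({D : DegRigid π N | D.1.mark = X.1.mark} ×ˢ
        ({D : DegRigid π N | D.1.mark = X.1.mark} ×ˢ {D : DegRigid π N | D.1.mark = X.1.mark})) := by
    intro A hA hAX
    obtain rfl : M = N := congrArg Sigma.fst hAX
    obtain ⟨ρ, hρ⟩ := wDegDiagram_eq hAX.symm
    obtain ⟨g, hg, hX⟩ := hρ.symm
    have hT' := hT.smul ρ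
    have hc := hT'.const g
    have hD : ∀ i j, (ρ • D).1.arr i j → g i = g j := by
      rcases hA with rfl | rfl | rfl
      · exact hg
      · exact hc.1.1 hg
      · exact hc.2.1 hg
    have hE := hc.1.2 hD
    have hF := hc.2.2 hD
    have hT'' := hT'.conj (w := w) hD hE hF
    have hAm : X.1.mark = ((ρ • D).conj w g hD).1.mark := by
      rw [hX]
      rcases hA with rfl | rfl | rfl
      · rfl
      · exact hT''.1.1
      · exact hT''.1.2
    refine ⟨((ρ • D).conj w g hD, (ρ • E).conj w g hE, (ρ • F).conj w g hF),
      ⟨hAm.symm, hT''.1.1.trans hAm.symm, hT''.1.2.trans hAm.symm⟩, ?_⟩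
    simp only [hrel, wDegDiagram_conj, wDegDiagram_smul]
  by_cases h1 : wDegDiagram w D = wDegDiagram w X
  · exact key D (.inl rfl) h1
  by_cases h2 : wDegDiagram w E = wDegDiagram w X
  · exact key E (.inr (.inl rfl)) h2
  by_cases h3 : wDegDiagram w F = wDegDiagram w X
  · exact key F (.inr (.inr rfl)) h3
  refine absurd ?_ hr
  change (Finsupp.single (wDegDiagram w D) 1 - Finsupp.single (wDegDiagram w E) 1
      - Finsupp.single (wDegDiagram w F) 1 : WDegDiagram w →₀ ℚ) (wDegDiagram w X) = 0
  rw [Finsupp.sub_apply, Finsupp.sub_apply, Finsupp.single_eq_of_ne' h1,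
    Finsupp.single_eq_of_ne' h2, Finsupp.single_eq_of_ne' h3, sub_zero, sub_zero]

/-- The series of `w`-orbits of degenerate diagrams that are formal (possibly infinite) linear
combinations of triangle relators. -/
noncomputable def triangleSubmodule (w : π →* ℤˣ) : Submodule ℚ (WDegSeries w) :=
  (LinearMap.range (extend (fun r : triangleRelators w => r.1) (triangleRelators_finite w))).comap
    (Submodule.subtype _)

/-- Series of `w`-orbits of degenerate diagrams, modulo the triangle relations. -/
abbrev WDegTriangleSeries (w : π →* ℤˣ) := WDegSeries w ⧸ triangleSubmodule w

/-- The projection `s_w`. -/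
noncomputable abbrev sW (w : π →* ℤˣ) : WDegSeries w →ₗ[ℚ] WDegTriangleSeries w :=
  (triangleSubmodule w).mkQ

end Series

end GaussTheory

namespace GaussTheory

variable {π : Type*} [Group π]

/-! ### Arrow diagrams on a line -/

section Line

/-! Let φ(A) be |Aut A| times the coefficient of A in the series (`weight`). In ⟨S(𝒜), I(G)⟩ the
automorphism factors cancel, so the pairing is the sum over all subdiagrams of G of the product of
their signs times φ of the underlying arrow diagram (`pair_twistedS`). In the same way S_aw^a
becomes the pull-back of functions along `wOrbit` (`weight_wS`). Condition 1 therefore says that φ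
is invariant under w-moves, and condition 3 that φ vanishes on the diagrams of AP₁ and AP₂. It
remains to compare these properties, and d_w, with the behaviour of the sum under each move.

The circle is cut open to a line. Points are natural numbers, arrows are pairs of points, and the
decorations are encoded by a potential M and a total product T: the edge from p to the next point q
carries M(p)⁻¹M(q), with a factor T in between if the edge passes the cut. Merging of edges is then
automatic: removal of arrows changes neither M nor T (`sub_lineGauss`), and I(G) is a sum over the
subsets of one finite set of arrows (`subSum_lineGauss`). If such a sum vanishes for every subset S'
of S, its terms vanish (`eq_zero_of_sum_powerset`); this Möbius inversion turns invariance for all G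
into pointwise properties of φ.

Move by move: w-moves act on each term separately. For R₁, the difference of the two sides consists
of the terms that contain the isolated arrow, so it gives AP₁. For R₂, terms with exactly one of the
two arrows cancel, because the ends slide along edges decorated by 1 and the signs are opposite; the
terms with both arrows give AP₂ (`lineSum_parallel`). For R₃, the terms with at most one of the
three arrows cancel by sliding. The terms with two arrows form a combination of three differences,
the six-term relation `SixTerm`, and the terms with three arrows form a cubic part
(`lineSum_tri_sub`). From invariance, changing the common sign of the three arrows separates the two
parts (`sixTerm_of_move`). Conversely, `SixTerm` applied to diagrams with one additional arrow,
together with AP₂, kills the cubic part (`full_eq`).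

Finally, the coefficient of d_w at a degenerate diagram is, up to the sign ε, the difference of φ on
its two resolutions (`dW_shrink`, `dW_line`). Hence `SixTerm` says that the coefficients of d_w at
x→y→z and at the two non monotonic diagrams x→y, x→z and x→z, y→z add up to 0 (`dW_sites`). This is
exactly membership in the span of the triangle relators. A non monotonic diagram D lies in a single
relator D - E - F, with E and F monotonic, so the relators can be used to eliminate all non
monotonic diagrams; what is left at a monotonic diagram is that sum of three coefficients.
Symmetries can identify some of these w-orbits, and `relator_sum_eq_zero` checks that the count
stays right. `sixTerm_of_sW` and `sW_of_sixTerm` are the two directions. -/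

theorem val_finRotate {N : ℕ} (i : Fin N) :
    (finRotate N i).val = if i.val + 1 = N then 0 else i.val + 1 := by
  obtain _ | n := N
  · exact i.elim0
  · rw [finRotate_apply]
    split_ifs with h
    · have : i = Fin.last n := Fin.ext (by simp; omega)
      subst this; simp
    · rw [Fin.val_add_one_of_lt]
      rw [Fin.lt_def]; simp; omega

theorem val_finRotate_pow {N : ℕ} (r : ℕ) (i : Fin N) :
    ((finRotate N ^ r) i).val = (i.val + r) % N := by
  induction r with
  | zero => simp [Nat.mod_eq_of_lt i.2]
  | succ r ih =>
    rw [pow_succ', Equiv.Perm.mul_apply, val_finRotate, ih]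
    have hN : 0 < N := i.pos
    have h1 := Nat.mod_lt (i.val + r) hN
    rw [← add_assoc, Nat.add_mod (i.val + r) 1]
    obtain rfl | h2 : N = 1 ∨ 1 < N := by omega
    · simp [Nat.mod_one]
    · rw [Nat.mod_eq_of_lt h2]
      split_ifs with h
      · rw [h, Nat.mod_self]
      · exact (Nat.mod_eq_of_lt (by omega)).symm

/-- The end points of a finite set of arrows between natural numbers; an arrow is the pair of
its tail and its head. -/
def pts (S : Finset (ℕ × ℕ)) : Finset ℕ := S.image Prod.fst ∪ S.image Prod.snd

theorem mem_pts {S : Finset (ℕ × ℕ)} {p : ℕ} : p ∈ pts S ↔ ∃ a ∈ S, a.1 = p ∨ a.2 = p := by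
  simp only [pts, Finset.mem_union, Finset.mem_image]
  grind

theorem fst_mem_pts {S : Finset (ℕ × ℕ)} {a : ℕ × ℕ} (h : a ∈ S) : a.1 ∈ pts S :=
  mem_pts.2 ⟨a, h, .inl rfl⟩

theorem snd_mem_pts {S : Finset (ℕ × ℕ)} {a : ℕ × ℕ} (h : a ∈ S) : a.2 ∈ pts S :=
  mem_pts.2 ⟨a, h, .inr rfl⟩

theorem pts_mono {S S' : Finset (ℕ × ℕ)} (h : S ⊆ S') : pts S ⊆ pts S' := fun _ hp => by
  obtain ⟨a, ha, hp⟩ := mem_pts.1 hp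
  exact mem_pts.2 ⟨a, h ha, hp⟩

theorem pts_insert (a : ℕ × ℕ) (S : Finset (ℕ × ℕ)) :
    pts (insert a S) = insert a.1 (insert a.2 (pts S)) := by
  ext p
  simp only [mem_pts, Finset.mem_insert]
  grind

/-- The ends of the arrows are pairwise distinct. -/
structure Good (S : Finset (ℕ × ℕ)) : Prop where
  irrefl : ∀ a ∈ S, a.1 ≠ a.2
  disj : ∀ a ∈ S, ∀ b ∈ S, a ≠ b → a.1 ≠ b.1 ∧ a.1 ≠ b.2 ∧ a.2 ≠ b.1 ∧ a.2 ≠ b.2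

theorem Good.mono {S S' : Finset (ℕ × ℕ)} (h : Good S') (hs : S ⊆ S') : Good S :=
  ⟨fun a ha => h.irrefl a (hs ha), fun a ha b hb => h.disj a (hs ha) b (hs hb)⟩

theorem good_insert {a : ℕ × ℕ} {S : Finset (ℕ × ℕ)} (h : Good S) (ha : a.1 ≠ a.2)
    (h1 : a.1 ∉ pts S) (h2 : a.2 ∉ pts S) : Good (insert a S) := by
  have k1 : ∀ b ∈ S, b.1 ≠ a.1 ∧ b.2 ≠ a.1 := fun b hb =>
    ⟨fun e => h1 (mem_pts.2 ⟨b, hb, .inl e⟩), fun e => h1 (mem_pts.2 ⟨b, hb, .inr e⟩)⟩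
  have k2 : ∀ b ∈ S, b.1 ≠ a.2 ∧ b.2 ≠ a.2 := fun b hb =>
    ⟨fun e => h2 (mem_pts.2 ⟨b, hb, .inl e⟩), fun e => h2 (mem_pts.2 ⟨b, hb, .inr e⟩)⟩
  have k3 := h.1
  have k4 := h.2
  constructor
  · simp only [Finset.mem_insert]
    rintro b (rfl | hb)
    · exact ha
    · exact k3 b hb
  · simp only [Finset.mem_insert]
    rintro b (rfl | hb) c (rfl | hc) hbc
    · exact absurd rfl hbc
    · exact ⟨(k1 c hc).1.symm, (k1 c hc).2.symm, (k2 c hc).1.symm, (k2 c hc).2.symm⟩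
    · exact ⟨(k1 b hb).1, (k2 b hb).1, (k1 b hb).2, (k2 b hb).2⟩
    · exact k4 b hb c hc hbc

theorem Good.of_insert {a : ℕ × ℕ} {S : Finset (ℕ × ℕ)} (h : Good (insert a S)) (ha : a ∉ S) :
    Good S ∧ a.1 ≠ a.2 ∧ a.1 ∉ pts S ∧ a.2 ∉ pts S := by
  refine ⟨h.mono (Finset.subset_insert _ _), h.1 a (Finset.mem_insert_self _ _), ?_, ?_⟩ <;>
  · intro hp
    obtain ⟨b, hb, hp⟩ := mem_pts.1 hp
    have := h.2 a (Finset.mem_insert_self _ _) b (Finset.mem_insert_of_mem hb)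
      (by rintro rfl; exact ha hb)
    grind

/-- `e` enumerates the finite set `P` increasingly. -/
structure Enum {N : ℕ} (e : Fin N → ℕ) (P : Finset ℕ) : Prop where
  mono : StrictMono e
  mem : ∀ p, p ∈ P ↔ ∃ i, e i = p

theorem Enum.mem' {N : ℕ} {e : Fin N → ℕ} {P : Finset ℕ} (h : Enum e P) (i : Fin N) : e i ∈ P :=
  (h.mem _).2 ⟨i, rfl⟩

theorem Enum.card {N : ℕ} {e : Fin N → ℕ} {P : Finset ℕ} (h : Enum e P) : P.card = N := by
  have : P = Finset.univ.image e := by ext p; simp [h.mem]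
  rw [this, Finset.card_image_of_injective _ h.mono.injective, Finset.card_fin]

theorem enum_orderEmbOfFin (P : Finset ℕ) : Enum (P.orderEmbOfFin rfl) P :=
  ⟨(P.orderEmbOfFin rfl).strictMono, fun p => by
    rw [← Set.mem_range, Finset.range_orderEmbOfFin]; rfl⟩

/-- The circle that results from joining the ends of a line with arrows `S`.  The decoration of
the edge between consecutive points `p < q` is `(M p)⁻¹ * M q`, the product of all decorations of
the closed line is `T`. -/
def lineCirc {N : ℕ} (e : Fin N → ℕ) (M : ℕ → π) (T : π) (S : Finset (ℕ × ℕ)) : Circ π N where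
  arr i j := (e i, e j) ∈ S
  mark i := (M (e i))⁻¹ * ((if e i < e (finRotate N i) then 1 else T) * M (e (finRotate N i)))
  free _ := ConjClasses.mk T

theorem Good.inc_unique {S : Finset (ℕ × ℕ)} (hS : Good S) {p q q' : ℕ}
    (h : (p, q) ∈ S ∨ (q, p) ∈ S) (h' : (p, q') ∈ S ∨ (q', p) ∈ S) : q' = q := by
  rcases h with h | h <;> rcases h' with h' | h'
  · by_contra hne
    exact (hS.2 _ h _ h' (by simp [Ne.symm hne])).1 rfl
  · by_cases hne : (p, q) = (q', p)
    · have := hS.1 _ h; grind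
    · exact absurd rfl (hS.2 _ h _ h' hne).2.1
  · by_cases hne : (q, p) = (p, q')
    · have := hS.1 _ h; grind
    · exact absurd rfl (hS.2 _ h _ h' hne).2.2.1
  · by_contra hne
    exact (hS.2 _ h _ h' (by simp [Ne.symm hne])).2.2.2 rfl

theorem isArrow_lineCirc {N : ℕ} {e : Fin N → ℕ} {S : Finset (ℕ × ℕ)} (he : Enum e (pts S))
    (hS : Good S) (M : ℕ → π) (T : π) : (lineCirc e M T S).IsArrow := by
  constructor
  · intro i j h h'
    have h1 : e j = e i ∨ (e i, e j) ≠ (e j, e i) := by grind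
    rcases h1 with h1 | h1
    · exact hS.1 _ h h1.symm
    · exact (hS.2 _ h _ h' h1).2.1 rfl
  · intro i
    obtain ⟨a, ha, hi⟩ := mem_pts.1 (he.mem' i)
    obtain ⟨k, hk⟩ := (he.mem _).1 (fst_mem_pts ha)
    obtain ⟨l, hl⟩ := (he.mem _).1 (snd_mem_pts ha)
    have hkl : (e k, e l) ∈ S := by rw [hk, hl]; exact ha
    rcases hi with hi | hi
    · have : k = i := he.mono.injective (hk.trans hi)
      subst this
      exact ⟨l, .inl hkl, fun m hm => he.mono.injective (hS.inc_unique (.inl hkl) hm)⟩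
    · have : l = i := he.mono.injective (hl.trans hi)
      subst this
      exact ⟨k, .inr hkl, fun m hm => he.mono.injective (hS.inc_unique (.inr hkl) hm)⟩

theorem good_of_isArrow {N : ℕ} {e : Fin N → ℕ} {S : Finset (ℕ × ℕ)} (he : Enum e (pts S))
    {M : ℕ → π} {T : π} (h : (lineCirc e M T S).IsArrow) : Good S := by
  have key : ∀ a ∈ S, ∃ i j, e i = a.1 ∧ e j = a.2 ∧ (lineCirc e M T S).arr i j := by
    intro a ha
    obtain ⟨i, hi⟩ := (he.mem _).1 (fst_mem_pts ha)
    obtain ⟨j, hj⟩ := (he.mem _).1 (snd_mem_pts ha)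
    exact ⟨i, j, hi, hj, by change (e i, e j) ∈ S; rw [hi, hj]; exact ha⟩
  have hinj := he.mono.injective
  have huniq : ∀ i j k, (lineCirc e M T S).inc i j → (lineCirc e M T S).inc i k → j = k :=
    fun i j k h1 h2 => (h.2 i).unique h1 h2
  constructor
  · intro a ha hne
    obtain ⟨i, j, hi, hj, hij⟩ := key a ha
    obtain rfl : i = j := hinj (by rw [hi, hj, hne])
    exact h.1 _ _ hij hij
  · intro a ha b hb hab
    obtain ⟨i, j, hi, hj, hij⟩ := key a ha
    obtain ⟨k, l, hk, hl, hkl⟩ := key b hb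
    refine ⟨fun e1 => ?_, fun e1 => ?_, fun e1 => ?_, fun e1 => ?_⟩
    · obtain rfl : i = k := hinj (by rw [hi, hk, e1])
      obtain rfl := huniq _ _ _ (.inl hij) (.inl hkl)
      exact hab (Prod.ext e1 (hj.symm.trans hl))
    · obtain rfl : i = l := hinj (by rw [hi, hl, e1])
      obtain rfl := huniq _ _ _ (.inl hij) (.inr hkl)
      exact h.1 _ _ hij hkl
    · obtain rfl : j = k := hinj (by rw [hj, hk, e1])
      obtain rfl := huniq _ _ _ (.inr hij) (.inl hkl)
      exact h.1 _ _ hij hkl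
    · obtain rfl : j = l := hinj (by rw [hj, hl, e1])
      obtain rfl := huniq _ _ _ (.inr hij) (.inr hkl)
      exact hab (Prod.ext (hi.symm.trans hk) e1)

open scoped Classical in
/-- The value of `φ` on the arrow diagram with the arrows `S` on the line. -/
noncomputable def lineVal (φ : ArrowDiagram π → ℚ) (M : ℕ → π) (T : π) (S : Finset (ℕ × ℕ)) : ℚ :=
  if h : (lineCirc ((pts S).orderEmbOfFin rfl) M T S).IsArrow then φ (arrowDiagram ⟨_, h⟩) else 0

/-- An increasing enumeration of a finite set is unique, so the value can be computed with any one.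
This avoids transport along equalities between `N` and the cardinality of `pts S`. -/
theorem lineVal_eq (φ : ArrowDiagram π → ℚ) {N : ℕ} {e : Fin N → ℕ} {S : Finset (ℕ × ℕ)}
    {M : ℕ → π} {T : π} (he : Enum e (pts S)) (h : (lineCirc e M T S).IsArrow) :
    lineVal φ M T S = φ (arrowDiagram ⟨_, h⟩) := by
  obtain rfl := he.card
  obtain rfl := Finset.orderEmbOfFin_unique rfl he.mem' he.mono
  exact dif_pos h

theorem arrowDiagram_smul {N : ℕ} (A : ArrowRigid π N) (ρ : Rot N) :
    arrowDiagram (ρ • A) = arrowDiagram A :=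
  congrArg (Sigma.mk N) (Quotient.sound' ⟨ρ, rfl⟩)

/-! ### Order preserving relabelling -/

/-- Relabelling of the ends of arrows. -/
def mapArr (f : ℕ → ℕ) (S : Finset (ℕ × ℕ)) : Finset (ℕ × ℕ) := S.image (Prod.map f f)

theorem pts_mapArr (f : ℕ → ℕ) (S : Finset (ℕ × ℕ)) : pts (mapArr f S) = (pts S).image f := by
  ext p
  simp only [mem_pts, mapArr, Finset.mem_image]
  constructor
  · rintro ⟨_, ⟨a, ha, rfl⟩, h⟩
    rcases h with h | h
    · exact ⟨a.1, ⟨a, ha, .inl rfl⟩, h⟩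
    · exact ⟨a.2, ⟨a, ha, .inr rfl⟩, h⟩
  · rintro ⟨q, ⟨a, ha, h⟩, rfl⟩
    exact ⟨_, ⟨a, ha, rfl⟩, h.imp (congrArg f) (congrArg f)⟩

theorem mapArr_insert (f : ℕ → ℕ) (a : ℕ × ℕ) (S : Finset (ℕ × ℕ)) :
    mapArr f (insert a S) = insert (f a.1, f a.2) (mapArr f S) := Finset.image_insert _ _ _

theorem mapArr_congr {f g : ℕ → ℕ} {S : Finset (ℕ × ℕ)} (h : ∀ p ∈ pts S, f p = g p) :
    mapArr f S = mapArr g S :=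
  Finset.image_congr fun _ ha => Prod.ext (h _ (fst_mem_pts ha)) (h _ (snd_mem_pts ha))

theorem mapArr_mapArr (f g : ℕ → ℕ) (S : Finset (ℕ × ℕ)) :
    mapArr f (mapArr g S) = mapArr (f ∘ g) S := by
  simp only [mapArr, Finset.image_image]; rfl

theorem mapArr_eq_self {f : ℕ → ℕ} {S : Finset (ℕ × ℕ)} (h : ∀ p ∈ pts S, f p = p) :
    mapArr f S = S := by
  rw [mapArr_congr (g := id) h]; simp [mapArr]

theorem Good.mapArr {f : ℕ → ℕ} {S : Finset (ℕ × ℕ)} (hS : Good S) (hf : Set.InjOn f (pts S)) :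
    Good (mapArr f S) := by
  constructor
  · intro b hb
    obtain ⟨a, ha, rfl⟩ := Finset.mem_image.1 hb
    exact fun h => hS.1 a ha (hf (fst_mem_pts ha) (snd_mem_pts ha) h)
  · intro b hb b' hb' hne
    obtain ⟨a, ha, rfl⟩ := Finset.mem_image.1 hb
    obtain ⟨a', ha', rfl⟩ := Finset.mem_image.1 hb'
    have := hS.2 a ha a' ha' (by rintro rfl; exact hne rfl)
    have h1 := fst_mem_pts ha
    have h2 := snd_mem_pts ha
    have h1' := fst_mem_pts ha'
    have h2' := snd_mem_pts ha'
    exact ⟨fun h => this.1 (hf h1 h1' h), fun h => this.2.1 (hf h1 h2' h),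
      fun h => this.2.2.1 (hf h2 h1' h), fun h => this.2.2.2 (hf h2 h2' h)⟩

theorem lineCirc_mapArr {N : ℕ} {e : Fin N → ℕ} {S : Finset (ℕ × ℕ)} {P : Finset ℕ}
    (he : Enum e P) (hP : pts S ⊆ P) {f : ℕ → ℕ} (hf : StrictMonoOn f P) {M M' : ℕ → π} (T : π)
    (hM : ∀ p ∈ P, M' (f p) = M p) :
    lineCirc (f ∘ e) M' T (mapArr f S) = lineCirc e M T S := by
  ext i j
  · simp only [lineCirc, Function.comp]
    constructor
    · intro h
      obtain ⟨a, ha, h⟩ := Finset.mem_image.1 h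
      have h1 := hf.injOn (hP (fst_mem_pts ha)) (he.mem' i) (congrArg Prod.fst h)
      have h2 := hf.injOn (hP (snd_mem_pts ha)) (he.mem' j) (congrArg Prod.snd h)
      rw [← h1, ← h2]; exact ha
    · intro h
      exact Finset.mem_image.2 ⟨_, h, rfl⟩
  · simp only [lineCirc, Function.comp, hM _ (he.mem' _),
      hf.lt_iff_lt (he.mem' i) (he.mem' (finRotate N i))]
  · rfl

theorem Enum.comp {N : ℕ} {e : Fin N → ℕ} {P : Finset ℕ} (he : Enum e P) {f : ℕ → ℕ}
    (hf : StrictMonoOn f P) : Enum (f ∘ e) (P.image f) :=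
  ⟨fun i j hij => hf (he.mem' i) (he.mem' j) (he.mono hij), fun p => by
    simp only [Finset.mem_image, he.mem, Function.comp]
    constructor
    · rintro ⟨_, ⟨i, rfl⟩, rfl⟩; exact ⟨i, rfl⟩
    · rintro ⟨i, rfl⟩; exact ⟨_, ⟨i, rfl⟩, rfl⟩⟩

/-- Only the order of the points and the potential at them enter the circle, so points may be moved
freely as long as both are kept. -/
theorem lineVal_mapArr (φ : ArrowDiagram π → ℚ) {S : Finset (ℕ × ℕ)} (hS : Good S) {f : ℕ → ℕ}
    (hf : StrictMonoOn f (pts S)) {M M' : ℕ → π} (T : π) (hM : ∀ p ∈ pts S, M' (f p) = M p) :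
    lineVal φ M' T (mapArr f S) = lineVal φ M T S := by
  have he := enum_orderEmbOfFin (pts S)
  have h1 := isArrow_lineCirc he hS M T
  have h2 := lineCirc_mapArr he subset_rfl hf T hM
  rw [lineVal_eq φ he h1, lineVal_eq φ (by rw [pts_mapArr]; exact he.comp hf) (h2 ▸ h1)]
  congr 2
  exact Subtype.ext h2

/-! ### Rotation -/

/-- The points below `t` are moved behind the other ones. -/
def cut (t B p : ℕ) : ℕ := if p < t then p + B else p

/-- The map `M`, extended to the points moved by `cut`. -/
def shiftM (T : π) (B : ℕ) (M : ℕ → π) (p : ℕ) : π := if B ≤ p then T * M (p - B) else M p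

theorem shiftM_cut (T : π) (M : ℕ → π) {t B p : ℕ} (hp : p < B) :
    shiftM T B M (cut t B p) = if p < t then T * M p else M p := by
  unfold shiftM cut
  split_ifs <;> first | omega | simp

theorem cut_injOn {t B : ℕ} {P : Finset ℕ} (hB : ∀ p ∈ P, p < B) : Set.InjOn (cut t B) P := by
  intro p hp q hq h
  have := hB p hp
  have := hB q hq
  unfold cut at h
  split_ifs at h <;> omega

/-- The points below `t` form an initial segment; its length is the amount of rotation that moves
the cut to `t`. -/
theorem exists_lt_iff {N : ℕ} {e : Fin N → ℕ} (he : StrictMono e) (t : ℕ) :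
    ∃ r ≤ N, ∀ i, e i < t ↔ i.val < r := by
  classical
  have hex : ∃ k, ∀ h : k < N, t ≤ e ⟨k, h⟩ := ⟨N, fun h => absurd h (lt_irrefl _)⟩
  refine ⟨Nat.find hex, Nat.find_min' hex fun h => absurd h (lt_irrefl _), fun i => ?_⟩
  constructor
  · intro h
    by_contra hi
    push Not at hi
    have h1 := Nat.find_spec hex (lt_of_le_of_lt hi i.2)
    have h2 := he.monotone (show (⟨_, lt_of_le_of_lt hi i.2⟩ : Fin N) ≤ i from hi)
    omega
  · intro h
    have := Nat.find_min hex h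
    push Not at this
    exact this.2

/-- Moving the cut to `t` renumbers the points cyclically. A point carried behind the others has
passed the cut once, so its potential acquires the factor `T`; this is the correction in `shiftM`.
-/
theorem rot_lineCirc {N : ℕ} {e : Fin N → ℕ} {P : Finset ℕ} (he : Enum e P)
    (M : ℕ → π) (T : π) {t B r : ℕ} (hB : ∀ p ∈ P, p < B) (hr : r ≤ N)
    (hrt : ∀ i, e i < t ↔ i.val < r) :
    Enum (fun i => cut t B (e ((finRotate N ^ r) i))) (P.image (cut t B)) ∧
      ∀ S, pts S ⊆ P → lineCirc (fun i => cut t B (e ((finRotate N ^ r) i))) (shiftM T B M) T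
        (mapArr (cut t B) S) = (finRotate N ^ r)⁻¹ • lineCirc e M T S := by
  set σ : Equiv.Perm (Fin N) := finRotate N ^ r with hσ
  have hσv : ∀ i, (σ i).val = (i.val + r) % N := fun i => val_finRotate_pow r i
  have hinj := cut_injOn (t := t) hB
  refine ⟨⟨?_, fun p => ?_⟩, fun S hS => ?_⟩
  · intro i j hij
    have hij : i.val < j.val := hij
    have b1 := hB _ (he.mem' (σ i))
    have b2 := hB _ (he.mem' (σ j))
    have v1 := hσv i
    have v2 := hσv j
    have hi := i.2
    have hj := j.2
    have hm : ∀ a b : Fin N, a.val < b.val → e a < e b := fun a b h => he.mono h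
    have hmij := hm (σ i) (σ j)
    simp only [cut, hrt]
    by_cases c1 : i.val + r < N
    · rw [Nat.mod_eq_of_lt c1] at v1
      by_cases c2 : j.val + r < N
      · rw [Nat.mod_eq_of_lt c2] at v2
        rw [if_neg (by omega), if_neg (by omega)]
        exact hmij (by omega)
      · rw [Nat.mod_eq_sub_mod (by omega), Nat.mod_eq_of_lt (by omega)] at v2
        rw [if_neg (by omega), if_pos (by omega)]
        omega
    · rw [Nat.mod_eq_sub_mod (by omega), Nat.mod_eq_of_lt (by omega)] at v1 v2
      rw [if_pos (by omega), if_pos (by omega)]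
      exact Nat.add_lt_add_right (hmij (by omega)) B
  · simp only [Finset.mem_image, he.mem]
    constructor
    · rintro ⟨_, ⟨i, rfl⟩, rfl⟩
      exact ⟨σ⁻¹ i, by simp⟩
    · rintro ⟨i, rfl⟩
      exact ⟨_, ⟨σ i, rfl⟩, rfl⟩
  · ext i j
    · simp only [lineCirc, Circ.smul_def, inv_inv]
      constructor
      · intro h
        obtain ⟨a, ha, h⟩ := Finset.mem_image.1 h
        have h1 := hinj (hS (fst_mem_pts ha)) (he.mem' (σ i)) (congrArg Prod.fst h)
        have h2 := hinj (hS (snd_mem_pts ha)) (he.mem' (σ j)) (congrArg Prod.snd h)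
        rw [← h1, ← h2]; exact ha
      · intro h
        exact Finset.mem_image.2 ⟨_, h, rfl⟩
    · have hc : σ (finRotate N i) = finRotate N (σ i) := by
        have := (Commute.refl (finRotate N)).pow_left r
        exact congrArg (fun τ : Equiv.Perm (Fin N) => τ i) this.eq
      have b1 := hB _ (he.mem' (σ i))
      have b2 := hB _ (he.mem' (finRotate N (σ i)))
      simp only [lineCirc, Circ.smul_def, inv_inv, hc, shiftM_cut T M b1, shiftM_cut T M b2]
      generalize e (σ i) = p at *
      generalize e (finRotate N (σ i)) = q at *
      have hlt : cut t B p < cut t B q ↔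
          (p < t ∧ q < t ∧ p < q) ∨ (t ≤ p ∧ q < t) ∨ (t ≤ p ∧ t ≤ q ∧ p < q) := by
        unfold cut; split_ifs <;> omega
      -- The old edge has the factor `T` if `q ≤ p`. In the new line this factor comes either from
      -- the new cut or from the shifted potential; the cases run over the positions of `p` and `q`
      -- relative to `t` and to each other.
      by_cases c1 : p < t <;> by_cases c2 : q < t <;> by_cases c3 : p < q <;>
        simp only [hlt, c1, c2, c3, not_lt.1, if_true, if_false, and_true, and_false,
          or_false, ← not_lt, not_true, not_false_iff, or_true] <;>
        first | omega | group
    · rfl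

theorem exists_rot_lineCirc {N : ℕ} {e : Fin N → ℕ} {P : Finset ℕ} (he : Enum e P)
    (M : ℕ → π) (T : π) (t : ℕ) {B : ℕ} (hB : ∀ p ∈ P, p < B) :
    ∃ (e' : Fin N → ℕ) (ρ : Rot N), Enum e' (P.image (cut t B)) ∧
      ∀ S, pts S ⊆ P → lineCirc e' (shiftM T B M) T (mapArr (cut t B) S) =
        (ρ : Equiv.Perm (Fin N)) • lineCirc e M T S := by
  obtain ⟨r, hr, hrt⟩ := exists_lt_iff he.mono t
  exact ⟨_, ⟨_, inv_mem (pow_mem (Subgroup.mem_zpowers _) r)⟩, rot_lineCirc he M T hB hr hrt⟩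

/-- The value belongs to a diagram up to rotation, so it does not depend on where the circle is cut.
-/
theorem lineVal_cut (φ : ArrowDiagram π → ℚ) {S : Finset (ℕ × ℕ)} (hS : Good S) (M : ℕ → π)
    (T : π) (t : ℕ) {B : ℕ} (hB : ∀ p ∈ pts S, p < B) :
    lineVal φ (shiftM T B M) T (mapArr (cut t B) S) = lineVal φ M T S := by
  have he := enum_orderEmbOfFin (pts S)
  obtain ⟨e', ρ, he', h⟩ := exists_rot_lineCirc he M T t hB
  have h1 := isArrow_lineCirc he hS M T
  have h2 := h S subset_rfl
  rw [← pts_mapArr] at he'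
  rw [lineVal_eq φ he h1, lineVal_eq φ he' (h2 ▸ h1.smul _),
    ← arrowDiagram_smul ⟨_, h1⟩ ρ]
  congr 2
  exact Subtype.ext h2

end Line

section Line

/-! ### Gauss diagrams on a line -/

/-- The Gauss diagram with the arrows `S` on the line; the sign of an arrow is the value of `s`
at its ends. -/
def lineGauss {N : ℕ} {e : Fin N → ℕ} {S : Finset (ℕ × ℕ)} (he : Enum e (pts S)) (hS : Good S)
    (M : ℕ → π) (T : π) {s : ℕ → ℤˣ} (hs : ∀ a ∈ S, s a.1 = s a.2) : GaussRigid π N where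
  circ := lineCirc e M T S
  isArrow := isArrow_lineCirc he hS M T
  sign i := s (e i)
  sign_eq _ _ h := hs _ h

/-- Each decorated circle without isolated points comes from a line. -/
theorem exists_lineCirc {N : ℕ} (X : Circ π N) (hX : ∀ i, ∃ j, X.inc i j) :
    ∃ (M : ℕ → π) (T : π) (S : Finset (ℕ × ℕ)), Enum (Fin.val : Fin N → ℕ) (pts S) ∧
      X = lineCirc Fin.val M T S := by
  classical
  set m : ℕ → π := fun t => if h : t < N then X.mark ⟨t, h⟩ else 1 with hm
  set M : ℕ → π := fun p => ((List.range p).map m).prod with hM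
  have hMs : ∀ p, M (p + 1) = M p * m p := fun p => by
    simp [hM, List.range_succ]
  -- The potential is the product of the decorations passed so far, so `T` is the product of all of
  -- them; without points `T` has to be a representative of the conjugacy class `free`.
  set T : π := if h : N = 0 then (X.free h).exists_rep.choose else M N with hT
  set S : Finset (ℕ × ℕ) := (Finset.univ.filter fun a : Fin N × Fin N => X.arr a.1 a.2).image
    (Prod.map Fin.val Fin.val) with hS
  have hmem : ∀ i j : Fin N, (i.val, j.val) ∈ S ↔ X.arr i j := by
    intro i j
    simp only [hS, Finset.mem_image, Finset.mem_filter, Finset.mem_univ, true_and]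
    constructor
    · rintro ⟨a, ha, h⟩
      have h1 := Fin.ext (congrArg Prod.fst h)
      have h2 := Fin.ext (congrArg Prod.snd h)
      rw [← h1, ← h2]; exact ha
    · exact fun h => ⟨(i, j), h, rfl⟩
  refine ⟨M, T, S, ⟨fun _ _ h => h, fun p => ?_⟩, ?_⟩
  · rw [mem_pts]
    constructor
    · rintro ⟨b, hb, h⟩
      obtain ⟨a, -, rfl⟩ := Finset.mem_image.1 hb
      rcases h with h | h
      · exact ⟨a.1, h⟩
      · exact ⟨a.2, h⟩
    · rintro ⟨i, rfl⟩
      obtain ⟨j, h | h⟩ := hX i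
      · exact ⟨_, (hmem _ _).2 h, .inl rfl⟩
      · exact ⟨_, (hmem _ _).2 h, .inr rfl⟩
  · ext i j
    · exact (hmem i j).symm
    · have hN : N ≠ 0 := by have := i.2; omega
      have hmi : m i = X.mark i := by simp [hm]
      simp only [lineCirc, val_finRotate, ← hmi]
      split_ifs with h1 h2 h2
      · omega
      · have h3 : M N = M i * m i := (congrArg M h1).symm.trans (hMs i)
        have h4 : M 0 = 1 := by simp [hM]
        rw [h4, hT, dif_neg hN, h3]
        simp
      · rw [hMs]; simp
      · omega
    · change X.free i = ConjClasses.mk T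
      rw [hT, dif_pos i]
      exact (X.free i).exists_rep.choose_spec.symm

/-- Each Gauss diagram comes from a line. -/
theorem exists_lineGauss {N : ℕ} (G : GaussRigid π N) :
    ∃ (M : ℕ → π) (T : π) (S : Finset (ℕ × ℕ)) (s : ℕ → ℤˣ) (hs : ∀ a ∈ S, s a.1 = s a.2)
      (he : Enum (Fin.val : Fin N → ℕ) (pts S)) (hS : Good S), G = lineGauss he hS M T hs := by
  obtain ⟨M, T, S, he, h⟩ := exists_lineCirc G.circ fun i => (G.isArrow.2 i).exists
  have hS : Good S := good_of_isArrow he (h ▸ G.isArrow)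
  have hs : ∀ p : Fin N, (fun q => if h : q < N then G.sign ⟨q, h⟩ else 1) p.val = G.sign p :=
    fun p => by simp
  refine ⟨M, T, S, fun q => if h : q < N then G.sign ⟨q, h⟩ else 1, fun a ha => ?_, he, hS, ?_⟩
  · obtain ⟨i, hi⟩ := (he.mem _).1 (fst_mem_pts ha)
    obtain ⟨j, hj⟩ := (he.mem _).1 (snd_mem_pts ha)
    rw [← hi, ← hj, hs, hs]
    refine G.sign_eq i j ?_
    rw [h]
    change (i.val, j.val) ∈ S
    rw [hi, hj]; exact ha
  · ext1
    · exact h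
    · exact funext fun i => (hs i).symm

/-! ### Subdiagrams -/

open scoped Classical in
/-- The value of `φ`, weighted by the signs, on the subdiagrams of a Gauss diagram. -/
noncomputable def subSum (φ : ArrowDiagram π → ℚ) {N : ℕ} (G : GaussRigid π N) : ℚ :=
  ∑ K : G.ArrowSet, ((G.sub K).totalSign : ℤ) * φ (arrowDiagram (G.sub K).toArrow)

/-- The product telescopes. Because of `l ≤ N` the arc passes the cut at most once, hence at most
one factor `T`. -/
theorem arcProd_lineGauss {N : ℕ} {e : Fin N → ℕ} {S : Finset (ℕ × ℕ)} (he : Enum e (pts S))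
    (hS : Good S) (M : ℕ → π) (T : π) {s : ℕ → ℤˣ} (hs : ∀ a ∈ S, s a.1 = s a.2) (i : Fin N)
    (l : ℕ) (hl : l ≤ N) :
    (lineGauss he hS M T hs).arcProd i l =
      (M (e i))⁻¹ * ((if i.val + l < N then 1 else T) * M (e ((finRotate N)^[l] i))) := by
  induction l with
  | zero => simp [GaussRigid.arcProd]
  | succ l ih =>
    have h1 : (lineGauss he hS M T hs).arcProd i (l + 1) =
        (lineGauss he hS M T hs).arcProd i l * (lineCirc e M T S).mark ((finRotate N)^[l] i) := by
      simp [GaussRigid.arcProd, List.range_succ, lineGauss]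
    rw [h1, ih (by omega), Function.iterate_succ_apply']
    set j := (finRotate N)^[l] i with hj
    have hjv : j.val = (i.val + l) % N := by
      rw [hj, ← val_finRotate_pow, Equiv.Perm.iterate_eq_pow]
    have hlt : e j < e (finRotate N j) ↔ j.val + 1 < N := by
      rw [he.mono.lt_iff_lt, Fin.lt_def, val_finRotate]
      have := j.2
      split_ifs <;> omega
    have hi := i.2
    simp only [lineCirc, hlt]
    by_cases c1 : i.val + l < N
    · rw [Nat.mod_eq_of_lt c1] at hjv
      rw [if_pos c1, hjv]
      simp [add_assoc]
    · rw [Nat.mod_eq_sub_mod (by omega), Nat.mod_eq_of_lt (by omega)] at hjv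
      rw [if_neg c1, if_pos (by omega), if_neg (by omega)]
      simp [mul_assoc]

/-- The product over a full turn from a point `p` is `(M p)⁻¹ * (T * M p)`, a conjugate of `T`. -/
theorem freeMark_lineGauss {N : ℕ} {e : Fin N → ℕ} {S : Finset (ℕ × ℕ)} (he : Enum e (pts S))
    (hS : Good S) (M : ℕ → π) (T : π) {s : ℕ → ℤˣ} (hs : ∀ a ∈ S, s a.1 = s a.2) :
    (lineGauss he hS M T hs).freeMark = ConjClasses.mk T := by
  by_cases hN : N = 0
  · exact dif_pos hN
  · rw [GaussRigid.freeMark, dif_neg hN]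
    set i : Fin N := ⟨0, by omega⟩ with hi
    have h0 : ∀ l : ℕ, ((finRotate N)^[l] i).val = l % N := fun l => by
      rw [Equiv.Perm.iterate_eq_pow, val_finRotate_pow]; simp [hi]
    have h1 : List.ofFn (lineGauss he hS M T hs).circ.mark =
        (List.range N).map fun t => (lineGauss he hS M T hs).circ.mark ((finRotate N)^[t] i) := by
      refine List.ext_getElem (by simp) fun k h1 h2 => ?_
      simp only [List.getElem_ofFn, List.getElem_map, List.getElem_range]
      congr 1
      have hk : k < N := by simpa using h1
      exact Fin.ext (by rw [h0, Nat.mod_eq_of_lt hk])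
    have h2 := arcProd_lineGauss he hS M T hs i N le_rfl
    have h3 : (finRotate N)^[N] i = i := Fin.ext (by rw [h0]; simp [hi])
    rw [GaussRigid.arcProd, ← h1, h3, if_neg (by simp)] at h2
    rw [h2, ConjClasses.mk_eq_mk_iff_isConj, isConj_iff]
    exact ⟨M (e i), by group⟩

/-- The tails of the arrows are in bijection with the arrows, since different arrows have no end in
common. -/
theorem totalSign_lineGauss {N : ℕ} {e : Fin N → ℕ} {S : Finset (ℕ × ℕ)} (he : Enum e (pts S))
    (hS : Good S) (M : ℕ → π) (T : π) {s : ℕ → ℤˣ} (hs : ∀ a ∈ S, s a.1 = s a.2) :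
    (lineGauss he hS M T hs).totalSign = ∏ a ∈ S, s a.1 := by
  classical
  rw [GaussRigid.totalSign, Finset.prod_ite, Finset.prod_const_one, mul_one]
  symm
  have hex : ∀ a ∈ S, ∃ i, e i = a.1 := fun a ha => (he.mem _).1 (fst_mem_pts ha)
  choose g hg using hex
  refine Finset.prod_bij g (fun a ha => ?_) (fun a ha b hb hab => ?_)
    (fun i hi => ?_) (fun a ha => ?_)
  · rw [Finset.mem_filter]
    obtain ⟨j, hj⟩ := (he.mem _).1 (snd_mem_pts ha)
    refine ⟨Finset.mem_univ _, j, ?_⟩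
    change (e _, e _) ∈ S
    rw [hj, hg a ha]; exact ha
  · by_contra hne
    exact (hS.2 a ha b hb hne).1 (by rw [← hg a ha, ← hg b hb, hab])
  · obtain ⟨-, j, hij⟩ := Finset.mem_filter.1 hi
    exact ⟨_, hij, he.mono.injective (hg _ hij)⟩
  · exact congrArg s (hg a ha).symm

/-- The set of arrows of a subdiagram. -/
def arrowsIn {N : ℕ} (e : Fin N → ℕ) (K : Finset (Fin N)) (S : Finset (ℕ × ℕ)) :
    Finset (ℕ × ℕ) := S.filter fun a => a.1 ∈ K.image e

theorem pts_arrowsIn {N : ℕ} {e : Fin N → ℕ} {S : Finset (ℕ × ℕ)} (he : Enum e (pts S))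
    {K : Finset (Fin N)} {M : ℕ → π} {T : π}
    (hK : ∀ i j, (lineCirc e M T S).inc i j → i ∈ K → j ∈ K) :
    pts (arrowsIn e K S) = K.image e := by
  ext p
  rw [mem_pts]
  have key : ∀ a ∈ S, a.1 ∈ K.image e ↔ a.2 ∈ K.image e := by
    intro a ha
    obtain ⟨i, hi⟩ := (he.mem _).1 (fst_mem_pts ha)
    obtain ⟨j, hj⟩ := (he.mem _).1 (snd_mem_pts ha)
    have hij : (e i, e j) ∈ S := by rw [hi, hj]; exact ha
    rw [← hi, ← hj]
    constructor <;> intro h <;> obtain ⟨k, hk, h⟩ := Finset.mem_image.1 h <;>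
      obtain rfl := he.mono.injective h
    · exact Finset.mem_image_of_mem _ (hK _ _ (.inl hij) hk)
    · exact Finset.mem_image_of_mem _ (hK _ _ (.inr hij) hk)
  constructor
  · rintro ⟨a, ha, h⟩
    obtain ⟨ha, ha'⟩ := Finset.mem_filter.1 ha
    rcases h with rfl | rfl
    · exact ha'
    · exact (key a ha).1 ha'
  · intro hp
    obtain ⟨i, hi, rfl⟩ := Finset.mem_image.1 hp
    obtain ⟨a, ha, h⟩ := mem_pts.1 (he.mem' i)
    refine ⟨a, Finset.mem_filter.2 ⟨ha, ?_⟩, h⟩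
    rcases h with h | h
    · rw [h]; exact hp
    · rw [key a ha, h]; exact hp

/-- This is the advantage of the potential: by telescoping, the merged edges have the decorations
given by the same `M` and `T`, so that a subdiagram is just a subset of the arrows. -/
theorem sub_lineGauss {N : ℕ} {e : Fin N → ℕ} {S : Finset (ℕ × ℕ)} (he : Enum e (pts S))
    (hS : Good S) (M : ℕ → π) (T : π) {s : ℕ → ℤˣ} (hs : ∀ a ∈ S, s a.1 = s a.2)
    (K : (lineGauss he hS M T hs).ArrowSet) :
    ∃ he' : Enum (fun i => e (K.1.orderEmbOfFin rfl i)) (pts (arrowsIn e K.1 S)),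
      (lineGauss he hS M T hs).sub K = lineGauss he' (hS.mono (Finset.filter_subset _ _)) M T
        (fun a ha => hs a (Finset.mem_filter.1 ha).1) := by
  have hp := pts_arrowsIn (M := M) (T := T) he K.2
  have he' : Enum (fun i => e (K.1.orderEmbOfFin rfl i)) (pts (arrowsIn e K.1 S)) := by
    rw [hp]
    refine ⟨he.mono.comp (K.1.orderEmbOfFin rfl).strictMono, fun p => ?_⟩
    rw [Finset.mem_image]
    constructor
    · rintro ⟨i, hi, rfl⟩
      have : i ∈ Set.range (K.1.orderEmbOfFin rfl) := by
        rw [Finset.range_orderEmbOfFin]; exact hi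
      obtain ⟨k, rfl⟩ := this
      exact ⟨k, rfl⟩
    · rintro ⟨k, rfl⟩
      exact ⟨_, K.1.orderEmbOfFin_mem rfl k, rfl⟩
  refine ⟨he', ?_⟩
  have hc : ((lineGauss he hS M T hs).sub K).circ =
      lineCirc (fun i => e (K.1.orderEmbOfFin rfl i)) M T (arrowsIn e K.1 S) := by
    ext i j
    · change (_, _) ∈ S ↔ (_, _) ∈ arrowsIn e K.1 S
      rw [arrowsIn, Finset.mem_filter]
      exact ⟨fun h => ⟨h, Finset.mem_image_of_mem _ (K.1.orderEmbOfFin_mem rfl i)⟩, fun h => h.1⟩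
    · change (lineGauss he hS M T hs).arcProd _ _ = _
      set a := K.1.orderEmbOfFin rfl i with ha
      set b := K.1.orderEmbOfFin rfl (finRotate _ i) with hb
      have ha2 := a.2
      have hb2 := b.2
      have hN : NeZero N := ⟨by omega⟩
      have hv : ((b - a : Fin N).val) = if a ≤ b then b.val - a.val else N + b.val - a.val := by
        rw [Fin.sub_def]
        simp only [Fin.le_def]
        split_ifs with h
        · rw [Nat.mod_eq_sub_mod (by omega), Nat.mod_eq_of_lt (by omega)]; omega
        · rw [Nat.mod_eq_of_lt (by omega)]; omega
      have hle : (b - a : Fin N).val ≤ N := (b - a).2.le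
      rw [arcProd_lineGauss _ _ _ _ _ _ _ hle]
      have hr : (finRotate N)^[(b - a : Fin N).val] a = b := by
        apply Fin.ext
        rw [Equiv.Perm.iterate_eq_pow, val_finRotate_pow, hv]
        simp only [Fin.le_def]
        split_ifs with h
        · rw [Nat.mod_eq_of_lt (by omega)]; omega
        · rw [Nat.mod_eq_sub_mod (by omega), Nat.mod_eq_of_lt (by omega)]; omega
      rw [hr]
      simp only [lineCirc, ← ha, ← hb]
      congr 3
      rw [hv, he.mono.lt_iff_lt]
      -- If the next remaining point were the same one, `b - a` would be `0` and the arc empty,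
      -- whereas the line gives a full turn `T`. It does not happen, because an arrow has two ends
      -- and so no arrow diagram has a single point.
      have hab : a ≠ b := by
        intro hab
        have h1 : i = finRotate _ i := (K.1.orderEmbOfFin rfl).injective hab
        obtain ⟨j, hj, -⟩ := ((lineGauss he hS M T hs).sub K).isArrow.2 i
        have h2 := congrArg Fin.val h1
        rw [val_finRotate] at h2
        have h3 := i.2
        have h4 := j.2
        have h5 : i = j := by
          apply Fin.ext
          split_ifs at h2 <;> omega
        subst h5
        rcases hj with hj | hj <;>
          exact ((lineGauss he hS M T hs).sub K).isArrow.1 _ _ hj hj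
      simp only [Fin.le_def, Fin.lt_def]
      rw [Ne, Fin.ext_iff] at hab
      split_ifs <;> simp only [eq_iff_iff] <;> omega
    · exact freeMark_lineGauss he hS M T hs
  ext1
  · exact hc
  · rfl

/-- The sum of the values of `φ`, weighted by the signs, over all subsets of a set of arrows on
the line. -/
noncomputable def lineSum (φ : ArrowDiagram π → ℚ) (M : ℕ → π) (T : π) (s : ℕ → ℤˣ)
    (S : Finset (ℕ × ℕ)) : ℚ :=
  ∑ S' ∈ S.powerset, (∏ a ∈ S', ((s a.1 : ℤ) : ℚ)) * lineVal φ M T S'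

theorem exists_arrowSet {N : ℕ} {e : Fin N → ℕ} {S S' : Finset (ℕ × ℕ)} (he : Enum e (pts S))
    (hS : Good S) (M : ℕ → π) (T : π) {s : ℕ → ℤˣ} (hs : ∀ a ∈ S, s a.1 = s a.2) (hS' : S' ⊆ S) :
    ∃ K : (lineGauss he hS M T hs).ArrowSet, arrowsIn e K.1 S = S' ∧
      ∀ i, i ∈ K.1 ↔ e i ∈ pts S' := by
  classical
  refine ⟨⟨Finset.univ.filter fun i => e i ∈ pts S', fun i j hij hi => ?_⟩, ?_, fun i => by simp⟩
  · simp only [Finset.mem_filter, Finset.mem_univ, true_and] at hi ⊢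
    obtain ⟨a, ha, hi⟩ := mem_pts.1 hi
    have h1 : (e i, a.1) ∈ S ∨ (a.1, e i) ∈ S ∨ (e i, a.2) ∈ S ∨ (a.2, e i) ∈ S := by
      have := hS' ha
      grind
    refine mem_pts.2 ⟨a, ha, ?_⟩
    have h2 : (e i, e j) ∈ S ∨ (e j, e i) ∈ S := hij
    rcases hi with hi | hi
    · right
      exact hS.inc_unique h2 (.inl (by rw [← hi]; exact hS' ha))
    · left
      exact hS.inc_unique h2 (.inr (by rw [← hi]; exact hS' ha))
  · ext a
    simp only [arrowsIn, Finset.mem_filter, Finset.mem_image, Finset.mem_univ, true_and]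
    constructor
    · rintro ⟨ha, i, hi, hia⟩
      rw [hia] at hi
      obtain ⟨b, hb, h⟩ := mem_pts.1 hi
      by_contra hab
      have := hS.2 a ha b (hS' hb) (by rintro rfl; exact hab hb)
      grind
    · intro ha
      obtain ⟨i, hi⟩ := (he.mem _).1 (fst_mem_pts (hS' ha))
      exact ⟨hS' ha, i, by rw [hi]; exact fst_mem_pts ha, hi⟩

theorem subSum_lineGauss (φ : ArrowDiagram π → ℚ) {N : ℕ} {e : Fin N → ℕ} {S : Finset (ℕ × ℕ)}
    (he : Enum e (pts S)) (hS : Good S) (M : ℕ → π) (T : π) {s : ℕ → ℤˣ}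
    (hs : ∀ a ∈ S, s a.1 = s a.2) :
    subSum φ (lineGauss he hS M T hs) = lineSum φ M T s S := by
  classical
  refine Finset.sum_bij (fun K _ => arrowsIn e K.1 S)
    (fun K _ => Finset.mem_powerset.2 (Finset.filter_subset _ _)) (fun K _ L _ h => ?_)
    (fun S' hS' => ?_) (fun K _ => ?_)
  · have h1 := congrArg pts h
    rw [pts_arrowsIn (M := M) (T := T) he K.2, pts_arrowsIn (M := M) (T := T) he L.2] at h1
    exact Subtype.ext (Finset.image_injective he.mono.injective h1)
  · have hS' := Finset.mem_powerset.1 hS'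
    obtain ⟨K, hK, -⟩ := exists_arrowSet he hS M T hs hS'
    exact ⟨K, Finset.mem_univ _, hK⟩
  · obtain ⟨he', h⟩ := sub_lineGauss he hS M T hs K
    rw [h, totalSign_lineGauss, lineVal_eq φ he' (isArrow_lineCirc he' (hS.mono (Finset.filter_subset _ _)) M T)]
    push_cast
    rfl

theorem subSum_sub_lineGauss (φ : ArrowDiagram π → ℚ) {N : ℕ} {e : Fin N → ℕ}
    {S : Finset (ℕ × ℕ)} (he : Enum e (pts S)) (hS : Good S) (M : ℕ → π) (T : π) {s : ℕ → ℤˣ}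
    (hs : ∀ a ∈ S, s a.1 = s a.2) (K : (lineGauss he hS M T hs).ArrowSet) :
    subSum φ ((lineGauss he hS M T hs).sub K) = lineSum φ M T s (arrowsIn e K.1 S) := by
  obtain ⟨he', h⟩ := sub_lineGauss he hS M T hs K
  rw [h, subSum_lineGauss]

end Line

/-! ### Normalized coefficients -/

section Weight

theorem aut_ne_zero {X : ℕ → Type*} [∀ N, MulAction (Rot N) (X N)]
    (D : Σ N : ℕ, MulAction.orbitRel.Quotient (Rot N) (X N)) : (aut D : ℚ) ≠ 0 := by
  obtain ⟨N, q⟩ := D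
  induction q using Quotient.inductionOn' with
  | h x =>
    have h : aut (⟨N, Quotient.mk'' x⟩ : Σ N : ℕ, MulAction.orbitRel.Quotient (Rot N) (X N)) =
      Nat.card (MulAction.stabilizer (Rot N) x) := rfl
    rw [h]
    exact_mod_cast Nat.card_pos.ne'

/-- The pairing with a series, as a function on diagrams. -/
noncomputable def weight {X : ℕ → Type*} [∀ N, MulAction (Rot N) (X N)]
    (φ : (Σ N : ℕ, MulAction.orbitRel.Quotient (Rot N) (X N)) → ℚ)
    (D : Σ N : ℕ, MulAction.orbitRel.Quotient (Rot N) (X N)) : ℚ := aut D * φ D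

theorem pair_single {X : ℕ → Type*} [∀ N, MulAction (Rot N) (X N)]
    (φ : (Σ N : ℕ, MulAction.orbitRel.Quotient (Rot N) (X N)) → ℚ)
    (D : Σ N : ℕ, MulAction.orbitRel.Quotient (Rot N) (X N)) :
    pair φ (Finsupp.single D 1) = weight φ D := by
  rw [pair, Finsupp.sum_single_index (by simp), mul_one, weight]

/-- The factor |Aut G| of the pairing cancels the denominator in S and leaves |Aut A| times the
coefficient of A. -/
theorem pair_twistedS (𝒜 : ArrowSeries π) {N : ℕ} (G : GaussRigid π N) :
    pair (twistedS 𝒜).1 G.subdiagramSum = subSum (weight 𝒜.1) G := by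
  classical
  rw [pair, GaussRigid.subdiagramSum, subSum, ← Finsupp.sum_finsetSum_index (by simp)
    (fun _ _ _ => mul_add _ _ _)]
  refine Finset.sum_congr rfl fun K _ => ?_
  rw [Finsupp.sum_single_index (by simp), mul_one]
  have h := aut_ne_zero (G.sub K).diagram
  have h2 : forgetSigns (G.sub K).diagram = arrowDiagram (G.sub K).toArrow := rfl
  have h3 : totalSign (G.sub K).diagram = (G.sub K).totalSign := rfl
  simp only [twistedS, LinearMap.coe_mk, AddHom.coe_mk, h2, h3, weight]
  field_simp

theorem wArrowDiagram_eq {w : π →* ℤˣ} {N : ℕ} {A B : ArrowRigid π N}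
    (h : wArrowDiagram w A = wArrowDiagram w B) :
    ∃ ρ : Rot N, Circ.WEquiv w A.1 ((ρ : Equiv.Perm (Fin N)) • B.1) := by
  have h1 : (Quotient.mk'' (Quotient.mk (arrowSetoid w N) A) :
      MulAction.orbitRel.Quotient (Rot N) (WArrowRigid w N)) = Quotient.mk'' ⟦B⟧ :=
    eq_of_heq (Sigma.mk.inj h).2
  obtain ⟨ρ, hρ⟩ := Quotient.exact' h1
  have h2 : Quotient.mk (arrowSetoid w N) (ρ • B) = Quotient.mk (arrowSetoid w N) A := hρ
  exact ⟨ρ, (arrowSetoid w N).symm (Quotient.exact h2)⟩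

theorem wOrbit_arrowDiagram (w : π →* ℤˣ) {N : ℕ} (A : ArrowRigid π N) :
    wOrbit w (arrowDiagram A) = wArrowDiagram w A := rfl

theorem exists_arrowDiagram (D : ArrowDiagram π) :
    ∃ (N : ℕ) (A : ArrowRigid π N), D = arrowDiagram A := by
  obtain ⟨N, q⟩ := D
  induction q using Quotient.inductionOn' with
  | h A => exact ⟨N, A, rfl⟩

theorem wOrbit_surjective (w : π →* ℤˣ) : Function.Surjective (wOrbit (π := π) w) := by
  rintro ⟨N, q⟩
  induction q using Quotient.inductionOn' with
  | h q =>
  induction q using Quotient.inductionOn with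
  | h A => exact ⟨arrowDiagram A, rfl⟩

/-- A function on arrow diagrams is invariant under `w`-moves. -/
def WInvariant (w : π →* ℤˣ) (φ : ArrowDiagram π → ℚ) : Prop :=
  ∀ (N : ℕ) (A B : ArrowRigid π N), Circ.WEquiv w A.1 B.1 → φ (arrowDiagram A) = φ (arrowDiagram B)

theorem WInvariant.eq_of_wOrbit {w : π →* ℤˣ} {φ : ArrowDiagram π → ℚ} (h : WInvariant w φ)
    {D E : ArrowDiagram π} (hDE : wOrbit w D = wOrbit w E) : φ D = φ E := by
  obtain ⟨N, A, rfl⟩ := exists_arrowDiagram D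
  obtain ⟨M, B, rfl⟩ := exists_arrowDiagram E
  rw [wOrbit_arrowDiagram, wOrbit_arrowDiagram] at hDE
  obtain rfl : N = M := congrArg Sigma.fst hDE
  obtain ⟨ρ, hρ⟩ := wArrowDiagram_eq hDE
  rw [h N A (ρ • B) hρ, arrowDiagram_smul]

/-- The quotient |Aut α| / |Aut A| in S_aw^a is the one for which normalized coefficients are simply
pulled back to the arrow diagrams. -/
theorem weight_wS {w : π →* ℤˣ} (𝒜w : WArrowSeries w) (D : ArrowDiagram π) :
    weight (wS w 𝒜w).1 D = weight 𝒜w.1 (wOrbit w D) := by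
  have h := aut_ne_zero D
  simp only [weight, wS, LinearMap.coe_mk, AddHom.coe_mk]
  field_simp

theorem wInvariant_wS {w : π →* ℤˣ} (𝒜w : WArrowSeries w) :
    WInvariant w (weight (wS w 𝒜w).1) := by
  intro N A B h
  rw [weight_wS, weight_wS, wOrbit_arrowDiagram, wOrbit_arrowDiagram]
  have : Quotient.mk (arrowSetoid w N) A = Quotient.mk (arrowSetoid w N) B := Quotient.sound h
  rw [wArrowDiagram, this]
  rfl

/-- Normalized coefficients that are constant on w-orbits descend: evaluate at any representative
and divide by the order of the symmetry group of the orbit. -/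
theorem exists_wS {w : π →* ℤˣ} {𝒜 : ArrowSeries π} (h : WInvariant w (weight 𝒜.1)) :
    ∃ 𝒜w : WArrowSeries w, wS w 𝒜w = 𝒜 := by
  set rep := Function.surjInv (wOrbit_surjective (π := π) w) with hrep
  have hr : ∀ α, wOrbit w (rep α) = α := Function.surjInv_eq _
  obtain ⟨n, hn⟩ := 𝒜.2
  refine ⟨⟨fun α => weight 𝒜.1 (rep α) / aut α, n, fun α hα => ?_⟩, ?_⟩
  · have h1 : (rep α).1 = α.1 := congrArg Sigma.fst (hr α)
    change weight 𝒜.1 (rep α) / _ = 0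
    rw [weight, hn (rep α) (by change n < (rep α).1 / 2; rw [h1]; exact hα)]
    simp
  · ext D
    have h1 := h.eq_of_wOrbit (hr (wOrbit w D))
    have h2 := aut_ne_zero D
    have h3 := aut_ne_zero (wOrbit w D)
    change (aut (wOrbit w D) : ℚ) / aut D * (weight 𝒜.1 (rep (wOrbit w D)) / aut (wOrbit w D)) = _
    rw [h1, weight]
    field_simp

/-- S_aw^a and T_aw^a are adjoint for the normalized pairings, so condition 3 is a statement about
`weight 𝒜.1`. -/
theorem pair_wT {w : π →* ℤˣ} {𝒜w : WArrowSeries w} {𝒜 : ArrowSeries π} (h : wS w 𝒜w = 𝒜)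
    (D : ArrowDiagram π) : pair 𝒜w.1 (wT w (Finsupp.single D 1)) = weight 𝒜.1 D := by
  rw [wT, Finsupp.lmapDomain_apply, Finsupp.mapDomain_single, pair_single, ← h, weight_wS]

end Weight

/-! ### The map `d_w` on the two resolutions of a degenerate diagram -/

section Differential

/-- Rotations act freely on the points. A degenerate diagram has a distinguished point, so a
rotation that preserves this point is trivial. -/
theorem rot_eq_one_of_fixed {N : ℕ} {ρ : Rot N} {i : Fin N}
    (h : (ρ : Equiv.Perm (Fin N)) i = i) : ρ = 1 := by
  obtain ⟨σ, hσ⟩ := ρ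
  obtain ⟨k, rfl⟩ : ∃ k : ℕ, finRotate N ^ k = σ := by
    have := mem_powers_iff_mem_zpowers.2 hσ
    exact this
  have h1 : ((finRotate N ^ k) i).val = i.val := congrArg Fin.val h
  rw [val_finRotate_pow] at h1
  have h2 : k % N = 0 := by
    have := i.2
    have h3 : (i.val + k) % N = (i.val + 0) % N := by rw [h1, add_zero, Nat.mod_eq_of_lt this]
    have h4 : k ≡ 0 [MOD N] := Nat.ModEq.add_left_cancel' _ h3
    simpa [Nat.ModEq] using h4
  refine Subtype.ext (Equiv.ext fun j => Fin.ext ?_)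
  change ((finRotate N ^ k) j).val = j.val
  rw [val_finRotate_pow, Nat.add_mod, h2, add_zero, Nat.mod_mod, Nat.mod_eq_of_lt j.2]

/-- The exchange of the two ends of the base edge. -/
def Circ.swapEnds {K : ℕ} (X : Circ π (K + 2)) : Circ π (K + 2) where
  arr i j := X.arr (Equiv.swap 0 (Fin.last _) i) (Equiv.swap 0 (Fin.last _) j)
  mark := X.mark
  free := X.free

theorem glue_swap {K : ℕ} (a : Fin (K + 2)) : glue (Equiv.swap 0 (Fin.last _) a) = glue a := by
  rw [Equiv.swap_apply_def]
  split_ifs with h h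
  · rw [h, glue_zero, glue_last]
  · rw [h, glue_zero, glue_last]
  · rfl

namespace Circ

variable {K : ℕ} {X Y : Circ π (K + 2)}

theorem swapEnds_swapEnds (X : Circ π (K + 2)) : X.swapEnds.swapEnds = X := by
  ext <;> simp [swapEnds]

theorem IsArrow.swapEnds (h : X.IsArrow) : X.swapEnds.IsArrow := by
  refine ⟨fun i j => h.1 _ _, fun i => ?_⟩
  obtain ⟨j, hj, hu⟩ := h.2 (Equiv.swap 0 (Fin.last _) i)
  refine ⟨Equiv.swap 0 (Fin.last _) j, ?_, fun k hk => ?_⟩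
  · simpa [inc, Circ.swapEnds] using hj
  · have := hu _ hk
    rw [← this]; simp

theorem Nice.swapEnds (h : X.Nice) : X.swapEnds.Nice :=
  ⟨h.1, fun hi => h.2 (by simpa [inc, Circ.swapEnds, or_comm] using hi)⟩

theorem shrink_swapEnds (X : Circ π (K + 2)) : X.swapEnds.shrink = X.shrink := by
  ext i j
  · constructor
    · rintro ⟨a, b, rfl, rfl, h⟩
      exact ⟨_, _, glue_swap a, glue_swap b, h⟩
    · rintro ⟨a, b, rfl, rfl, h⟩
      exact ⟨_, _, glue_swap a, glue_swap b, by simpa [Circ.swapEnds] using h⟩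
  · rfl
  · rfl

theorem shrink_conj (w : π →* ℤˣ) (g : Fin (K + 1) → π) (X : Circ π (K + 2)) :
    (X.conj w fun i => g (glue i)).shrink = X.shrink.conj w g := by
  ext i j
  · simp only [shrink, conj]
    constructor
    · rintro ⟨a, b, rfl, rfl, h⟩
      split_ifs at h ⊢
      · exact ⟨a, b, rfl, rfl, h⟩
      · exact ⟨b, a, rfl, rfl, h⟩
    · intro h
      split_ifs at h with h1
      · obtain ⟨a, b, rfl, rfl, h⟩ := h
        exact ⟨a, b, rfl, rfl, by rwa [if_pos h1]⟩
      · obtain ⟨a, b, rfl, rfl, h⟩ := h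
        exact ⟨b, a, rfl, rfl, by rwa [if_neg h1]⟩
  · simp only [shrink, conj, glue_castSucc, glue_rotate]
  · rfl

theorem Nice.conj_glue (h : X.Nice) {w : π →* ℤˣ} {g : Fin (K + 1) → π}
    (hg : ∀ i j, X.arr i j → g (glue i) = g (glue j)) : (X.conj w fun i => g (glue i)).Nice :=
  ⟨by simp [conj, h.1, glue_last, glue_zero], by
    rw [inc_conj (g := fun i => g (glue i)) hg]; exact h.2⟩

theorem swapEnds_conj (w : π →* ℤˣ) (g : Fin (K + 1) → π) (X : Circ π (K + 2)) :
    (X.conj w fun i => g (glue i)).swapEnds = X.swapEnds.conj w fun i => g (glue i) := by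
  ext i j <;> simp [swapEnds, conj, glue_swap]

/-- The partners of the ends of a nice base edge. -/
theorem exists_partners (h : X.IsArrow) (hn : X.Nice) : ∃ p q, X.inc 0 p ∧ X.inc (Fin.last _) q ∧
    p ≠ 0 ∧ p ≠ Fin.last _ ∧ q ≠ 0 ∧ q ≠ Fin.last _ ∧ p ≠ q := by
  obtain ⟨p, hp, -⟩ := h.2 0
  obtain ⟨q, hq, -⟩ := h.2 (Fin.last _)
  have hirr : ∀ a, ¬ X.inc a a := fun a ha => by
    rcases ha with ha | ha <;> exact h.1 _ _ ha ha
  refine ⟨p, q, hp, hq, ?_, ?_, ?_, ?_, ?_⟩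
  · rintro rfl; exact hirr _ hp
  · rintro rfl; exact hn.2 hp.symm
  · rintro rfl; exact hn.2 hq
  · rintro rfl; exact hirr _ hq
  · rintro rfl
    exact absurd ((h.2 p).unique hp.symm hq.symm) (by simp [Fin.ext_iff])

/-- The chord from `q` to the last point separates `0` from `p` precisely when `q < p`. -/
theorem eta_last {p q : Fin (K + 2)} (h : X.IsArrow) (hp : X.inc 0 p) (hq : X.inc (Fin.last _) q)
    (hp1 : p ≠ Fin.last _) (hq1 : q ≠ Fin.last _) :
    X.eta (Fin.last _) = if q < p then 1 else -1 := by
  classical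
  refine if_congr ?_ rfl rfl
  simp only [finRotate_last]
  have h1 := Fin.le_last p
  have h2 : q < Fin.last _ := Fin.lt_last_iff_ne_last.2 hq1
  constructor
  · rintro ⟨a, b, ha, hb, hc⟩
    obtain rfl := (h.2 _).unique ha hq
    obtain rfl := (h.2 _).unique hb hp
    rw [Crosses, min_eq_right h2.le, max_eq_left h2.le] at hc
    rcases hc with ⟨hc, -⟩ | ⟨hc, -⟩
    · exact absurd hc.1 (by simp)
    · exact hc.1
  · intro hlt
    refine ⟨q, p, hq, hp, ?_⟩
    rw [Crosses, min_eq_right h2.le, max_eq_left h2.le]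
    refine .inr ⟨⟨hlt, ?_⟩, fun hc => absurd hc.1 (by simp)⟩
    exact Fin.lt_last_iff_ne_last.2 hp1

theorem up_eq {N : ℕ} {X : Circ π N} {e : Fin N} {P Q : Prop} [Decidable P] [Decidable Q]
    (hP : X.IsHead e ↔ P) (hQ : X.IsHead (finRotate N e) ↔ Q) :
    X.up e = (if P then 1 else 0) + (if Q then 1 else 0) := by
  classical
  exact congrArg₂ _ (if_congr hP rfl rfl) (if_congr hQ rfl rfl)

/-- The exchange interchanges the two partners, which switches between crossing and not crossing,
while the number of arrowheads on the edge stays the same. -/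
theorem eps_swapEnds (h : X.IsArrow) (hn : X.Nice) :
    X.swapEnds.eps (Fin.last _) = -X.eps (Fin.last _) := by
  obtain ⟨p, q, hp, hq, p0, p1, q0, q1, hpq⟩ := exists_partners h hn
  have hp' : X.swapEnds.inc (Fin.last _) p := by
    simpa [inc, Circ.swapEnds, Equiv.swap_apply_of_ne_of_ne p0 p1] using hp
  have hq' : X.swapEnds.inc 0 q := by
    simpa [inc, Circ.swapEnds, Equiv.swap_apply_of_ne_of_ne q0 q1] using hq
  have hH : ∀ i, X.swapEnds.IsHead i ↔ X.IsHead (Equiv.swap 0 (Fin.last _) i) := by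
    intro i
    constructor
    · rintro ⟨j, hj⟩; exact ⟨_, hj⟩
    · rintro ⟨j, hj⟩; exact ⟨Equiv.swap 0 (Fin.last _) j, by simpa [Circ.swapEnds] using hj⟩
  have hup : X.swapEnds.up (Fin.last _) = X.up (Fin.last _) := by
    classical
    rw [up_eq (X := X) Iff.rfl Iff.rfl, up_eq (hH _) (hH _), finRotate_last,
      Equiv.swap_apply_left, Equiv.swap_apply_right, add_comm]
  rw [eps, eps, hup, eta_last h hp hq p1 q1, eta_last h.swapEnds hq' hp' q1 p1]
  rcases lt_or_gt_of_ne hpq with h1 | h1 <;> simp [h1, h1.not_gt]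

theorem isHead_conj (h : X.IsArrow) {w : π →* ℤˣ} {g : Fin (K + 2) → π}
    (hg : ∀ i j, X.arr i j → g i = g j) (i : Fin (K + 2)) :
    (X.conj w g).IsHead i ↔ if w (g i) = 1 then X.IsHead i else ¬ X.IsHead i := by
  obtain ⟨j, hj, hu⟩ := h.2 i
  have h1 : X.IsHead i ↔ X.arr j i := by
    refine ⟨fun ⟨k, hk⟩ => ?_, fun h => ⟨j, h⟩⟩
    rw [← hu k (.inr hk)]; exact hk
  have h2 : (X.conj w g).IsHead i ↔ (X.conj w g).arr j i := by
    refine ⟨fun ⟨k, hk⟩ => ?_, fun h => ⟨j, h⟩⟩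
    rw [← hu k ((inc_conj hg i k).1 (.inr hk))]; exact hk
  have hgij : g j = g i := by
    rcases hj with hj | hj
    · exact (hg _ _ hj).symm
    · exact hg _ _ hj
  rw [h1, h2]
  simp only [conj, hgij]
  have h3 := h.1 i j
  have h4 : X.arr i j ∨ X.arr j i := hj
  split_ifs <;> tauto

/-- Crossing is not affected by reversing arrows. As `g` agrees at both ends, both arrows or none
are reversed, and ↑ and 2 - ↑ have the same parity. -/
theorem eps_conj (h : X.IsArrow) (hn : X.Nice) {w : π →* ℤˣ} {g : Fin (K + 2) → π}
    (hg : ∀ i j, X.arr i j → g i = g j) (he : g (Fin.last _) = g 0) :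
    (X.conj w g).eps (Fin.last _) = X.eps (Fin.last _) := by
  obtain ⟨p, q, hp, hq, p0, p1, q0, q1, hpq⟩ := exists_partners h hn
  rw [eps, eps, eta_last h hp hq p1 q1, eta_last (h.conj hg) ((inc_conj hg _ _).2 hp)
    ((inc_conj hg _ _).2 hq) p1 q1]
  congr 1
  classical
  rw [up_eq (X := X) Iff.rfl Iff.rfl, up_eq (isHead_conj h hg _) (isHead_conj h hg _),
    finRotate_last, he]
  by_cases hw : w (g 0) = 1
  · simp [hw]
  · by_cases h1 : X.IsHead (Fin.last _) <;> by_cases h2 : X.IsHead 0 <;> simp [hw, h1, h2]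

/-- Shrinking only forgets which of the two arrows at the degenerate point ended at `0` and which at
the last point; the partner of `0` restores this information. -/
theorem arr_of_shrink_eq (hX : X.IsArrow) (hY : Y.IsArrow) (nX : X.Nice) (nY : Y.Nice)
    (hs : X.shrink = Y.shrink) {p : Fin (K + 2)} (h1 : X.inc 0 p) (h2 : Y.inc 0 p)
    {a b : Fin (K + 2)} (hab : X.arr a b) : Y.arr a b := by
  have h3 : Y.shrink.arr (glue a) (glue b) := hs ▸ ⟨a, b, rfl, rfl, hab⟩
  have irr : ∀ a, ¬ X.inc a a := fun a ha => by
    rcases ha with ha | ha <;> exact hX.1 _ _ ha ha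
  have irr' : ∀ a, ¬ Y.inc a a := fun a ha => by
    rcases ha with ha | ha <;> exact hY.1 _ _ ha ha
  have sX : ∀ {a b}, X.inc a b → X.inc b a := fun h => h.symm
  have sY : ∀ {a b}, Y.inc a b → Y.inc b a := fun h => h.symm
  have ne : (0 : Fin (K + 2)) ≠ Fin.last _ := by simp [Fin.ext_iff]
  have u0 : ∀ b, X.inc 0 b → b = p := fun b hb => (hX.2 0).unique hb h1
  have u1 : ∀ b, Y.inc 0 b → b = p := fun b hb => (hY.2 0).unique hb h2
  have nl : ¬ X.inc (Fin.last _) p := fun h => ne ((hX.2 p).unique (sX h1) (sX h))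
  have nl' : ¬ Y.inc (Fin.last _) p := fun h => ne ((hY.2 p).unique (sY h2) (sY h))
  have nX2 := nX.2
  have nY2 := nY.2
  have i1 : X.inc a b := .inl hab
  have i1' := sX i1
  obtain ⟨a', b', ha, hb, h⟩ := h3
  have i2 : Y.inc a' b' := .inl h
  have i2' := sY i2
  rcases glue_eq ha with rfl | ⟨rfl, rfl⟩ | ⟨rfl, rfl⟩ <;>
    rcases glue_eq hb with rfl | ⟨rfl, rfl⟩ | ⟨rfl, rfl⟩
  · exact h
  all_goals grind

/-- A degenerate point has exactly two resolutions: the partner `p` of `0` in `X` is joined in `Y`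
either to `0` or to the last point. -/
theorem eq_or_eq_swapEnds (hX : X.IsArrow) (hY : Y.IsArrow) (nX : X.Nice) (nY : Y.Nice)
    (hs : X.shrink = Y.shrink) : Y = X ∨ Y = X.swapEnds := by
  have key : ∀ {X Y : Circ π (K + 2)} {p : Fin (K + 2)}, X.IsArrow → Y.IsArrow → X.Nice →
      Y.Nice → X.shrink = Y.shrink → X.inc 0 p → Y.inc 0 p → Y = X := by
    intro X Y p hX hY nX nY hs h1 h2
    ext i j
    · exact ⟨arr_of_shrink_eq hY hX nY nX hs.symm h2 h1, arr_of_shrink_eq hX hY nX nY hs h1 h2⟩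
    · induction i using Fin.lastCases with
      | last => rw [nX.1, nY.1]
      | cast i => exact (congrFun (congrArg Circ.mark hs) i).symm
    · exact absurd i (by simp)
  obtain ⟨p, q, hp, hq, p0, p1, q0, q1, hpq⟩ := exists_partners hX nX
  have h1 : Y.shrink.inc 0 (glue p) := by
    rw [← hs, inc_shrink]; exact ⟨0, p, glue_zero, rfl, hp⟩
  obtain ⟨a, b, ha, hb, hab⟩ := inc_shrink.1 h1
  obtain rfl : b = p := by
    rcases glue_eq hb with h | ⟨-, h⟩ | ⟨-, h⟩
    · exact h
    · exact absurd h p0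
    · exact absurd h p1
  rw [← glue_zero] at ha
  rcases glue_eq ha with rfl | ⟨rfl, -⟩ | ⟨rfl, h⟩
  · exact .inl (key hX hY nX nY hs hp hab)
  · right
    have h2 : Y.swapEnds.inc 0 b := by
      simpa [inc, Circ.swapEnds, Equiv.swap_apply_of_ne_of_ne p0 p1] using hab
    rw [← key hX hY.swapEnds nX nY.swapEnds (hs.trans (shrink_swapEnds Y).symm) hp h2,
      swapEnds_swapEnds]
  · exact absurd h (by simp [Fin.ext_iff])

theorem center_shrink (h : X.IsArrow) {i j k : Fin (K + 1)} (hjk : j ≠ k)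
    (hj : X.shrink.inc i j) (hk : X.shrink.inc i k) : i = 0 := by
  by_contra hi
  obtain ⟨a, b, rfl, rfl, hab⟩ := inc_shrink.1 hj
  obtain ⟨a', b', ha, rfl, hab'⟩ := inc_shrink.1 hk
  rcases glue_eq ha with rfl | ⟨-, rfl⟩ | ⟨-, rfl⟩
  · exact hjk (by rw [(h.2 _).unique hab hab'])
  · exact hi glue_zero
  · exact hi glue_last

end Circ

/-- The exchange of the two ends of the base edge of an arrow diagram. -/
def ArrowRigid.swapEnds {K : ℕ} (A : ArrowRigid π (K + 2)) : ArrowRigid π (K + 2) :=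
  ⟨A.1.swapEnds, A.2.swapEnds⟩

/-- A conjugation of the degenerate diagram lifts through `glue`, since it has a single value at the
degenerate point. Hence at most two based w-orbits contribute to a degenerate w-orbit. -/
theorem wEquiv_of_wDegDiagram_shrink {w : π →* ℤˣ} {K : ℕ} {A B : ArrowRigid π (K + 2)}
    (hA : A.1.Nice) (hB : B.1.Nice)
    (h : wDegDiagram w (A.shrink hA) = wDegDiagram w (B.shrink hB)) :
    Circ.WEquiv w A.1 B.1 ∨ Circ.WEquiv w A.swapEnds.1 B.1 := by
  obtain ⟨ρ, g, hg, hρ⟩ := wDegDiagram_eq h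
  have hgA : ∀ i j, A.1.arr i j → g (glue i) = g (glue j) := fun i j hij =>
    hg _ _ ⟨i, j, rfl, rfl, hij⟩
  have hgA' : ∀ i j, A.swapEnds.1.arr i j → g (glue i) = g (glue j) := fun i j hij => by
    rw [← glue_swap i, ← glue_swap j]
    exact hgA _ _ hij
  -- The point `0` is the degenerate point of both shrunk diagrams, so the rotation fixes it.
  have h1 : ρ = 1 := by
    obtain ⟨p, q, hp, hq, p0, p1, q0, q1, hpq⟩ := Circ.exists_partners A.2 hA
    have e1 : B.1.shrink.inc ((ρ : Equiv.Perm (Fin (K + 1)))⁻¹ 0)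
        ((ρ : Equiv.Perm (Fin (K + 1)))⁻¹ (glue p)) := by
      change ((ρ : Equiv.Perm (Fin (K + 1))) • (B.shrink hB).1).inc 0 (glue p)
      rw [hρ, Circ.inc_conj hg]
      exact Circ.inc_shrink.2 ⟨_, _, glue_zero, rfl, hp⟩
    have e2 : B.1.shrink.inc ((ρ : Equiv.Perm (Fin (K + 1)))⁻¹ 0)
        ((ρ : Equiv.Perm (Fin (K + 1)))⁻¹ (glue q)) := by
      change ((ρ : Equiv.Perm (Fin (K + 1))) • (B.shrink hB).1).inc 0 (glue q)
      rw [hρ, Circ.inc_conj hg]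
      exact Circ.inc_shrink.2 ⟨_, _, glue_last, rfl, hq⟩
    have e3 := Circ.center_shrink B.2 (fun e => by
      have e := (ρ : Equiv.Perm (Fin (K + 1)))⁻¹.injective e
      rcases glue_eq e with e | ⟨e, -⟩ | ⟨e, -⟩
      · exact hpq e
      · exact p1 e
      · exact p0 e) e1 e2
    refine rot_eq_one_of_fixed (i := 0) ?_
    rw [Equiv.Perm.inv_eq_iff_eq] at e3
    exact e3.symm
  subst h1
  have h2 : (A.1.conj w fun i => g (glue i)).shrink = B.1.shrink := by
    rw [Circ.shrink_conj]
    exact hρ.symm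
  rcases Circ.eq_or_eq_swapEnds (A.2.conj hgA) B.2 (hA.conj_glue hgA) hB h2 with h3 | h3
  · exact .inl ⟨_, hgA, h3⟩
  · rw [Circ.swapEnds_conj] at h3
    exact .inr ⟨_, hgA', h3⟩

/-- δ_w is well defined: both the shrunk w-orbit and the sign ε are independent of the chosen nice
representative. -/
theorem wDegDiagram_shrink_congr {w : π →* ℤˣ} {K : ℕ} {A B : ArrowRigid π (K + 2)}
    (hA : A.1.Nice) (hB : B.1.Nice) (h : Circ.WEquiv w A.1 B.1) :
    wDegDiagram w (A.shrink hA) = wDegDiagram w (B.shrink hB) ∧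
      B.1.eps (Fin.last _) = A.1.eps (Fin.last _) := by
  obtain ⟨g, hg, hB'⟩ := h
  -- The base edge is decorated by `1` before and after the conjugation, which forces `g` to agree
  -- at its ends, so `g` descends to the shrunk circle.
  have h0 : g (Fin.last _) = g 0 := by
    have h1 := hB.1
    rw [hB'] at h1
    simp only [Circ.conj, hA.1, finRotate_last, mul_one] at h1
    exact inv_mul_eq_one.1 h1
  have hgl : g = fun i => g (glue i).castSucc := by
    funext i
    induction i using Fin.lastCases with
    | last => rw [glue_last]; exact h0
    | cast i => rw [glue_castSucc]
  refine ⟨?_, by rw [hB', Circ.eps_conj A.2 hA hg h0]⟩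
  have h2 : Quotient.mk (degSetoid w _) (A.shrink hA) =
      Quotient.mk (degSetoid w _) (B.shrink hB) := by
    refine Quotient.sound ⟨fun i => g i.castSucc, ?_, ?_⟩
    · rintro i j ⟨a, b, rfl, rfl, hab⟩
      have := hg a b hab
      rw [hgl] at this
      exact this
    · change B.1.shrink = A.1.shrink.conj w _
      rw [hB', hgl, Circ.shrink_conj w fun i => g i.castSucc]
      simp only [glue_castSucc]
  rw [wDegDiagram, h2]
  rfl

theorem deltaW_of_nice {w : π →* ℤˣ} {K : ℕ} (b : WArrowRigid w (K + 2))
    (h : ∃ A : ArrowRigid π (K + 2), Quotient.mk (arrowSetoid w _) A = b ∧ A.1.Nice) :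
    deltaW w ⟨K + 2, b⟩ =
      Finsupp.single (wDegDiagram w (ArrowRigid.shrink h.choose h.choose_spec.2))
        ((h.choose.1.eps (Fin.last _) : ℤ) : ℚ) := by
  rw [deltaW, dif_pos h]

theorem deltaW_shrink {w : π →* ℤˣ} {K : ℕ} (A : ArrowRigid π (K + 2)) (hA : A.1.Nice) :
    deltaW w ⟨K + 2, Quotient.mk (arrowSetoid w _) A⟩ (wDegDiagram w (A.shrink hA)) =
      ((A.1.eps (Fin.last _) : ℤ) : ℚ) := by
  generalize hb : Quotient.mk (arrowSetoid w _) A = b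
  have hex : ∃ B : ArrowRigid π (K + 2),
      Quotient.mk (arrowSetoid w _) B = b ∧ B.1.Nice := ⟨A, hb, hA⟩
  have h1 : Circ.WEquiv w A.1 hex.choose.1 :=
    (arrowSetoid w _).symm (Quotient.exact (hex.choose_spec.1.trans hb.symm))
  obtain ⟨h2, h3⟩ := wDegDiagram_shrink_congr hA hex.choose_spec.2 h1
  rw [deltaW_of_nice b hex, h2, Finsupp.single_eq_same, h3]

/-- The same based w-orbit arises once for each rotation in the stabilizer. This multiplicity is the
normalization factor in `weight`. -/
theorem wBullet_self {w : π →* ℤˣ} (b : WBasedDiagram w) :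
    wBullet w ⟨b.1, Quotient.mk'' b.2⟩ b = aut (⟨b.1, Quotient.mk'' b.2⟩ : WArrowDiagram w) := by
  classical
  obtain ⟨N, A⟩ := b
  change (∑ ρ : Rot N, Finsupp.single (⟨N, ρ • A⟩ : WBasedDiagram w) (1 : ℚ)) ⟨N, A⟩ =
    (Nat.card (MulAction.stabilizer (Rot N) A) : ℚ)
  rw [Finsupp.finsetSum_apply, Nat.card_eq_fintype_card]
  have h : ∀ ρ : Rot N, Finsupp.single (⟨N, ρ • A⟩ : WBasedDiagram w) (1 : ℚ) ⟨N, A⟩ =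
      if ρ ∈ MulAction.stabilizer (Rot N) A then 1 else 0 := by
    intro ρ
    rw [Finsupp.single_apply]
    refine if_congr ?_ rfl rfl
    rw [MulAction.mem_stabilizer_iff]
    exact ⟨fun h => eq_of_heq (Sigma.mk.inj h).2, fun h => by rw [h]⟩
  simp only [h, Finset.sum_boole]
  rw [Fintype.card_subtype]

theorem dW_apply {w : π →* ℤˣ} (𝒜w : WArrowSeries w) (D : WDegDiagram w) :
    (dW w 𝒜w).1 D = ∑ᶠ b : WBasedDiagram w,
      weight 𝒜w.1 ⟨b.1, Quotient.mk'' b.2⟩ * deltaW w b D := by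
  change (∑ᶠ b : WBasedDiagram w, (∑ᶠ α, 𝒜w.1 α * wBullet w α b) * deltaW w b D) = _
  refine finsum_congr fun b => ?_
  rw [finsum_eq_single _ (⟨b.1, Quotient.mk'' b.2⟩ : WArrowDiagram w) fun α hα => ?_]
  · rw [wBullet_self, weight, mul_comm (𝒜w.1 _)]
  · rw [not_not.1 fun h => hα (wBullet_ne_zero h), mul_zero]

/-- Only the two resolutions contribute to a degenerate diagram, with opposite signs by
`eps_swapEnds`. -/
theorem dW_shrink {w : π →* ℤˣ} (𝒜w : WArrowSeries w) {K : ℕ} (A : ArrowRigid π (K + 2))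
    (hA : A.1.Nice) : (dW w 𝒜w).1 (wDegDiagram w (A.shrink hA)) = ((A.1.eps (Fin.last _) : ℤ) : ℚ) *
      (weight 𝒜w.1 (wArrowDiagram w A) - weight 𝒜w.1 (wArrowDiagram w A.swapEnds)) := by
  classical
  have hA' : A.swapEnds.1.Nice := hA.swapEnds
  set b₁ : WBasedDiagram w := ⟨K + 2, Quotient.mk (arrowSetoid w _) A⟩ with hb1
  set b₂ : WBasedDiagram w := ⟨K + 2, Quotient.mk (arrowSetoid w _) A.swapEnds⟩ with hb2
  have hD : wDegDiagram w (A.swapEnds.shrink hA') = wDegDiagram w (A.shrink hA) := by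
    congr 1
    exact Subtype.ext (Circ.shrink_swapEnds A.1)
  -- No coincidence of the two terms: a w-move keeps the chords as they are, in particular the
  -- partner of the first point, and no rotation is allowed for based diagrams.
  have hne : b₁ ≠ b₂ := by
    intro h
    have h1 : Quotient.mk (arrowSetoid w _) A = Quotient.mk (arrowSetoid w _) A.swapEnds :=
      eq_of_heq (Sigma.mk.inj h).2
    obtain ⟨g, hg, h2⟩ := Quotient.exact h1
    obtain ⟨p, q, hp, hq, p0, p1, q0, q1, hpq⟩ := Circ.exists_partners A.2 hA
    have h3 : A.1.swapEnds.inc 0 p := by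
      change A.swapEnds.1.inc 0 p
      rw [h2, Circ.inc_conj hg]; exact hp
    have h4 : A.1.inc (Fin.last _) p := by
      simpa [Circ.inc, Circ.swapEnds, Equiv.swap_apply_of_ne_of_ne p0 p1] using h3
    exact absurd ((A.2.2 p).unique hp.symm h4.symm) (by simp [Fin.ext_iff])
  rw [dW_apply, finsum_eq_sum_of_support_subset (s := {b₁, b₂}) _ fun b hb => ?_,
    Finset.sum_pair hne]
  · rw [deltaW_shrink A hA]
    have h := deltaW_shrink (w := w) A.swapEnds hA'
    rw [hD] at h
    rw [h]
    change _ + _ * (((A.1.swapEnds.eps (Fin.last _) : ℤˣ) : ℤ) : ℚ) = _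
    rw [Circ.eps_swapEnds A.2 hA]
    push_cast
    change weight 𝒜w.1 (wArrowDiagram w A) * _ + weight 𝒜w.1 (wArrowDiagram w A.swapEnds) * _ = _
    ring
  · have hb' := right_ne_zero_of_mul hb
    obtain ⟨L, B, hB, rfl, h⟩ := deltaW_ne_zero hb'
    obtain rfl : K = L := by
      have := congrArg Sigma.fst h
      simpa [wDegDiagram] using this
    simp only [Finset.coe_insert, Finset.coe_singleton, Set.mem_insert_iff, Set.mem_singleton_iff]
    rcases wEquiv_of_wDegDiagram_shrink hA hB h with h1 | h1
    · exact .inl (congrArg (Sigma.mk (K + 2)) (Quotient.sound ((arrowSetoid w _).symm h1)))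
    · exact .inr (congrArg (Sigma.mk (K + 2)) (Quotient.sound ((arrowSetoid w _).symm h1)))

end Differential

/-! ### Sums over sets of arrows -/

/-- Möbius inversion on the lattice of subsets: by induction all terms of proper subsets vanish, so
only the term of `S` is left in the sum over all subsets of `S`. -/
theorem eq_zero_of_sum_powerset {α : Type*} [DecidableEq α] {q : Finset α → ℚ} {S : Finset α}
    (h : ∀ S' ⊆ S, ∑ R ∈ S'.powerset, q R = 0) : q S = 0 := by
  induction S using Finset.strongInduction with
  | H S ih =>
    have h1 := h S subset_rfl
    rw [← Finset.sum_erase_add _ _ (Finset.mem_powerset_self S), Finset.sum_eq_zero, zero_add] at h1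
    · exact h1
    · intro R hR
      obtain ⟨hne, hR⟩ := Finset.mem_erase.1 hR
      have hR := Finset.mem_powerset.1 hR
      exact ih R (hR.ssubset_of_ne hne) fun S' hS' => h S' (hS'.trans hR)

theorem sum_powerset_image {α β : Type*} [DecidableEq β] {f : α → β} {S : Finset α}
    (hf : Set.InjOn f S) (q : Finset β → ℚ) :
    ∑ R ∈ (S.image f).powerset, q R = ∑ R ∈ S.powerset, q (R.image f) := by
  rw [Finset.powerset_image, Finset.sum_image (Finset.image_injOn_powerset_of_injOn hf)]

theorem prodMap_injOn {f : ℕ → ℕ} {S : Finset (ℕ × ℕ)} (hf : Set.InjOn f (pts S)) :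
    Set.InjOn (Prod.map f f) (S : Set (ℕ × ℕ)) := by
  intro a ha b hb h
  exact Prod.ext (hf (fst_mem_pts ha) (fst_mem_pts hb) (congrArg Prod.fst h))
    (hf (snd_mem_pts ha) (snd_mem_pts hb) (congrArg Prod.snd h))

theorem lineSum_insert (φ : ArrowDiagram π → ℚ) (M : ℕ → π) (T : π) (s : ℕ → ℤˣ) {a : ℕ × ℕ}
    {S : Finset (ℕ × ℕ)} (ha : a ∉ S) :
    lineSum φ M T s (insert a S) = lineSum φ M T s S +
      ∑ R ∈ S.powerset, ((s a.1 : ℤ) : ℚ) * (∏ b ∈ R, ((s b.1 : ℤ) : ℚ)) *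
        lineVal φ M T (insert a R) := by
  rw [lineSum, Finset.sum_powerset_insert ha, lineSum]
  congr 1
  refine Finset.sum_congr rfl fun R hR => ?_
  rw [Finset.prod_insert fun h => ha (Finset.mem_powerset.1 hR h)]

/-! ### Rotation of Gauss diagrams -/

theorem exists_finRotate_pow {N : ℕ} (ρ : Rot N) :
    ∃ r ≤ N, (ρ : Equiv.Perm (Fin N)) = (finRotate N ^ r)⁻¹ := by
  rcases Nat.eq_zero_or_pos N with rfl | hN
  · exact ⟨0, le_rfl, Equiv.ext fun i => i.elim0⟩
  obtain ⟨k, hk⟩ : ∃ k : ℕ, finRotate N ^ k = (ρ : Equiv.Perm (Fin N))⁻¹ :=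
    mem_powers_iff_mem_zpowers.2 (inv_mem ρ.2)
  refine ⟨k % N, (Nat.mod_lt _ hN).le, ?_⟩
  rw [← inv_inv (ρ : Equiv.Perm (Fin N)), ← hk]
  congr 1
  ext i
  rw [val_finRotate_pow, val_finRotate_pow, Nat.add_mod_mod]

/-- A rotation moves the cut. The subsets of arrows correspond to each other, with the same signs
and, by `lineVal_cut`, the same values. -/
theorem subSum_smul (φ : ArrowDiagram π → ℚ) {N : ℕ} (G : GaussRigid π N) (ρ : Rot N) :
    subSum φ (ρ • G) = subSum φ G := by
  obtain ⟨M, T, S, s, hs, he, hS, rfl⟩ := exists_lineGauss G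
  obtain ⟨r, hr, hρ⟩ := exists_finRotate_pow ρ
  have hB : ∀ p ∈ pts S, p < N := fun p hp => by
    obtain ⟨i, rfl⟩ := (he.mem p).1 hp
    exact i.2
  have hinj := cut_injOn (t := r) hB
  obtain ⟨he', hc⟩ := rot_lineCirc he M T hB hr (t := r) (fun i => Iff.rfl)
  rw [← pts_mapArr] at he'
  set s' : ℕ → ℤˣ := fun q => if N ≤ q then s (q - N) else s q with hs'
  have hss : ∀ p ∈ pts S, s' (cut r N p) = s p := by
    intro p hp
    have := hB p hp
    simp only [hs', cut]
    by_cases h : p < r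
    · simp [h]
    · rw [if_neg h, if_neg (by omega)]
  have hs2 : ∀ a ∈ mapArr (cut r N) S, s' a.1 = s' a.2 := by
    intro b hb
    obtain ⟨a, ha, rfl⟩ := Finset.mem_image.1 hb
    change s' (cut r N a.1) = s' (cut r N a.2)
    rw [hss _ (fst_mem_pts ha), hss _ (snd_mem_pts ha), hs a ha]
  have hG : ρ • lineGauss he hS M T hs = lineGauss he' (hS.mapArr hinj) (shiftM T N M) T hs2 := by
    ext1
    · change (ρ : Equiv.Perm (Fin N)) • lineCirc _ M T S = lineCirc _ _ T _
      rw [hρ]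
      exact (hc S subset_rfl).symm
    · funext i
      change s ((ρ : Equiv.Perm (Fin N))⁻¹ i).val = s' (cut r N _)
      rw [hss _ (he.mem' _), hρ, inv_inv]
  rw [hG, subSum_lineGauss, subSum_lineGauss, lineSum, lineSum, mapArr,
    sum_powerset_image (prodMap_injOn hinj)]
  refine Finset.sum_congr rfl fun R hR => ?_
  have hR := Finset.mem_powerset.1 hR
  have hRp := pts_mono hR
  rw [Finset.prod_image fun a ha b hb => prodMap_injOn hinj (hR ha) (hR hb)]
  congr 1
  · refine Finset.prod_congr rfl fun a ha => ?_
    change ((s' (cut r N a.1) : ℤ) : ℚ) = _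
    rw [hss _ (fst_mem_pts (hR ha))]
  · exact lineVal_cut φ (hS.mono hR) M T r fun p hp => hB p (hRp hp)

/-! ### `w`-moves -/

/-- The arrows are reversed where `w (g i) = -1`. -/
def flipArr (w : π →* ℤˣ) (g : ℕ → π) (S : Finset (ℕ × ℕ)) : Finset (ℕ × ℕ) :=
  S.image fun a => if w (g a.1) = 1 then a else a.swap

theorem pts_flipArr (w : π →* ℤˣ) (g : ℕ → π) (S : Finset (ℕ × ℕ)) :
    pts (flipArr w g S) = pts S := by
  ext p
  simp only [mem_pts, flipArr, Finset.mem_image]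
  constructor
  · rintro ⟨_, ⟨a, ha, rfl⟩, h⟩
    refine ⟨a, ha, ?_⟩
    split_ifs at h
    · exact h
    · exact h.symm
  · rintro ⟨a, ha, h⟩
    refine ⟨_, ⟨a, ha, rfl⟩, ?_⟩
    split_ifs
    · exact h
    · exact h.symm

theorem mem_flipArr {w : π →* ℤˣ} {g : ℕ → π} {S : Finset (ℕ × ℕ)}
    (hg : ∀ a ∈ S, g a.1 = g a.2) {p q : ℕ} :
    (p, q) ∈ flipArr w g S ↔ if w (g p) = 1 then (p, q) ∈ S else (q, p) ∈ S := by
  rw [flipArr, Finset.mem_image]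
  constructor
  · rintro ⟨a, ha, h⟩
    split_ifs at h with h1
    · subst h
      rwa [if_pos h1]
    · have h2 : a = (q, p) := by rw [← Prod.swap_swap a, h]; rfl
      subst h2
      rw [if_neg (by rw [← hg _ ha]; exact h1)]
      exact ha
  · intro h
    split_ifs at h with h1
    · exact ⟨_, h, by rw [if_pos h1]⟩
    · exact ⟨_, h, by rw [if_neg (by rw [hg _ h]; exact h1)]; rfl⟩

/-- On the line, conjugation is right multiplication of the potential by `g`; the total product `T`
does not change. -/
theorem lineCirc_flipArr {w : π →* ℤˣ} {g : ℕ → π} {S : Finset (ℕ × ℕ)}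
    (hg : ∀ a ∈ S, g a.1 = g a.2) {N : ℕ} (e : Fin N → ℕ) (M : ℕ → π) (T : π) :
    lineCirc e (fun p => M p * g p) T (flipArr w g S) =
      (lineCirc e M T S).conj w fun i => g (e i) := by
  ext i j
  · exact mem_flipArr hg
  · simp only [lineCirc, Circ.conj]
    group
  · rfl

theorem Good.flipArr {w : π →* ℤˣ} {g : ℕ → π} {S : Finset (ℕ × ℕ)} (hS : Good S)
    (hg : ∀ a ∈ S, g a.1 = g a.2) : Good (flipArr w g S) := by
  have he := enum_orderEmbOfFin (pts S)
  have h := isArrow_lineCirc he hS (fun _ => (1 : π)) 1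
  refine good_of_isArrow (e := (pts S).orderEmbOfFin rfl) (M := fun p => 1 * g p) (T := (1 : π))
    (by rw [pts_flipArr]; exact he) ?_
  rw [lineCirc_flipArr hg]
  exact h.conj fun i j hij => hg _ hij

/-- An arrow and its reverse are not both in a good set, so reversing some arrows does not identify
any two of them. -/
theorem flip_injOn {w : π →* ℤˣ} {g : ℕ → π} {S : Finset (ℕ × ℕ)} (hS : Good S) :
    Set.InjOn (fun a : ℕ × ℕ => if w (g a.1) = 1 then a else a.swap) S := by
  intro a ha b hb h
  by_contra hne
  have h1 := hS.2 a ha b hb hne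
  simp only at h
  split_ifs at h
  · exact hne h
  · exact h1.2.1 (congrArg Prod.fst h)
  · exact h1.2.2.1 (congrArg Prod.fst h)
  · exact hne (Prod.swap_injective h)

/-- Invariance under `w`-moves of arrow diagrams on the line. -/
def LineInvariant (w : π →* ℤˣ) (φ : ArrowDiagram π → ℚ) : Prop :=
  ∀ (M : ℕ → π) (T : π) (S : Finset (ℕ × ℕ)) (g : ℕ → π), Good S → (∀ a ∈ S, g a.1 = g a.2) →
    lineVal φ (fun p => M p * g p) T (flipArr w g S) = lineVal φ M T S

theorem WInvariant.line {w : π →* ℤˣ} {φ : ArrowDiagram π → ℚ} (h : WInvariant w φ) :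
    LineInvariant w φ := by
  intro M T S g hS hg
  have he := enum_orderEmbOfFin (pts S)
  rw [lineVal_eq φ he (isArrow_lineCirc he hS M T),
    lineVal_eq φ (e := (pts S).orderEmbOfFin rfl) (by rw [pts_flipArr]; exact he)
      (isArrow_lineCirc (by rw [pts_flipArr]; exact he) (hS.flipArr hg) _ T)]
  exact (h _ _ _ ⟨_, fun i j hij => hg _ hij, lineCirc_flipArr hg _ M T⟩).symm

theorem exists_conj_line {w : π →* ℤˣ} {N : ℕ} {S : Finset (ℕ × ℕ)} {M : ℕ → π} {T : π}
    {Y : Circ π N} (he : Enum (Fin.val : Fin N → ℕ) (pts S))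
    (h : Circ.WEquiv w (lineCirc Fin.val M T S) Y) :
    ∃ g : ℕ → π, (∀ a ∈ S, g a.1 = g a.2) ∧
      Y = lineCirc Fin.val (fun p => M p * g p) T (flipArr w g S) := by
  obtain ⟨g, hg, rfl⟩ := h
  obtain ⟨g', h1⟩ : ∃ g' : ℕ → π, ∀ i : Fin N, g' i.val = g i :=
    ⟨fun p => if h : p < N then g ⟨p, h⟩ else 1, fun i => by simp⟩
  have h2 : ∀ a ∈ S, g' a.1 = g' a.2 := by
    intro a ha
    obtain ⟨i, hi⟩ := (he.mem _).1 (fst_mem_pts ha)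
    obtain ⟨j, hj⟩ := (he.mem _).1 (snd_mem_pts ha)
    rw [← hi, ← hj, h1, h1]
    refine hg i j ?_
    change (i.val, j.val) ∈ S
    rw [hi, hj]; exact ha
  refine ⟨_, h2, ?_⟩
  rw [lineCirc_flipArr h2]
  exact congrArg (fun k => (lineCirc Fin.val M T S).conj w k) (funext fun i => (h1 i).symm)

theorem LineInvariant.wInvariant {w : π →* ℤˣ} {φ : ArrowDiagram π → ℚ} (h : LineInvariant w φ) :
    WInvariant w φ := by
  rintro N ⟨A, hA⟩ ⟨B, hB⟩ hAB
  obtain ⟨M, T, S, he, rfl⟩ := exists_lineCirc A fun i => (hA.2 i).exists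
  have hS := good_of_isArrow he hA
  obtain ⟨g, hg, rfl⟩ := exists_conj_line he hAB
  rw [← lineVal_eq φ he hA, ← lineVal_eq φ (by rw [pts_flipArr]; exact he) hB, h M T S g hS hg]

theorem lineSum_flipArr {w : π →* ℤˣ} (φ : ArrowDiagram π → ℚ) (M : ℕ → π) (T : π)
    {s : ℕ → ℤˣ} {S : Finset (ℕ × ℕ)} (hS : Good S) (hs : ∀ a ∈ S, s a.1 = s a.2) {g : ℕ → π} :
    lineSum φ (fun p => M p * g p) T s (flipArr w g S) =
      ∑ R ∈ S.powerset, (∏ a ∈ R, ((s a.1 : ℤ) : ℚ)) *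
        lineVal φ (fun p => M p * g p) T (flipArr w g R) := by
  rw [lineSum, flipArr, sum_powerset_image (flip_injOn hS)]
  refine Finset.sum_congr rfl fun R hR => ?_
  have hR := Finset.mem_powerset.1 hR
  rw [Finset.prod_image fun a ha b hb => flip_injOn hS (hR ha) (hR hb)]
  congr 1
  refine Finset.prod_congr rfl fun a ha => ?_
  split_ifs
  · rfl
  · rw [Prod.fst_swap, hs a (hR ha)]

/-- A w-move on a Gauss diagram restricts to w-moves on its subdiagrams and keeps all signs, so the
two sums agree term by term. -/
theorem subSum_conj {w : π →* ℤˣ} {φ : ArrowDiagram π → ℚ} (h : LineInvariant w φ) {N : ℕ}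
    {G G' : GaussRigid π N} (hc : Circ.WEquiv w G.circ G'.circ) (hsg : G'.sign = G.sign) :
    subSum φ G = subSum φ G' := by
  obtain ⟨M, T, S, s, hs, he, hS, rfl⟩ := exists_lineGauss G
  obtain ⟨g, hg, hY⟩ := exists_conj_line he hc
  have hs' : ∀ a ∈ flipArr w g S, s a.1 = s a.2 := by
    intro b hb
    obtain ⟨a, ha, rfl⟩ := Finset.mem_image.1 hb
    split_ifs
    · exact hs a ha
    · exact (hs a ha).symm
  have hG : G' = lineGauss (by rw [pts_flipArr]; exact he) (hS.flipArr hg)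
      (fun p => M p * g p) T hs' := by
    ext1
    · exact hY
    · exact hsg
  rw [hG, subSum_lineGauss, subSum_lineGauss, lineSum_flipArr φ M T hS hs, lineSum]
  refine Finset.sum_congr rfl fun R hR => ?_
  have hR := Finset.mem_powerset.1 hR
  rw [h M T R g (hS.mono hR) fun a ha => hg a (hR ha)]

/-- Give all arrows the sign 1. Invariance of the sum for every subset of the arrows yields
invariance of each value by Möbius inversion. -/
theorem lineInvariant_of_move {w : π →* ℤˣ} {φ : ArrowDiagram π → ℚ}
    (h : ∀ G G' : Σ N : ℕ, GaussRigid π N, Move w G G' → subSum φ G.2 = subSum φ G'.2) :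
    LineInvariant w φ := by
  intro M T S g hS hg
  refine sub_eq_zero.1 (eq_zero_of_sum_powerset
    (q := fun R => lineVal φ (fun p => M p * g p) T (flipArr w g R) - lineVal φ M T R)
    fun S' hS' => ?_)
  have hs : ∀ R : Finset (ℕ × ℕ), ∀ a ∈ R, (fun _ => (1 : ℤˣ)) a.1 = (fun _ => (1 : ℤˣ)) a.2 :=
    fun _ _ _ => rfl
  have hg' : ∀ a ∈ S', g a.1 = g a.2 := fun a ha => hg a (hS' ha)
  have he := enum_orderEmbOfFin (pts S')
  have he' : Enum ((pts S').orderEmbOfFin rfl) (pts (flipArr w g S')) := by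
    rw [pts_flipArr]; exact he
  have hm := h ⟨_, lineGauss (s := fun _ => 1) he (hS.mono hS') M T (hs S')⟩
    ⟨_, lineGauss (s := fun _ => 1) he' ((hS.mono hS').flipArr hg') (fun p => M p * g p) T (hs _)⟩
    (.conjugacy _ _ ⟨_, fun i j hij => hg' _ hij, lineCirc_flipArr hg' _ M T⟩ rfl)
  rw [subSum_lineGauss, subSum_lineGauss, lineSum_flipArr φ M T (hS.mono hS') (hs _), lineSum] at hm
  simp only [Units.val_one, Int.cast_one, Finset.prod_const_one, one_mul] at hm
  rw [Finset.sum_sub_distrib, hm, sub_self]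

/-! ### Adjacent points -/

/-- The points `p` and `q` bound an edge with decoration `1`, from `p` to `q`, of the circle with
the points `P`. -/
def Adj (M : ℕ → π) (T : π) (P : Finset ℕ) (p q : ℕ) : Prop :=
  (p < q ∧ (∀ r ∈ P, r ≤ p ∨ q ≤ r) ∧ M p = M q) ∨
    (q ≤ p ∧ (∀ r ∈ P, q ≤ r ∧ r ≤ p) ∧ M p = T * M q)

theorem Adj.mono {M : ℕ → π} {T : π} {P P' : Finset ℕ} {p q : ℕ} (h : Adj M T P p q)
    (hP : P' ⊆ P) : Adj M T P' p q :=
  h.imp (fun h => ⟨h.1, fun r hr => h.2.1 r (hP hr), h.2.2⟩)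
    (fun h => ⟨h.1, fun r hr => h.2.1 r (hP hr), h.2.2⟩)

theorem Enum.lt_finRotate {N : ℕ} {e : Fin N → ℕ} {P : Finset ℕ} (he : Enum e P) (i : Fin N) :
    e i < e (finRotate N i) ↔ i.val + 1 < N := by
  rw [he.mono.lt_iff_lt, Fin.lt_def, val_finRotate]
  have := i.2
  split_ifs <;> omega

theorem adj_of_mark {N : ℕ} {e : Fin N → ℕ} {P : Finset ℕ} (he : Enum e P) {M : ℕ → π} {T : π}
    {S : Finset (ℕ × ℕ)} {i : Fin N} (h : (lineCirc e M T S).mark i = 1) :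
    Adj M T P (e i) (e (finRotate N i)) := by
  have hlt := he.lt_finRotate i
  have hv := val_finRotate i
  have hi := i.2
  have hle : ∀ a b : Fin N, e a ≤ e b ↔ a.val ≤ b.val := fun a b => he.mono.le_iff_le
  simp only [lineCirc] at h
  by_cases hlt' : e i < e (finRotate N i)
  · refine .inl ⟨hlt', fun r hr => ?_, ?_⟩
    · obtain ⟨k, rfl⟩ := (he.mem r).1 hr
      rw [hle, hle, hv]
      have := hlt.1 hlt'
      split_ifs <;> omega
    · rw [if_pos hlt', one_mul] at h
      exact inv_mul_eq_one.1 h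
  · have h2 : i.val + 1 = N := by omega
    rw [if_pos h2] at hv
    refine .inr ⟨not_lt.1 hlt', fun r hr => ?_, ?_⟩
    · obtain ⟨k, rfl⟩ := (he.mem r).1 hr
      rw [hle, hle, hv]
      omega
    · rw [if_neg hlt'] at h
      exact inv_mul_eq_one.1 h

/-- Adjacency refers to the points and the potential only. The same edge is therefore decorated by
`1` for every set of arrows with these points. -/
theorem exists_of_adj {N : ℕ} {e : Fin N → ℕ} {P : Finset ℕ} (he : Enum e P) {M : ℕ → π} {T : π}
    {p q : ℕ} (hp : p ∈ P) (hq : q ∈ P) (h : Adj M T P p q) :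
    ∃ i, e i = p ∧ e (finRotate N i) = q ∧ ∀ S, (lineCirc e M T S).mark i = 1 := by
  obtain ⟨i, rfl⟩ := (he.mem p).1 hp
  obtain ⟨j, rfl⟩ := (he.mem q).1 hq
  have hlt := he.lt_finRotate i
  have hv := val_finRotate i
  have hi := i.2
  have hj := j.2
  have hle : ∀ a b : Fin N, e a ≤ e b ↔ a.val ≤ b.val := fun a b => he.mono.le_iff_le
  have hll : ∀ a b : Fin N, e a < e b ↔ a.val < b.val := fun a b => he.mono.lt_iff_lt
  rcases h with ⟨h1, h2, h3⟩ | ⟨h1, h2, h3⟩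
  · have h4 := h2 _ (he.mem' (finRotate N i))
    rw [hll] at h1
    rw [hle, hle] at h4
    have h6 : finRotate N i = j := by
      by_contra hne
      have h5 : (finRotate N i).val ≠ j.val := fun e => hne (Fin.ext e)
      split_ifs at hv <;> omega
    refine ⟨i, rfl, by rw [h6], fun S => ?_⟩
    simp only [lineCirc, h6, if_pos ((hll _ _).2 h1), h3]
    group
  · have h4 := h2 _ (he.mem' (finRotate N i))
    have h4' : e j ≤ e ⟨0, by omega⟩ ∧ _ := h2 _ (he.mem' _)
    rw [hle] at h1
    rw [hle, hle] at h4 h4'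
    simp only at h4'
    have h6 : finRotate N i = j := by
      refine Fin.ext ?_
      split_ifs at hv <;> omega
    refine ⟨i, rfl, by rw [h6], fun S => ?_⟩
    simp only [lineCirc, h6, if_neg (not_lt.2 ((hle _ _).2 h1)), h3]
    group

/-! ### Sliding an end of an arrow along an edge -/

/-- No other end lies between `p` and `q` and the potentials agree across the edge, so replacing `p`
by `q` does not change the decorated circle, up to rotation. -/
theorem lineVal_slide_aux (φ : ArrowDiagram π → ℚ) {M : ℕ → π} {T : π} {S : Finset (ℕ × ℕ)}
    (hS : Good S) {p q : ℕ} (hp : p ∈ pts S) (hq : q ∉ pts S) (h : Adj M T (insert q (pts S)) p q) :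
    lineVal φ M T (mapArr (fun r => if r = p then q else r) S) = lineVal φ M T S := by
  have hpq : p ≠ q := by rintro rfl; exact hq hp
  have hne : ∀ r ∈ pts S, r ≠ q := fun r hr => by rintro rfl; exact hq hr
  have hinj : Set.InjOn (fun r => if r = p then q else r) (pts S) := by
    intro r hr r' hr' h
    have := hne r hr
    have := hne r' hr'
    simp only at h
    split_ifs at h <;> omega
  rcases h with ⟨h1, h2, h3⟩ | ⟨h1, h2, h3⟩
  · refine lineVal_mapArr φ hS (fun r hr r' hr' h => ?_) T fun r hr => ?_
    · have := h2 r (Finset.mem_insert_of_mem hr)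
      have := h2 r' (Finset.mem_insert_of_mem hr')
      have := hne r hr
      have := hne r' hr'
      split_ifs <;> omega
    · split_ifs with h
      · rw [h, h3]
      · rfl
  · have hB : ∀ r ∈ pts (mapArr (fun r => if r = p then q else r) S), r < p + 1 := by
      intro r hr
      rw [pts_mapArr] at hr
      obtain ⟨r', hr', rfl⟩ := Finset.mem_image.1 hr
      have := h2 r' (Finset.mem_insert_of_mem hr')
      split_ifs <;> omega
    -- Here the edge from `p` to `q` passes the end of the line. Cutting just behind `q` sends `q`
    -- to a point beyond `p`, with the potential `T * M q = M p`, and the composite relabelling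
    -- preserves the order.
    rw [← lineVal_cut φ (hS.mapArr hinj) M T (q + 1) hB, mapArr_mapArr]
    refine lineVal_mapArr φ hS (fun r hr r' hr' h => ?_) T fun r hr => ?_
    · have := h2 r (Finset.mem_insert_of_mem hr)
      have := h2 r' (Finset.mem_insert_of_mem hr')
      have := hne r hr
      have := hne r' hr'
      simp only [Function.comp, cut]
      split_ifs <;> omega
    · have := h2 r (Finset.mem_insert_of_mem hr)
      have := hne r hr
      simp only [Function.comp]
      rw [shiftM_cut T M (by split_ifs <;> omega)]
      split_ifs with h4 h5 h5
      · rw [h4, h3]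
      · omega
      · omega
      · rfl

/-- Sliding against the orientation of the circle is the inverse of a slide along it. -/
theorem lineVal_slide (φ : ArrowDiagram π → ℚ) {M : ℕ → π} {T : π} {S : Finset (ℕ × ℕ)}
    (hS : Good S) {p q : ℕ} (hp : p ∈ pts S) (hq : q ∉ pts S)
    (h : Adj M T (insert q (pts S)) p q ∨ Adj M T (insert q (pts S)) q p) :
    lineVal φ M T (mapArr (fun r => if r = p then q else r) S) = lineVal φ M T S := by
  rcases h with h | h
  · exact lineVal_slide_aux φ hS hp hq h
  · have hne : ∀ r ∈ pts S, r ≠ q := fun r hr => by rintro rfl; exact hq hr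
    have hinj : Set.InjOn (fun r => if r = p then q else r) (pts S) := by
      intro r hr r' hr' h
      have := hne r hr
      have := hne r' hr'
      simp only at h
      split_ifs at h <;> omega
    have hpts := pts_mapArr (fun r => if r = p then q else r) S
    have hq' : q ∈ pts (mapArr (fun r => if r = p then q else r) S) := by
      rw [hpts]
      exact Finset.mem_image.2 ⟨p, hp, if_pos rfl⟩
    have hp' : p ∉ pts (mapArr (fun r => if r = p then q else r) S) := by
      rw [hpts]
      intro h
      obtain ⟨r, hr, h⟩ := Finset.mem_image.1 h
      split_ifs at h with h1
      · exact hne p hp h.symm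
      · exact h1 h
    have hback : mapArr (fun r => if r = q then p else r)
        (mapArr (fun r => if r = p then q else r) S) = S := by
      rw [mapArr_mapArr]
      refine mapArr_eq_self fun r hr => ?_
      have := hne r hr
      simp only [Function.comp]
      split_ifs <;> omega
    have := lineVal_slide_aux φ (hS.mapArr hinj) hq' hp' (h.mono fun r hr => ?_)
    · rw [← this, hback]
    · rw [hpts] at hr
      rcases Finset.mem_insert.1 hr with rfl | hr
      · exact Finset.mem_insert_of_mem hp
      · obtain ⟨r', hr', rfl⟩ := Finset.mem_image.1 hr
        split_ifs
        · exact Finset.mem_insert_self _ _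
        · exact Finset.mem_insert_of_mem hr'

theorem mapArr_insert_eq {f : ℕ → ℕ} {a b : ℕ × ℕ} {S : Finset (ℕ × ℕ)}
    (hab : (f a.1, f a.2) = b) (hf : ∀ p ∈ pts S, f p = p) :
    mapArr f (insert a S) = insert b (mapArr id S) := by
  rw [mapArr_insert, hab, mapArr_congr (f := f) (g := id) hf]

theorem mapArr_id (S : Finset (ℕ × ℕ)) : mapArr id S = S := by simp [mapArr]

theorem lineVal_slide_tail (φ : ArrowDiagram π → ℚ) {M : ℕ → π} {T : π} {S : Finset (ℕ × ℕ)}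
    {p q h : ℕ} (hS : Good (insert (p, h) S)) (hp : (p, h) ∉ S) (hq : q ∉ pts (insert (p, h) S))
    (hadj : Adj M T (insert q (pts (insert (p, h) S))) p q ∨
      Adj M T (insert q (pts (insert (p, h) S))) q p) :
    lineVal φ M T (insert (q, h) S) = lineVal φ M T (insert (p, h) S) := by
  obtain ⟨-, h1, h2, h3⟩ := hS.of_insert hp
  rw [← lineVal_slide φ hS (fst_mem_pts (Finset.mem_insert_self _ _)) hq hadj,
    mapArr_insert_eq (b := (q, h)), mapArr_id]
  · have h1 : p ≠ h := h1
    simp [h1.symm]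
  · rintro r hr
    refine if_neg ?_
    rintro rfl
    exact h2 hr

theorem lineVal_slide_head (φ : ArrowDiagram π → ℚ) {M : ℕ → π} {T : π} {S : Finset (ℕ × ℕ)}
    {p q t : ℕ} (hS : Good (insert (t, p) S)) (hp : (t, p) ∉ S) (hq : q ∉ pts (insert (t, p) S))
    (hadj : Adj M T (insert q (pts (insert (t, p) S))) p q ∨
      Adj M T (insert q (pts (insert (t, p) S))) q p) :
    lineVal φ M T (insert (t, q) S) = lineVal φ M T (insert (t, p) S) := by
  obtain ⟨-, h1, h2, h3⟩ := hS.of_insert hp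
  rw [← lineVal_slide φ hS (snd_mem_pts (Finset.mem_insert_self _ _)) hq hadj,
    mapArr_insert_eq (b := (t, q)), mapArr_id]
  · have h1 : t ≠ p := h1
    simp [h1]
  · rintro r hr
    refine if_neg ?_
    rintro rfl
    exact h3 hr

/-! ### The first and the second Reidemeister moves -/

/-- The value of `φ` is `0` on arrow diagrams with an isolated arrow that surrounds an edge with
decoration `1`. -/
def LineAP1 (φ : ArrowDiagram π → ℚ) : Prop :=
  ∀ (M : ℕ → π) (T : π) (S : Finset (ℕ × ℕ)) (a : ℕ × ℕ), Good S → a ∈ S →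
    (Adj M T (pts S) a.1 a.2 ∨ Adj M T (pts S) a.2 a.1) → lineVal φ M T S = 0

/-- The value of `φ` is `0` on arrow diagrams with two parallel arrows. -/
def LineAP2 (φ : ArrowDiagram π → ℚ) : Prop :=
  ∀ (M : ℕ → π) (T : π) (S : Finset (ℕ × ℕ)) (a b : ℕ × ℕ), Good S → a ∈ S → b ∈ S → a ≠ b →
    Adj M T (pts S) a.1 b.1 → (Adj M T (pts S) a.2 b.2 ∨ Adj M T (pts S) b.2 a.2) →
    lineVal φ M T S = 0

theorem lineAP1_iff {φ : ArrowDiagram π → ℚ} : LineAP1 φ ↔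
    ∀ (N : ℕ) (A : ArrowRigid π N) (i : Fin N), A.1.inc i (finRotate N i) → A.1.mark i = 1 →
      φ (arrowDiagram A) = 0 := by
  constructor
  · rintro h N ⟨A, hA⟩ i hi hm
    obtain ⟨M, T, S, he, rfl⟩ := exists_lineCirc A fun i => (hA.2 i).exists
    have hS := good_of_isArrow he hA
    rw [← lineVal_eq φ he hA]
    have hadj := adj_of_mark he hm
    rcases hi with hi | hi
    · exact h M T S _ hS hi (.inl hadj)
    · exact h M T S _ hS hi (.inr hadj)
  · intro h M T S a hS ha hadj
    have he := enum_orderEmbOfFin (pts S)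
    rw [lineVal_eq φ he (isArrow_lineCirc he hS M T)]
    rcases hadj with hadj | hadj
    · obtain ⟨i, h1, h2, h3⟩ := exists_of_adj he (fst_mem_pts ha) (snd_mem_pts ha) hadj
      exact h _ _ i (.inl (by change (_, _) ∈ S; rw [h1, h2]; exact ha)) (h3 S)
    · obtain ⟨i, h1, h2, h3⟩ := exists_of_adj he (snd_mem_pts ha) (fst_mem_pts ha) hadj
      exact h _ _ i (.inr (by change (_, _) ∈ S; rw [h1, h2]; exact ha)) (h3 S)

theorem Circ.finRotate_ne {N : ℕ} {X : Circ π N} (h : X.Asymm) {i j : Fin N} (hij : X.arr i j) :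
    finRotate N i ≠ i := by
  intro hi
  have h1 := congrArg Fin.val hi
  rw [val_finRotate] at h1
  have h2 := i.2
  have h3 := j.2
  obtain rfl : i = j := Fin.ext (by split_ifs at h1 <;> omega)
  exact h _ _ hij hij

theorem lineAP2_iff {φ : ArrowDiagram π → ℚ} : LineAP2 φ ↔
    ∀ (N : ℕ) (A : ArrowRigid π N) (i j : Fin N),
      ((A.1.arr i j ∧ A.1.arr (finRotate N i) (finRotate N j)) ∨
        (A.1.arr i (finRotate N j) ∧ A.1.arr (finRotate N i) j)) →
      A.1.mark i = 1 → A.1.mark j = 1 → φ (arrowDiagram A) = 0 := by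
  constructor
  · rintro h N ⟨A, hA⟩ i j hij hi hj
    obtain ⟨M, T, S, he, rfl⟩ := exists_lineCirc A fun i => (hA.2 i).exists
    have hS := good_of_isArrow he hA
    rw [← lineVal_eq φ he hA]
    have hadj := adj_of_mark he hi
    have hadj' := adj_of_mark he hj
    rcases hij with ⟨h1, h2⟩ | ⟨h1, h2⟩
    · exact h M T S _ _ hS h1 h2
        (fun e => Circ.finRotate_ne hA.1 h1 (Fin.ext (congrArg Prod.fst e).symm)) hadj (.inl hadj')
    · exact h M T S _ _ hS h1 h2
        (fun e => Circ.finRotate_ne hA.1 h1 (Fin.ext (congrArg Prod.fst e).symm)) hadj (.inr hadj')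
  · intro h M T S a b hS ha hb hab h1 h2
    have he := enum_orderEmbOfFin (pts S)
    rw [lineVal_eq φ he (isArrow_lineCirc he hS M T)]
    obtain ⟨i, i1, i2, i3⟩ := exists_of_adj he (fst_mem_pts ha) (fst_mem_pts hb) h1
    rcases h2 with h2 | h2
    · obtain ⟨j, j1, j2, j3⟩ := exists_of_adj he (snd_mem_pts ha) (snd_mem_pts hb) h2
      refine h _ _ i j (.inl ⟨?_, ?_⟩) (i3 S) (j3 S)
      · change (_, _) ∈ S; rw [i1, j1]; exact ha
      · change (_, _) ∈ S; rw [i2, j2]; exact hb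
    · obtain ⟨j, j1, j2, j3⟩ := exists_of_adj he (snd_mem_pts hb) (snd_mem_pts ha) h2
      refine h _ _ i j (.inr ⟨?_, ?_⟩) (i3 S) (j3 S)
      · change (_, _) ∈ S; rw [i1, j2]; exact ha
      · change (_, _) ∈ S; rw [i2, j1]; exact hb

theorem arrowsIn_eq {N : ℕ} {e : Fin N → ℕ} {S S' : Finset (ℕ × ℕ)} (he : Enum e (pts S))
    (hS : Good S) (hS' : S' ⊆ S) {K : Finset (Fin N)} (hK : ∀ i, i ∈ K ↔ e i ∈ pts S') :
    arrowsIn e K S = S' := by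
  ext a
  simp only [arrowsIn, Finset.mem_filter, Finset.mem_image, hK]
  constructor
  · rintro ⟨ha, i, hi, hia⟩
    rw [hia] at hi
    obtain ⟨b, hb, h⟩ := mem_pts.1 hi
    by_contra hab
    have := hS.2 a ha b (hS' hb) (by rintro rfl; exact hab hb)
    grind
  · intro ha
    obtain ⟨i, hi⟩ := (he.mem _).1 (fst_mem_pts (hS' ha))
    exact ⟨hS' ha, i, by rw [hi]; exact fst_mem_pts ha, hi⟩

theorem mem_pts_erase {S : Finset (ℕ × ℕ)} (hS : Good S) {a : ℕ × ℕ} (ha : a ∈ S) {p : ℕ} :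
    p ∈ pts (S.erase a) ↔ p ∈ pts S ∧ p ≠ a.1 ∧ p ≠ a.2 := by
  have h := (Finset.insert_erase ha) ▸ hS
  obtain ⟨-, -, h1, h2⟩ := h.of_insert (Finset.notMem_erase a S)
  have h3 := pts_insert a (S.erase a)
  rw [Finset.insert_erase ha] at h3
  rw [h3, Finset.mem_insert, Finset.mem_insert]
  constructor
  · intro h
    exact ⟨.inr (.inr h), by rintro rfl; exact h1 h, by rintro rfl; exact h2 h⟩
  · tauto

/-- The subdiagrams of `G` without the isolated arrow are those of the smaller diagram. In the
others the arrow still surrounds an edge decorated by `1`, so they contribute 0. -/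
theorem subSum_r1 {φ : ArrowDiagram π → ℚ} (h : LineAP1 φ) {N : ℕ} (G : GaussRigid π N) (i : Fin N)
    (hi : G.circ.inc i (finRotate N i)) (hm : G.circ.mark i = 1) (K : G.ArrowSet)
    (hK : ∀ a, a ∈ K.1 ↔ a ≠ i ∧ a ≠ finRotate N i) : subSum φ G = subSum φ (G.sub K) := by
  obtain ⟨M, T, S, s, hs, he, hS, rfl⟩ := exists_lineGauss G
  have hadj := adj_of_mark he hm
  obtain ⟨a, ha, haK, hadj⟩ : ∃ a ∈ S, (∀ p : Fin N, (p.val ≠ a.1 ∧ p.val ≠ a.2) ↔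
      p ≠ i ∧ p ≠ finRotate N i) ∧ (Adj M T (pts S) a.1 a.2 ∨ Adj M T (pts S) a.2 a.1) := by
    rcases hi with hi | hi
    · exact ⟨_, hi, fun p => by simp [Fin.ext_iff], .inl hadj⟩
    · exact ⟨_, hi, fun p => by simp [Fin.ext_iff, and_comm], .inr hadj⟩
  rw [subSum_lineGauss, subSum_sub_lineGauss, arrowsIn_eq he hS (Finset.erase_subset a S)
    (K := K.1) fun p => by rw [hK, mem_pts_erase hS ha, haK, and_iff_right (he.mem' p)]]
  have h1 := lineSum_insert φ M T s (Finset.notMem_erase a S)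
  rw [Finset.insert_erase ha] at h1
  rw [h1, Finset.sum_eq_zero, add_zero]
  intro R hR
  have hR' : insert a R ⊆ S := Finset.insert_subset ha
    ((Finset.mem_powerset.1 hR).trans (Finset.erase_subset _ _))
  rw [h M T (insert a R) a (hS.mono hR') (Finset.mem_insert_self _ _)
    (hadj.imp (fun h => h.mono (pts_mono hR')) fun h => h.mono (pts_mono hR')), mul_zero]

/-- Of the four kinds of subsets, those with just `a` and those with just `b` cancel: sliding both
ends identifies the diagrams and the signs are opposite. With both arrows the two signs multiply to
-1. -/
theorem lineSum_parallel (φ : ArrowDiagram π → ℚ) (M : ℕ → π) (T : π) (s : ℕ → ℤˣ)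
    {a b : ℕ × ℕ} {S : Finset (ℕ × ℕ)} (hS : Good (insert a (insert b S))) (ha : a ∉ insert b S)
    (hb : b ∉ S) (hadj : Adj M T (pts (insert a (insert b S))) a.1 b.1)
    (hadj' : Adj M T (pts (insert a (insert b S))) a.2 b.2 ∨
      Adj M T (pts (insert a (insert b S))) b.2 a.2) (hsab : s b.1 = -s a.1) :
    lineSum φ M T s (insert a (insert b S)) = lineSum φ M T s S -
      ∑ R ∈ S.powerset, (∏ c ∈ R, ((s c.1 : ℤ) : ℚ)) * lineVal φ M T (insert a (insert b R)) := by
  rw [lineSum_insert φ M T s ha, lineSum_insert φ M T s hb, Finset.sum_powerset_insert hb,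
    add_assoc, sub_eq_add_neg, add_right_inj, ← Finset.sum_add_distrib, ← Finset.sum_add_distrib,
    ← Finset.sum_neg_distrib]
  refine Finset.sum_congr rfl fun R hR => ?_
  have hR := Finset.mem_powerset.1 hR
  have hR' : insert b (insert a R) ⊆ insert a (insert b S) := by
    rw [Finset.insert_comm]
    exact Finset.insert_subset_insert _ (Finset.insert_subset_insert _ hR)
  have hg := hS.mono hR'
  have hab : a ≠ b := fun h => ha (by simp [h])
  have haR : a ∉ R := fun h => ha (Finset.mem_insert_of_mem (hR h))
  have hbR : b ∉ R := fun h => hb (hR h)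
  have hga := hg.mono (Finset.subset_insert b (insert a R))
  have hbR' : b ∉ insert a R := by simp [hab.symm, hbR]
  obtain ⟨-, b12, hb1, hb2⟩ := hg.of_insert hbR'
  have hp : pts (insert b (insert a R)) = insert b.1 (insert b.2 (pts (insert a R))) :=
    pts_insert _ _
  have hadj1 := hadj.mono (pts_mono hR')
  have hadj2 := hadj'.imp (fun h => h.mono (pts_mono hR')) fun h => h.mono (pts_mono hR')
  rw [hp] at hadj1 hadj2
  -- Slide the tail of `a` to that of `b`, then the head.
  have key : lineVal φ M T (insert b R) = lineVal φ M T (insert a R) := by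
    have e1 : lineVal φ M T (insert (b.1, a.2) R) = lineVal φ M T (insert (a.1, a.2) R) := by
      refine lineVal_slide_tail φ hga haR hb1 (.inl (hadj1.mono ?_))
      exact Finset.insert_subset_insert _ (Finset.subset_insert _ _)
    have ha2 : a.2 ∉ pts R ∧ b.1 ≠ a.2 ∧ b.1 ∉ pts R := by
      obtain ⟨-, q1, q2, q3⟩ := hga.of_insert haR
      rw [pts_insert, Finset.mem_insert, Finset.mem_insert] at hb1
      tauto
    have hg2 : Good (insert (b.1, a.2) R) :=
      good_insert (hga.mono (Finset.subset_insert _ _)) ha2.2.1 ha2.2.2 ha2.1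
    have hsub : pts (insert (b.1, a.2) R) ⊆ insert b.1 (pts (insert a R)) := by
      rw [pts_insert, pts_insert]
      exact Finset.insert_subset_insert _ (Finset.subset_insert _ _)
    have hsub2 : insert b.2 (pts (insert (b.1, a.2) R)) ⊆
        insert b.1 (insert b.2 (pts (insert a R))) := by
      rw [Finset.insert_comm b.1]
      exact Finset.insert_subset_insert _ hsub
    have e2 : lineVal φ M T (insert (b.1, b.2) R) = lineVal φ M T (insert (b.1, a.2) R) := by
      refine lineVal_slide_head φ hg2 ?_ ?_
        (hadj2.imp (fun h => h.mono hsub2) fun h => h.mono hsub2)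
      · intro h
        exact ha2.2.2 (fst_mem_pts (a := (b.1, a.2)) h)
      · intro h
        rcases Finset.mem_insert.1 (hsub h) with h | h
        · exact b12 h.symm
        · exact hb2 h
    exact e2.trans e1
  have hss : ((s a.1 : ℤ) : ℚ) * ((s a.1 : ℤ) : ℚ) = 1 := by
    rcases Int.units_eq_one_or (s a.1) with h | h <;> simp [h]
  rw [key, Finset.prod_insert hbR, hsab]
  push_cast
  linear_combination (-(∏ c ∈ R, ((s c.1 : ℤ) : ℚ)) * lineVal φ M T (insert a (insert b R))) * hss

theorem subSum_r2 {φ : ArrowDiagram π → ℚ} (h : LineAP2 φ) {N : ℕ} (G : GaussRigid π N)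
    (i j : Fin N) (hij : (G.circ.arr i j ∧ G.circ.arr (finRotate N i) (finRotate N j)) ∨
        (G.circ.arr i (finRotate N j) ∧ G.circ.arr (finRotate N i) j))
    (hi : G.circ.mark i = 1) (hj : G.circ.mark j = 1)
    (hsg : G.sign (finRotate N i) = -G.sign i) (K : G.ArrowSet)
    (hK : ∀ a, a ∈ K.1 ↔ a ≠ i ∧ a ≠ finRotate N i ∧ a ≠ j ∧ a ≠ finRotate N j) :
    subSum φ G = subSum φ (G.sub K) := by
  have hne : finRotate N i ≠ i := by
    rcases hij with hij | hij
    · exact Circ.finRotate_ne G.isArrow.1 hij.1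
    · exact Circ.finRotate_ne G.isArrow.1 hij.1
  obtain ⟨M, T, S, s, hs, he, hS, rfl⟩ := exists_lineGauss G
  have hadj := adj_of_mark he hi
  have hadj' := adj_of_mark he hj
  obtain ⟨a, b, ha, hb, hab, haK, hadj, hadj', hsab⟩ : ∃ a b, a ∈ S ∧ b ∈ S ∧ a ≠ b ∧
      (∀ p : Fin N, ((p.val ≠ a.1 ∧ p.val ≠ a.2) ∧ (p.val ≠ b.1 ∧ p.val ≠ b.2)) ↔
      p ≠ i ∧ p ≠ finRotate N i ∧ p ≠ j ∧ p ≠ finRotate N j) ∧ Adj M T (pts S) a.1 b.1 ∧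
      (Adj M T (pts S) a.2 b.2 ∨ Adj M T (pts S) b.2 a.2) ∧ s b.1 = -s a.1 := by
    rcases hij with ⟨h1, h2⟩ | ⟨h1, h2⟩
    · refine ⟨_, _, h1, h2, fun e => hne (Fin.ext (congrArg Prod.fst e).symm), fun p => ?_, hadj,
        .inl hadj', hsg⟩
      simp only [Fin.ext_iff, Ne]; tauto
    · refine ⟨_, _, h1, h2, fun e => hne (Fin.ext (congrArg Prod.fst e).symm), fun p => ?_, hadj,
        .inr hadj', hsg⟩
      simp only [Fin.ext_iff, Ne]; tauto
  have hb0 : b ∈ S.erase a := Finset.mem_erase.2 ⟨hab.symm, hb⟩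
  have hS' : insert a (insert b ((S.erase a).erase b)) = S := by
    rw [Finset.insert_erase hb0, Finset.insert_erase ha]
  have hsub : (S.erase a).erase b ⊆ S := (Finset.erase_subset _ _).trans (Finset.erase_subset _ _)
  rw [subSum_lineGauss, subSum_sub_lineGauss, arrowsIn_eq he hS hsub (K := K.1) fun p => by
      rw [hK, mem_pts_erase (hS.mono (Finset.erase_subset a S)) hb0, mem_pts_erase hS ha, ← haK,
        and_iff_right (he.mem' p)]]
  have h1 := lineSum_parallel φ M T s (hS'.symm ▸ hS) (by simp [hab]) (Finset.notMem_erase b _)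
    (hS'.symm ▸ hadj) (hS'.symm ▸ hadj') hsab
  rw [hS'] at h1
  rw [h1, sub_eq_self]
  refine Finset.sum_eq_zero fun R hR => ?_
  have hR' : insert a (insert b R) ⊆ S := Finset.insert_subset ha (Finset.insert_subset hb
    ((Finset.mem_powerset.1 hR).trans hsub))
  rw [h M T _ a b (hS.mono hR') (by simp) (by simp) hab (hadj.mono (pts_mono hR'))
    (hadj'.imp (fun h => h.mono (pts_mono hR')) fun h => h.mono (pts_mono hR')), mul_zero]

/-- With all signs 1, invariance under R₁ says that the values on the sets `insert a R`, for `R ⊆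
S'`, add up to 0; Möbius inversion over `S'` isolates one of them. -/
theorem lineAP1_of_move {w : π →* ℤˣ} {φ : ArrowDiagram π → ℚ}
    (h : ∀ G G' : Σ N : ℕ, GaussRigid π N, Move w G G' → subSum φ G.2 = subSum φ G'.2) :
    LineAP1 φ := by
  intro M T S a hS ha hadj
  rw [← Finset.insert_erase ha]
  refine eq_zero_of_sum_powerset (q := fun R => lineVal φ M T (insert a R)) fun S' hS' => ?_
  have haS : a ∉ S' := fun h => Finset.notMem_erase a S (hS' h)
  have hsub : insert a S' ⊆ S := Finset.insert_subset ha (hS'.trans (Finset.erase_subset _ _))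
  have hg := hS.mono hsub
  have hadj := hadj.imp (fun h => h.mono (pts_mono hsub)) fun h => h.mono (pts_mono hsub)
  have he := enum_orderEmbOfFin (pts (insert a S'))
  have ha' : a ∈ insert a S' := Finset.mem_insert_self _ _
  have hs : ∀ b ∈ insert a S', (fun _ => (1 : ℤˣ)) b.1 = (fun _ => (1 : ℤˣ)) b.2 :=
    fun _ _ => rfl
  obtain ⟨i, hi, hm, hai⟩ : ∃ i, (lineCirc ((pts (insert a S')).orderEmbOfFin rfl) M T
      (insert a S')).inc i (finRotate _ i) ∧ (lineCirc ((pts (insert a S')).orderEmbOfFin rfl) M T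
      (insert a S')).mark i = 1 ∧ ∀ p, (p ≠ i ∧ p ≠ finRotate _ i) ↔
        ((pts (insert a S')).orderEmbOfFin rfl p ≠ a.1 ∧
          (pts (insert a S')).orderEmbOfFin rfl p ≠ a.2) := by
    rcases hadj with hadj | hadj
    · obtain ⟨i, h1, h2, h3⟩ := exists_of_adj he (fst_mem_pts ha') (snd_mem_pts ha') hadj
      refine ⟨i, .inl ?_, h3 _, fun p => ?_⟩
      · change (_, _) ∈ _; rw [h1, h2]; exact ha'
      · rw [← h1, ← h2, he.mono.injective.ne_iff, he.mono.injective.ne_iff]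
    · obtain ⟨i, h1, h2, h3⟩ := exists_of_adj he (snd_mem_pts ha') (fst_mem_pts ha') hadj
      refine ⟨i, .inr ?_, h3 _, fun p => ?_⟩
      · change (_, _) ∈ _; rw [h1, h2]; exact ha'
      · rw [← h1, ← h2, he.mono.injective.ne_iff, he.mono.injective.ne_iff, and_comm]
  obtain ⟨K, hK, hK'⟩ := exists_arrowSet (s := fun _ => 1) he hg M T hs (Finset.subset_insert a S')
  have hmem := @mem_pts_erase _ hg a ha'
  rw [Finset.erase_insert haS] at hmem
  have hm := h ⟨_, lineGauss (s := fun _ => 1) he hg M T hs⟩ ⟨_, GaussRigid.sub _ K⟩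
    (.r1 _ i hi hm K fun p => by
      rw [hK', hmem, hai, and_iff_right (he.mem' p)])
  simp only at hm
  rw [subSum_lineGauss, subSum_sub_lineGauss, hK, lineSum_insert φ M T _ haS, add_eq_left] at hm
  simpa using hm

theorem lineAP2_of_move {w : π →* ℤˣ} {φ : ArrowDiagram π → ℚ}
    (h : ∀ G G' : Σ N : ℕ, GaussRigid π N, Move w G G' → subSum φ G.2 = subSum φ G'.2) :
    LineAP2 φ := by
  intro M T S a b hS ha hb hab hadj hadj'
  have hb0 : b ∈ S.erase a := Finset.mem_erase.2 ⟨hab.symm, hb⟩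
  rw [← Finset.insert_erase ha, ← Finset.insert_erase hb0]
  refine eq_zero_of_sum_powerset (q := fun R => lineVal φ M T (insert a (insert b R)))
    fun S' hS' => ?_
  have hbS : b ∉ S' := fun h => Finset.notMem_erase b _ (hS' h)
  have haS : a ∉ insert b S' := fun h => by
    rcases Finset.mem_insert.1 h with h | h
    · exact hab h
    · exact Finset.notMem_erase a S (Finset.erase_subset _ _ (hS' h))
  have hsub : insert a (insert b S') ⊆ S := Finset.insert_subset ha (Finset.insert_subset hb
    (hS'.trans ((Finset.erase_subset _ _).trans (Finset.erase_subset _ _))))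
  have hg := hS.mono hsub
  have hadj := hadj.mono (pts_mono hsub)
  have hadj' := hadj'.imp (fun h => h.mono (pts_mono hsub)) fun h => h.mono (pts_mono hsub)
  set S₂ := insert a (insert b S') with hS2
  have he := enum_orderEmbOfFin (pts S₂)
  have ha' : a ∈ S₂ := Finset.mem_insert_self _ _
  have hb' : b ∈ S₂ := Finset.mem_insert_of_mem (Finset.mem_insert_self _ _)
  -- Only `b` is negative. This is what R₂ needs, and the signs of the remaining arrows disappear
  -- from the sum.
  set s : ℕ → ℤˣ := fun p => if p = b.1 ∨ p = b.2 then -1 else 1 with hsdef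
  have hs1 : ∀ c ∈ S₂, c ≠ b → s c.1 = 1 ∧ s c.2 = 1 := by
    intro c hc hcb
    have := hg.2 c hc b hb' hcb
    simp [hsdef, this]
  have hs : ∀ c ∈ S₂, s c.1 = s c.2 := by
    intro c hc
    by_cases hcb : c = b
    · subst hcb; simp [hsdef]
    · rw [(hs1 c hc hcb).1, (hs1 c hc hcb).2]
  have hsa := (hs1 a ha' hab).1
  have hsb : s b.1 = -1 := by simp [hsdef]
  obtain ⟨i, i1, i2, i3⟩ := exists_of_adj he (fst_mem_pts ha') (fst_mem_pts hb') hadj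
  have hmem : ∀ p, p ∈ pts S' ↔ p ∈ pts S₂ ∧ (p ≠ a.1 ∧ p ≠ a.2) ∧ (p ≠ b.1 ∧ p ≠ b.2) := by
    intro p
    have h1 := @mem_pts_erase _ hg a ha' p
    rw [hS2, Finset.erase_insert haS] at h1
    have h2 := @mem_pts_erase _ (hg.mono (Finset.subset_insert _ _)) b (Finset.mem_insert_self _ _) p
    rw [Finset.erase_insert hbS] at h2
    rw [h2, h1, and_assoc]
  obtain ⟨K, hK, hK'⟩ := exists_arrowSet he hg M T hs
    (show S' ⊆ S₂ from (Finset.subset_insert _ _).trans (Finset.subset_insert _ _))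
  have hinj := he.mono.injective
  have hm : subSum φ (lineGauss he hg M T hs) =
      subSum φ ((lineGauss he hg M T hs).sub K) := by
    rcases hadj' with hadj' | hadj'
    · obtain ⟨j, j1, j2, j3⟩ := exists_of_adj he (snd_mem_pts ha') (snd_mem_pts hb') hadj'
      refine h ⟨_, _⟩ ⟨_, _⟩ (.r2 _ i j (.inl ⟨?_, ?_⟩) (i3 S₂) (j3 S₂) ?_ K fun p => ?_)
      · change (_, _) ∈ _; rw [i1, j1]; exact ha'
      · change (_, _) ∈ _; rw [i2, j2]; exact hb'
      · change s _ = -s _; rw [i1, i2, hsa, hsb]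
      · rw [hK', hmem, ← i1, ← i2, ← j1, ← j2, and_iff_right (he.mem' p)]
        simp only [hinj.ne_iff]; tauto
    · obtain ⟨j, j1, j2, j3⟩ := exists_of_adj he (snd_mem_pts hb') (snd_mem_pts ha') hadj'
      refine h ⟨_, _⟩ ⟨_, _⟩ (.r2 _ i j (.inr ⟨?_, ?_⟩) (i3 S₂) (j3 S₂) ?_ K fun p => ?_)
      · change (_, _) ∈ _; rw [i1, j2]; exact ha'
      · change (_, _) ∈ _; rw [i2, j1]; exact hb'
      · change s _ = -s _; rw [i1, i2, hsa, hsb]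
      · rw [hK', hmem, ← i1, ← i2, ← j1, ← j2, and_iff_right (he.mem' p)]
        simp only [hinj.ne_iff]; tauto
  rw [subSum_lineGauss, subSum_sub_lineGauss, hK,
    lineSum_parallel φ M T s hg haS hbS hadj hadj' (by rw [hsa, hsb]), sub_eq_self] at hm
  rw [← hm]
  refine Finset.sum_congr rfl fun R hR => ?_
  rw [Finset.prod_eq_one, one_mul]
  intro c hc
  have hcS := Finset.mem_powerset.1 hR hc
  rw [(hs1 c (Finset.mem_insert_of_mem (Finset.mem_insert_of_mem hcS))
    (by rintro rfl; exact hbS hcS)).1]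
  simp

/-! ### The six-term relations -/

/-- Three disjoint edges with decoration `1` on a line, away from the arrows `S`. -/
structure Sites (M : ℕ → π) (S : Finset (ℕ × ℕ)) (x₁ x₂ y₁ y₂ z₁ z₂ : ℕ) : Prop where
  good : Good S
  x : x₁ < x₂
  y : y₁ < y₂
  z : z₁ < z₂
  Mx : M x₁ = M x₂
  My : M y₁ = M y₂
  Mz : M z₁ = M z₂
  sx : ∀ r ∈ pts S, r < x₁ ∨ x₂ < r
  sy : ∀ r ∈ pts S, r < y₁ ∨ y₂ < r
  sz : ∀ r ∈ pts S, r < z₁ ∨ z₂ < r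
  xy : x₂ < y₁ ∨ y₂ < x₁
  yz : y₂ < z₁ ∨ z₂ < y₁
  xz : x₂ < z₁ ∨ z₂ < x₁

theorem Sites.mono {M : ℕ → π} {S R : Finset (ℕ × ℕ)} {x₁ x₂ y₁ y₂ z₁ z₂ : ℕ}
    (h : Sites M S x₁ x₂ y₁ y₂ z₁ z₂) (hR : R ⊆ S) : Sites M R x₁ x₂ y₁ y₂ z₁ z₂ :=
  { h with
    good := h.good.mono hR
    sx := fun r hr => h.sx r (pts_mono hR hr)
    sy := fun r hr => h.sy r (pts_mono hR hr)
    sz := fun r hr => h.sz r (pts_mono hR hr) }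

/-- The points of three edges are not ends of the arrows in `S`. -/
theorem Sites.notMem {M : ℕ → π} {S : Finset (ℕ × ℕ)} {x₁ x₂ y₁ y₂ z₁ z₂ : ℕ}
    (h : Sites M S x₁ x₂ y₁ y₂ z₁ z₂) {p : ℕ} (hp : (x₁ ≤ p ∧ p ≤ x₂) ∨ (y₁ ≤ p ∧ p ≤ y₂) ∨
      (z₁ ≤ p ∧ p ≤ z₂)) : p ∉ pts S := by
  intro h'
  have := h.sx p h'
  have := h.sy p h'
  have := h.sz p h'
  omega

theorem good_insert_two {S : Finset (ℕ × ℕ)} (hS : Good S) {p q p' q' : ℕ} (hp : p ∉ pts S)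
    (hq : q ∉ pts S) (hp' : p' ∉ pts S) (hq' : q' ∉ pts S) (h : [p, q, p', q'].Nodup) :
    Good (insert (p, q) (insert (p', q') S)) := by
  simp only [List.nodup_cons, List.mem_cons, List.not_mem_nil, or_false, not_or] at h
  refine good_insert (good_insert hS h.2.2.1 hp' hq') h.1.1 ?_ ?_ <;>
    simp only [pts_insert, Finset.mem_insert, not_or] <;> tauto

/-- The difference of the two resolutions of a degenerate diagram with arrows `x → y`, `x → z`. -/
noncomputable def diffX (φ : ArrowDiagram π → ℚ) (M : ℕ → π) (T : π) (S : Finset (ℕ × ℕ))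
    (x₁ x₂ y z : ℕ) : ℚ :=
  lineVal φ M T (insert (x₁, y) (insert (x₂, z) S)) -
    lineVal φ M T (insert (x₂, y) (insert (x₁, z) S))

/-- The difference of the two resolutions of a degenerate diagram with arrows `x → y → z`. -/
noncomputable def diffY (φ : ArrowDiagram π → ℚ) (M : ℕ → π) (T : π) (S : Finset (ℕ × ℕ))
    (x y₁ y₂ z : ℕ) : ℚ :=
  lineVal φ M T (insert (x, y₁) (insert (y₂, z) S)) -
    lineVal φ M T (insert (x, y₂) (insert (y₁, z) S))

/-- The difference of the two resolutions of a degenerate diagram with arrows `x → z`, `y → z`. -/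
noncomputable def diffZ (φ : ArrowDiagram π → ℚ) (M : ℕ → π) (T : π) (S : Finset (ℕ × ℕ))
    (x y z₁ z₂ : ℕ) : ℚ :=
  lineVal φ M T (insert (x, z₁) (insert (y, z₂) S)) -
    lineVal φ M T (insert (x, z₂) (insert (y, z₁) S))

/-- The six-term relations. -/
def SixTerm (φ : ArrowDiagram π → ℚ) : Prop :=
  ∀ (M : ℕ → π) (T : π) (S : Finset (ℕ × ℕ)) (x₁ x₂ y₁ y₂ z₁ z₂ : ℕ),
    Sites M S x₁ x₂ y₁ y₂ z₁ z₂ →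
    diffX φ M T S x₁ x₂ y₁ z₁ + diffY φ M T S x₁ y₁ y₂ z₁ + diffZ φ M T S x₁ y₁ z₁ z₂ = 0

section Slide

variable {M : ℕ → π} {S : Finset (ℕ × ℕ)} {x₁ x₂ y₁ y₂ z₁ z₂ : ℕ}

theorem lineVal_slide_head' (φ : ArrowDiagram π → ℚ) {M : ℕ → π} (T : π) {S : Finset (ℕ × ℕ)}
    {p q t : ℕ} (hS : Good S) (ht : t ∉ pts S) (htp : t < p ∨ q < t) (hpq : p < q)
    (hM : M p = M q) (h : ∀ r ∈ pts S, r < p ∨ q < r) :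
    lineVal φ M T (insert (t, q) S) = lineVal φ M T (insert (t, p) S) := by
  have hp : p ∉ pts S := fun hr => by have := h p hr; omega
  have hq : q ∉ pts S := fun hr => by have := h q hr; omega
  refine lineVal_slide_head φ (good_insert hS (by simp only; omega) ht hp)
    (fun hh => hp (snd_mem_pts hh)) ?_ (.inl (.inl ⟨hpq, fun r hr => ?_, hM⟩))
  · simp only [pts_insert, Finset.mem_insert, not_or]
    exact ⟨by omega, by omega, hq⟩
  · simp only [pts_insert, Finset.mem_insert] at hr
    rcases hr with rfl | rfl | rfl | hr
    · omega
    · omega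
    · omega
    · have := h r hr
      omega

theorem lineVal_slide_tail' (φ : ArrowDiagram π → ℚ) {M : ℕ → π} (T : π) {S : Finset (ℕ × ℕ)}
    {p q t : ℕ} (hS : Good S) (ht : t ∉ pts S) (htp : t < p ∨ q < t) (hpq : p < q)
    (hM : M p = M q) (h : ∀ r ∈ pts S, r < p ∨ q < r) :
    lineVal φ M T (insert (q, t) S) = lineVal φ M T (insert (p, t) S) := by
  have hp : p ∉ pts S := fun hr => by have := h p hr; omega
  have hq : q ∉ pts S := fun hr => by have := h q hr; omega
  refine lineVal_slide_tail φ (good_insert hS (by simp only; omega) hp ht)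
    (fun hh => hp (fst_mem_pts hh)) ?_ (.inl (.inl ⟨hpq, fun r hr => ?_, hM⟩))
  · simp only [pts_insert, Finset.mem_insert, not_or]
    exact ⟨by omega, by omega, hq⟩
  · simp only [pts_insert, Finset.mem_insert] at hr
    rcases hr with rfl | rfl | rfl | hr
    · omega
    · omega
    · omega
    · have := h r hr
      omega

/-- After shortening the edges there is room for one more arrow with its ends on the original edges.
This prepares the six-term relations for diagrams in which three arrows meet the edges. -/
theorem Sites.add (h : Sites M S x₁ x₂ y₁ y₂ z₁ z₂) {p q x₁' x₂' y₁' y₂' z₁' z₂' : ℕ}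
    (hpq : p ≠ q) (hp : p ∉ pts S) (hq : q ∉ pts S)
    (hx : x₁ ≤ x₁' ∧ x₁' < x₂' ∧ x₂' ≤ x₂) (hy : y₁ ≤ y₁' ∧ y₁' < y₂' ∧ y₂' ≤ y₂)
    (hz : z₁ ≤ z₁' ∧ z₁' < z₂' ∧ z₂' ≤ z₂)
    (Mx : M x₁' = M x₂') (My : M y₁' = M y₂') (Mz : M z₁' = M z₂')
    (px : p < x₁' ∨ x₂' < p) (py : p < y₁' ∨ y₂' < p) (pz : p < z₁' ∨ z₂' < p)
    (qx : q < x₁' ∨ x₂' < q) (qy : q < y₁' ∨ y₂' < q) (qz : q < z₁' ∨ z₂' < q) :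
    Sites M (insert (p, q) S) x₁' x₂' y₁' y₂' z₁' z₂' where
  good := good_insert h.good hpq hp hq
  x := hx.2.1
  y := hy.2.1
  z := hz.2.1
  Mx := Mx
  My := My
  Mz := Mz
  sx r hr := by
    simp only [pts_insert, Finset.mem_insert] at hr
    rcases hr with rfl | rfl | hr
    · exact px
    · exact qx
    · have := h.sx r hr
      omega
  sy r hr := by
    simp only [pts_insert, Finset.mem_insert] at hr
    rcases hr with rfl | rfl | hr
    · exact py
    · exact qy
    · have := h.sy r hr
      omega
  sz r hr := by
    simp only [pts_insert, Finset.mem_insert] at hr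
    rcases hr with rfl | rfl | hr
    · exact pz
    · exact qz
    · have := h.sz r hr
      omega
  xy := by have := h.xy; omega
  yz := by have := h.yz; omega
  xz := by have := h.xz; omega

/-- The maps `f` and `g` choose the directions of the two arrows, so that one statement covers
out-out, in-out and in-in pairs. The ends `s` and `t` stay, the ends `p` and `q` slide. -/
theorem slide_two (φ : ArrowDiagram π → ℚ) (T : π) (hS : Good S) {s t p₁ p₂ q₁ q₂ p q : ℕ}
    (f g : ℕ → ℕ → ℕ × ℕ) (hf : f = Prod.mk ∨ f = fun s p => (p, s))
    (hg : g = Prod.mk ∨ g = fun t q => (q, t))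
    (hp : p = p₁ ∨ p = p₂) (hq : q = q₁ ∨ q = q₂) (hs : s ∉ pts S) (ht : t ∉ pts S) (hst : s ≠ t)
    (hp' : p₁ < p₂) (hq' : q₁ < q₂) (Mp : M p₁ = M p₂) (Mq : M q₁ = M q₂)
    (sp : ∀ r ∈ pts S, r < p₁ ∨ p₂ < r) (sq : ∀ r ∈ pts S, r < q₁ ∨ q₂ < r)
    (hpq : p₂ < q₁ ∨ q₂ < p₁) (hsp : s < p₁ ∨ p₂ < s) (hsq : s < q₁ ∨ q₂ < s)
    (htp : t < p₁ ∨ p₂ < t) (htq : t < q₁ ∨ q₂ < t) :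
    lineVal φ M T (insert (f s p) (insert (g t q) S)) =
      lineVal φ M T (insert (f s p₁) (insert (g t q₁) S)) := by
  have np : ∀ r, p₁ ≤ r → r ≤ p₂ → r ∉ pts S := fun r h1 h2 h => by have := sp r h; omega
  have nq : ∀ r, q₁ ≤ r → r ≤ q₂ → r ∉ pts S := fun r h1 h2 h => by have := sq r h; omega
  have key : ∀ (f : ℕ → ℕ → ℕ × ℕ), (f = Prod.mk ∨ f = fun s p => (p, s)) →
      ∀ (R : Finset (ℕ × ℕ)) (s p p₁ p₂ : ℕ), (p = p₁ ∨ p = p₂) → Good R → s ∉ pts R →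
      (s < p₁ ∨ p₂ < s) → p₁ < p₂ → M p₁ = M p₂ → (∀ r ∈ pts R, r < p₁ ∨ p₂ < r) →
      lineVal φ M T (insert (f s p) R) = lineVal φ M T (insert (f s p₁) R) := by
    rintro f (rfl | rfl) R s p p₁ p₂ (rfl | rfl) h1 h2 h3 h4 h5 h6
    · rfl
    · exact lineVal_slide_head' φ T h1 h2 h3 h4 h5 h6
    · rfl
    · exact lineVal_slide_tail' φ T h1 h2 h3 h4 h5 h6
  have pg : ∀ t q, pts (insert (g t q) S) = insert t (insert q (pts S)) := by
    intro t q
    rcases hg with rfl | rfl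
    · exact pts_insert _ _
    · rw [pts_insert, Finset.insert_comm]
  have pf : pts (insert (f s p₁) S) = insert s (insert p₁ (pts S)) := by
    rcases hf with rfl | rfl
    · exact pts_insert _ _
    · rw [pts_insert, Finset.insert_comm]
  have g1 : Good (insert (g t q) S) := by
    have hq1 := nq q (by omega) (by omega)
    rcases hg with rfl | rfl
    · exact good_insert hS (by simp only; omega) ht hq1
    · exact good_insert hS (by simp only; omega) hq1 ht
  have f1 : Good (insert (f s p₁) S) := by
    have hp1 := np p₁ (by omega) (by omega)
    rcases hf with rfl | rfl
    · exact good_insert hS (by simp only; omega) hs hp1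
    · exact good_insert hS (by simp only; omega) hp1 hs
  rw [key f hf _ s p p₁ p₂ hp g1 (by rw [pg]; simp only [Finset.mem_insert, hs, or_false]; omega)
    hsp hp' Mp, Finset.insert_comm,
    key g hg _ t q q₁ q₂ hq f1 (by rw [pf]; simp only [Finset.mem_insert, ht, or_false]; omega)
    htq hq' Mq, Finset.insert_comm]
  · rw [pf]
    intro r hr
    simp only [Finset.mem_insert] at hr
    rcases hr with rfl | rfl | hr
    · exact hsq
    · omega
    · exact sq r hr
  · rw [pg]
    intro r hr
    simp only [Finset.mem_insert] at hr
    rcases hr with rfl | rfl | hr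
    · exact htp
    · omega
    · exact sp r hr

theorem Sites.slideX (h : Sites M S x₁ x₂ y₁ y₂ z₁ z₂) (φ : ArrowDiagram π → ℚ) (T : π)
    {y z s t : ℕ} (hy : y = y₁ ∨ y = y₂) (hz : z = z₁ ∨ z = z₂)
    (hst : (s = x₁ ∧ t = x₂) ∨ (s = x₂ ∧ t = x₁)) :
    lineVal φ M T (insert (s, y) (insert (t, z) S)) =
      lineVal φ M T (insert (s, y₁) (insert (t, z₁) S)) := by
  obtain ⟨g, hx1, hy1, hz1, Mx, My, Mz, sx, sy, sz, xy, yz, xz⟩ := h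
  refine slide_two φ T g Prod.mk Prod.mk (.inl rfl) (.inl rfl) hy hz (fun h => ?_) (fun h => ?_)
    ?_ hy1 hz1 My Mz sy sz yz ?_ ?_ ?_ ?_
  · have := sx _ h; omega
  · have := sx _ h; omega
  all_goals omega

theorem Sites.slideY (h : Sites M S x₁ x₂ y₁ y₂ z₁ z₂) (φ : ArrowDiagram π → ℚ) (T : π)
    {x z s t : ℕ} (hx : x = x₁ ∨ x = x₂) (hz : z = z₁ ∨ z = z₂)
    (hst : (s = y₁ ∧ t = y₂) ∨ (s = y₂ ∧ t = y₁)) :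
    lineVal φ M T (insert (x, s) (insert (t, z) S)) =
      lineVal φ M T (insert (x₁, s) (insert (t, z₁) S)) := by
  obtain ⟨g, hx1, hy1, hz1, Mx, My, Mz, sx, sy, sz, xy, yz, xz⟩ := h
  refine slide_two φ T g (fun s p => (p, s)) Prod.mk (.inr rfl) (.inl rfl) hx hz (fun h => ?_)
    (fun h => ?_) ?_ hx1 hz1 Mx Mz sx sz xz ?_ ?_ ?_ ?_
  · have := sy _ h; omega
  · have := sy _ h; omega
  all_goals omega

theorem Sites.slideZ (h : Sites M S x₁ x₂ y₁ y₂ z₁ z₂) (φ : ArrowDiagram π → ℚ) (T : π)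
    {x y s t : ℕ} (hx : x = x₁ ∨ x = x₂) (hy : y = y₁ ∨ y = y₂)
    (hst : (s = z₁ ∧ t = z₂) ∨ (s = z₂ ∧ t = z₁)) :
    lineVal φ M T (insert (x, s) (insert (y, t) S)) =
      lineVal φ M T (insert (x₁, s) (insert (y₁, t) S)) := by
  obtain ⟨g, hx1, hy1, hz1, Mx, My, Mz, sx, sy, sz, xy, yz, xz⟩ := h
  refine slide_two φ T g (fun s p => (p, s)) (fun s p => (p, s)) (.inr rfl) (.inr rfl) hx hy
    (fun h => ?_) (fun h => ?_) ?_ hx1 hy1 Mx My sx sy xy ?_ ?_ ?_ ?_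
  · have := sz _ h; omega
  · have := sz _ h; omega
  all_goals omega

/-- In each of the three differences, only the order of the ends on one edge matters; the single end
on each of the other two edges may be placed at either of its end points. -/
theorem Sites.sum_slide (h : Sites M S x₁ x₂ y₁ y₂ z₁ z₂) (φ : ArrowDiagram π → ℚ) (T : π)
    {x y z : ℕ} (hx : x = x₁ ∨ x = x₂) (hy : y = y₁ ∨ y = y₂) (hz : z = z₁ ∨ z = z₂) :
    diffX φ M T S x₁ x₂ y z + diffY φ M T S x y₁ y₂ z + diffZ φ M T S x y z₁ z₂ =
      diffX φ M T S x₁ x₂ y₁ z₁ + diffY φ M T S x₁ y₁ y₂ z₁ + diffZ φ M T S x₁ y₁ z₁ z₂ := by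
  simp only [diffX, diffY, diffZ]
  rw [h.slideX φ T hy hz (.inl ⟨rfl, rfl⟩), h.slideX φ T hy hz (.inr ⟨rfl, rfl⟩),
    h.slideY φ T hx hz (.inl ⟨rfl, rfl⟩), h.slideY φ T hx hz (.inr ⟨rfl, rfl⟩),
    h.slideZ φ T hx hy (.inl ⟨rfl, rfl⟩), h.slideZ φ T hx hy (.inr ⟨rfl, rfl⟩)]

theorem SixTerm.slide {φ : ArrowDiagram π → ℚ} (hφ : SixTerm φ)
    (h : Sites M S x₁ x₂ y₁ y₂ z₁ z₂) (T : π) {x y z : ℕ} (hx : x = x₁ ∨ x = x₂)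
    (hy : y = y₁ ∨ y = y₂) (hz : z = z₁ ∨ z = z₂) :
    diffX φ M T S x₁ x₂ y z + diffY φ M T S x y₁ y₂ z + diffZ φ M T S x y z₁ z₂ = 0 := by
  rw [h.sum_slide φ T hx hy hz, hφ M T S x₁ x₂ y₁ y₂ z₁ z₂ h]

end Slide

theorem LineAP2.eq_zero {φ : ArrowDiagram π → ℚ} (h : LineAP2 φ) {M : ℕ → π} (T : π)
    {S : Finset (ℕ × ℕ)} (hS : Good S) {p q p' q' p₁ p₂ q₁ q₂ : ℕ}
    (hp : (p = p₁ ∧ p' = p₂) ∨ (p = p₂ ∧ p' = p₁)) (hq : (q = q₁ ∧ q' = q₂) ∨ (q = q₂ ∧ q' = q₁))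
    (hp' : p₁ < p₂) (hq' : q₁ < q₂) (Mp : M p₁ = M p₂) (Mq : M q₁ = M q₂)
    (sp : ∀ r ∈ pts S, r < p₁ ∨ p₂ < r) (sq : ∀ r ∈ pts S, r < q₁ ∨ q₂ < r)
    (hpq : p₂ < q₁ ∨ q₂ < p₁) :
    lineVal φ M T (insert (p, q) (insert (p', q') S)) = 0 := by
  have np : ∀ r, r = p₁ ∨ r = p₂ → r ∉ pts S := fun r h1 h => by have := sp r h; omega
  have nq : ∀ r, r = q₁ ∨ r = q₂ → r ∉ pts S := fun r h1 h => by have := sq r h; omega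
  have hg : Good (insert (p, q) (insert (p', q') S)) :=
    good_insert_two hS (np _ (by omega)) (nq _ (by omega)) (np _ (by omega)) (nq _ (by omega))
      (by simp; omega)
  have hpts : pts (insert (p, q) (insert (p', q') S)) = insert p (insert q (insert p'
    (insert q' (pts S)))) := by simp only [pts_insert]
  have ap : Adj M T (pts (insert (p, q) (insert (p', q') S))) p₁ p₂ := by
    refine .inl ⟨hp', fun r hr => ?_, Mp⟩
    simp only [hpts, Finset.mem_insert] at hr
    rcases hr with rfl | rfl | rfl | rfl | hr
    any_goals omega
    have := sp r hr; omega
  have aq : Adj M T (pts (insert (p, q) (insert (p', q') S))) q₁ q₂ := by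
    refine .inl ⟨hq', fun r hr => ?_, Mq⟩
    simp only [hpts, Finset.mem_insert] at hr
    rcases hr with rfl | rfl | rfl | rfl | hr
    any_goals omega
    have := sq r hr; omega
  have ha : (p, q) ∈ insert (p, q) (insert (p', q') S) := Finset.mem_insert_self _ _
  have hb : (p', q') ∈ insert (p, q) (insert (p', q') S) :=
    Finset.mem_insert_of_mem (Finset.mem_insert_self _ _)
  have hne : (p, q) ≠ (p', q') := by simp; omega
  rcases hp with ⟨rfl, rfl⟩ | ⟨rfl, rfl⟩
  · refine h M T _ (p, q) (p', q') hg ha hb hne ap ?_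
    rcases hq with ⟨rfl, rfl⟩ | ⟨rfl, rfl⟩
    · exact .inl aq
    · exact .inr aq
  · refine h M T _ (p', q') (p, q) hg hb ha hne.symm ap ?_
    rcases hq with ⟨rfl, rfl⟩ | ⟨rfl, rfl⟩
    · exact .inr aq
    · exact .inl aq

/-! ### Diagrams with all three arrows of a third Reidemeister move -/

section Full

variable {φ : ArrowDiagram π → ℚ} {M : ℕ → π} {S : Finset (ℕ × ℕ)}
  {x₁ x₂ y₁ y₂ z₁ z₂ : ℕ}

/-- The third arrow `(s, t)` has no end between the two tails or between the two heads, so the other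
two arrows remain parallel. -/
theorem LineAP2.eq_zero_insert (h : LineAP2 φ) (T : π) (hS : Good S) {p q p' q' p₁ p₂ q₁ q₂ s t : ℕ}
    (hp : (p = p₁ ∧ p' = p₂) ∨ (p = p₂ ∧ p' = p₁)) (hq : (q = q₁ ∧ q' = q₂) ∨ (q = q₂ ∧ q' = q₁))
    (hp' : p₁ < p₂) (hq' : q₁ < q₂) (Mp : M p₁ = M p₂) (Mq : M q₁ = M q₂)
    (sp : ∀ r ∈ pts S, r < p₁ ∨ p₂ < r) (sq : ∀ r ∈ pts S, r < q₁ ∨ q₂ < r)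
    (hpq : p₂ < q₁ ∨ q₂ < p₁) (hs : s ∉ pts S) (ht : t ∉ pts S) (hst : s ≠ t)
    (hsp : s < p₁ ∨ p₂ < s) (hsq : s < q₁ ∨ q₂ < s) (htp : t < p₁ ∨ p₂ < t)
    (htq : t < q₁ ∨ q₂ < t) :
    lineVal φ M T (insert (s, t) (insert (p, q) (insert (p', q') S))) = 0 := by
  rw [Finset.insert_comm (s, t), Finset.insert_comm (s, t)]
  refine h.eq_zero T (good_insert hS hst hs ht) hp hq hp' hq' Mp Mq ?_ ?_ hpq
  all_goals
    intro r hr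
    simp only [pts_insert, Finset.mem_insert] at hr
    rcases hr with rfl | rfl | hr
  · exact hsp
  · exact htp
  · exact sp r hr
  · exact hsq
  · exact htq
  · exact sq r hr

/-- The value of the diagram with three arrows `xa → ya`, `xc → zc`, `yb → zb` and the arrows `S`. -/
noncomputable def full (φ : ArrowDiagram π → ℚ) (M : ℕ → π) (T : π) (S : Finset (ℕ × ℕ))
    (xa xc ya yb zb zc : ℕ) : ℚ :=
  lineVal φ M T (insert (xa, ya) (insert (xc, zc) (insert (yb, zb) S)))

/-- The six-term relation is applied twice, with an additional arrow `y₁ → z₁` and with `y₂ → z₂`.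
Of the four terms in the second and third difference, two contain parallel arrows and vanish by AP₂.
The other two contain `y₁ → z₁`, `y₂ → z₂` and an arrow from `x₁` to `ym` or `zm`; they occur in
both applications with opposite signs. The first differences remain. -/
theorem full_sum_b (h6 : SixTerm φ) (h2 : LineAP2 φ) (T : π) (h : Sites M S x₁ x₂ y₁ y₂ z₁ z₂)
    {ym zm : ℕ} (hy : y₁ < ym ∧ ym < y₂) (hz : z₁ < zm ∧ zm < z₂)
    (My : M ym = M y₁) (Mz : M zm = M z₁) :
    full φ M T S x₁ x₂ y₂ y₁ z₁ z₂ - full φ M T S x₂ x₁ y₂ y₁ z₁ z₂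
      + full φ M T S x₁ x₂ y₁ y₂ z₂ z₁ - full φ M T S x₂ x₁ y₁ y₂ z₂ z₁ = 0 := by
  obtain ⟨-, lx, ly, lz, Mx1, My1, Mz1, -, -, -, xy, yz, xz⟩ := id h
  have i1 := h6.slide (h.add (p := y₁) (q := z₁) (x₁' := x₁) (x₂' := x₂) (y₁' := ym)
    (y₂' := y₂) (z₁' := zm) (z₂' := z₂) (by omega) (h.notMem (by omega)) (h.notMem (by omega))
    (by omega) (by omega) (by omega) Mx1 (My.trans My1) (Mz.trans Mz1) (by omega)
    (by omega) (by omega) (by omega) (by omega) (by omega)) T (.inl rfl) (.inr rfl) (.inr rfl)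
  have e1a := h2.eq_zero_insert T h.good (s := x₁) (t := y₂) (.inr ⟨rfl, rfl⟩) (.inr ⟨rfl, rfl⟩)
    (by omega : y₁ < ym) (by omega : z₁ < z₂) My.symm Mz1
    (fun r hr => by have := h.sy r hr; omega)
    (fun r hr => by have := h.sz r hr; omega) (by omega)
    (h.notMem (by omega)) (h.notMem (by omega)) (by omega) (by omega) (by omega) (by omega)
    (by omega)
  have e1b := h2.eq_zero_insert T h.good (s := x₁) (t := z₂) (.inr ⟨rfl, rfl⟩) (.inr ⟨rfl, rfl⟩)
    (by omega : y₁ < y₂) (by omega : z₁ < zm) My1 Mz.symm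
    (fun r hr => by have := h.sy r hr; omega)
    (fun r hr => by have := h.sz r hr; omega) (by omega)
    (h.notMem (by omega)) (h.notMem (by omega)) (by omega) (by omega) (by omega) (by omega)
    (by omega)
  have i2 := h6.slide (h.add (p := y₂) (q := z₂) (x₁' := x₁) (x₂' := x₂) (y₁' := y₁)
    (y₂' := ym) (z₁' := z₁) (z₂' := zm) (by omega) (h.notMem (by omega)) (h.notMem (by omega))
    (by omega) (by omega) (by omega) Mx1 My.symm Mz.symm (by omega)
    (by omega) (by omega) (by omega) (by omega) (by omega)) T (.inl rfl) (.inl rfl) (.inl rfl)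
  have e2a := h2.eq_zero_insert T h.good (s := x₁) (t := y₁) (.inl ⟨rfl, rfl⟩) (.inl ⟨rfl, rfl⟩)
    (by omega : ym < y₂) (by omega : z₁ < z₂) (My.trans My1) Mz1
    (fun r hr => by have := h.sy r hr; omega)
    (fun r hr => by have := h.sz r hr; omega) (by omega)
    (h.notMem (by omega)) (h.notMem (by omega)) (by omega) (by omega) (by omega) (by omega)
    (by omega)
  have e2b := h2.eq_zero_insert T h.good (s := x₁) (t := z₁) (.inl ⟨rfl, rfl⟩) (.inl ⟨rfl, rfl⟩)
    (by omega : y₁ < y₂) (by omega : zm < z₂) My1 (Mz.trans Mz1)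
    (fun r hr => by have := h.sy r hr; omega)
    (fun r hr => by have := h.sz r hr; omega) (by omega)
    (h.notMem (by omega)) (h.notMem (by omega)) (by omega) (by omega) (by omega) (by omega)
    (by omega)
  simp only [Finset.insert_comm] at e1a e1b e2a e2b
  simp only [diffX, diffY, diffZ, Finset.insert_comm] at i1 i2
  simp only [full, Finset.insert_comm]
  linarith

/-- The same computation with the additional arrows `y₁ → z₂` and `y₂ → z₁`. -/
theorem full_sum_b' (h6 : SixTerm φ) (h2 : LineAP2 φ) (T : π) (h : Sites M S x₁ x₂ y₁ y₂ z₁ z₂)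
    {ym zm : ℕ} (hy : y₁ < ym ∧ ym < y₂) (hz : z₁ < zm ∧ zm < z₂)
    (My : M ym = M y₁) (Mz : M zm = M z₁) :
    full φ M T S x₁ x₂ y₂ y₁ z₂ z₁ - full φ M T S x₂ x₁ y₂ y₁ z₂ z₁
      + full φ M T S x₁ x₂ y₁ y₂ z₁ z₂ - full φ M T S x₂ x₁ y₁ y₂ z₁ z₂ = 0 := by
  obtain ⟨-, lx, ly, lz, Mx1, My1, Mz1, -, -, -, xy, yz, xz⟩ := id h
  have i1 := h6.slide (h.add (p := y₁) (q := z₂) (x₁' := x₁) (x₂' := x₂) (y₁' := ym)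
    (y₂' := y₂) (z₁' := z₁) (z₂' := zm) (by omega) (h.notMem (by omega)) (h.notMem (by omega))
    (by omega) (by omega) (by omega) Mx1 (My.trans My1) Mz.symm (by omega)
    (by omega) (by omega) (by omega) (by omega) (by omega)) T (.inl rfl) (.inr rfl) (.inl rfl)
  have e1a := h2.eq_zero_insert T h.good (s := x₁) (t := y₂) (.inr ⟨rfl, rfl⟩) (.inl ⟨rfl, rfl⟩)
    (by omega : y₁ < ym) (by omega : z₁ < z₂) My.symm Mz1
    (fun r hr => by have := h.sy r hr; omega)
    (fun r hr => by have := h.sz r hr; omega) (by omega)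
    (h.notMem (by omega)) (h.notMem (by omega)) (by omega) (by omega) (by omega) (by omega)
    (by omega)
  have e1b := h2.eq_zero_insert T h.good (s := x₁) (t := z₁) (.inr ⟨rfl, rfl⟩) (.inl ⟨rfl, rfl⟩)
    (by omega : y₁ < y₂) (by omega : zm < z₂) My1 (Mz.trans Mz1)
    (fun r hr => by have := h.sy r hr; omega)
    (fun r hr => by have := h.sz r hr; omega) (by omega)
    (h.notMem (by omega)) (h.notMem (by omega)) (by omega) (by omega) (by omega) (by omega)
    (by omega)
  have i2 := h6.slide (h.add (p := y₂) (q := z₁) (x₁' := x₁) (x₂' := x₂) (y₁' := y₁)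
    (y₂' := ym) (z₁' := zm) (z₂' := z₂) (by omega) (h.notMem (by omega)) (h.notMem (by omega))
    (by omega) (by omega) (by omega) Mx1 My.symm (Mz.trans Mz1) (by omega)
    (by omega) (by omega) (by omega) (by omega) (by omega)) T (.inl rfl) (.inl rfl) (.inr rfl)
  have e2a := h2.eq_zero_insert T h.good (s := x₁) (t := y₁) (.inl ⟨rfl, rfl⟩) (.inr ⟨rfl, rfl⟩)
    (by omega : ym < y₂) (by omega : z₁ < z₂) (My.trans My1) Mz1
    (fun r hr => by have := h.sy r hr; omega)
    (fun r hr => by have := h.sz r hr; omega) (by omega)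
    (h.notMem (by omega)) (h.notMem (by omega)) (by omega) (by omega) (by omega) (by omega)
    (by omega)
  have e2b := h2.eq_zero_insert T h.good (s := x₁) (t := z₂) (.inl ⟨rfl, rfl⟩) (.inr ⟨rfl, rfl⟩)
    (by omega : y₁ < y₂) (by omega : z₁ < zm) My1 Mz.symm
    (fun r hr => by have := h.sy r hr; omega)
    (fun r hr => by have := h.sz r hr; omega) (by omega)
    (h.notMem (by omega)) (h.notMem (by omega)) (by omega) (by omega) (by omega) (by omega)
    (by omega)
  simp only [Finset.insert_comm] at e1a e1b e2a e2b
  simp only [diffX, diffY, diffZ, Finset.insert_comm] at i1 i2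
  simp only [full, Finset.insert_comm]
  linarith

/-- The additional arrow is now `x₁ → z₁`, then `x₂ → z₂`; the second differences remain. -/
theorem full_sum_c (h6 : SixTerm φ) (h2 : LineAP2 φ) (T : π) (h : Sites M S x₁ x₂ y₁ y₂ z₁ z₂)
    {xm zm : ℕ} (hx : x₁ < xm ∧ xm < x₂) (hz : z₁ < zm ∧ zm < z₂)
    (Mx : M xm = M x₁) (Mz : M zm = M z₁) :
    full φ M T S x₂ x₁ y₁ y₂ z₂ z₁ - full φ M T S x₂ x₁ y₂ y₁ z₂ z₁
      + full φ M T S x₁ x₂ y₁ y₂ z₁ z₂ - full φ M T S x₁ x₂ y₂ y₁ z₁ z₂ = 0 := by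
  obtain ⟨-, lx, ly, lz, Mx1, My1, Mz1, -, -, -, xy, yz, xz⟩ := id h
  have i1 := h6.slide (h.add (p := x₁) (q := z₁) (x₁' := xm) (x₂' := x₂) (y₁' := y₁)
    (y₂' := y₂) (z₁' := zm) (z₂' := z₂) (by omega) (h.notMem (by omega)) (h.notMem (by omega))
    (by omega) (by omega) (by omega) (Mx.trans Mx1) My1 (Mz.trans Mz1) (by omega)
    (by omega) (by omega) (by omega) (by omega) (by omega)) T (.inr rfl) (.inl rfl) (.inr rfl)
  have e1a := h2.eq_zero_insert T h.good (s := x₂) (t := y₁) (.inr ⟨rfl, rfl⟩) (.inr ⟨rfl, rfl⟩)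
    (by omega : x₁ < xm) (by omega : z₁ < z₂) Mx.symm Mz1
    (fun r hr => by have := h.sx r hr; omega)
    (fun r hr => by have := h.sz r hr; omega) (by omega)
    (h.notMem (by omega)) (h.notMem (by omega)) (by omega) (by omega) (by omega) (by omega)
    (by omega)
  have e1b := h2.eq_zero_insert T h.good (s := y₁) (t := z₂) (.inr ⟨rfl, rfl⟩) (.inr ⟨rfl, rfl⟩)
    (by omega : x₁ < x₂) (by omega : z₁ < zm) Mx1 Mz.symm
    (fun r hr => by have := h.sx r hr; omega)
    (fun r hr => by have := h.sz r hr; omega) (by omega)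
    (h.notMem (by omega)) (h.notMem (by omega)) (by omega) (by omega) (by omega) (by omega)
    (by omega)
  have i2 := h6.slide (h.add (p := x₂) (q := z₂) (x₁' := x₁) (x₂' := xm) (y₁' := y₁)
    (y₂' := y₂) (z₁' := z₁) (z₂' := zm) (by omega) (h.notMem (by omega)) (h.notMem (by omega))
    (by omega) (by omega) (by omega) Mx.symm My1 Mz.symm (by omega)
    (by omega) (by omega) (by omega) (by omega) (by omega)) T (.inl rfl) (.inl rfl) (.inl rfl)
  have e2a := h2.eq_zero_insert T h.good (s := x₁) (t := y₁) (.inl ⟨rfl, rfl⟩) (.inl ⟨rfl, rfl⟩)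
    (by omega : xm < x₂) (by omega : z₁ < z₂) (Mx.trans Mx1) Mz1
    (fun r hr => by have := h.sx r hr; omega)
    (fun r hr => by have := h.sz r hr; omega) (by omega)
    (h.notMem (by omega)) (h.notMem (by omega)) (by omega) (by omega) (by omega) (by omega)
    (by omega)
  have e2b := h2.eq_zero_insert T h.good (s := y₁) (t := z₁) (.inl ⟨rfl, rfl⟩) (.inl ⟨rfl, rfl⟩)
    (by omega : x₁ < x₂) (by omega : zm < z₂) Mx1 (Mz.trans Mz1)
    (fun r hr => by have := h.sx r hr; omega)
    (fun r hr => by have := h.sz r hr; omega) (by omega)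
    (h.notMem (by omega)) (h.notMem (by omega)) (by omega) (by omega) (by omega) (by omega)
    (by omega)
  simp only [Finset.insert_comm] at e1a e1b e2a e2b
  simp only [diffX, diffY, diffZ, Finset.insert_comm] at i1 i2
  simp only [full, Finset.insert_comm]
  linarith

/-- The additional arrow is now `x₁ → y₁`, then `x₂ → y₂`; the third differences remain. -/
theorem full_sum_a (h6 : SixTerm φ) (h2 : LineAP2 φ) (T : π) (h : Sites M S x₁ x₂ y₁ y₂ z₁ z₂)
    {xm ym : ℕ} (hx : x₁ < xm ∧ xm < x₂) (hy : y₁ < ym ∧ ym < y₂)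
    (Mx : M xm = M x₁) (My : M ym = M y₁) :
    full φ M T S x₁ x₂ y₁ y₂ z₂ z₁ - full φ M T S x₁ x₂ y₁ y₂ z₁ z₂
      + full φ M T S x₂ x₁ y₂ y₁ z₂ z₁ - full φ M T S x₂ x₁ y₂ y₁ z₁ z₂ = 0 := by
  obtain ⟨-, lx, ly, lz, Mx1, My1, Mz1, -, -, -, xy, yz, xz⟩ := id h
  have i1 := h6.slide (h.add (p := x₁) (q := y₁) (x₁' := xm) (x₂' := x₂) (y₁' := ym)
    (y₂' := y₂) (z₁' := z₁) (z₂' := z₂) (by omega) (h.notMem (by omega)) (h.notMem (by omega))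
    (by omega) (by omega) (by omega) (Mx.trans Mx1) (My.trans My1) Mz1 (by omega)
    (by omega) (by omega) (by omega) (by omega) (by omega)) T (.inr rfl) (.inr rfl) (.inl rfl)
  have e1a := h2.eq_zero_insert T h.good (s := x₂) (t := z₁) (.inr ⟨rfl, rfl⟩) (.inr ⟨rfl, rfl⟩)
    (by omega : x₁ < xm) (by omega : y₁ < y₂) Mx.symm My1
    (fun r hr => by have := h.sx r hr; omega)
    (fun r hr => by have := h.sy r hr; omega) (by omega)
    (h.notMem (by omega)) (h.notMem (by omega)) (by omega) (by omega) (by omega) (by omega)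
    (by omega)
  have e1b := h2.eq_zero_insert T h.good (s := y₂) (t := z₁) (.inr ⟨rfl, rfl⟩) (.inr ⟨rfl, rfl⟩)
    (by omega : x₁ < x₂) (by omega : y₁ < ym) Mx1 My.symm
    (fun r hr => by have := h.sx r hr; omega)
    (fun r hr => by have := h.sy r hr; omega) (by omega)
    (h.notMem (by omega)) (h.notMem (by omega)) (by omega) (by omega) (by omega) (by omega)
    (by omega)
  have i2 := h6.slide (h.add (p := x₂) (q := y₂) (x₁' := x₁) (x₂' := xm) (y₁' := y₁)
    (y₂' := ym) (z₁' := z₁) (z₂' := z₂) (by omega) (h.notMem (by omega)) (h.notMem (by omega))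
    (by omega) (by omega) (by omega) Mx.symm My.symm Mz1 (by omega)
    (by omega) (by omega) (by omega) (by omega) (by omega)) T (.inl rfl) (.inl rfl) (.inl rfl)
  have e2a := h2.eq_zero_insert T h.good (s := x₁) (t := z₁) (.inl ⟨rfl, rfl⟩) (.inl ⟨rfl, rfl⟩)
    (by omega : xm < x₂) (by omega : y₁ < y₂) (Mx.trans Mx1) My1
    (fun r hr => by have := h.sx r hr; omega)
    (fun r hr => by have := h.sy r hr; omega) (by omega)
    (h.notMem (by omega)) (h.notMem (by omega)) (by omega) (by omega) (by omega) (by omega)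
    (by omega)
  have e2b := h2.eq_zero_insert T h.good (s := y₁) (t := z₁) (.inl ⟨rfl, rfl⟩) (.inl ⟨rfl, rfl⟩)
    (by omega : x₁ < x₂) (by omega : ym < y₂) Mx1 (My.trans My1)
    (fun r hr => by have := h.sx r hr; omega)
    (fun r hr => by have := h.sy r hr; omega) (by omega)
    (h.notMem (by omega)) (h.notMem (by omega)) (by omega) (by omega) (by omega) (by omega)
    (by omega)
  simp only [Finset.insert_comm] at e1a e1b e2a e2b
  simp only [diffX, diffY, diffZ, Finset.insert_comm] at i1 i2
  simp only [full, Finset.insert_comm]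
  linarith

/-- The relations that result from the six-term relations for diagrams with three arrows. -/
theorem full_eq (h6 : SixTerm φ) (h2 : LineAP2 φ) (T : π) (h : Sites M S x₁ x₂ y₁ y₂ z₁ z₂)
    {xa xc ya yb zb zc : ℕ} (hx : (xa = x₁ ∧ xc = x₂) ∨ (xa = x₂ ∧ xc = x₁))
    (hy : (ya = y₁ ∧ yb = y₂) ∨ (ya = y₂ ∧ yb = y₁))
    (hz : (zb = z₁ ∧ zc = z₂) ∨ (zb = z₂ ∧ zc = z₁)) :
    full φ M T S xa xc ya yb zb zc = full φ M T S xc xa yb ya zc zb := by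
  -- Doubling all positions makes room for the midpoints `f p + 1`; the potential `M (n / 2)` takes
  -- the same value there as at `f p`.
  set f : ℕ → ℕ := fun p => 2 * p with hf
  have hf' : StrictMono f := fun p q hpq => by simp only [hf]; omega
  have hfull : ∀ xa xc ya yb zb zc, ((xa = x₁ ∧ xc = x₂) ∨ (xa = x₂ ∧ xc = x₁)) →
      ((ya = y₁ ∧ yb = y₂) ∨ (ya = y₂ ∧ yb = y₁)) → ((zb = z₁ ∧ zc = z₂) ∨ (zb = z₂ ∧ zc = z₁)) →
      full φ (fun n => M (n / 2)) T (mapArr f S) (f xa) (f xc) (f ya) (f yb) (f zb) (f zc) =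
        full φ M T S xa xc ya yb zb zc := by
    intro xa xc ya yb zb zc hx hy hz
    obtain ⟨-, lx, ly, lz, -, -, -, -, -, -, xy, yz, xz⟩ := id h
    simp only [full]
    rw [← mapArr_insert f (yb, zb), ← mapArr_insert f (xc, zc), ← mapArr_insert f (xa, ya)]
    refine lineVal_mapArr φ ?_ (hf'.strictMonoOn _) T fun p _ => by simp [hf]
    refine good_insert (good_insert_two h.good (h.notMem (by omega)) (h.notMem (by omega))
      (h.notMem (by omega)) (h.notMem (by omega)) ?_) (by simp only; omega) ?_ ?_
    · simp; omega
    · simp only [pts_insert, Finset.mem_insert, h.notMem (p := xa) (by omega), or_false]; omega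
    · simp only [pts_insert, Finset.mem_insert, h.notMem (p := ya) (by omega), or_false]; omega
  have hs : Sites (fun n => M (n / 2)) (mapArr f S) (f x₁) (f x₂) (f y₁) (f y₂) (f z₁) (f z₂) := by
    obtain ⟨hg, lx, ly, lz, Mx, My, Mz, sx, sy, sz, xy, yz, xz⟩ := id h
    refine ⟨hg.mapArr hf'.injective.injOn, hf' lx, hf' ly, hf' lz, by simpa [hf] using Mx,
      by simpa [hf] using My, by simpa [hf] using Mz, fun r hr => ?_, fun r hr => ?_,
      fun r hr => ?_, ?_, ?_, ?_⟩
    · rw [pts_mapArr] at hr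
      obtain ⟨r, hr', rfl⟩ := Finset.mem_image.1 hr
      have := sx r hr'
      simp only [hf]; omega
    · rw [pts_mapArr] at hr
      obtain ⟨r, hr', rfl⟩ := Finset.mem_image.1 hr
      have := sy r hr'
      simp only [hf]; omega
    · rw [pts_mapArr] at hr
      obtain ⟨r, hr', rfl⟩ := Finset.mem_image.1 hr
      have := sz r hr'
      simp only [hf]; omega
    all_goals simp only [hf]; omega
  have hm : ∀ p, (fun n => M (n / 2)) (f p + 1) = (fun n => M (n / 2)) (f p) := fun p => by
    have e1 : (2 * p + 1) / 2 = p := by omega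
    have e2 : 2 * p / 2 = p := by omega
    simp only [hf, e1, e2]
  have hl : ∀ p q, p < q → f p < f p + 1 ∧ f p + 1 < f q := fun p q h => by
    simp only [hf]; omega
  have eb := full_sum_b h6 h2 T hs (hl _ _ h.y) (hl _ _ h.z) (hm _) (hm _)
  have eb' := full_sum_b' h6 h2 T hs (hl _ _ h.y) (hl _ _ h.z) (hm _) (hm _)
  have ec := full_sum_c h6 h2 T hs (hl _ _ h.x) (hl _ _ h.z) (hm _) (hm _)
  have ea := full_sum_a h6 h2 T hs (hl _ _ h.x) (hl _ _ h.y) (hm _) (hm _)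
  simp only [hfull _ _ _ _ _ _ (.inl ⟨rfl, rfl⟩) (.inl ⟨rfl, rfl⟩) (.inl ⟨rfl, rfl⟩),
    hfull _ _ _ _ _ _ (.inl ⟨rfl, rfl⟩) (.inl ⟨rfl, rfl⟩) (.inr ⟨rfl, rfl⟩),
    hfull _ _ _ _ _ _ (.inl ⟨rfl, rfl⟩) (.inr ⟨rfl, rfl⟩) (.inl ⟨rfl, rfl⟩),
    hfull _ _ _ _ _ _ (.inl ⟨rfl, rfl⟩) (.inr ⟨rfl, rfl⟩) (.inr ⟨rfl, rfl⟩),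
    hfull _ _ _ _ _ _ (.inr ⟨rfl, rfl⟩) (.inl ⟨rfl, rfl⟩) (.inl ⟨rfl, rfl⟩),
    hfull _ _ _ _ _ _ (.inr ⟨rfl, rfl⟩) (.inl ⟨rfl, rfl⟩) (.inr ⟨rfl, rfl⟩),
    hfull _ _ _ _ _ _ (.inr ⟨rfl, rfl⟩) (.inr ⟨rfl, rfl⟩) (.inl ⟨rfl, rfl⟩),
    hfull _ _ _ _ _ _ (.inr ⟨rfl, rfl⟩) (.inr ⟨rfl, rfl⟩) (.inr ⟨rfl, rfl⟩)] at eb eb' ec ea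
  -- Record the order of the ends on the three edges by signs, + for the natural order with `zb`
  -- before `zc`, and let g be the value minus the value with all three orders reversed. The
  -- relations read g(+-+) + g(++-) = 0, g(+++) = g(-++), g(+++) = g(+-+) and g(++-) = g(+++). Hence
  -- 2g(+++) = 0, and all g vanish.
  rcases hx with ⟨rfl, rfl⟩ | ⟨rfl, rfl⟩ <;> rcases hy with ⟨rfl, rfl⟩ | ⟨rfl, rfl⟩ <;>
    rcases hz with ⟨rfl, rfl⟩ | ⟨rfl, rfl⟩ <;> linarith

end Full

/-! ### The third Reidemeister move on a line -/

theorem lineSum_insert_three (φ : ArrowDiagram π → ℚ) (M : ℕ → π) (T : π) (s : ℕ → ℤˣ)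
    {a b c : ℕ × ℕ} {S : Finset (ℕ × ℕ)} (ha : a ∉ insert c (insert b S)) (hc : c ∉ insert b S)
    (hb : b ∉ S) :
    lineSum φ M T s (insert a (insert c (insert b S))) =
      ∑ R ∈ S.powerset, (∏ d ∈ R, ((s d.1 : ℤ) : ℚ)) *
        (lineVal φ M T R + (s a.1 : ℤ) * lineVal φ M T (insert a R)
          + (s c.1 : ℤ) * lineVal φ M T (insert c R) + (s b.1 : ℤ) * lineVal φ M T (insert b R)
          + (s a.1 : ℤ) * (s c.1 : ℤ) * lineVal φ M T (insert a (insert c R))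
          + (s a.1 : ℤ) * (s b.1 : ℤ) * lineVal φ M T (insert a (insert b R))
          + (s b.1 : ℤ) * (s c.1 : ℤ) * lineVal φ M T (insert c (insert b R))
          + (s a.1 : ℤ) * (s c.1 : ℤ) * (s b.1 : ℤ) *
            lineVal φ M T (insert a (insert c (insert b R)))) := by
  rw [lineSum, Finset.sum_powerset_insert ha, Finset.sum_powerset_insert hc,
    Finset.sum_powerset_insert hb, Finset.sum_powerset_insert hb,
    Finset.sum_powerset_insert hc, Finset.sum_powerset_insert hb, Finset.sum_powerset_insert hb]
  simp only [← Finset.sum_add_distrib]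
  refine Finset.sum_congr rfl fun R hR => ?_
  have hR := Finset.mem_powerset.1 hR
  have h1 : b ∉ R := fun h => hb (hR h)
  have h2 : c ∉ insert b R := fun h => hc (Finset.insert_subset_insert _ hR h)
  have h3 : a ∉ insert c (insert b R) := fun h =>
    ha (Finset.insert_subset_insert _ (Finset.insert_subset_insert _ hR) h)
  have h2' : c ∉ R := fun h => h2 (Finset.mem_insert_of_mem h)
  have h3' : a ∉ insert b R := fun h => h3 (Finset.mem_insert_of_mem h)
  have h3'' : a ∉ insert c R := fun h =>
    h3 (Finset.insert_subset_insert _ (Finset.subset_insert _ _) h)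
  have h3''' : a ∉ R := fun h => h3' (Finset.mem_insert_of_mem h)
  rw [Finset.prod_insert h3, Finset.prod_insert h2, Finset.prod_insert h1,
    Finset.prod_insert h2', Finset.prod_insert h3', Finset.prod_insert h3'',
    Finset.prod_insert h3''', Finset.prod_insert h1, Finset.prod_insert h2']
  ring

theorem lineVal_slide_both (φ : ArrowDiagram π → ℚ) {M : ℕ → π} (T : π) {S : Finset (ℕ × ℕ)}
    (hS : Good S) {p q p₁ p₂ q₁ q₂ : ℕ} (hp : p = p₁ ∨ p = p₂) (hq : q = q₁ ∨ q = q₂)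
    (hp' : p₁ < p₂) (hq' : q₁ < q₂) (Mp : M p₁ = M p₂) (Mq : M q₁ = M q₂)
    (sp : ∀ r ∈ pts S, r < p₁ ∨ p₂ < r) (sq : ∀ r ∈ pts S, r < q₁ ∨ q₂ < r)
    (hpq : p₂ < q₁ ∨ q₂ < p₁) :
    lineVal φ M T (insert (p, q) S) = lineVal φ M T (insert (p₁, q₁) S) := by
  have np : p₁ ∉ pts S := fun h => by have := sp _ h; omega
  have nq : q ∉ pts S := fun h => by have := sq _ h; omega
  trans lineVal φ M T (insert (p₁, q) S)
  · rcases hp with rfl | rfl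
    · rfl
    · exact lineVal_slide_tail' φ T hS nq (by omega) hp' Mp sp
  · rcases hq with rfl | rfl
    · rfl
    · exact lineVal_slide_head' φ T hS np (by omega) hq' Mq sq

section R3

variable {φ : ArrowDiagram π → ℚ} {M : ℕ → π} {S : Finset (ℕ × ℕ)}
  {x₁ x₂ y₁ y₂ z₁ z₂ xa xc ya yb zb zc : ℕ}

/-- The arrows of the left hand side of a third Reidemeister move. -/
def tri (S : Finset (ℕ × ℕ)) (xa xc ya yb zb zc : ℕ) : Finset (ℕ × ℕ) :=
  insert (xa, ya) (insert (xc, zc) (insert (yb, zb) S))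

theorem pts_tri (S : Finset (ℕ × ℕ)) (xa xc ya yb zb zc : ℕ) (p : ℕ) :
    p ∈ pts (tri S xa xc ya yb zb zc) ↔
      (p = xa ∨ p = xc ∨ p = ya ∨ p = yb ∨ p = zb ∨ p = zc) ∨ p ∈ pts S := by
  simp only [tri, pts_insert, Finset.mem_insert]; tauto

theorem Sites.good_tri (h : Sites M S x₁ x₂ y₁ y₂ z₁ z₂)
    (hx : (xa = x₁ ∧ xc = x₂) ∨ (xa = x₂ ∧ xc = x₁))
    (hy : (ya = y₁ ∧ yb = y₂) ∨ (ya = y₂ ∧ yb = y₁))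
    (hz : (zb = z₁ ∧ zc = z₂) ∨ (zb = z₂ ∧ zc = z₁)) : Good (tri S xa xc ya yb zb zc) := by
  obtain ⟨hg, lx, ly, lz, -, -, -, -, -, -, xy, yz, xz⟩ := id h
  refine good_insert (good_insert_two hg (h.notMem (by omega)) (h.notMem (by omega))
    (h.notMem (by omega)) (h.notMem (by omega)) ?_) (by simp only; omega) ?_ ?_
  · simp; omega
  · simp only [pts_insert, Finset.mem_insert, h.notMem (p := xa) (by omega), or_false]; omega
  · simp only [pts_insert, Finset.mem_insert, h.notMem (p := ya) (by omega), or_false]; omega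

theorem Sites.notMem_tri (h : Sites M S x₁ x₂ y₁ y₂ z₁ z₂)
    (hx : (xa = x₁ ∧ xc = x₂) ∨ (xa = x₂ ∧ xc = x₁))
    (hy : (ya = y₁ ∧ yb = y₂) ∨ (ya = y₂ ∧ yb = y₁)) :
    (xa, ya) ∉ insert (xc, zc) (insert (yb, zb) S) ∧ (xc, zc) ∉ insert (yb, zb) S ∧
      (yb, zb) ∉ S := by
  obtain ⟨hg, lx, ly, lz, -, -, -, -, -, -, xy, yz, xz⟩ := id h
  have h1 : ∀ q, (xa, q) ∉ S := fun q hq => h.notMem (p := xa) (by omega) (fst_mem_pts hq)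
  have h2 : ∀ q, (xc, q) ∉ S := fun q hq => h.notMem (p := xc) (by omega) (fst_mem_pts hq)
  have h3 : ∀ q, (yb, q) ∉ S := fun q hq => h.notMem (p := yb) (by omega) (fst_mem_pts hq)
  simp only [Finset.mem_insert, Prod.mk.injEq, h1, h2, h3, or_false, not_false_iff, and_true]
  omega

/-- Expand by how many of the three arrows a subset contains. With at most one of them, both sides
agree by sliding. With two of them, exactly one edge carries two ends, and the exchange there gives
one of the three differences. With all three the `full` terms arise. -/
theorem lineSum_tri_sub (h : Sites M S x₁ x₂ y₁ y₂ z₁ z₂) (T : π)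
    (hx : (xa = x₁ ∧ xc = x₂) ∨ (xa = x₂ ∧ xc = x₁))
    (hy : (ya = y₁ ∧ yb = y₂) ∨ (ya = y₂ ∧ yb = y₁))
    (hz : (zb = z₁ ∧ zc = z₂) ∨ (zb = z₂ ∧ zc = z₁)) (s s' : ℕ → ℤˣ)
    (hs : ∀ p ∈ pts S, s' p = s p) (sa : s' xc = s xa) (sc : s' xa = s xc) (sb : s' ya = s yb) :
    lineSum φ M T s (tri S xa xc ya yb zb zc) - lineSum φ M T s' (tri S xc xa yb ya zc zb) =
      ∑ R ∈ S.powerset, (∏ d ∈ R, ((s d.1 : ℤ) : ℚ)) *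
        ((s xa : ℤ) * (s xc : ℤ) * diffX φ M T R xa xc y₁ z₁
          + (s xa : ℤ) * (s yb : ℤ) * diffY φ M T R x₁ ya yb z₁
          + (s yb : ℤ) * (s xc : ℤ) * diffZ φ M T R x₁ y₁ zc zb
          + (s xa : ℤ) * (s xc : ℤ) * (s yb : ℤ) *
            (full φ M T R xa xc ya yb zb zc - full φ M T R xc xa yb ya zc zb)) := by
  obtain ⟨n1, n2, n3⟩ := h.notMem_tri (zc := zc) (zb := zb) hx hy
  have hx' : (xc = x₁ ∧ xa = x₂) ∨ (xc = x₂ ∧ xa = x₁) := by omega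
  have hy' : (yb = y₁ ∧ ya = y₂) ∨ (yb = y₂ ∧ ya = y₁) := by omega
  have hz' : (zc = z₁ ∧ zb = z₂) ∨ (zc = z₂ ∧ zb = z₁) := by omega
  obtain ⟨m1, m2, m3⟩ := h.notMem_tri (zc := zb) (zb := zc) hx' hy'
  rw [tri, tri, lineSum_insert_three φ M T s n1 n2 n3, lineSum_insert_three φ M T s' m1 m2 m3,
    ← Finset.sum_sub_distrib]
  refine Finset.sum_congr rfl fun R hR => ?_
  have hRS := Finset.mem_powerset.1 hR
  have hR := h.mono hRS
  obtain ⟨hg, lx, ly, lz, Mx, My, Mz, sx, sy, sz, xy, yz, xz⟩ := id hR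
  have hp : ∏ d ∈ R, ((s' d.1 : ℤ) : ℚ) = ∏ d ∈ R, ((s d.1 : ℤ) : ℚ) :=
    Finset.prod_congr rfl fun d hd => by rw [hs _ (fst_mem_pts (hRS hd))]
  have e1 : ∀ {x y}, (x = x₁ ∨ x = x₂) → (y = y₁ ∨ y = y₂) →
      lineVal φ M T (insert (x, y) R) = lineVal φ M T (insert (x₁, y₁) R) := fun hx hy =>
    lineVal_slide_both φ T hg hx hy lx ly Mx My sx sy xy
  have e2 : ∀ {x z}, (x = x₁ ∨ x = x₂) → (z = z₁ ∨ z = z₂) →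
      lineVal φ M T (insert (x, z) R) = lineVal φ M T (insert (x₁, z₁) R) := fun hx hz =>
    lineVal_slide_both φ T hg hx hz lx lz Mx Mz sx sz xz
  have e3 : ∀ {y z}, (y = y₁ ∨ y = y₂) → (z = z₁ ∨ z = z₂) →
      lineVal φ M T (insert (y, z) R) = lineVal φ M T (insert (y₁, z₁) R) := fun hy hz =>
    lineVal_slide_both φ T hg hy hz ly lz My Mz sy sz yz
  have a1 : xa = x₁ ∨ xa = x₂ := by omega
  have a2 : xc = x₁ ∨ xc = x₂ := by omega
  have a3 : ya = y₁ ∨ ya = y₂ := by omega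
  have a4 : yb = y₁ ∨ yb = y₂ := by omega
  have a5 : zb = z₁ ∨ zb = z₂ := by omega
  have a6 : zc = z₁ ∨ zc = z₂ := by omega
  rw [hp, ← mul_sub]
  congr 1
  have E1 := (e1 a1 a3).trans (e1 a2 a4).symm
  have E2 := (e2 a2 a6).trans (e2 a1 a5).symm
  have E3 := (e3 a4 a5).trans (e3 a3 a6).symm
  have X1 := hR.slideX φ T a3 a6 hx
  have X2 := hR.slideX φ T a4 a5 hx'
  have Y1 := hR.slideY φ T a1 a5 hy
  have Y2 := hR.slideY φ T a2 a6 hy'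
  have Z1 := hR.slideZ φ T a2 a4 hz'
  have Z2 := hR.slideZ φ T a1 a3 hz
  simp only [sa, sb, sc, full, diffX, diffY, diffZ]
  linear_combination (s xa : ℤ) * E1 + (s xc : ℤ) * E2 + (s yb : ℤ) * E3
    + (s xa : ℤ) * (s xc : ℤ) * (X1 - X2) + (s xa : ℤ) * (s yb : ℤ) * (Y1 - Y2)
    + (s yb : ℤ) * (s xc : ℤ) * (Z1 - Z2)

/-- The sign of the order of two points. -/
def ordSign (p q : ℕ) : ℤˣ := if p < q then 1 else -1

/-- The sign conditions `e1`, `e2` say that the three differences, written in the natural order of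
the ends, occur with one common sign, so that the quadratic part is a multiple of a six-term
relation. -/
theorem lineSum_r3 (h6 : SixTerm φ) (h2 : LineAP2 φ) (h : Sites M S x₁ x₂ y₁ y₂ z₁ z₂) (T : π)
    (hx : (xa = x₁ ∧ xc = x₂) ∨ (xa = x₂ ∧ xc = x₁))
    (hy : (ya = y₁ ∧ yb = y₂) ∨ (ya = y₂ ∧ yb = y₁))
    (hz : (zb = z₁ ∧ zc = z₂) ∨ (zb = z₂ ∧ zc = z₁)) (s s' : ℕ → ℤˣ)
    (hs : ∀ p ∈ pts S, s' p = s p) (sa : s' xc = s xa) (sc : s' xa = s xc) (sb : s' ya = s yb)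
    (e1 : s xa * s xc * ordSign xa xc = s xa * s yb * ordSign ya yb)
    (e2 : s xa * s yb * ordSign ya yb = s yb * s xc * ordSign zc zb) :
    lineSum φ M T s (tri S xa xc ya yb zb zc) = lineSum φ M T s' (tri S xc xa yb ya zc zb) := by
  rw [← sub_eq_zero, lineSum_tri_sub h T hx hy hz s s' hs sa sc sb]
  refine Finset.sum_eq_zero fun R hR => ?_
  have hR := h.mono (Finset.mem_powerset.1 hR)
  rw [full_eq h6 h2 T hR hx hy hz, sub_self, mul_zero, add_zero]
  have dx : diffX φ M T R xa xc y₁ z₁ = (ordSign xa xc : ℤ) * diffX φ M T R x₁ x₂ y₁ z₁ := by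
    have := h.x
    rcases hx with ⟨rfl, rfl⟩ | ⟨rfl, rfl⟩
    · simp [ordSign, this]
    · simp [ordSign, this.not_gt, diffX]
  have dy : diffY φ M T R x₁ ya yb z₁ = (ordSign ya yb : ℤ) * diffY φ M T R x₁ y₁ y₂ z₁ := by
    have := h.y
    rcases hy with ⟨rfl, rfl⟩ | ⟨rfl, rfl⟩
    · simp [ordSign, this]
    · simp [ordSign, this.not_gt, diffY]
  have dz : diffZ φ M T R x₁ y₁ zc zb = (ordSign zc zb : ℤ) * diffZ φ M T R x₁ y₁ z₁ z₂ := by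
    have := h.z
    rcases hz with ⟨rfl, rfl⟩ | ⟨rfl, rfl⟩
    · simp [ordSign, this.not_gt, diffZ]
    · simp [ordSign, this]
  have k1 := congrArg (fun u : ℤˣ => ((u : ℤ) : ℚ)) e1
  have k2 := congrArg (fun u : ℤˣ => ((u : ℤ) : ℚ)) e2
  push_cast at k1 k2
  rw [dx, dy, dz]
  have := h6 M T R x₁ x₂ y₁ y₂ z₁ z₂ hR
  linear_combination (∏ d ∈ R, ((s d.1 : ℤ) : ℚ)) *
    ((s xa : ℤ) * (s yb : ℤ) * (ordSign ya yb : ℤ) * this + diffX φ M T R x₁ x₂ y₁ z₁ * k1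
      - diffZ φ M T R x₁ y₁ z₁ z₂ * k2)

end R3

/-! ### The signs of the edges in a third Reidemeister move -/

theorem ordSign_swap {p q : ℕ} (h : p ≠ q) : ordSign q p = -ordSign p q := by
  unfold ordSign
  split_ifs <;> first | omega | simp

theorem ordSign_congr {p q p' q' : ℕ} (h : p < q ↔ p' < q') : ordSign p q = ordSign p' q' :=
  if_congr h rfl rfl

namespace Circ

variable {N : ℕ} {X : Circ π N}

theorem eta_eq (hX : X.IsArrow) {e a b : Fin N} (ha : X.inc e a) (hb : X.inc (finRotate N e) b)
    [Decidable (Crosses e a (finRotate N e) b)] :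
    X.eta e = if Crosses e a (finRotate N e) b then 1 else -1 := by
  classical
  refine if_congr ⟨?_, fun h => ⟨a, b, ha, hb, h⟩⟩ rfl rfl
  rintro ⟨a', b', ha', hb', h⟩
  rwa [(hX.2 _).unique ha ha', (hX.2 _).unique hb hb']

/-- Whether the arrows at two consecutive points cross depends on the cyclic order of the edge and
the two partners, and the product of the three order signs is the sign of this cyclic order. -/
theorem eta_ordSign (hX : X.IsArrow) {e a b : Fin N} (ha : X.inc e a)
    (hb : X.inc (finRotate N e) b) (he : (finRotate N e).val = e.val + 1)
    (hae : a ≠ finRotate N e) (hbe : b ≠ e) :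
    X.eta e = ordSign a b * ordSign e a * ordSign e b := by
  classical
  have h1 : a ≠ e := by
    rintro rfl; rcases ha with h | h <;> exact hX.1 _ _ h h
  have h2 : b ≠ finRotate N e := by
    rintro rfl; rcases hb with h | h <;> exact hX.1 _ _ h h
  have h3 : a ≠ b := by
    rintro rfl
    have := congrArg Fin.val ((hX.2 a).unique ha.symm hb.symm)
    omega
  rw [eta_eq hX ha hb]
  rw [Ne, Fin.ext_iff] at *
  have hc : Crosses e a (finRotate N e) b ↔ (e.val < a.val ∧ e.val < b.val ∧ a.val < b.val) ∨
      (a.val < e.val ∧ b.val < e.val ∧ a.val < b.val) ∨ (b.val < e.val ∧ e.val < a.val) := by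
    rcases lt_or_gt_of_ne h1 with h | h
    · have h' : a ≤ e := h.le
      rw [Crosses, min_eq_right h', max_eq_left h']
      simp only [Xor, Fin.lt_def]
      omega
    · have h' : e ≤ a := h.le
      rw [Crosses, min_eq_left h', max_eq_right h']
      simp only [Xor, Fin.lt_def]
      omega
  simp only [hc, ordSign]
  split_ifs <;> first | omega | simp

theorem IsArrow.isHead (hX : X.IsArrow) {a b : Fin N} (h : X.arr a b) : X.IsHead b ∧ ¬ X.IsHead a := by
  refine ⟨⟨a, h⟩, fun ⟨c, hc⟩ => ?_⟩
  obtain rfl := (hX.2 a).unique (.inl h) (.inr hc)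
  exact hX.1 _ _ h hc

/-- Three disjoint edges `i`, `j`, `k` that are joined by arrows `xa → ya`, `xc → zc` and
`yb → zb`. -/
structure Triangle (X : Circ π N) (i j k xa xc ya yb zb zc : Fin N) : Prop where
  isArrow : X.IsArrow
  a : X.arr xa ya
  c : X.arr xc zc
  b : X.arr yb zb
  x : (xa = i ∧ xc = finRotate N i) ∨ (xa = finRotate N i ∧ xc = i)
  y : (ya = j ∧ yb = finRotate N j) ∨ (ya = finRotate N j ∧ yb = j)
  z : (zb = k ∧ zc = finRotate N k) ∨ (zb = finRotate N k ∧ zc = k)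
  nodup : [i, finRotate N i, j, finRotate N j, k, finRotate N k].Nodup

variable {i j k xa xc ya yb zb zc : Fin N}

theorem Triangle.up (h : X.Triangle i j k xa xc ya yb zb zc) :
    X.up i = 0 ∧ X.up j = 1 ∧ X.up k = 2 := by
  obtain ⟨hX, ha, hc, hb, hx, hy, hz, -⟩ := h
  obtain ⟨a1, a2⟩ := hX.isHead ha
  obtain ⟨c1, c2⟩ := hX.isHead hc
  obtain ⟨b1, b2⟩ := hX.isHead hb
  refine ⟨?_, ?_, ?_⟩
  · rcases hx with ⟨rfl, rfl⟩ | ⟨rfl, rfl⟩ <;> simp only [Circ.up, if_false, *]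
  · rcases hy with ⟨rfl, rfl⟩ | ⟨rfl, rfl⟩ <;> simp only [Circ.up, if_true, if_false, *]
  · rcases hz with ⟨rfl, rfl⟩ | ⟨rfl, rfl⟩ <;> simp only [Circ.up, if_true, *]

theorem eta_triangle (hX : X.IsArrow) {e p q a b j k : Fin N}
    (hpq : (p = e ∧ q = finRotate N e) ∨ (p = finRotate N e ∧ q = e)) (ha : X.inc p a)
    (hb : X.inc q b) (haj : a = j ∨ a = finRotate N j) (hbk : b = k ∨ b = finRotate N k)
    (he : (finRotate N e).val = e.val + 1) (hj : (finRotate N j).val = j.val + 1)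
    (hk : (finRotate N k).val = k.val + 1)
    (hn : [e, finRotate N e, j, finRotate N j, k, finRotate N k].Nodup) :
    X.eta e = ordSign p q * (ordSign j k * ordSign e j * ordSign e k) := by
  simp only [List.nodup_cons, List.mem_cons, List.not_mem_nil, or_false, not_or, Fin.ext_iff,
    he, hj, hk] at hn
  rw [Fin.ext_iff, Fin.ext_iff, hj] at haj
  rw [Fin.ext_iff, Fin.ext_iff, hk] at hbk
  have e1 : ordSign a b = ordSign j k := ordSign_congr (by omega)
  have e2 : ordSign b a = -ordSign j k := by rw [← e1]; exact ordSign_swap (by omega)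
  have e3 : ordSign e a = ordSign e j := ordSign_congr (by omega)
  have e4 : ordSign e b = ordSign e k := ordSign_congr (by omega)
  have o : ordSign e (finRotate N e) = 1 := if_pos (by omega)
  have o' : ordSign (finRotate N e) e = -1 := if_neg (by omega)
  have n1 : a ≠ finRotate N e := by rw [Ne, Fin.ext_iff]; omega
  have n2 : b ≠ finRotate N e := by rw [Ne, Fin.ext_iff]; omega
  have n3 : a ≠ e := by rw [Ne, Fin.ext_iff]; omega
  have n4 : b ≠ e := by rw [Ne, Fin.ext_iff]; omega
  rcases hpq with ⟨rfl, rfl⟩ | ⟨rfl, rfl⟩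
  · rw [eta_ordSign hX ha hb he n1 n4, e1, e3, e4, o, one_mul]
  · rw [eta_ordSign hX hb ha he n2 n3, e2, e3, e4, o', neg_mul, neg_mul, neg_one_mul,
      mul_right_comm]

/-- The last factor is the cyclic orientation of the three edges. At `j` it appears with the
opposite sign, compensated by `(-1)^↑` with ↑ = 1. Being common to all three edges it drops out of
the R₃ condition, which becomes a condition on signs and local orders. -/
theorem Triangle.eps (h : X.Triangle i j k xa xc ya yb zb zc)
    (hi : (finRotate N i).val = i.val + 1) (hj : (finRotate N j).val = j.val + 1)
    (hk : (finRotate N k).val = k.val + 1) :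
    X.eps i = ordSign xa xc * (ordSign i j * ordSign j k * ordSign i k) ∧
    X.eps j = ordSign ya yb * (ordSign i j * ordSign j k * ordSign i k) ∧
    X.eps k = ordSign zc zb * (ordSign i j * ordSign j k * ordSign i k) := by
  obtain ⟨ui, uj, uk⟩ := h.up
  obtain ⟨hX, ha, hc, hb, hx, hy, hz, hn⟩ := h
  have hn' : [j, finRotate N j, i, finRotate N i, k, finRotate N k].Nodup :=
    (List.perm_append_comm_assoc [i, finRotate N i] [j, finRotate N j] _).nodup_iff.1 hn
  have hn'' : [k, finRotate N k, i, finRotate N i, j, finRotate N j].Nodup :=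
    (List.perm_append_comm (l₁ := [i, finRotate N i, j, finRotate N j])).nodup_iff.1 hn
  have ne : ∀ {p q : Fin N}, p ≠ q → ordSign q p = -ordSign p q := fun h =>
    ordSign_swap (Fin.val_injective.ne h)
  have hd := hn
  simp only [List.nodup_cons, List.mem_cons, List.not_mem_nil, or_false, not_or] at hd
  have ij := ne hd.1.2.1
  have jk := ne hd.2.2.1.2.1
  have ik := ne hd.1.2.2.2.1
  simp only [Circ.eps, ui, uj, uk]
  refine ⟨?_, ?_, ?_⟩
  · rw [eta_triangle hX hx (.inl ha) (.inl hc) (hy.imp And.left And.left)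
      (hz.imp And.right And.right).symm hi hj hk hn]
    simp only [pow_zero, mul_one, mul_comm, mul_left_comm]
  · rw [eta_triangle hX hy (.inr ha) (.inl hb) (hx.imp And.left And.left)
      (hz.imp And.left And.left) hj hi hk hn', ij]
    simp only [pow_one, mul_neg, neg_mul, mul_one, neg_neg, mul_comm, mul_left_comm]
  · rw [eta_triangle hX (hz.symm.imp And.symm And.symm) (.inr hc) (.inr hb)
      (hx.imp And.right And.right).symm (hy.imp And.right And.right).symm hk hi hj hn'', ik, jk]
    simp only [even_two.neg_pow, one_pow, mul_neg, neg_mul, mul_one, neg_neg, mul_comm,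
      mul_left_comm]

end Circ

/-! ### The third Reidemeister move -/

/-- `τ` exchanges three pairs of points. -/
structure Exch {ι : Type*} (τ : ι → ι) (xa xc ya yb zb zc : ι) : Prop where
  map_xa : τ xa = xc
  map_xc : τ xc = xa
  map_ya : τ ya = yb
  map_yb : τ yb = ya
  map_zb : τ zb = zc
  map_zc : τ zc = zb
  other : ∀ p, p ≠ xa → p ≠ xc → p ≠ ya → p ≠ yb → p ≠ zb → p ≠ zc → τ p = p

namespace Exch

variable {ι : Type*} {τ : ι → ι} {xa xc ya yb zb zc : ι}

theorem involutive (h : Exch τ xa xc ya yb zb zc) : Function.Involutive τ := by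
  intro p
  by_cases h1 : p = xa
  · rw [h1, h.map_xa, h.map_xc]
  by_cases h2 : p = xc
  · rw [h2, h.map_xc, h.map_xa]
  by_cases h3 : p = ya
  · rw [h3, h.map_ya, h.map_yb]
  by_cases h4 : p = yb
  · rw [h4, h.map_yb, h.map_ya]
  by_cases h5 : p = zb
  · rw [h5, h.map_zb, h.map_zc]
  by_cases h6 : p = zc
  · rw [h6, h.map_zc, h.map_zb]
  rw [h.other p h1 h2 h3 h4 h5 h6, h.other p h1 h2 h3 h4 h5 h6]

theorem eq_or_notMem (h : Exch τ xa xc ya yb zb zc) {P : Set ι} (hxa : xa ∉ P) (hxc : xc ∉ P)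
    (hya : ya ∉ P) (hyb : yb ∉ P) (hzb : zb ∉ P) (hzc : zc ∉ P) (p : ι) :
    τ p = p ∨ (p ∉ P ∧ τ p ∉ P) := by
  by_cases h1 : p = xa
  · rw [h1, h.map_xa]; exact .inr ⟨hxa, hxc⟩
  by_cases h2 : p = xc
  · rw [h2, h.map_xc]; exact .inr ⟨hxc, hxa⟩
  by_cases h3 : p = ya
  · rw [h3, h.map_ya]; exact .inr ⟨hya, hyb⟩
  by_cases h4 : p = yb
  · rw [h4, h.map_yb]; exact .inr ⟨hyb, hya⟩
  by_cases h5 : p = zb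
  · rw [h5, h.map_zb]; exact .inr ⟨hzb, hzc⟩
  by_cases h6 : p = zc
  · rw [h6, h.map_zc]; exact .inr ⟨hzc, hzb⟩
  exact .inl (h.other p h1 h2 h3 h4 h5 h6)

theorem mem_tri (h : Exch τ xa xc ya yb zb zc) {e : ι → ℕ} (he : Function.Injective e)
    {S : Finset (ℕ × ℕ)} (hS : ∀ p, p = xa ∨ p = xc ∨ p = ya ∨ p = yb ∨ p = zb ∨ p = zc →
      e p ∉ pts S) (p q : ι) :
    (e (τ p), e (τ q)) ∈ tri S (e xa) (e xc) (e ya) (e yb) (e zb) (e zc) ↔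
      (e p, e q) ∈ tri S (e xc) (e xa) (e yb) (e ya) (e zc) (e zb) := by
  have key : ∀ p a b, τ b = a → (τ p = a ↔ p = b) := by
    rintro p a b rfl
    exact h.involutive.injective.eq_iff
  have hfix : ∀ p, τ p = p ∨ (e p ∉ pts S ∧ e (τ p) ∉ pts S) :=
    h.eq_or_notMem (P := {p | e p ∈ pts S}) (hS _ (by simp)) (hS _ (by simp)) (hS _ (by simp))
      (hS _ (by simp)) (hS _ (by simp)) (hS _ (by simp))
  have hS' : (e (τ p), e (τ q)) ∈ S ↔ (e p, e q) ∈ S := by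
    rcases hfix p with h1 | ⟨h1, h1'⟩
    · rcases hfix q with h2 | ⟨h2, h2'⟩
      · rw [h1, h2]
      · exact iff_of_false (fun h => h2' (snd_mem_pts h)) fun h => h2 (snd_mem_pts h)
    · exact iff_of_false (fun h => h1' (fst_mem_pts h)) fun h => h1 (fst_mem_pts h)
  simp only [tri, Finset.mem_insert, Prod.mk.injEq, he.eq_iff, hS', key p _ _ h.map_xc, key q _ _ h.map_yb,
    key p _ _ h.map_xa, key q _ _ h.map_zb, key p _ _ h.map_ya, key q _ _ h.map_zc]

end Exch

/-- `τ` exchanges the ends of three edges. -/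
structure Flips {N : ℕ} (τ : Fin N → Fin N) (i j k : Fin N) : Prop where
  map_i : τ i = finRotate N i
  map_i' : τ (finRotate N i) = i
  map_j : τ j = finRotate N j
  map_j' : τ (finRotate N j) = j
  map_k : τ k = finRotate N k
  map_k' : τ (finRotate N k) = k
  other : ∀ p, p ≠ i → p ≠ finRotate N i → p ≠ j → p ≠ finRotate N j → p ≠ k → p ≠ finRotate N k →
    τ p = p

theorem flips_flip {N : ℕ} {i j k : Fin N}
    (hn : [i, finRotate N i, j, finRotate N j, k, finRotate N k].Nodup) :
    Flips (GaussRigid.flip i * GaussRigid.flip j * GaussRigid.flip k) i j k := by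
  simp only [List.nodup_cons, List.mem_cons, List.not_mem_nil, or_false, not_or] at hn
  obtain ⟨⟨h1, h2, h3, h4, h5⟩, ⟨h6, h7, h8, h9⟩, ⟨h10, h11, h12⟩, ⟨h13, h14⟩, h15, -⟩ := hn
  have ne : ∀ {a b c : Fin N}, c ≠ a → c ≠ b → Equiv.swap a b c = c :=
    Equiv.swap_apply_of_ne_of_ne
  simp only [GaussRigid.flip]
  constructor
  · simp only [Equiv.Perm.mul_apply]
    rw [ne h4 h5, ne h2 h3, Equiv.swap_apply_left]
  · simp only [Equiv.Perm.mul_apply]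
    rw [ne h8 h9, ne h6 h7, Equiv.swap_apply_right]
  · simp only [Equiv.Perm.mul_apply]
    rw [ne h11 h12, Equiv.swap_apply_left, ne (Ne.symm h3) (Ne.symm h7)]
  · simp only [Equiv.Perm.mul_apply]
    rw [ne h13 h14, Equiv.swap_apply_right, ne (Ne.symm h2) (Ne.symm h6)]
  · simp only [Equiv.Perm.mul_apply]
    rw [Equiv.swap_apply_left, ne (Ne.symm h12) (Ne.symm h14), ne (Ne.symm h5) (Ne.symm h9)]
  · simp only [Equiv.Perm.mul_apply]
    rw [Equiv.swap_apply_right, ne (Ne.symm h11) (Ne.symm h13), ne (Ne.symm h4) (Ne.symm h8)]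
  · intro p p1 p2 p3 p4 p5 p6
    simp only [Equiv.Perm.mul_apply]
    rw [ne p5 p6, ne p3 p4, ne p1 p2]

theorem Flips.exch {N : ℕ} {τ : Fin N → Fin N} {i j k xa xc ya yb zb zc : Fin N}
    (h : Flips τ i j k)
    (x : (xa = i ∧ xc = finRotate N i) ∨ (xa = finRotate N i ∧ xc = i))
    (y : (ya = j ∧ yb = finRotate N j) ∨ (ya = finRotate N j ∧ yb = j))
    (z : (zb = k ∧ zc = finRotate N k) ∨ (zb = finRotate N k ∧ zc = k)) :
    Exch τ xa xc ya yb zb zc := by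
  have hx : τ xa = xc ∧ τ xc = xa := by
    rcases x with ⟨rfl, rfl⟩ | ⟨rfl, rfl⟩
    exacts [⟨h.map_i, h.map_i'⟩, ⟨h.map_i', h.map_i⟩]
  have hy : τ ya = yb ∧ τ yb = ya := by
    rcases y with ⟨rfl, rfl⟩ | ⟨rfl, rfl⟩
    exacts [⟨h.map_j, h.map_j'⟩, ⟨h.map_j', h.map_j⟩]
  have hz : τ zb = zc ∧ τ zc = zb := by
    rcases z with ⟨rfl, rfl⟩ | ⟨rfl, rfl⟩
    exacts [⟨h.map_k, h.map_k'⟩, ⟨h.map_k', h.map_k⟩]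
  refine ⟨hx.1, hx.2, hy.1, hy.2, hz.1, hz.2, fun p h1 h2 h3 h4 h5 h6 => ?_⟩
  have := h.other p
  rcases x with ⟨rfl, rfl⟩ | ⟨rfl, rfl⟩ <;> rcases y with ⟨rfl, rfl⟩ | ⟨rfl, rfl⟩ <;>
    rcases z with ⟨rfl, rfl⟩ | ⟨rfl, rfl⟩ <;> apply this <;> assumption

theorem eq_and_eq_or {ι : Type*} {a b p q : ι} (hp : p = a ∨ p = b) (hq : q = a ∨ q = b)
    (h : p ≠ q) : (p = a ∧ q = b) ∨ (p = b ∧ q = a) := by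
  rcases hp with rfl | rfl <;> rcases hq with rfl | rfl
  exacts [absurd rfl h, .inl ⟨rfl, rfl⟩, .inr ⟨rfl, rfl⟩, absurd rfl h]

/-- With no head on `i` and only heads on `k`, the links determine the directions: both arrows at
`i` leave it and both arrows at `k` arrive there. The three arrows are then distinct at each edge.
-/
theorem Circ.exists_triangle {N : ℕ} {G : GaussRigid π N} {i j k : Fin N}
    (hn : [i, finRotate N i, j, finRotate N j, k, finRotate N k].Nodup)
    (hij : G.Linked i j) (hjk : G.Linked j k) (hik : G.Linked i k)
    (ui : G.circ.up i = 0) (uk : G.circ.up k = 2) :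
    ∃ xa xc ya yb zb zc, G.circ.Triangle i j k xa xc ya yb zb zc := by
  have hi : ¬ G.circ.IsHead i ∧ ¬ G.circ.IsHead (finRotate N i) := by
    unfold Circ.up at ui
    split_ifs at ui <;> simp_all
  have hk : G.circ.IsHead k ∧ G.circ.IsHead (finRotate N k) := by
    unfold Circ.up at uk
    split_ifs at uk <;> simp_all
  have hd := hn
  simp only [List.nodup_cons, List.mem_cons, List.not_mem_nil, or_false, not_or] at hd
  have hX := G.isArrow
  obtain ⟨xa, ya, hxa, hya, ha⟩ := hij
  obtain ⟨xc, zc, hxc, hzc, hc⟩ := hik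
  obtain ⟨yb, zb, hyb, hzb, hb⟩ := hjk
  have ha : G.circ.arr xa ya := by
    refine ha.resolve_right fun h => ?_
    have := (hX.isHead h).1
    rcases hxa with rfl | rfl
    exacts [hi.1 this, hi.2 this]
  have hc : G.circ.arr xc zc := by
    refine hc.resolve_right fun h => ?_
    have := (hX.isHead h).1
    rcases hxc with rfl | rfl
    exacts [hi.1 this, hi.2 this]
  have hb : G.circ.arr yb zb := by
    refine hb.resolve_right fun h => ?_
    have := (hX.isHead h).2
    rcases hzb with rfl | rfl
    exacts [this hk.1, this hk.2]
  have nyz : ∀ {p q : Fin N}, (p = j ∨ p = finRotate N j) → (q = k ∨ q = finRotate N k) → p ≠ q := by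
    rintro p q (rfl | rfl) (rfl | rfl)
    exacts [hd.2.2.1.2.1, hd.2.2.1.2.2, hd.2.2.2.1.1, hd.2.2.2.1.2]
  have nxy : ∀ {p q : Fin N}, (p = i ∨ p = finRotate N i) → (q = j ∨ q = finRotate N j) → p ≠ q := by
    rintro p q (rfl | rfl) (rfl | rfl)
    exacts [hd.1.2.1, hd.1.2.2.1, hd.2.1.1, hd.2.1.2.1]
  have dx : xa ≠ xc := by
    rintro rfl
    exact nyz hya hzc ((hX.2 xa).unique (.inl ha) (.inl hc))
  have dy : ya ≠ yb := by
    rintro rfl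
    exact (hX.isHead hb).2 (hX.isHead ha).1
  have dz : zb ≠ zc := by
    rintro rfl
    exact nxy hxc hyb ((hX.2 zb).unique (.inr hc) (.inr hb))
  exact ⟨xa, xc, ya, yb, zb, zc, hX, ha, hc, hb, eq_and_eq_or hxa hxc dx, eq_and_eq_or hya hyb dy,
    eq_and_eq_or hzb hzc dz, hn⟩

theorem Adj.eq {M : ℕ → π} {T : π} {P : Finset ℕ} {p q : ℕ} (h : Adj M T P p q) (hpq : p < q) :
    M p = M q := by
  rcases h with h | h
  · exact h.2.2
  · exact absurd h.1 (not_le.2 hpq)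

theorem edgeSign_eq {N : ℕ} {G : GaussRigid π N} {e p q : Fin N}
    (h : (p = e ∧ q = finRotate N e) ∨ (p = finRotate N e ∧ q = e)) :
    G.edgeSign e = G.sign p * G.sign q * G.circ.eps e := by
  rcases h with ⟨rfl, rfl⟩ | ⟨rfl, rfl⟩
  · rfl
  · rw [mul_comm (G.sign _)]; rfl

theorem lt_or_lt_of_pair {p q i r : ℕ} (h : (p = i ∧ q = i + 1) ∨ (p = i + 1 ∧ q = i))
    (hp : r ≠ p) (hq : r ≠ q) : r < i ∨ i + 1 < r := by omega

theorem lt_or_lt_of_ne {i j : ℕ} (h₁ : i ≠ j) (h₂ : i ≠ j + 1) (h₃ : i + 1 ≠ j) :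
    i + 1 < j ∨ j + 1 < i := by omega

/-- The case in which no edge of the move passes the cut, so that each edge is a pair of consecutive
numbers and `lineSum_r3` applies. -/
theorem subSum_triangle {φ : ArrowDiagram π → ℚ} (h6 : SixTerm φ) (h2 : LineAP2 φ) {N : ℕ}
    {G G' : GaussRigid π N} {i j k xa xc ya yb zb zc : Fin N} {τ : Fin N → Fin N}
    (ht : G.circ.Triangle i j k xa xc ya yb zb zc)
    (vi : (finRotate N i).val = i.val + 1) (vj : (finRotate N j).val = j.val + 1)
    (vk : (finRotate N k).val = k.val + 1)
    (mi : G.circ.mark i = 1) (mj : G.circ.mark j = 1) (mk : G.circ.mark k = 1)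
    (s1 : G.edgeSign i = G.edgeSign j) (s2 : G.edgeSign j = G.edgeSign k)
    (hm : G'.circ.mark = G.circ.mark) (hτ : Exch τ xa xc ya yb zb zc)
    (harr : ∀ a b, G'.circ.arr a b ↔ G.circ.arr (τ a) (τ b)) (hsg : ∀ a, G'.sign a = G.sign (τ a)) :
    subSum φ G = subSum φ G' := by
  obtain ⟨e1, e2, e3⟩ := ht.eps vi vj vk
  -- The cyclic orientation cancels, and since an arrow has the same sign at both ends, the
  -- hypotheses become exactly those of `lineSum_r3`.
  generalize ordSign i j * ordSign j k * ordSign i k = σ at e1 e2 e3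
  rw [edgeSign_eq ht.x, edgeSign_eq ht.y, e1, e2, ← mul_assoc, ← mul_assoc, mul_left_inj,
    ← G.sign_eq _ _ ht.a] at s1
  rw [edgeSign_eq ht.y, edgeSign_eq ht.z, e2, e3, ← mul_assoc, ← mul_assoc, mul_left_inj,
    ← G.sign_eq _ _ ht.a, ← G.sign_eq _ _ ht.b, ← G.sign_eq _ _ ht.c] at s2
  obtain ⟨M, T, S, s, hs, he, hS, rfl⟩ := exists_lineGauss G
  obtain ⟨-, ha, hc, hb, hx, hy, hz, hn⟩ := ht
  clear e1 e2 e3 σ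
  simp only [List.nodup_cons, List.mem_cons, List.not_mem_nil, or_false, not_or, Fin.ext_iff,
    vi, vj, vk] at hn
  have Mx := (adj_of_mark he mi).eq (by omega)
  have My := (adj_of_mark he mj).eq (by omega)
  have Mz := (adj_of_mark he mk).eq (by omega)
  rw [vi] at Mx
  rw [vj] at My
  rw [vk] at Mz
  change (xa.val, ya.val) ∈ S at ha
  change (xc.val, zc.val) ∈ S at hc
  change (yb.val, zb.val) ∈ S at hb
  rw [Fin.ext_iff, Fin.ext_iff, Fin.ext_iff, Fin.ext_iff, vi] at hx
  rw [Fin.ext_iff, Fin.ext_iff, Fin.ext_iff, Fin.ext_iff, vj] at hy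
  rw [Fin.ext_iff, Fin.ext_iff, Fin.ext_iff, Fin.ext_iff, vk] at hz
  have xy := lt_or_lt_of_ne hn.1.2.1 hn.1.2.2.1 hn.2.1.1
  have yz := lt_or_lt_of_ne hn.2.2.1.2.1 hn.2.2.1.2.2 hn.2.2.2.1.1
  have xz := lt_or_lt_of_ne hn.1.2.2.2.1 hn.1.2.2.2.2 hn.2.1.2.2.1
  have dx : xa.val ≠ xc.val := by clear hn; omega
  have dy : ya.val ≠ yb.val := by clear hn; omega
  have dxy : xa.val ≠ yb.val ∧ xc.val ≠ yb.val := by clear hn; omega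
  clear hn
  have hc1 : (xc.val, zc.val) ∈ S.erase (xa.val, ya.val) :=
    Finset.mem_erase.2 ⟨fun h => dx (congrArg Prod.fst h).symm, hc⟩
  have hb1 : (yb.val, zb.val) ∈ S.erase (xa.val, ya.val) :=
    Finset.mem_erase.2 ⟨fun h => dxy.1 (congrArg Prod.fst h).symm, hb⟩
  have hb2 : (yb.val, zb.val) ∈ (S.erase (xa.val, ya.val)).erase (xc.val, zc.val) :=
    Finset.mem_erase.2 ⟨fun h => dxy.2 (congrArg Prod.fst h).symm, hb1⟩
  set S₀ := ((S.erase (xa.val, ya.val)).erase (xc.val, zc.val)).erase (yb.val, zb.val) with hS₀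
  have hSeq : tri S₀ xa xc ya yb zb zc = S := by
    rw [tri, hS₀, Finset.insert_erase hb2, Finset.insert_erase hc1, Finset.insert_erase ha]
  have hg1 := hS.mono (Finset.erase_subset (xa.val, ya.val) S)
  have hg2 := hg1.mono (Finset.erase_subset (xc.val, zc.val) _)
  have hpt : ∀ p, p ∈ pts S₀ → (p ≠ xa ∧ p ≠ ya) ∧ (p ≠ xc ∧ p ≠ zc) ∧ (p ≠ yb ∧ p ≠ zb) := by
    intro p hp
    have := (mem_pts_erase hg2 hb2).1 hp
    have h1 := (mem_pts_erase hg1 hc1).1 this.1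
    have h2 := (mem_pts_erase hS ha).1 h1.1
    exact ⟨h2.2, h1.2, this.2⟩
  have hsites : Sites M S₀ i (i + 1) j (j + 1) k (k + 1) :=
    ⟨hg2.mono (Finset.erase_subset _ _), i.val.lt_succ_self, j.val.lt_succ_self,
      k.val.lt_succ_self, Mx, My, Mz,
      fun r hr => lt_or_lt_of_pair hx (hpt r hr).1.1 (hpt r hr).2.1.1,
      fun r hr => lt_or_lt_of_pair hy (hpt r hr).1.2 (hpt r hr).2.2.1,
      fun r hr => lt_or_lt_of_pair hz (hpt r hr).2.2.2 (hpt r hr).2.1.2, xy, yz, xz⟩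
  have hvinj : Function.Injective (Fin.val : Fin N → ℕ) := Fin.val_injective
  have hmem := hτ.mem_tri hvinj (S := S₀) (by
    rintro p hp hp'
    have := hpt _ hp'
    rcases hp with rfl | rfl | rfl | rfl | rfl | rfl
    exacts [this.1.1 rfl, this.2.1.1 rfl, this.1.2 rfl, this.2.2.1 rfl, this.2.2.2 rfl,
      this.2.1.2 rfl])
  rw [hSeq] at hmem
  set S' := tri S₀ xc xa yb ya zc zb with hS'
  have hx' := hx.symm.imp And.symm And.symm
  have hy' := hy.symm.imp And.symm And.symm
  have hz' := hz.symm.imp And.symm And.symm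
  have hg' : Good S' := hsites.good_tri hx' hy' hz'
  have hp' : pts S' = pts S := by
    ext p
    rw [← hSeq, pts_tri, pts_tri]
    refine or_congr_left ?_
    clear hx hy hz hx' hy' hz' xy yz xz dx dy dxy
    tauto
  have he' : Enum (Fin.val : Fin N → ℕ) (pts S') := hp' ▸ he
  set s' : ℕ → ℤˣ := fun q => if h : q < N then G'.sign ⟨q, h⟩ else 1 with hs'
  have hs'v : ∀ p : Fin N, s' p = s (τ p) := fun p => by simp [hs', hsg]; rfl
  have hs'' : ∀ a ∈ S', s' a.1 = s' a.2 := by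
    intro a haS
    obtain ⟨p, hp⟩ := (he'.mem _).1 (fst_mem_pts haS)
    obtain ⟨q, hq⟩ := (he'.mem _).1 (snd_mem_pts haS)
    rw [← hp, ← hq, hs'v, hs'v]
    exact hs _ ((hmem p q).2 (by rw [hp, hq]; exact haS))
  have hG' : G' = lineGauss he' hg' M T hs'' := by
    ext1
    · ext p q
      · exact (harr p q).trans (hmem p q)
      · rw [hm]; rfl
      · exact absurd (by assumption) (Fin.pos i).ne'
    · exact funext fun p => by
        rw [hsg]; exact (hs'v p).symm
  rw [hG', subSum_lineGauss, subSum_lineGauss, ← hSeq]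
  refine lineSum_r3 h6 h2 hsites T hx hy hz s s' (fun p hp => ?_) ?_ ?_ ?_ s1 s2
  · have hpS : p ∈ pts S := pts_mono (by rw [← hSeq]; intro a ha; simp [tri, ha]) hp
    obtain ⟨p, rfl⟩ := (he.mem _).1 hpS
    have := hpt _ hp
    rw [hs'v, hτ.other p]
    all_goals rw [Ne, Fin.ext_iff]
    exacts [this.1.1, this.2.1.1, this.1.2, this.2.2.1, this.2.2.2, this.2.1.2]
  · rw [hs'v, hτ.map_xc]
  · rw [hs'v, hτ.map_xa]
  · rw [hs'v, hτ.map_ya]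

/-! ### Moving the edges of a third Reidemeister move away from the cut -/

/-- The rotation by one point. -/
def rotOne (N : ℕ) : Rot N := ⟨finRotate N, Subgroup.mem_zpowers _⟩

theorem finRotate_inv_apply {N : ℕ} (a : Fin N) : (finRotate N)⁻¹ (finRotate N a) = a :=
  Equiv.symm_apply_apply _ _

namespace Circ

variable {N : ℕ}

/-- A point lies between `a` and `b` if and only if it is below exactly one of them. Crossing is
then expressed through comparisons alone, whose behaviour under rotation is known from `lt_rotate`.
-/
theorem crosses_iff {a b c d : Fin N} (hac : a ≠ c) (had : a ≠ d) (hbc : b ≠ c) (hbd : b ≠ d) :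
    Crosses a b c d ↔ ((a.val < c.val ↔ b.val < c.val) ↔ ¬(a.val < d.val ↔ b.val < d.val)) := by
  have key : ∀ {a b c : Fin N}, a ≠ c → b ≠ c →
      ((min a b < c ∧ c < max a b) ↔ ¬ (a.val < c.val ↔ b.val < c.val)) := by
    intro a b c hac hbc
    rw [Ne, Fin.ext_iff] at hac hbc
    rw [min_lt_iff, lt_max_iff, Fin.lt_def, Fin.lt_def, Fin.lt_def, Fin.lt_def]
    omega
  rw [Crosses, key hac hbc, key had hbd, Xor]
  tauto

theorem lt_rotate (a b : Fin N) : (finRotate N a).val < (finRotate N b).val ↔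
    b.val + 1 ≠ N ∧ (a.val + 1 = N ∨ a.val < b.val) := by
  rw [val_finRotate, val_finRotate]
  have := a.2
  have := b.2
  split_ifs <;> omega

theorem crosses_rotate {a b c d : Fin N} (hab : a ≠ b) (hac : a ≠ c) (had : a ≠ d) (hbc : b ≠ c)
    (hbd : b ≠ d) (hcd : c ≠ d) :
    Crosses (finRotate N a) (finRotate N b) (finRotate N c) (finRotate N d) ↔ Crosses a b c d := by
  have hi := (finRotate N).injective
  rw [crosses_iff hac had hbc hbd, crosses_iff (hi.ne hac) (hi.ne had) (hi.ne hbc) (hi.ne hbd),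
    lt_rotate, lt_rotate, lt_rotate, lt_rotate]
  have lt : ∀ {p q : Fin N}, p ≠ q → p.val + 1 = N → ¬ p.val < q.val ∧ q.val + 1 ≠ N := by
    intro p q hpq hp
    rw [Ne, Fin.ext_iff] at hpq
    have := q.2
    omega
  by_cases ha : a.val + 1 = N
  · simp [lt hac ha, lt had ha, lt hab ha, ha]
    rcases lt_or_ge b c with h | h <;> rcases lt_or_ge b d with h' | h' <;>
      simp [h, h', not_le.2, not_lt.2]
  by_cases hb : b.val + 1 = N
  · simp [lt hbc hb, lt hbd hb, ha, hb]
    rcases lt_or_ge a c with h | h <;> rcases lt_or_ge a d with h' | h' <;>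
      simp [h, h', not_le.2, not_lt.2]
  by_cases hc : c.val + 1 = N
  · have h1 : a.val < c.val := by
      have := a.2
      omega
    have h2 : b.val < c.val := by
      have := b.2
      omega
    simp [lt hcd hc, ha, hb, hc, h1, h2]
  by_cases hd : d.val + 1 = N
  · have h1 : a.val < d.val := by
      have := a.2
      omega
    have h2 : b.val < d.val := by
      have := b.2
      omega
    simp [ha, hb, hc, hd, h1, h2]
  simp [ha, hb, hc, hd]

theorem arr_rotate (X : Circ π N) (a b : Fin N) :
    (finRotate N • X).arr (finRotate N a) (finRotate N b) ↔ X.arr a b := by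
  change X.arr ((finRotate N)⁻¹ _) ((finRotate N)⁻¹ _) ↔ _
  rw [finRotate_inv_apply, finRotate_inv_apply]

theorem inc_rotate (X : Circ π N) (a b : Fin N) :
    (finRotate N • X).inc (finRotate N a) (finRotate N b) ↔ X.inc a b :=
  or_congr (arr_rotate X a b) (arr_rotate X b a)

theorem isHead_rotate (X : Circ π N) (a : Fin N) :
    (finRotate N • X).IsHead (finRotate N a) ↔ X.IsHead a := by
  constructor
  · rintro ⟨b, hb⟩
    obtain ⟨b, rfl⟩ := (finRotate N).surjective b
    exact ⟨b, (arr_rotate X b a).1 hb⟩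
  · rintro ⟨b, hb⟩
    exact ⟨_, (arr_rotate X b a).2 hb⟩

theorem eps_rotate {X : Circ π N} (hX : X.IsArrow) {e a b : Fin N} (ha : X.inc e a)
    (hb : X.inc (finRotate N e) b) (he : finRotate N e ≠ e) (hae : a ≠ finRotate N e) (hbe : b ≠ e) :
    (finRotate N • X).eps (finRotate N e) = X.eps e := by
  classical
  have h1 : a ≠ e := by
    rintro rfl; rcases ha with h | h <;> exact hX.1 _ _ h h
  have h2 : b ≠ finRotate N e := by
    rintro rfl; rcases hb with h | h <;> exact hX.1 _ _ h h
  have h3 : a ≠ b := by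
    rintro rfl
    exact he ((hX.2 a).unique ha.symm hb.symm).symm
  rw [eps, eps, eta_eq hX ha hb, eta_eq (hX.smul _) ((inc_rotate X _ _).2 ha)
    ((inc_rotate X _ _).2 hb)]
  congr 1
  · exact if_congr (crosses_rotate h1.symm he.symm hbe.symm hae h3 h2.symm) rfl rfl
  · rw [up_eq (isHead_rotate X e) (isHead_rotate X _), up_eq (X := X) Iff.rfl Iff.rfl]

variable {X : Circ π N} {i j k xa xc ya yb zb zc : Fin N}

theorem Triangle.rotate (h : X.Triangle i j k xa xc ya yb zb zc) :
    (finRotate N • X).Triangle (finRotate N i) (finRotate N j) (finRotate N k) (finRotate N xa)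
      (finRotate N xc) (finRotate N ya) (finRotate N yb) (finRotate N zb) (finRotate N zc) where
  isArrow := h.isArrow.smul _
  a := (arr_rotate X _ _).2 h.a
  c := (arr_rotate X _ _).2 h.c
  b := (arr_rotate X _ _).2 h.b
  x := h.x.imp (And.imp (congrArg _) (congrArg _)) (And.imp (congrArg _) (congrArg _))
  y := h.y.imp (And.imp (congrArg _) (congrArg _)) (And.imp (congrArg _) (congrArg _))
  z := h.z.imp (And.imp (congrArg _) (congrArg _)) (And.imp (congrArg _) (congrArg _))
  nodup := h.nodup.map (finRotate N).injective

theorem eps_rotate_pair (hX : X.IsArrow) {e a b p q : Fin N}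
    (hpq : (p = e ∧ q = finRotate N e) ∨ (p = finRotate N e ∧ q = e)) (ha : X.inc p a)
    (hb : X.inc q b) (he : finRotate N e ≠ e) (hap : a ≠ q) (hbq : b ≠ p) :
    (finRotate N • X).eps (finRotate N e) = X.eps e := by
  rcases hpq with ⟨rfl, rfl⟩ | ⟨rfl, rfl⟩
  · exact eps_rotate hX ha hb he hap hbq
  · exact eps_rotate hX hb ha he hbq hap

theorem Triangle.eps_rotate (h : X.Triangle i j k xa xc ya yb zb zc) :
    (finRotate N • X).eps (finRotate N i) = X.eps i ∧
    (finRotate N • X).eps (finRotate N j) = X.eps j ∧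
    (finRotate N • X).eps (finRotate N k) = X.eps k := by
  obtain ⟨hX, ha, hc, hb, hx, hy, hz, hn⟩ := h
  simp only [List.nodup_cons, List.mem_cons, List.not_mem_nil, or_false, not_or] at hn
  obtain ⟨⟨h1, h2, h3, h4, h5⟩, ⟨h6, h7, h8, h9⟩, ⟨h10, h11, h12⟩, ⟨h13, h14⟩, h15, -⟩ := hn
  have ne : ∀ {p q a a' b b' : Fin N}, (p = a ∨ p = a') → (q = b ∨ q = b') → a ≠ b → a ≠ b' →
      a' ≠ b → a' ≠ b' → p ≠ q := by
    rintro p q a a' b b' (rfl | rfl) (rfl | rfl) h1 h2 h3 h4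
    exacts [h1, h2, h3, h4]
  have xa' := hx.imp And.left And.left
  have xc' := (hx.imp And.right And.right).symm
  have ya' := hy.imp And.left And.left
  have yb' := (hy.imp And.right And.right).symm
  have zb' := hz.imp And.left And.left
  have zc' := (hz.imp And.right And.right).symm
  refine ⟨eps_rotate_pair hX hx (.inl ha) (.inl hc) (Ne.symm h1) (ne xc' ya' h2 h3 h6 h7).symm
    (ne xa' zc' h4 h5 h8 h9).symm, eps_rotate_pair hX hy (.inr ha) (.inl hb) (Ne.symm h10)
    (ne xa' yb' h2 h3 h6 h7) (ne ya' zb' h11 h12 h13 h14).symm, eps_rotate_pair hX hz (.inr hb)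
    (.inr hc) (Ne.symm h15) (ne yb' zc' h11 h12 h13 h14) (ne xc' zb' h4 h5 h8 h9)⟩

end Circ

/-- If one edge passes the cut, rotate by one point: this edge then starts at the first point. The
other two edges are disjoint from it, so they do not end at the last point and are not carried onto
the cut. -/
theorem subSum_triangle' {φ : ArrowDiagram π → ℚ} (h6 : SixTerm φ) (h2 : LineAP2 φ) {N : ℕ}
    {G G' : GaussRigid π N} {i j k xa xc ya yb zb zc : Fin N} {τ : Fin N → Fin N}
    (ht : G.circ.Triangle i j k xa xc ya yb zb zc)
    (mi : G.circ.mark i = 1) (mj : G.circ.mark j = 1) (mk : G.circ.mark k = 1)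
    (s1 : G.edgeSign i = G.edgeSign j) (s2 : G.edgeSign j = G.edgeSign k)
    (hm : G'.circ.mark = G.circ.mark) (hτ : Exch τ xa xc ya yb zb zc)
    (harr : ∀ a b, G'.circ.arr a b ↔ G.circ.arr (τ a) (τ b)) (hsg : ∀ a, G'.sign a = G.sign (τ a)) :
    subSum φ G = subSum φ G' := by
  have v := fun e : Fin N => val_finRotate e
  by_cases hw : i.val + 1 ≠ N ∧ j.val + 1 ≠ N ∧ k.val + 1 ≠ N
  · exact subSum_triangle h6 h2 ht (by rw [v, if_neg hw.1]) (by rw [v, if_neg hw.2.1])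
      (by rw [v, if_neg hw.2.2]) mi mj mk s1 s2 hm hτ harr hsg
  obtain ⟨e1, e2, e3⟩ := ht.eps_rotate
  have hn := ht.nodup
  simp only [List.nodup_cons, List.mem_cons, List.not_mem_nil, or_false, not_or, Fin.ext_iff] at hn
  have key : ∀ e : Fin N, e.val + 2 ≠ N →
      (finRotate N (finRotate N e)).val = (finRotate N e).val + 1 := by
    intro e he
    rw [v, v]
    have := e.2
    split_ifs <;> omega
  have key' : ∀ e f : Fin N, f.val + 1 = N → (finRotate N e).val ≠ f.val → e.val + 2 ≠ N := by
    intro e f hf hef h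
    rw [v] at hef
    split_ifs at hef <;> omega
  obtain ⟨w1, w2, w3⟩ : i.val + 2 ≠ N ∧ j.val + 2 ≠ N ∧ k.val + 2 ≠ N := by
    obtain ⟨⟨h1, h2, h3, h4, h5⟩, ⟨h6, h7, h8, h9⟩, ⟨h10, h11, h12⟩, ⟨h13, h14⟩, h15, -⟩ := hn
    by_cases wi : i.val + 1 = N
    · exact ⟨by omega, key' j i wi (Ne.symm h3), key' k i wi (Ne.symm h5)⟩
    by_cases wj : j.val + 1 = N
    · exact ⟨key' i j wj h6, by omega, key' k j wj (Ne.symm h12)⟩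
    by_cases wk : k.val + 1 = N
    · exact ⟨key' i k wk h8, key' j k wk h13, by omega⟩
    exact absurd ⟨wi, wj, wk⟩ hw
  have hes : ∀ e, (finRotate N • G.circ).eps (finRotate N e) = G.circ.eps e →
      (rotOne N • G).edgeSign (finRotate N e) = G.edgeSign e := by
    intro e he
    have hsm : ∀ p, (rotOne N • G).sign (finRotate N p) = G.sign p := fun p =>
      congrArg G.sign (finRotate_inv_apply _)
    unfold GaussRigid.edgeSign
    rw [hsm, hsm]
    exact congrArg _ he
  rw [← subSum_smul φ G (rotOne N), ← subSum_smul φ G' (rotOne N)]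
  have hmark : ∀ (H : GaussRigid π N) e, (rotOne N • H).circ.mark (finRotate N e) = H.circ.mark e :=
    fun H e => congrArg H.circ.mark (finRotate_inv_apply _)
  refine subSum_triangle h6 h2 (τ := fun p => finRotate N (τ ((finRotate N)⁻¹ p)))
    (G := rotOne N • G) ht.rotate (key i w1) (key j w2) (key k w3) ?_ ?_ ?_ ?_ ?_ ?_ ?_ ?_ ?_
  · rw [hmark, mi]
  · rw [hmark, mj]
  · rw [hmark, mk]
  · rw [hes i e1, hes j e2, s1]
  · rw [hes j e2, hes k e3, s2]
  · exact funext fun p => congrFun hm _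
  · refine ⟨?_, ?_, ?_, ?_, ?_, ?_, fun p h1 h2 h3 h4 h5 h6 => ?_⟩
    · rw [finRotate_inv_apply, hτ.map_xa]
    · rw [finRotate_inv_apply, hτ.map_xc]
    · rw [finRotate_inv_apply, hτ.map_ya]
    · rw [finRotate_inv_apply, hτ.map_yb]
    · rw [finRotate_inv_apply, hτ.map_zb]
    · rw [finRotate_inv_apply, hτ.map_zc]
    · obtain ⟨p, rfl⟩ := (finRotate N).surjective p
      rw [finRotate_inv_apply, hτ.other p]
      all_goals rintro rfl; contradiction
  · intro a b
    have := harr ((finRotate N)⁻¹ a) ((finRotate N)⁻¹ b)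
    change G'.circ.arr _ _ ↔ G.circ.arr ((finRotate N)⁻¹ _) ((finRotate N)⁻¹ _)
    rw [finRotate_inv_apply, finRotate_inv_apply]
    exact this
  · intro a
    change G'.sign _ = G.sign ((finRotate N)⁻¹ _)
    rw [finRotate_inv_apply]
    exact hsg _

theorem GaussRigid.Linked.symm {N : ℕ} {G : GaussRigid π N} {i j : Fin N} (h : G.Linked i j) :
    G.Linked j i := by
  obtain ⟨a, b, ha, hb, hab⟩ := h
  exact ⟨b, a, hb, ha, hab.symm⟩

/-- The numbers of heads on the three edges are 0, 1, 2 in some order, and all hypotheses are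
symmetric in the edges. Sorting by the number of heads leads to arrows `x → y`, `x → z`, `y → z`. -/
theorem subSum_r3 {φ : ArrowDiagram π → ℚ} (h6 : SixTerm φ) (h2 : LineAP2 φ) {N : ℕ}
    {G G' : GaussRigid π N} {i j k : Fin N}
    (hd : [i, finRotate N i, j, finRotate N j, k, finRotate N k].Nodup)
    (hi : G.circ.mark i = 1) (hj : G.circ.mark j = 1) (hk : G.circ.mark k = 1)
    (hij : G.Linked i j) (hjk : G.Linked j k) (hik : G.Linked i k)
    (hs : G.edgeSign i = G.edgeSign j ∧ G.edgeSign j = G.edgeSign k)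
    (hu : G.circ.up i ≠ G.circ.up j ∧ G.circ.up j ≠ G.circ.up k ∧ G.circ.up i ≠ G.circ.up k)
    (hm : G'.circ.mark = G.circ.mark) {τ : Fin N → Fin N} (hτ : Flips τ i j k)
    (ha : ∀ a b, G'.circ.arr a b ↔ G.circ.arr (τ a) (τ b))
    (hsg : ∀ a, G'.sign a = G.sign (τ a)) : subSum φ G = subSum φ G' := by
  have key : ∀ {i j k : Fin N}, [i, finRotate N i, j, finRotate N j, k, finRotate N k].Nodup →
      G.circ.mark i = 1 → G.circ.mark j = 1 → G.circ.mark k = 1 → G.Linked i j → G.Linked j k →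
      G.Linked i k → G.edgeSign i = G.edgeSign j → G.edgeSign j = G.edgeSign k →
      G.circ.up i = 0 → G.circ.up k = 2 → Flips τ i j k → subSum φ G = subSum φ G' := by
    intro i j k hd hi hj hk hij hjk hik s1 s2 u1 u2 hτ
    obtain ⟨xa, xc, ya, yb, zb, zc, ht⟩ := Circ.exists_triangle hd hij hjk hik u1 u2
    exact subSum_triangle' h6 h2 ht hi hj hk s1 s2 hm (hτ.exch ht.x ht.y ht.z) ha hsg
  have swap₁ : ∀ {i j k : Fin N}, [i, finRotate N i, j, finRotate N j, k, finRotate N k].Nodup →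
      [j, finRotate N j, i, finRotate N i, k, finRotate N k].Nodup := fun {i j k} h =>
    (List.perm_append_comm_assoc [i, finRotate N i] [j, finRotate N j] _).nodup_iff.1 h
  have cyc : ∀ {i j k : Fin N}, [i, finRotate N i, j, finRotate N j, k, finRotate N k].Nodup →
      [k, finRotate N k, i, finRotate N i, j, finRotate N j].Nodup := fun {i j k} h =>
    (List.perm_append_comm (l₁ := [i, finRotate N i, j, finRotate N j])).nodup_iff.1 h
  have le : ∀ e, G.circ.up e ≤ 2 := by
    intro e
    unfold Circ.up
    split_ifs <;> omega
  have li := le i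
  have lj := le j
  have lk := le k
  obtain ⟨s1, s2⟩ := hs
  obtain ⟨t1, t1', t2, t2', t3, t3', t⟩ := hτ
  have cases : (G.circ.up i = 0 ∧ G.circ.up k = 2) ∨ (G.circ.up i = 0 ∧ G.circ.up j = 2) ∨
      (G.circ.up j = 0 ∧ G.circ.up k = 2) ∨ (G.circ.up j = 0 ∧ G.circ.up i = 2) ∨
      (G.circ.up k = 0 ∧ G.circ.up j = 2) ∨ (G.circ.up k = 0 ∧ G.circ.up i = 2) := by omega
  rcases cases with ⟨u1, u2⟩ | ⟨u1, u2⟩ | ⟨u1, u2⟩ | ⟨u1, u2⟩ | ⟨u1, u2⟩ | ⟨u1, u2⟩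
  · exact key hd hi hj hk hij hjk hik s1 s2 u1 u2 ⟨t1, t1', t2, t2', t3, t3', t⟩
  · exact key (swap₁ (cyc hd)) hi hk hj hik hjk.symm hij (s1.trans s2) s2.symm u1 u2
      ⟨t1, t1', t3, t3', t2, t2', fun p h1 h2 h3 h4 h5 h6 => t p h1 h2 h5 h6 h3 h4⟩
  · exact key (swap₁ hd) hj hi hk hij.symm hik hjk s1.symm (s1.trans s2) u1 u2
      ⟨t2, t2', t1, t1', t3, t3', fun p h1 h2 h3 h4 h5 h6 => t p h3 h4 h1 h2 h5 h6⟩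
  · exact key (cyc (cyc hd)) hj hk hi hjk hik.symm hij.symm s2 (s1.trans s2).symm u1 u2
      ⟨t2, t2', t3, t3', t1, t1', fun p h1 h2 h3 h4 h5 h6 => t p h5 h6 h1 h2 h3 h4⟩
  · exact key (cyc hd) hk hi hj hik.symm hij hjk.symm (s1.trans s2).symm s1 u1 u2
      ⟨t3, t3', t1, t1', t2, t2', fun p h1 h2 h3 h4 h5 h6 => t p h3 h4 h5 h6 h1 h2⟩
  · exact key (cyc (swap₁ hd)) hk hj hi hjk.symm hij.symm hik.symm s2.symm s1.symm u1 u2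
      ⟨t3, t3', t2, t2', t1, t1', fun p h1 h2 h3 h4 h5 h6 => t p h5 h6 h3 h4 h1 h2⟩

/-! ### From invariance under the third Reidemeister move to the six-term relations -/

/-- For the arrows `x₁ → y₁`, `x₂ → z₁`, `y₂ → z₂` all local orders are positive, so w(e)ε(e) agrees
on the three edges as soon as the three arrows have a common sign. Both choices of this sign `κ` are
admissible. -/
theorem lineSum_tri_of_move {w : π →* ℤˣ} {φ : ArrowDiagram π → ℚ}
    (h : ∀ G G' : Σ N : ℕ, GaussRigid π N, Move w G G' → subSum φ G.2 = subSum φ G'.2)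
    {M : ℕ → π} (T : π) {S : Finset (ℕ × ℕ)} {x₁ x₂ y₁ y₂ z₁ z₂ : ℕ}
    (hS : Sites M S x₁ x₂ y₁ y₂ z₁ z₂) {s : ℕ → ℤˣ} {κ : ℤˣ}
    (hκ : ∀ p, p = x₁ ∨ p = x₂ ∨ p = y₁ ∨ p = y₂ ∨ p = z₁ ∨ p = z₂ → s p = κ)
    (hs : ∀ a ∈ S, s a.1 = s a.2) :
    lineSum φ M T s (tri S x₁ x₂ y₁ y₂ z₂ z₁) = lineSum φ M T s (tri S x₂ x₁ y₂ y₁ z₁ z₂) := by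
  have hg := hS.good_tri (.inl ⟨rfl, rfl⟩) (.inl ⟨rfl, rfl⟩) (.inr ⟨rfl, rfl⟩)
  have hg' := hS.good_tri (.inr ⟨rfl, rfl⟩) (.inr ⟨rfl, rfl⟩) (.inl ⟨rfl, rfl⟩)
  set S₁ := tri S x₁ x₂ y₁ y₂ z₂ z₁ with hS₁
  set S₂ := tri S x₂ x₁ y₂ y₁ z₁ z₂ with hS₂
  have hp := pts_tri S x₁ x₂ y₁ y₂ z₂ z₁
  have hpp : pts S₂ = pts S₁ := by
    ext p
    rw [hS₁, hS₂, pts_tri, pts_tri]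
    refine or_congr_left ?_
    tauto
  have hs₁ : ∀ a ∈ S₁, s a.1 = s a.2 := by
    intro a ha
    simp only [hS₁, tri, Finset.mem_insert] at ha
    rcases ha with rfl | rfl | rfl | ha
    · rw [hκ x₁ (by simp), hκ y₁ (by simp)]
    · rw [hκ x₂ (by simp), hκ z₁ (by simp)]
    · rw [hκ y₂ (by simp), hκ z₂ (by simp)]
    · exact hs a ha
  have hs₂ : ∀ a ∈ S₂, s a.1 = s a.2 := by
    intro a ha
    simp only [hS₂, tri, Finset.mem_insert] at ha
    rcases ha with rfl | rfl | rfl | ha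
    · rw [hκ x₂ (by simp), hκ y₂ (by simp)]
    · rw [hκ x₁ (by simp), hκ z₂ (by simp)]
    · rw [hκ y₁ (by simp), hκ z₁ (by simp)]
    · exact hs a ha
  obtain ⟨e, he⟩ : ∃ e : Fin (pts S₁).card → ℕ, Enum e (pts S₁) := ⟨_, enum_orderEmbOfFin _⟩
  generalize (pts S₁).card = N at e he
  have he₂ : Enum e (pts S₂) := hpp ▸ he
  obtain ⟨-, lx, ly, lz, Mx, My, Mz, sx, sy, sz, xy, yz, xz⟩ := id hS
  have ax : Adj M T (pts S₁) x₁ x₂ := by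
    refine .inl ⟨lx, fun r hr => ?_, Mx⟩
    rcases (hp r).1 hr with (rfl | rfl | rfl | rfl | rfl | rfl) | hr
    any_goals omega
    have := sx r hr
    omega
  have ay : Adj M T (pts S₁) y₁ y₂ := by
    refine .inl ⟨ly, fun r hr => ?_, My⟩
    rcases (hp r).1 hr with (rfl | rfl | rfl | rfl | rfl | rfl) | hr
    any_goals omega
    have := sy r hr
    omega
  have az : Adj M T (pts S₁) z₁ z₂ := by
    refine .inl ⟨lz, fun r hr => ?_, Mz⟩
    rcases (hp r).1 hr with (rfl | rfl | rfl | rfl | rfl | rfl) | hr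
    any_goals omega
    have := sz r hr
    omega
  obtain ⟨i, i1, i2, mi⟩ := exists_of_adj he ((hp _).2 (by simp)) ((hp _).2 (by simp)) ax
  obtain ⟨j, j1, j2, mj⟩ := exists_of_adj he ((hp _).2 (by simp)) ((hp _).2 (by simp)) ay
  obtain ⟨k, k1, k2, mk⟩ := exists_of_adj he ((hp _).2 (by simp)) ((hp _).2 (by simp)) az
  have hn : [i, finRotate N i, j, finRotate N j, k, finRotate N k].Nodup := by
    refine List.Nodup.of_map e ?_
    simp only [List.map_cons, List.map_nil, i1, i2, j1, j2, k1, k2, List.nodup_cons,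
      List.mem_cons, List.not_mem_nil, or_false, not_or, List.nodup_nil, and_true, not_false_iff]
    clear hp hκ sx sy sz
    omega
  have v : ∀ e', e e' < e (finRotate N e') → (finRotate N e').val = e'.val + 1 := by
    intro e' h
    have := (he.lt_finRotate e').1 h
    rw [val_finRotate, if_neg (by omega)]
  have vi := v i (by rw [i1, i2]; exact lx)
  have vj := v j (by rw [j1, j2]; exact ly)
  have vk := v k (by rw [k1, k2]; exact lz)
  have harr : ∀ p q, (lineCirc e M T S₁).arr p q ↔ (e p, e q) ∈ S₁ := fun p q => Iff.rfl
  have ht : (lineCirc e M T S₁).Triangle i j k i (finRotate N i) j (finRotate N j)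
      (finRotate N k) k :=
    { isArrow := isArrow_lineCirc he hg M T
      a := by rw [harr, i1, j1]; simp [hS₁, tri]
      c := by rw [harr, i2, k1]; simp [hS₁, tri]
      b := by rw [harr, j2, k2]; simp [hS₁, tri]
      x := .inl ⟨rfl, rfl⟩
      y := .inl ⟨rfl, rfl⟩
      z := .inr ⟨rfl, rfl⟩
      nodup := hn }
  obtain ⟨e1, e2, e3⟩ := ht.eps vi vj vk
  obtain ⟨u1, u2, u3⟩ := ht.up
  have o : ∀ e' : Fin N, (finRotate N e').val = e'.val + 1 → ordSign e' (finRotate N e') = 1 :=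
    fun e' h => if_pos (by omega)
  rw [o i vi, one_mul] at e1
  rw [o j vj, one_mul] at e2
  rw [o k vk, one_mul] at e3
  have hτ := (flips_flip hn).exch ht.x ht.y ht.z
  have hsi := hκ x₁ (by simp)
  have hsi' := hκ x₂ (by simp)
  have hsj := hκ y₁ (by simp)
  have hsj' := hκ y₂ (by simp)
  have hsk := hκ z₁ (by simp)
  have hsk' := hκ z₂ (by simp)
  rw [← i1] at hsi
  rw [← i2] at hsi'
  rw [← j1] at hsj
  rw [← j2] at hsj'
  rw [← k1] at hsk
  rw [← k2] at hsk'
  have hE : ∀ e' : Fin N, s (e e') = κ → s (e (finRotate N e')) = κ →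
      (lineGauss he hg M T hs₁).edgeSign e' = κ * κ * (lineCirc e M T S₁).eps e' := by
    intro e' h1 h2
    change s (e e') * s (e (finRotate N e')) * _ = _
    rw [h1, h2]
    rfl
  have hsym := ht.isArrow
  have hm := h ⟨_, lineGauss he hg M T hs₁⟩ ⟨_, lineGauss he₂ hg' M T hs₂⟩
    (.r3 _ _ i j k hn (mi _) (mj _) (mk _) ⟨_, _, .inl rfl, .inl rfl, .inl ht.a⟩
      ⟨_, _, .inr rfl, .inr rfl, .inl ht.b⟩ ⟨_, _, .inr rfl, .inl rfl, .inl ht.c⟩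
      ⟨by rw [hE i hsi hsi', hE j hsj hsj', e1, e2], by rw [hE j hsj hsj', hE k hsk hsk', e2, e3]⟩
      ?_ rfl _ rfl ?_ ?_)
  · rw [subSum_lineGauss, subSum_lineGauss] at hm
    exact hm
  · change (lineCirc e M T S₁).up i ≠ (lineCirc e M T S₁).up j ∧ (lineCirc e M T S₁).up j ≠
      (lineCirc e M T S₁).up k ∧ (lineCirc e M T S₁).up i ≠ (lineCirc e M T S₁).up k
    rw [u1, u2, u3]
    decide
  · intro a b
    have := hτ.mem_tri he.mono.injective (S := S) (by
      rintro p (rfl | rfl | rfl | rfl | rfl | rfl)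
      · rw [i1]; exact hS.notMem (by omega)
      · rw [i2]; exact hS.notMem (by omega)
      · rw [j1]; exact hS.notMem (by omega)
      · rw [j2]; exact hS.notMem (by omega)
      · rw [k2]; exact hS.notMem (by omega)
      · rw [k1]; exact hS.notMem (by omega)) a b
    rw [i1, i2, j1, j2, k1, k2] at this
    exact this.symm
  · intro a
    change s (e a) = s (e _)
    rcases hτ.eq_or_notMem (P := {p | s (e p) ≠ κ}) (by simpa using hsi) (by simpa using hsi')
      (by simpa using hsj) (by simpa using hsj') (by simpa using hsk') (by simpa using hsk) a with
      h1 | ⟨h1, h2⟩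
    · rw [h1]
    · simp only [Set.mem_ofPred_eq, not_not] at h1 h2
      rw [h1, h2]

/-- The quadratic part comes with `κ * κ = 1` and the cubic part with `κ * κ * κ = κ`. Adding the
identities for `κ = 1` and `κ = -1` eliminates the cubic part. -/
theorem sixTerm_of_move {w : π →* ℤˣ} {φ : ArrowDiagram π → ℚ}
    (h : ∀ G G' : Σ N : ℕ, GaussRigid π N, Move w G G' → subSum φ G.2 = subSum φ G'.2) :
    SixTerm φ := by
  intro M T S x₁ x₂ y₁ y₂ z₁ z₂ hS
  have key : ∀ κ : ℤˣ, diffX φ M T S x₁ x₂ y₁ z₁ + diffY φ M T S x₁ y₁ y₂ z₁ +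
      diffZ φ M T S x₁ y₁ z₁ z₂ + ((κ : ℤ) : ℚ) *
        (full φ M T S x₁ x₂ y₁ y₂ z₂ z₁ - full φ M T S x₂ x₁ y₂ y₁ z₁ z₂) = 0 := by
    intro κ
    refine eq_zero_of_sum_powerset (q := fun R => diffX φ M T R x₁ x₂ y₁ z₁ +
      diffY φ M T R x₁ y₁ y₂ z₁ + diffZ φ M T R x₁ y₁ z₁ z₂ + ((κ : ℤ) : ℚ) *
        (full φ M T R x₁ x₂ y₁ y₂ z₂ z₁ - full φ M T R x₂ x₁ y₂ y₁ z₁ z₂)) fun S' hS' => ?_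
    have hS' := hS.mono hS'
    set s : ℕ → ℤˣ := fun p => if p = x₁ ∨ p = x₂ ∨ p = y₁ ∨ p = y₂ ∨ p = z₁ ∨ p = z₂ then κ else 1
      with hs
    have s1 : ∀ p ∈ pts S', s p = 1 := by
      intro p hp
      refine if_neg fun hp' => hS'.notMem (p := p) ?_ hp
      have := hS'.x
      have := hS'.y
      have := hS'.z
      omega
    have hκ : ∀ p, p = x₁ ∨ p = x₂ ∨ p = y₁ ∨ p = y₂ ∨ p = z₁ ∨ p = z₂ → s p = κ :=
      fun p hp => if_pos hp
    have h1 := lineSum_tri_of_move h T hS' hκ fun a ha => by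
      rw [s1 _ (fst_mem_pts ha), s1 _ (snd_mem_pts ha)]
    have h2 := lineSum_tri_sub (φ := φ) hS' T (.inl ⟨rfl, rfl⟩) (.inl ⟨rfl, rfl⟩) (.inr ⟨rfl, rfl⟩)
      s s (fun _ _ => rfl) (by rw [hκ _ (by simp), hκ _ (by simp)])
      (by rw [hκ _ (by simp), hκ _ (by simp)]) (by rw [hκ _ (by simp), hκ _ (by simp)])
    rw [h1, sub_self, hκ x₁ (by simp), hκ x₂ (by simp), hκ y₂ (by simp)] at h2
    rw [h2]
    refine Finset.sum_congr rfl fun R hR => ?_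
    have hκ2 : ((κ : ℤ) : ℚ) * ((κ : ℤ) : ℚ) = 1 := by
      rcases Int.units_eq_one_or κ with h | h <;> simp [h]
    rw [Finset.prod_eq_one fun d hd => by
      rw [s1 _ (fst_mem_pts (Finset.mem_powerset.1 hR hd))]; simp, hκ2]
    ring
  have k1 := key 1
  have k2 := key (-1)
  push_cast at k1 k2
  linarith

/-! ### Shrinking an edge of a diagram on a line -/

theorem Enum.snoc {K : ℕ} {e : Fin K → ℕ} {Q : Finset ℕ} (he : Enum e Q) {m : ℕ}
    (hm : ∀ q ∈ Q, q < m) : Enum (Fin.snoc (α := fun _ => ℕ) e m) (insert m Q) := by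
  refine ⟨fun i j hij => ?_, fun p => ?_⟩
  · induction j using Fin.lastCases with
    | last =>
      induction i using Fin.lastCases with
      | last => exact absurd hij (lt_irrefl _)
      | cast i => rw [Fin.snoc_last, Fin.snoc_castSucc]; exact hm _ (he.mem' i)
    | cast j =>
      induction i using Fin.lastCases with
      | last => exact absurd hij (not_lt.2 (Fin.le_last _))
      | cast i =>
        rw [Fin.snoc_castSucc, Fin.snoc_castSucc]
        exact he.mono (Fin.castSucc_lt_castSucc_iff.1 hij)
  · rw [Finset.mem_insert, he.mem]
    constructor
    · rintro (rfl | ⟨i, rfl⟩)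
      · exact ⟨Fin.last _, Fin.snoc_last _ _⟩
      · exact ⟨i.castSucc, Fin.snoc_castSucc _ _ _⟩
    · rintro ⟨i, rfl⟩
      induction i using Fin.lastCases with
      | last => left; rw [Fin.snoc_last]
      | cast i => right; exact ⟨i, by rw [Fin.snoc_castSucc]⟩

/-- The point `m` is replaced by `x`. -/
def merge (m x p : ℕ) : ℕ := if p = m then x else p

theorem merge_snoc {K : ℕ} {e : Fin (K + 1) → ℕ} {Q : Finset ℕ} (he : Enum e Q) {m : ℕ}
    (hm : ∀ q ∈ Q, q < m) (a : Fin (K + 2)) :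
    merge m (e 0) (Fin.snoc (α := fun _ => ℕ) e m a) = e (glue a) := by
  induction a using Fin.lastCases with
  | last => rw [Fin.snoc_last, glue_last, merge, if_pos rfl]
  | cast a => rw [Fin.snoc_castSucc, glue_castSucc, merge, if_neg (hm _ (he.mem' a)).ne]

/-- The hypothesis `hM` says that the base edge, from the last point `m` across the cut to the first
point, is decorated by `1`. Replacing `m` by the first point then leaves all other decorations
correct. -/
theorem shrink_lineCirc {K : ℕ} {e : Fin (K + 1) → ℕ} {Q : Finset ℕ} (he : Enum e Q) {m : ℕ}
    (hm : ∀ q ∈ Q, q < m) {M : ℕ → π} {T : π} {S : Finset (ℕ × ℕ)} (hS : pts S ⊆ insert m Q)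
    (hM : M m = T * M (e 0)) :
    (lineCirc (Fin.snoc (α := fun _ => ℕ) e m) M T S).shrink =
      lineCirc e M T (mapArr (merge m (e 0)) S) := by
  have he2 := he.snoc hm
  have hmerge := merge_snoc he hm
  ext i j
  · simp only [Circ.shrink, lineCirc]
    constructor
    · rintro ⟨a, b, rfl, rfl, h⟩
      rw [← hmerge, ← hmerge]
      exact Finset.mem_image.2 ⟨_, h, rfl⟩
    · intro h
      obtain ⟨⟨p, q⟩, hpq, h⟩ := Finset.mem_image.1 h
      obtain ⟨a, ha⟩ := (he2.mem p).1 (hS (fst_mem_pts hpq))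
      obtain ⟨b, hb⟩ := (he2.mem q).1 (hS (snd_mem_pts hpq))
      subst ha hb
      simp only [Prod.map, hmerge, Prod.mk.injEq] at h
      exact ⟨a, b, he.mono.injective h.1, he.mono.injective h.2, hpq⟩
  · rename_i i
    simp only [Circ.shrink, lineCirc, Fin.snoc_castSucc]
    congr 1
    induction i using Fin.lastCases with
    | last =>
      have h1 : finRotate (K + 2) (Fin.last K).castSucc = Fin.last (K + 1) := by
        rw [finRotate_apply]; ext; simp
      rw [h1, Fin.snoc_last, if_pos (hm _ (he.mem' _)), one_mul, hM, finRotate_last,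
        if_neg (not_lt.2 (he.mono.monotone (Fin.zero_le _)))]
    | cast i =>
      have h1 : finRotate (K + 2) i.castSucc.castSucc = (finRotate (K + 1) i.castSucc).castSucc := by
        rw [finRotate_apply, finRotate_apply]; ext; simp
      rw [h1, Fin.snoc_castSucc]
  · exact absurd ‹_› (Nat.succ_ne_zero K)

theorem swapEnds_lineCirc {K : ℕ} {e : Fin (K + 1) → ℕ} {Q : Finset ℕ} (he : Enum e Q) {m : ℕ}
    (hm : ∀ q ∈ Q, q < m) {M : ℕ → π} {T : π} {S : Finset (ℕ × ℕ)} :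
    (lineCirc (Fin.snoc (α := fun _ => ℕ) e m) M T S).swapEnds =
      lineCirc (Fin.snoc (α := fun _ => ℕ) e m) M T (mapArr (Equiv.swap (e 0) m) S) := by
  have he2 := he.snoc hm
  have hsw : ∀ a, Fin.snoc (α := fun _ => ℕ) e m (Equiv.swap 0 (Fin.last _) a) =
      Equiv.swap (e 0) m (Fin.snoc (α := fun _ => ℕ) e m a) := by
    intro a
    have h0 : Fin.snoc (α := fun _ => ℕ) e m 0 = e 0 := Fin.snoc_castSucc (α := fun _ => ℕ) _ _ 0
    have h1 : Fin.snoc (α := fun _ => ℕ) e m (Fin.last _) = m := Fin.snoc_last _ _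
    have := he2.mono.injective.map_swap 0 (Fin.last _) a
    rwa [h0, h1] at this
  ext i j
  · simp only [Circ.swapEnds, lineCirc, hsw]
    constructor
    · intro h
      exact Finset.mem_image.2 ⟨_, h, by simp⟩
    · intro h
      obtain ⟨⟨p, q⟩, hpq, h⟩ := Finset.mem_image.1 h
      simp only [Prod.map, Prod.mk.injEq] at h
      rw [← h.1, ← h.2]
      simpa using hpq
  · rfl
  · rfl

/-! ### The differential of a diagram on a line -/

/-- The arrow from `p` to `q`, or the other way round. -/
def arw (d : Bool) (p q : ℕ) : ℕ × ℕ := cond d (p, q) (q, p)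

/-- The sign of a direction. -/
def dirSign (d : Bool) : ℤˣ := cond d 1 (-1)

theorem mapArr_insert_arw (f : ℕ → ℕ) (d : Bool) (p q : ℕ) (S : Finset (ℕ × ℕ)) :
    mapArr f (insert (arw d p q) S) = insert (arw d (f p) (f q)) (mapArr f S) := by
  rw [mapArr_insert]
  cases d <;> rfl

theorem mem_pts_insert_arw {d : Bool} {p q r : ℕ} {S : Finset (ℕ × ℕ)} :
    r ∈ pts (insert (arw d p q) S) ↔ r = p ∨ r = q ∨ r ∈ pts S := by
  cases d <;> simp only [arw, cond, pts_insert, Finset.mem_insert] <;> tauto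

theorem mem_pts_insert_arw_two {d d' : Bool} {p q p' q' r : ℕ} {S : Finset (ℕ × ℕ)} :
    r ∈ pts (insert (arw d p q) (insert (arw d' p' q') S)) ↔
      r = p ∨ r = p' ∨ r = q ∨ r = q' ∨ r ∈ pts S := by
  rw [mem_pts_insert_arw, mem_pts_insert_arw]
  tauto

theorem good_insert_arw {S : Finset (ℕ × ℕ)} (hS : Good S) {d : Bool} {p q : ℕ} (hpq : p ≠ q)
    (hp : p ∉ pts S) (hq : q ∉ pts S) : Good (insert (arw d p q) S) := by
  cases d
  · exact good_insert hS hpq.symm hq hp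
  · exact good_insert hS hpq hp hq

theorem arw_mem_or {S : Finset (ℕ × ℕ)} {d : Bool} {p q : ℕ} (h : arw d p q ∈ S) :
    (p, q) ∈ S ∨ (q, p) ∈ S := by
  cases d
  · exact .inr h
  · exact .inl h

/-- Moving the cut to `t` reverses the order of two points precisely when `t` lies between them. -/
theorem ordSign_cut {t B p q : ℕ} (hp : p < B) (hq : q < B) (hpt : p ≠ t) (hqt : q ≠ t) :
    ordSign (cut t B p) (cut t B q) = ordSign t p * ordSign t q * ordSign p q := by
  unfold ordSign cut
  split_ifs <;> first | omega | simp

theorem eps_last_lineCirc {K : ℕ} {e : Fin (K + 2) → ℕ} {S : Finset (ℕ × ℕ)}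
    (he : Enum e (pts S)) (hS : Good S) (M : ℕ → π) (T : π) {d d' : Bool} {p q : ℕ}
    (hp : arw d (e (Fin.last _)) p ∈ S) (hq : arw d' (e 0) q ∈ S) (hp0 : p ≠ e 0) :
    (lineCirc e M T S).eps (Fin.last _) = dirSign d * dirSign d' * ordSign p q := by
  have hX := isArrow_lineCirc he hS M T
  have hpS : p ∈ pts S := by
    rcases arw_mem_or hp with h | h
    · exact snd_mem_pts h
    · exact fst_mem_pts h
  have hqS : q ∈ pts S := by
    rcases arw_mem_or hq with h | h
    · exact snd_mem_pts h
    · exact fst_mem_pts h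
  obtain ⟨i, rfl⟩ := (he.mem p).1 hpS
  obtain ⟨j, rfl⟩ := (he.mem q).1 hqS
  have hi : (lineCirc e M T S).inc (Fin.last _) i := arw_mem_or hp
  have hj : (lineCirc e M T S).inc 0 j := arw_mem_or hq
  have h1 : i ≠ Fin.last _ := by
    rintro rfl
    exact hX.1 _ _ (hi.elim id id) (hi.elim id id)
  have h2 : j ≠ Fin.last _ := by
    rintro rfl
    exact hp0 (congrArg e ((hX.2 _).unique hi hj.symm))
  have hl : (lineCirc e M T S).IsHead (Fin.last _) ↔ d = false := by
    cases d
    · exact iff_of_true (hX.isHead hp).1 rfl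
    · exact iff_of_false (hX.isHead hp).2 (by simp)
  have h0 : (lineCirc e M T S).IsHead (finRotate _ (Fin.last _)) ↔ d' = false := by
    rw [finRotate_last]
    cases d'
    · exact iff_of_true (hX.isHead hq).1 rfl
    · exact iff_of_false (hX.isHead hq).2 (by simp)
  rw [Circ.eps, Circ.eta_last hX hj hi h2 h1, Circ.up_eq hl h0, ordSign]
  simp only [he.mono.lt_iff_lt]
  cases d <;> cases d' <;> by_cases h : i < j <;> simp [dirSign, h]

set_option maxHeartbeats 1000000 in
-- This is `dW_shrink` for the edge from `x₁` to `x₂`. The three order signs form the cyclic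
-- orientation of the degenerate point and the two other ends, which does not depend on the cut.
theorem dW_line {w : π →* ℤˣ} (𝒜w : WArrowSeries w) {M : ℕ → π} {T : π} {S : Finset (ℕ × ℕ)}
    {x₁ x₂ a b : ℕ} {d d' : Bool} (hS : Good S) (hx : x₁ < x₂) (hM : M x₁ = M x₂)
    (hxS : ∀ r ∈ pts S, r < x₁ ∨ x₂ < r) (ha : a < x₁ ∨ x₂ < a) (hb : b < x₁ ∨ x₂ < b)
    (haS : a ∉ pts S) (hbS : b ∉ pts S) (hab : a ≠ b) {N : ℕ} {e : Fin N → ℕ}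
    (he : Enum e (pts (insert (arw d x₂ a) (insert (arw d' x₂ b) S))))
    (hD : (lineCirc e M T (insert (arw d x₂ a) (insert (arw d' x₂ b) S))).IsDeg) :
    (dW w 𝒜w).1 (wDegDiagram w ⟨_, hD⟩) =
      (((dirSign d * dirSign d' * (ordSign x₂ a * ordSign x₂ b * ordSign a b) : ℤˣ) : ℤ) : ℚ) *
      (lineVal (weight (wS w 𝒜w).1) M T (insert (arw d x₁ a) (insert (arw d' x₂ b) S)) -
        lineVal (weight (wS w 𝒜w).1) M T (insert (arw d x₂ a) (insert (arw d' x₁ b) S))) := by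
  set S₀ := insert (arw d x₂ a) (insert (arw d' x₂ b) S) with hS₀
  set S₁ := insert (arw d x₁ a) (insert (arw d' x₂ b) S) with hS₁
  set S₂ := insert (arw d x₂ a) (insert (arw d' x₁ b) S) with hS₂
  have hx1 : x₁ ∉ pts S := fun h => by have := hxS _ h; omega
  have hx2 : x₂ ∉ pts S := fun h => by have := hxS _ h; omega
  have g1 : Good S₁ := by
    refine good_insert_arw (good_insert_arw hS (by omega) hx2 hbS) (by omega) ?_ ?_ <;>
      rw [mem_pts_insert_arw] <;> simp only [not_or]
    · exact ⟨by omega, by omega, hx1⟩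
    · exact ⟨by omega, by omega, haS⟩
  have g2 : Good S₂ := by
    refine good_insert_arw (good_insert_arw hS (by omega) hx1 hbS) (by omega) ?_ ?_ <;>
      rw [mem_pts_insert_arw] <;> simp only [not_or]
    · exact ⟨by omega, by omega, hx2⟩
    · exact ⟨by omega, by omega, haS⟩
  have hp0 : ∀ r, r ∈ pts S₀ ↔ r = x₂ ∨ r = a ∨ r = b ∨ r ∈ pts S := by
    intro r; rw [hS₀, mem_pts_insert_arw_two, or_self_left]
  have hp1 : pts S₁ = insert x₁ (pts S₀) := by
    ext r
    rw [Finset.mem_insert, hp0, hS₁, mem_pts_insert_arw_two]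
  have hp2 : pts S₂ = insert x₁ (pts S₀) := by
    ext r
    rw [Finset.mem_insert, hp0, hS₂, mem_pts_insert_arw_two, or_left_comm]
  have hr : ∀ r ∈ pts S₀, r < x₁ ∨ x₂ ≤ r := by
    intro r h
    rcases (hp0 r).1 h with rfl | rfl | rfl | h
    · exact .inr le_rfl
    · omega
    · omega
    · have := hxS r h; omega
  obtain ⟨B, hB⟩ : ∃ B, ∀ r ∈ insert x₁ (pts S₀), r < B :=
    ⟨(insert x₁ (pts S₀)).sup id + 1, fun r h => Nat.lt_succ_of_le (Finset.le_sup (f := id) h)⟩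
  have hB0 : ∀ r ∈ pts S₀, r < B := fun r h => hB r (Finset.mem_insert_of_mem h)
  have hxB : x₂ < B := hB0 _ ((hp0 _).2 (.inl rfl))
  have haB : a < B := hB0 _ ((hp0 _).2 (.inr (.inl rfl)))
  have hbB : b < B := hB0 _ ((hp0 _).2 (.inr (.inr (.inl rfl))))
  -- Cutting between `x₁` and `x₂` turns the edge to be shrunk into the base edge: `x₂` becomes the
  -- first point and `x₁`, moved to `x₁ + B`, the last one.
  obtain ⟨e', ρ, he', hρ⟩ := exists_rot_lineCirc he M T x₂ hB0
  obtain ⟨K, rfl⟩ : ∃ K, N = K + 1 := by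
    obtain ⟨i, -⟩ := (he.mem x₂).1 ((hp0 _).2 (.inl rfl))
    exact ⟨N - 1, by have := i.2; omega⟩
  have hc1 : cut x₂ B x₁ = x₁ + B := if_pos hx
  have hc2 : cut x₂ B x₂ = x₂ := if_neg (lt_irrefl _)
  have he0 : e' 0 = x₂ := by
    obtain ⟨i, hi⟩ := (he'.mem x₂).1 (Finset.mem_image.2 ⟨x₂, (hp0 _).2 (.inl rfl), hc2⟩)
    have h1 := he'.mono.monotone (Fin.zero_le i)
    obtain ⟨r, -, h2⟩ := Finset.mem_image.1 (he'.mem' 0)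
    unfold cut at h2
    split_ifs at h2 <;> omega
  have hm : ∀ q ∈ (pts S₀).image (cut x₂ B), q < x₁ + B := by
    intro q hq
    obtain ⟨r, h1, rfl⟩ := Finset.mem_image.1 hq
    have := hr r h1
    have := hB0 r h1
    unfold cut
    split_ifs <;> omega
  have he2 := he'.snoc hm
  have hpc : ∀ R, pts R = insert x₁ (pts S₀) →
      insert (x₁ + B) ((pts S₀).image (cut x₂ B)) = pts (mapArr (cut x₂ B) R) := by
    intro R hR
    rw [pts_mapArr, hR, Finset.image_insert, hc1]
  have hM' : shiftM T B M (x₁ + B) = T * shiftM T B M (e' 0) := by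
    have h2 : shiftM T B M x₂ = M x₂ := if_neg (not_le.2 hxB)
    rw [he0, ← hc1, shiftM_cut T M (by omega), if_pos hx, hM, h2]
  have hi1 := cut_injOn (t := x₂) (P := pts S₁) (fun p hp => hB p (hp1 ▸ hp))
  have hi2 := cut_injOn (t := x₂) (P := pts S₂) (fun p hp => hB p (hp2 ▸ hp))
  have he21 := hpc S₁ hp1 ▸ he2
  have he22 := hpc S₂ hp2 ▸ he2
  have hA := isArrow_lineCirc he21 (g1.mapArr hi1) (shiftM T B M) T
  have hl : Fin.snoc (α := fun _ => ℕ) e' (x₁ + B) (Fin.last _) = x₁ + B := Fin.snoc_last _ _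
  have hl0 : Fin.snoc (α := fun _ => ℕ) e' (x₁ + B) 0 = x₂ :=
    (Fin.snoc_castSucc (α := fun _ => ℕ) _ _ 0).trans he0
  have hfix : ∀ r, r ∈ pts S ∨ r = a ∨ r = b → cut x₂ B r ≠ x₁ + B ∧ cut x₂ B r ≠ x₂ := by
    intro r h
    have : r < x₁ ∨ x₂ < r := by
      rcases h with h | rfl | rfl
      · exact hxS r h
      · exact ha
      · exact hb
    have := hB0 r ((hp0 r).2 (.inr (by rwa [← or_assoc, or_comm])))
    unfold cut
    constructor <;> split_ifs <;> omega
  have hmS : ∀ f : ℕ → ℕ, (∀ r, r ≠ x₁ + B → r ≠ x₂ → f r = r) →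
      mapArr (f ∘ cut x₂ B) S = mapArr (cut x₂ B) S := fun f hf =>
    mapArr_congr fun r h => hf _ (hfix r (.inl h)).1 (hfix r (.inl h)).2
  have hfab : ∀ f : ℕ → ℕ, (∀ r, r ≠ x₁ + B → r ≠ x₂ → f r = r) →
      f (cut x₂ B a) = cut x₂ B a ∧ f (cut x₂ B b) = cut x₂ B b := fun f hf =>
    ⟨hf _ (hfix a (.inr (.inl rfl))).1 (hfix a (.inr (.inl rfl))).2,
      hf _ (hfix b (.inr (.inr rfl))).1 (hfix b (.inr (.inr rfl))).2⟩
  have hin1 : arw d (x₁ + B) (cut x₂ B a) ∈ mapArr (cut x₂ B) S₁ := by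
    rw [hS₁, mapArr_insert_arw, hc1]; exact Finset.mem_insert_self _ _
  have hin2 : arw d' x₂ (cut x₂ B b) ∈ mapArr (cut x₂ B) S₁ := by
    rw [hS₁, mapArr_insert_arw, mapArr_insert_arw, hc2]
    exact Finset.mem_insert_of_mem (Finset.mem_insert_self _ _)
  have hnice : (lineCirc (Fin.snoc (α := fun _ => ℕ) e' (x₁ + B)) (shiftM T B M) T
      (mapArr (cut x₂ B) S₁)).Nice := by
    constructor
    · simp only [lineCirc, finRotate_last, hl, hl0]
      rw [if_neg (by omega), hM', he0]
      group
    · intro h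
      simp only [Circ.inc, lineCirc, hl, hl0] at h
      exact (hfix a (.inr (.inl rfl))).2 ((g1.mapArr hi1).inc_unique h (arw_mem_or hin1))
  have hshr : ArrowRigid.shrink (⟨_, hA⟩ : ArrowRigid π (K + 2)) hnice =
      ρ • (⟨lineCirc e M T S₀, hD⟩ : DegRigid π (K + 1)) := by
    refine Subtype.ext ?_
    change Circ.shrink _ = (ρ : Equiv.Perm (Fin (K + 1))) • lineCirc e M T S₀
    have hf : ∀ r, r ≠ x₁ + B → r ≠ x₂ → merge (x₁ + B) x₂ r = r := fun r h _ => if_neg h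
    rw [shrink_lineCirc he' hm (hpc S₁ hp1 ▸ subset_rfl) hM', ← hρ S₀ subset_rfl, he0, mapArr_mapArr]
    congr 1
    rw [hS₁, hS₀]
    simp only [mapArr_insert_arw, hmS _ hf, Function.comp, hfab _ hf, hc1, hc2]
    rw [merge, if_pos rfl, merge, if_neg (by omega)]
  have hswap : ArrowRigid.swapEnds (⟨_, hA⟩ : ArrowRigid π (K + 2)) =
      (⟨_, isArrow_lineCirc he22 (g2.mapArr hi2) (shiftM T B M) T⟩ : ArrowRigid π (K + 2)) := by
    refine Subtype.ext ?_
    change Circ.swapEnds _ = _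
    have hf : ∀ r, r ≠ x₁ + B → r ≠ x₂ → Equiv.swap x₂ (x₁ + B) r = r := fun r h h' =>
      Equiv.swap_apply_of_ne_of_ne h' h
    rw [swapEnds_lineCirc he' hm, he0, mapArr_mapArr]
    congr 1
    rw [hS₁, hS₂]
    simp only [mapArr_insert_arw, hmS _ hf, Function.comp, hfab _ hf, hc1, hc2,
      Equiv.swap_apply_left, Equiv.swap_apply_right]
  rw [← wDegDiagram_smul _ ρ, ← hshr, dW_shrink, hswap, ← wOrbit_arrowDiagram,
    ← wOrbit_arrowDiagram, ← weight_wS, ← weight_wS, ← lineVal_eq (weight (wS w 𝒜w).1) he21 hA, ← lineVal_eq (weight (wS w 𝒜w).1) he22,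
    lineVal_cut _ g1 M T x₂ (fun p hp => hB p (hp1 ▸ hp)),
    lineVal_cut _ g2 M T x₂ (fun p hp => hB p (hp2 ▸ hp)),
    eps_last_lineCirc he21 (g1.mapArr hi1) (shiftM T B M) T (by rw [hl]; exact hin1) (by rw [hl0]; exact hin2)
      (by rw [hl0]; exact (hfix a (.inr (.inl rfl))).2), ordSign_cut haB hbB (by omega) (by omega)]

/-! ### Degenerate diagrams and triangles -/

namespace Circ

variable {N : ℕ} {X Y : Circ π N}

theorem Asymm.not_inc (h : X.Asymm) (i : Fin N) : ¬ X.inc i i := fun hi =>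
  h i i (hi.elim id id) (hi.elim id id)

/-- Two different arrows meet at the point `c`. -/
def IsCenter (X : Circ π N) (c : Fin N) : Prop := ∃ j k, j ≠ k ∧ X.inc c j ∧ X.inc c k

theorem IsDeg.of_center (h : X.IsDeg) {c j k : Fin N} (hjk : j ≠ k) (hj : X.inc c j)
    (hk : X.inc c k) : (∀ i, i ≠ c → ∃! j, X.inc i j) ∧ ∀ l, X.inc c l ↔ l = j ∨ l = k := by
  obtain ⟨-, c', h2, j', k', hjk', h3⟩ := h
  have hc : c = c' := by
    by_contra hc
    exact hjk ((h2 c hc).unique hj hk)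
  subst hc
  refine ⟨h2, fun l => ?_⟩
  have h4 := (h3 j).1 hj
  have h5 := (h3 k).1 hk
  rw [h3]
  rcases h4 with rfl | rfl <;> rcases h5 with rfl | rfl
  · exact absurd rfl hjk
  · exact Iff.rfl
  · exact or_comm
  · exact absurd rfl hjk

theorem IsDeg.center_unique (h : X.IsDeg) {c c' : Fin N} (hc : X.IsCenter c)
    (hc' : X.IsCenter c') : c' = c := by
  obtain ⟨j, k, hjk, hj, hk⟩ := hc
  obtain ⟨j', k', hjk', hj', hk'⟩ := hc'
  by_contra hne
  exact hjk' (((h.of_center hjk hj hk).1 c' hne).unique hj' hk')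

/-- The arrows between the points of the two arrows that meet at the degenerate point. -/
theorem IsDeg.arr_center (h : X.IsDeg) {c u v : Fin N} (huv : u ≠ v) (hu : X.inc c u)
    (hv : X.inc c v) : (X.arr u c ↔ ¬ X.arr c u) ∧ (X.arr v c ↔ ¬ X.arr c v) ∧
      ¬ X.arr u v ∧ ¬ X.arr v u := by
  have h1 := (h.of_center huv hu hv).1
  have hcu : u ≠ c := by rintro rfl; exact h.1.not_inc _ hu
  have hcv : v ≠ c := by rintro rfl; exact h.1.not_inc _ hv
  refine ⟨⟨fun a b => h.1 _ _ a b, fun a => hu.resolve_left a⟩,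
    ⟨fun a b => h.1 _ _ a b, fun a => hv.resolve_left a⟩, fun a => ?_, fun a => ?_⟩
  · exact hcv ((h1 u hcu).unique (.inl a) hu.symm)
  · exact hcv ((h1 u hcu).unique (.inr a) hu.symm)

/-- At the three ends of the two arrows that meet at `c`, the arrows are determined by the
directions of these two, since no arrow joins `u` and `v`. -/
theorem IsDeg.arr_eq (hX : X.IsDeg) (hY : Y.IsDeg) {c u v : Fin N} (huv : u ≠ v)
    (h1 : X.inc c u) (h2 : X.inc c v) (h3 : Y.inc c u) (h4 : Y.inc c v)
    (e1 : X.arr c u ↔ Y.arr c u) (e2 : X.arr c v ↔ Y.arr c v)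
    (h : ∀ i j, ¬ ((i = c ∨ i = u ∨ i = v) ∧ (j = c ∨ j = u ∨ j = v)) →
      (X.arr i j ↔ Y.arr i j)) : X.arr = Y.arr := by
  obtain ⟨a1, a2, a3, a4⟩ := hX.arr_center huv h1 h2
  obtain ⟨b1, b2, b3, b4⟩ := hY.arr_center huv h3 h4
  have aa : ∀ i, ¬ X.arr i i := fun i hi => hX.1 _ _ hi hi
  have bb : ∀ i, ¬ Y.arr i i := fun i hi => hY.1 _ _ hi hi
  funext i j
  refine propext ?_
  by_cases hij : (i = c ∨ i = u ∨ i = v) ∧ (j = c ∨ j = u ∨ j = v)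
  · rcases hij with ⟨rfl | rfl | rfl, rfl | rfl | rfl⟩
    · exact iff_of_false (aa _) (bb _)
    · exact e1
    · exact e2
    · rw [a1, b1, e1]
    · exact iff_of_false (aa _) (bb _)
    · exact iff_of_false a3 b3
    · rw [a2, b2, e2]
    · exact iff_of_false a4 b4
    · exact iff_of_false (aa _) (bb _)
  · exact h i j hij

/-- An arrow that arrives at a point and an arrow that leaves it. -/
def Mono (X : Circ π N) : Prop := ∃ c p q, X.arr p c ∧ X.arr c q

theorem Mono.conj {w : π →* ℤˣ} {g : Fin N → π} (hg : ∀ i j, X.arr i j → g i = g j)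
    (h : X.Mono) : (X.conj w g).Mono := by
  obtain ⟨c, p, q, hp, hq⟩ := h
  have e1 := hg _ _ hp
  have e2 := hg _ _ hq
  by_cases h : w (g c) = 1
  · exact ⟨c, p, q, by simpa [Circ.conj, e1, h] using hp, by simpa [Circ.conj, h] using hq⟩
  · exact ⟨c, q, p, by simpa [Circ.conj, ← e2, h] using hq, by simpa [Circ.conj, h] using hp⟩

theorem Mono.smul (h : X.Mono) (σ : Equiv.Perm (Fin N)) : (σ • X).Mono := by
  obtain ⟨c, p, q, hp, hq⟩ := h
  exact ⟨σ c, σ p, σ q, by simpa [smul_def] using hp, by simpa [smul_def] using hq⟩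

/-- The two arrows at the degenerate point are conjugated by the same element, so both or none are
reversed. Monotonicity is therefore a property of the w-orbit. -/
theorem mono_of_wDegDiagram_eq {w : π →* ℤˣ} {D E : DegRigid π N}
    (h : wDegDiagram w D = wDegDiagram w E) (hD : D.1.Mono) : E.1.Mono := by
  obtain ⟨ρ, g, hg, hE⟩ := wDegDiagram_eq h
  have h1 : ((ρ : Equiv.Perm (Fin N)) • E.1).Mono := hE ▸ hD.conj hg
  simpa using h1.smul (ρ : Equiv.Perm (Fin N))⁻¹

end Circ

section Triangle

variable {N : ℕ} {w : π →* ℤˣ} {D E F D' E' F' X Y : DegRigid π N}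

theorem IsTriangle.symm (h : IsTriangle D E F) : IsTriangle D F E := by
  obtain ⟨⟨h1, h2⟩, x, y, z, h3, h4⟩ := h
  refine ⟨⟨h2, h1⟩, x, z, y, fun i j hij => (h3 i j fun h => hij ?_).symm, ?_⟩
  · rwa [or_comm (a := i = z), or_comm (a := j = z)]
  · exact h4.imp (fun h => ⟨h.1.symm, h.2.symm⟩) fun h => ⟨h.1.symm, h.2.symm⟩

theorem IsTriangle.mono (h : IsTriangle D E F) : E.1.Mono := by
  obtain ⟨-, x, y, z, -, ⟨-, h, -⟩ | ⟨-, h, -⟩⟩ := h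
  · exact ⟨y, x, z, h⟩
  · exact ⟨y, z, x, h.symm⟩

/-- The end points of the arrows of a triangle are distinct. -/
theorem IsTriangle.ne {x y z : Fin N} (h : ((D.1.arr x y ∧ D.1.arr x z) ∧
      (E.1.arr x y ∧ E.1.arr y z) ∧ (F.1.arr x z ∧ F.1.arr z y)) ∨
    ((D.1.arr y x ∧ D.1.arr z x) ∧ (E.1.arr y x ∧ E.1.arr z y) ∧ (F.1.arr z x ∧ F.1.arr y z))) :
    x ≠ y ∧ y ≠ z ∧ x ≠ z := by
  have hi : ∀ (A : DegRigid π N) {i j}, A.1.inc i j → i ≠ j := by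
    rintro A i _ h rfl; exact A.2.1.not_inc _ h
  rcases h with ⟨h1, h2, h3⟩ | ⟨h1, h2, h3⟩
  · exact ⟨hi D (.inl h1.1), hi E (.inl h2.2), hi D (.inl h1.2)⟩
  · exact ⟨hi D (.inr h1.1), hi E (.inr h2.2), hi D (.inr h1.2)⟩

theorem IsTriangle.not_mono (h : IsTriangle D E F) : ¬ D.1.Mono := by
  obtain ⟨-, x, y, z, -, h⟩ := h
  obtain ⟨-, hyz, -⟩ := IsTriangle.ne h
  rintro ⟨c, p, q, hp, hq⟩
  have hpq : p ≠ q := by rintro rfl; exact D.2.1 _ _ hp hq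
  have hinc : D.1.inc x y ∧ D.1.inc x z := by
    rcases h with ⟨h1, -⟩ | ⟨h1, -⟩
    · exact ⟨.inl h1.1, .inl h1.2⟩
    · exact ⟨.inr h1.1, .inr h1.2⟩
  obtain rfl := D.2.center_unique ⟨y, z, hyz, hinc⟩ ⟨p, q, hpq, .inr hp, .inl hq⟩
  have h5 := (D.2.of_center hyz hinc.1 hinc.2).2
  rcases h with ⟨h1, -⟩ | ⟨h1, -⟩
  · rcases (h5 p).1 (.inr hp) with rfl | rfl
    · exact D.2.1 _ _ hp h1.1
    · exact D.2.1 _ _ hp h1.2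
  · rcases (h5 q).1 (.inl hq) with rfl | rfl
    · exact D.2.1 _ _ hq h1.1
    · exact D.2.1 _ _ hq h1.2

theorem DegRigid.ext' (hm : X.1.mark = Y.1.mark) (ha : X.1.arr = Y.1.arr) : X = Y := by
  refine Subtype.ext (Circ.ext ha hm (funext fun h => ?_))
  subst h
  exact X.2.2.choose.elim0

/-- The two monotonic diagrams in a triangle relation are determined by the other one. -/
theorem IsTriangle.unique (h : IsTriangle D E F) (h' : IsTriangle D E' F') :
    (E' = E ∧ F' = F) ∨ (E' = F ∧ F' = E) := by
  have key : ∀ {E E' : DegRigid π N} {x y z : Fin N},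
      E.1.mark = D.1.mark → E'.1.mark = D.1.mark →
      (∀ i j, ¬ ((i = x ∨ i = y ∨ i = z) ∧ (j = x ∨ j = y ∨ j = z)) →
        (E.1.arr i j ↔ D.1.arr i j)) →
      (∀ i j, ¬ ((i = x ∨ i = y ∨ i = z) ∧ (j = x ∨ j = y ∨ j = z)) →
        (E'.1.arr i j ↔ D.1.arr i j)) →
      x ≠ z →
      ((E.1.arr x y ∧ E.1.arr y z) ∧ (E'.1.arr x y ∧ E'.1.arr y z)) ∨
      ((E.1.arr y x ∧ E.1.arr z y) ∧ (E'.1.arr y x ∧ E'.1.arr z y)) → E' = E := by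
    intro E E' x y z hm hm' ho ho' hxz ha
    refine DegRigid.ext' (hm'.trans hm.symm) ?_
    have ho2 : ∀ i j, ¬ ((i = y ∨ i = x ∨ i = z) ∧ (j = y ∨ j = x ∨ j = z)) →
        (E'.1.arr i j ↔ E.1.arr i j) := by
      intro i j hij
      have : ¬ ((i = x ∨ i = y ∨ i = z) ∧ (j = x ∨ j = y ∨ j = z)) := by
        rwa [or_left_comm, or_left_comm (a := j = x)]
      rw [ho i j this, ho' i j this]
    rcases ha with ⟨a, b⟩ | ⟨a, b⟩
    · exact E'.2.arr_eq E.2 hxz (.inr b.1) (.inl b.2) (.inr a.1) (.inl a.2)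
        (iff_of_false (E'.2.1 _ _ b.1) (E.2.1 _ _ a.1)) (iff_of_true b.2 a.2) ho2
    · exact E'.2.arr_eq E.2 hxz (.inl b.1) (.inr b.2) (.inl a.1) (.inr a.2)
        (iff_of_true b.1 a.1) (iff_of_false (E'.2.1 _ _ b.2) (E.2.1 _ _ a.2)) ho2
  obtain ⟨⟨h1, h2⟩, x, y, z, h3, h4⟩ := h
  obtain ⟨⟨h1', h2'⟩, x', y', z', h3', h4'⟩ := h'
  obtain ⟨hxy, hyz, hxz⟩ := IsTriangle.ne h4
  obtain ⟨-, hyz', -⟩ := IsTriangle.ne h4'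
  have inc : ∀ {E F : DegRigid π N} {x y z : Fin N}, ((D.1.arr x y ∧ D.1.arr x z) ∧
      (E.1.arr x y ∧ E.1.arr y z) ∧ (F.1.arr x z ∧ F.1.arr z y)) ∨
      ((D.1.arr y x ∧ D.1.arr z x) ∧ (E.1.arr y x ∧ E.1.arr z y) ∧
        (F.1.arr z x ∧ F.1.arr y z)) → D.1.inc x y ∧ D.1.inc x z := by
    rintro E F x y z (⟨h1, -⟩ | ⟨h1, -⟩)
    · exact ⟨.inl h1.1, .inl h1.2⟩
    · exact ⟨.inr h1.1, .inr h1.2⟩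
  obtain rfl := D.2.center_unique ⟨y, z, hyz, inc h4⟩ ⟨y', z', hyz', inc h4'⟩
  have h5 := (D.2.of_center hyz (inc h4).1 (inc h4).2).2
  have hy' := (h5 y').1 (inc h4').1
  have hz' := (h5 z').1 (inc h4').2
  have hsw : ∀ {y z : Fin N}, (∀ i j, ¬ ((i = x' ∨ i = y ∨ i = z) ∧ (j = x' ∨ j = y ∨ j = z)) →
      ((E.1.arr i j ↔ D.1.arr i j) ∧ (F.1.arr i j ↔ D.1.arr i j))) →
      ∀ i j, ¬ ((i = x' ∨ i = z ∨ i = y) ∧ (j = x' ∨ j = z ∨ j = y)) →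
      ((E.1.arr i j ↔ D.1.arr i j) ∧ (F.1.arr i j ↔ D.1.arr i j)) := by
    intro y z h i j hij
    exact h i j fun h => hij (by rwa [or_comm (a := i = z), or_comm (a := j = z)])
  rcases hy' with rfl | rfl <;> rcases hz' with rfl | rfl
  · exact absurd rfl hyz'
  · refine .inl ⟨key h1 h1' (fun i j hij => (h3 i j hij).1) (fun i j hij => (h3' i j hij).1)
      hxz ?_, key h2 h2' (x := x') (y := z') (z := y')
        (fun i j hij => (hsw h3 i j hij).2) (fun i j hij => ?_) hxy ?_⟩
    · rcases h4 with h4 | h4 <;> rcases h4' with h4' | h4'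
      · exact .inl ⟨h4.2.1, h4'.2.1⟩
      · exact absurd h4'.1.1 (D.2.1 _ _ h4.1.1)
      · exact absurd h4.1.1 (D.2.1 _ _ h4'.1.1)
      · exact .inr ⟨h4.2.1, h4'.2.1⟩
    · exact (h3' i j fun h => hij (by rwa [or_comm (a := i = z'), or_comm (a := j = z')])).2
    · rcases h4 with h4 | h4 <;> rcases h4' with h4' | h4'
      · exact .inl ⟨h4.2.2, h4'.2.2⟩
      · exact absurd h4'.1.1 (D.2.1 _ _ h4.1.1)
      · exact absurd h4.1.1 (D.2.1 _ _ h4'.1.1)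
      · exact .inr ⟨h4.2.2, h4'.2.2⟩
  · refine .inr ⟨key h2 h1' (x := x') (y := y') (z := z')
        (fun i j hij => (hsw h3 i j hij).2) (fun i j hij => (h3' i j hij).1) hxy ?_,
        key h1 h2' (fun i j hij => (h3 i j hij).1) (fun i j hij => ?_) hxz ?_⟩
    · rcases h4 with h4 | h4 <;> rcases h4' with h4' | h4'
      · exact .inl ⟨h4.2.2, h4'.2.1⟩
      · exact absurd h4'.1.1 (D.2.1 _ _ h4.1.2)
      · exact absurd h4.1.1 (D.2.1 _ _ h4'.1.2)
      · exact .inr ⟨h4.2.2, h4'.2.1⟩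
    · exact (h3' i j fun h => hij (by rwa [or_comm (a := i = z'), or_comm (a := j = z')])).2
    · rcases h4 with h4 | h4 <;> rcases h4' with h4' | h4'
      · exact .inl ⟨h4.2.1, h4'.2.2⟩
      · exact absurd h4'.1.1 (D.2.1 _ _ h4.1.2)
      · exact absurd h4.1.1 (D.2.1 _ _ h4'.1.2)
      · exact .inr ⟨h4.2.1, h4'.2.2⟩
  · exact absurd rfl hyz'

end Triangle

section Transport

variable {N : ℕ} {w : π →* ℤˣ} {D E F D₁ D₂ F₁ F₂ A B X Y : DegRigid π N}

/-- `B` results from `A` by `w`-moves and the rotation `ρ`. -/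
def Moved (w : π →* ℤˣ) (ρ : Rot N) (A B : DegRigid π N) : Prop :=
  wDegDiagram w A = wDegDiagram w B ∧ ∀ i j, B.1.inc ((ρ : Equiv.Perm (Fin N)) i)
    ((ρ : Equiv.Perm (Fin N)) j) ↔ A.1.inc i j

theorem Moved.isCenter {ρ : Rot N} (h : Moved w ρ A B) {c : Fin N} (hc : A.1.IsCenter c) :
    B.1.IsCenter ((ρ : Equiv.Perm (Fin N)) c) := by
  obtain ⟨j, k, hjk, hj, hk⟩ := hc
  exact ⟨_, _, (ρ : Equiv.Perm (Fin N)).injective.ne hjk, (h.2 _ _).2 hj, (h.2 _ _).2 hk⟩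

/-- A rotation that moves a degenerate point to itself is trivial. -/
theorem Moved.eq_one {ρ : Rot N} (h : Moved w ρ A B) {c : Fin N} (hA : A.1.IsCenter c)
    (hB : B.1.IsCenter c) : ρ = 1 :=
  rot_eq_one_of_fixed (B.2.center_unique hB (h.isCenter hA))

theorem moved_conj_smul (A : DegRigid π N) (ρ : Rot N) (g : Fin N → π)
    (hg : ∀ i j, (ρ • A).1.arr i j → g i = g j) : Moved w ρ A ((ρ • A).conj w g hg) := by
  refine ⟨by rw [wDegDiagram_conj, wDegDiagram_smul], fun i j => ?_⟩
  refine (Circ.inc_conj hg _ _).trans ?_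
  change (A.1.arr ((ρ : Equiv.Perm (Fin N))⁻¹ _) ((ρ : Equiv.Perm (Fin N))⁻¹ _) ∨
    A.1.arr ((ρ : Equiv.Perm (Fin N))⁻¹ _) ((ρ : Equiv.Perm (Fin N))⁻¹ _)) ↔ _
  simp [Circ.inc]

/-- If one of the diagrams of a triangle is equivalent to `X`, the triangle can be moved so that
this diagram becomes `X`. -/
theorem IsTriangle.transport (hT : IsTriangle D E F) (hA : A = D ∨ A = E ∨ A = F)
    (h : wDegDiagram w A = wDegDiagram w X) :
    ∃ (ρ : Rot N) (D' E' F' : DegRigid π N), IsTriangle D' E' F' ∧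
      (A = D → D' = X) ∧ (A = E → E' = X) ∧
      Moved w ρ D D' ∧ Moved w ρ E E' ∧ Moved w ρ F F' := by
  obtain ⟨ρ, hρ⟩ := wDegDiagram_eq h.symm
  obtain ⟨g, hg, hX⟩ := hρ.symm
  have hT' := hT.smul ρ
  have hc := hT'.const g
  have hD : ∀ i j, (ρ • D).1.arr i j → g i = g j := by
    rcases hA with rfl | rfl | rfl
    · exact hg
    · exact hc.1.1 hg
    · exact hc.2.1 hg
  have hE := hc.1.2 hD
  have hF := hc.2.2 hD
  refine ⟨ρ, _, _, _, hT'.conj (w := w) hD hE hF, ?_, ?_, moved_conj_smul D ρ g hD,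
    moved_conj_smul E ρ g hE, moved_conj_smul F ρ g hF⟩
  · rintro rfl
    exact Subtype.ext hX.symm
  · rintro rfl
    exact Subtype.ext hX.symm

theorem IsTriangle.centers (h : IsTriangle D E F) : ∃ a b c, D.1.IsCenter a ∧ E.1.IsCenter b ∧
    F.1.IsCenter c ∧ b ≠ c := by
  obtain ⟨-, x, y, z, -, h⟩ := h
  obtain ⟨hxy, hyz, hxz⟩ := IsTriangle.ne h
  refine ⟨x, y, z, ?_⟩
  rcases h with ⟨h1, h2, h3⟩ | ⟨h1, h2, h3⟩
  · exact ⟨⟨y, z, hyz, .inl h1.1, .inl h1.2⟩, ⟨x, z, hxz, .inr h2.1, .inl h2.2⟩,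
      ⟨x, y, hxy, .inr h3.1, .inl h3.2⟩, hyz⟩
  · exact ⟨⟨y, z, hyz, .inr h1.1, .inr h1.2⟩, ⟨x, z, hxz, .inl h2.1, .inr h2.2⟩,
      ⟨x, y, hxy, .inl h3.1, .inr h3.2⟩, hyz⟩

/-- An equivalence between `D₁` and `D₂` carries one triangle to the other. It cannot take `Y` to
`Y`: the rotation would fix the degenerate point of `Y` and be trivial, against `a ≠ b`. So it
identifies `Y` with `F₁`. The converse is the same argument, with the degenerate points of `Y` and
`F₁`. -/
theorem triangle_equiv_iff (hU : ∀ D F, IsTriangle D Y F → D = D₁ ∨ D = D₂)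
    (h1 : IsTriangle D₁ Y F₁) (h2 : IsTriangle D₂ Y F₂) {a b : Fin N} (ha : D₁.1.IsCenter a)
    (hb : D₂.1.IsCenter b) (hab : a ≠ b) :
    wDegDiagram w D₁ = wDegDiagram w D₂ ↔ wDegDiagram w F₁ = wDegDiagram w Y := by
  obtain ⟨-, c, f, -, hc, hf, hcf⟩ := h1.centers
  constructor
  · intro h
    obtain ⟨ρ, D', Y', F', hT, hD', -, m1, m2, -⟩ := h2.transport (.inl rfl) h.symm
    obtain rfl := hD' rfl
    rcases h1.unique hT with ⟨rfl, -⟩ | ⟨rfl, -⟩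
    · obtain rfl := m2.eq_one hc hc
      exact absurd (D'.2.center_unique ha (m1.isCenter hb)).symm hab
    · exact m2.1.symm
  · intro h
    obtain ⟨ρ, D', Y', F', hT, -, hY', m1, m2, -⟩ := h1.symm.transport (.inr (.inl rfl)) h
    obtain rfl := hY' rfl
    rcases hU _ _ hT with rfl | rfl
    · obtain rfl := m1.eq_one ha ha
      exact absurd (Y'.2.center_unique hc (m2.isCenter hf)).symm hcf
    · exact m1.1

/-- Each triangle relator vanishes on the sum of a monotonic diagram and of the two non monotonic
diagrams that form a triangle with it. -/
theorem relator_sum_eq_zero (hU : ∀ D F, IsTriangle D Y F → D = D₁ ∨ D = D₂)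
    (h1 : IsTriangle D₁ Y F₁) (h2 : IsTriangle D₂ Y F₂) {a b : Fin N} (ha : D₁.1.IsCenter a)
    (hb : D₂.1.IsCenter b) (hab : a ≠ b) {r : WDegDiagram w →₀ ℚ} (hr : r ∈ triangleRelators w) :
    r (wDegDiagram w D₁) + r (wDegDiagram w Y) + r (wDegDiagram w D₂) = 0 := by
  classical
  obtain ⟨M, D, E, F, hT, rfl⟩ := hr
  by_cases hM : M = N
  · subst hM
    have z : ∀ {A B : DegRigid π M}, A.1.Mono → ¬ B.1.Mono →
        wDegDiagram w A ≠ wDegDiagram w B := fun hA hB h =>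
      hB (Circ.mono_of_wDegDiagram_eq h hA)
    have z' : ∀ {A B : DegRigid π M}, A.1.Mono → ¬ B.1.Mono →
        wDegDiagram w B ≠ wDegDiagram w A := fun hA hB => (z hA hB).symm
    have key : ∀ {D₁ D₂ F₁ F₂ : DegRigid π M} {a b : Fin M},
        (∀ D F, IsTriangle D Y F → D = D₁ ∨ D = D₂) → IsTriangle D₁ Y F₁ → IsTriangle D₂ Y F₂ →
        D₁.1.IsCenter a → D₂.1.IsCenter b → a ≠ b → wDegDiagram w D = wDegDiagram w D₁ →
        ((if wDegDiagram w D = wDegDiagram w D₁ then 1 else 0) +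
          (if wDegDiagram w D = wDegDiagram w D₂ then 1 else 0) : ℚ) =
        (if wDegDiagram w E = wDegDiagram w Y then 1 else 0) +
          (if wDegDiagram w F = wDegDiagram w Y then 1 else 0) := by
      intro D₁ D₂ F₁ F₂ a b hU h1 h2 ha hb hab h
      obtain ⟨ρ, D', E', F', hT', hD', -, -, m2, m3⟩ := hT.transport (.inl rfl) h
      obtain rfl := hD' rfl
      -- If `D₁` and `D₂` are one w-orbit, it is counted twice on the left; exactly then `F₁` is the
      -- w-orbit of `Y`, and the relator contains `Y` twice.
      have hi := triangle_equiv_iff (w := w) hU h1 h2 ha hb hab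
      rw [h, if_pos rfl, m2.1, m3.1, if_congr hi rfl rfl]
      rcases h1.unique hT' with ⟨rfl, rfl⟩ | ⟨rfl, rfl⟩
      · rw [if_pos rfl]
      · rw [if_pos rfl, add_comm]
    simp only [Finsupp.sub_apply, Finsupp.single_apply]
    rw [if_neg (z hT.mono h1.not_mono), if_neg (z hT.symm.mono h1.not_mono),
      if_neg (z hT.mono h2.not_mono), if_neg (z hT.symm.mono h2.not_mono),
      if_neg (z' h1.mono hT.not_mono)]
    have : ((if wDegDiagram w D = wDegDiagram w D₁ then 1 else 0) +
          (if wDegDiagram w D = wDegDiagram w D₂ then 1 else 0) : ℚ) =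
        (if wDegDiagram w E = wDegDiagram w Y then 1 else 0) +
          (if wDegDiagram w F = wDegDiagram w Y then 1 else 0) := by
      by_cases c1 : wDegDiagram w D = wDegDiagram w D₁
      · exact key hU h1 h2 ha hb hab c1
      by_cases c2 : wDegDiagram w D = wDegDiagram w D₂
      · rw [add_comm]
        exact key (fun D F h => (hU D F h).symm) h2 h1 hb ha hab.symm c2
      -- A triangle that contains the w-orbit of `Y` can be moved so that it contains `Y` itself,
      -- and then its non monotonic diagram is `D₁` or `D₂`.
      have c3 : ∀ {E F : DegRigid π M}, IsTriangle D E F →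
          wDegDiagram w E ≠ wDegDiagram w Y := by
        intro E F hT hE
        obtain ⟨ρ, D', E', F', hT', -, hE', m, -⟩ := hT.transport (.inr (.inl rfl)) hE
        obtain rfl := hE' rfl
        rcases hU _ _ hT' with rfl | rfl
        · exact c1 m.1
        · exact c2 m.1
      rw [if_neg c1, if_neg c2, if_neg (c3 hT), if_neg (c3 hT.symm)]
    linarith
  · have z : ∀ (A : DegRigid π M) (B : DegRigid π N), wDegDiagram w A ≠ wDegDiagram w B :=
      fun A B h => hM (congrArg Sigma.fst h)
    simp [z]

/-- The arrows `p → c → q` of `Y` are replaced by `p → c` and `p → q`. -/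
def IsOut (D Y : DegRigid π N) (p c q : Fin N) : Prop :=
  D.1.mark = Y.1.mark ∧ (∀ i j, ¬ ((i = p ∨ i = c ∨ i = q) ∧ (j = p ∨ j = c ∨ j = q)) →
    (D.1.arr i j ↔ Y.1.arr i j)) ∧ D.1.arr p c ∧ D.1.arr p q

/-- The arrows `p → c → q` of `Y` are replaced by `c → q` and `p → q`. -/
def IsIn (D Y : DegRigid π N) (p c q : Fin N) : Prop :=
  D.1.mark = Y.1.mark ∧ (∀ i j, ¬ ((i = q ∨ i = c ∨ i = p) ∧ (j = q ∨ j = c ∨ j = p)) →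
    (D.1.arr i j ↔ Y.1.arr i j)) ∧ D.1.arr c q ∧ D.1.arr p q

/-- The degenerate point of `D` has to be the source `p` or the sink `q` of the path `p → c → q`,
according to the two kinds of triangle relations. -/
theorem IsTriangle.isOut_or_isIn (h : IsTriangle D Y F) {p c q : Fin N} (hp : Y.1.arr p c)
    (hq : Y.1.arr c q) : IsOut D Y p c q ∨ IsIn D Y p c q := by
  obtain ⟨⟨h1, -⟩, x, y, z, h3, h4⟩ := h
  obtain ⟨-, -, hxz⟩ := IsTriangle.ne h4
  have hpq : p ≠ q := by rintro rfl; exact Y.2.1 _ _ hp hq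
  have hY := (Y.2.of_center hpq (.inr hp) (.inl hq)).2
  have hc : Y.1.IsCenter c := ⟨p, q, hpq, .inr hp, .inl hq⟩
  rcases h4 with ⟨d, e, -⟩ | ⟨d, e, -⟩
  · obtain rfl := Y.2.center_unique hc ⟨x, z, hxz, .inr e.1, .inl e.2⟩
    have hx : x = p := ((hY x).1 (.inr e.1)).resolve_right fun h => Y.2.1 _ _ hq (h ▸ e.1)
    have hz : z = q := ((hY z).1 (.inl e.2)).resolve_left fun h => Y.2.1 _ _ hp (h ▸ e.2)
    subst hx hz
    exact .inl ⟨h1.symm, fun i j hij => (h3 i j hij).1.symm, d⟩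
  · obtain rfl := Y.2.center_unique hc ⟨x, z, hxz, .inl e.1, .inr e.2⟩
    have hx : x = q := ((hY x).1 (.inl e.1)).resolve_left fun h => Y.2.1 _ _ hp (h ▸ e.1)
    have hz : z = p := ((hY z).1 (.inr e.2)).resolve_right fun h => Y.2.1 _ _ hq (h ▸ e.2)
    subst hx hz
    exact .inr ⟨h1.symm, fun i j hij => (h3 i j hij).1.symm, d⟩

theorem IsOut.unique {p c q : Fin N} (hcq : c ≠ q) (h : IsOut A Y p c q) (h' : IsOut B Y p c q) :
    A = B := by
  obtain ⟨m, o, a, b⟩ := h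
  obtain ⟨m', o', a', b'⟩ := h'
  exact DegRigid.ext' (m.trans m'.symm) (A.2.arr_eq B.2 hcq (.inl a) (.inl b) (.inl a') (.inl b')
    (iff_of_true a a') (iff_of_true b b') fun i j hij => (o i j hij).trans (o' i j hij).symm)

theorem IsIn.unique {p c q : Fin N} (hcp : c ≠ p) (h : IsIn A Y p c q) (h' : IsIn B Y p c q) :
    A = B := by
  obtain ⟨m, o, a, b⟩ := h
  obtain ⟨m', o', a', b'⟩ := h'
  exact DegRigid.ext' (m.trans m'.symm) (A.2.arr_eq B.2 hcp (.inr a) (.inr b) (.inr a') (.inr b')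
    (iff_of_false (A.2.1 _ _ a) (B.2.1 _ _ a')) (iff_of_false (A.2.1 _ _ b) (B.2.1 _ _ b'))
    fun i j hij => (o i j hij).trans (o' i j hij).symm)

theorem IsTriangle.eq_or_eq {p c q : Fin N} (hp : Y.1.arr p c) (hq : Y.1.arr c q)
    (h1 : IsOut D₁ Y p c q) (h2 : IsIn D₂ Y p c q) (h : IsTriangle D Y F) : D = D₁ ∨ D = D₂ := by
  refine (h.isOut_or_isIn hp hq).imp (fun h => h.unique ?_ h1) fun h => h.unique ?_ h2
  · rintro rfl; exact Y.2.1.not_inc _ (.inl hq)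
  · rintro rfl; exact Y.2.1.not_inc _ (.inl hp)

theorem IsOut.relator_sum {p c q : Fin N} (hp : Y.1.arr p c) (hq : Y.1.arr c q)
    (o1 : IsOut D₁ Y p c q) (o2 : IsIn D₂ Y p c q) (h1 : IsTriangle D₁ Y F₁)
    (h2 : IsTriangle D₂ Y F₂) {r : WDegDiagram w →₀ ℚ} (hr : r ∈ triangleRelators w) :
    r (wDegDiagram w D₁) + r (wDegDiagram w Y) + r (wDegDiagram w D₂) = 0 := by
  have hi : ∀ (A : DegRigid π N) {i j}, A.1.arr i j → i ≠ j := by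
    rintro A i _ h rfl; exact A.2.1.not_inc _ (.inl h)
  exact relator_sum_eq_zero (fun D F h => h.eq_or_eq hp hq o1 o2) h1 h2
    ⟨c, q, hi Y hq, .inl o1.2.2.1, .inl o1.2.2.2⟩ ⟨p, c, hi Y hp, .inr o2.2.2.2, .inr o2.2.2.1⟩
    (hi D₁ o1.2.2.2) hr

end Transport

/-! ### Degenerate diagrams on a line -/

theorem Good.asymm {S : Finset (ℕ × ℕ)} (h : Good S) {p q : ℕ} (h1 : (p, q) ∈ S) :
    (q, p) ∉ S := by
  intro h2
  by_cases hne : (p, q) = (q, p)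
  · exact h.irrefl _ h1 (congrArg Prod.fst hne)
  · exact (h.disj _ h1 _ h2 hne).2.1 rfl

theorem inc_arw {S : Finset (ℕ × ℕ)} {d d' : Bool} {c u v p q : ℕ} :
    ((p, q) ∈ insert (arw d c u) (insert (arw d' c v) S) ∨
      (q, p) ∈ insert (arw d c u) (insert (arw d' c v) S)) ↔
    (((p, q) ∈ insert (arw d c u) S ∨ (q, p) ∈ insert (arw d c u) S) ∨
      ((p, q) ∈ insert (arw d' c v) S ∨ (q, p) ∈ insert (arw d' c v) S)) := by
  simp only [Finset.mem_insert]
  tauto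

theorem inc_insert_arw {S : Finset (ℕ × ℕ)} {d : Bool} {c u p q : ℕ} :
    ((p, q) ∈ insert (arw d c u) S ∨ (q, p) ∈ insert (arw d c u) S) ↔
      (p = c ∧ q = u) ∨ (p = u ∧ q = c) ∨ ((p, q) ∈ S ∨ (q, p) ∈ S) := by
  cases d <;> simp only [Finset.mem_insert, arw, cond, Prod.mk.injEq] <;> tauto

theorem opposite_ne_arw {d d' : Bool} {c u v p q : ℕ} (_ : c ≠ u) (_ : c ≠ v) (_ : u ≠ v)
    (h1 : (p, q) = arw d c u) : (q, p) ≠ arw d' c v := by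
  intro h2
  cases d <;> cases d' <;> simp only [arw, cond, Prod.mk.injEq] at h1 h2 <;> omega

/-- Each of the two arrows at `c` forms a good set together with `S`, and a point other than `c`
meets at most one of these arrows. Uniqueness of its partner follows from one of the two good sets.
-/
theorem isDeg_lineCirc {N : ℕ} {e : Fin N → ℕ} {S : Finset (ℕ × ℕ)} {d d' : Bool} {c u v : ℕ}
    (hS : Good S) (hc : c ∉ pts S) (hu : u ∉ pts S) (hv : v ∉ pts S) (hcu : c ≠ u) (hcv : c ≠ v)
    (huv : u ≠ v) (he : Enum e (insert c (insert u (insert v (pts S))))) (M : ℕ → π) (T : π) :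
    (lineCirc e M T (insert (arw d c u) (insert (arw d' c v) S))).IsDeg := by
  have g1 : Good (insert (arw d c u) S) := good_insert_arw hS hcu hc hu
  have g2 : Good (insert (arw d' c v) S) := good_insert_arw hS hcv hc hv
  have hin : ∀ {p q}, ((p, q) ∈ S ∨ (q, p) ∈ S) → p ∈ pts S ∧ q ∈ pts S := by
    rintro p q (h | h)
    · exact ⟨fst_mem_pts h, snd_mem_pts h⟩
    · exact ⟨snd_mem_pts h, fst_mem_pts h⟩
  have hinj := he.mono.injective
  obtain ⟨ic, hic⟩ := (he.mem c).1 (by simp)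
  obtain ⟨iu, hiu⟩ := (he.mem u).1 (by simp)
  obtain ⟨iv, hiv⟩ := (he.mem v).1 (by simp)
  refine ⟨fun i j h1 h2 => ?_, ic, fun i hi => ?_, iu, iv, ?_, fun l => ?_⟩
  · simp only [lineCirc] at h1 h2
    generalize e i = p at h1 h2
    generalize e j = q at h1 h2
    have a1 : arw d c u ∈ insert (arw d c u) S := Finset.mem_insert_self _ _
    have a2 : arw d' c v ∈ insert (arw d' c v) S := Finset.mem_insert_self _ _
    rcases Finset.mem_insert.1 h1 with h1 | h1
    · rcases Finset.mem_insert.1 h2 with h2 | h2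
      · rw [← h1] at g1 a1 h2
        exact g1.irrefl _ a1 (Prod.mk.inj h2).2
      · rcases Finset.mem_insert.1 h2 with h2 | h2
        · exact opposite_ne_arw hcu hcv huv h1 h2
        · exact g1.asymm (h1.symm ▸ a1) (Finset.mem_insert_of_mem h2)
    · rcases Finset.mem_insert.1 h2 with h2 | h2
      · rcases Finset.mem_insert.1 h1 with h1 | h1
        · exact opposite_ne_arw hcu hcv huv h2 h1
        · exact g1.asymm (h2.symm ▸ a1) (Finset.mem_insert_of_mem h1)
      · exact g2.asymm h1 h2
  · have hi' : e i ≠ c := fun h => hi (hinj (h.trans hic.symm))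
    have hex : ∃ q, q ∈ insert c (insert u (insert v (pts S))) ∧
        ((e i, q) ∈ insert (arw d c u) (insert (arw d' c v) S) ∨
          (q, e i) ∈ insert (arw d c u) (insert (arw d' c v) S)) := by
      simp only [inc_insert_arw]
      have := he.mem' i
      simp only [Finset.mem_insert] at this
      rcases this with h | h | h | h
      · exact absurd h hi'
      · exact ⟨c, by simp, .inr (.inl ⟨h, rfl⟩)⟩
      · exact ⟨c, by simp, .inr (.inr (.inr (.inl ⟨h, rfl⟩)))⟩
      · obtain ⟨a, ha, h | h⟩ := mem_pts.1 h
        · exact ⟨a.2, by simp [snd_mem_pts ha], .inr (.inr (.inr (.inr (.inl (h ▸ ha)))))⟩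
        · exact ⟨a.1, by simp [fst_mem_pts ha], .inr (.inr (.inr (.inr (.inr (h ▸ ha)))))⟩
    obtain ⟨q, hq, hq2⟩ := hex
    obtain ⟨j, rfl⟩ := (he.mem q).1 hq
    refine ⟨j, hq2, fun k hk => hinj ?_⟩
    have hk := inc_arw.1 hk
    have hq2 := inc_arw.1 hq2
    by_cases h : e i = v
    · have cl : ∀ {r}, ((e i, r) ∈ insert (arw d c u) S ∨ (r, e i) ∈ insert (arw d c u) S) →
          False := by
        intro r hr
        rcases inc_insert_arw.1 hr with h1 | h1 | h1
        · exact hi' h1.1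
        · exact huv (h1.1.symm.trans h)
        · exact hv (h ▸ (hin h1).1)
      exact g2.inc_unique (hq2.resolve_left cl) (hk.resolve_left cl)
    · have cl : ∀ {r}, ((e i, r) ∈ insert (arw d' c v) S ∨ (r, e i) ∈ insert (arw d' c v) S) →
          (e i, r) ∈ insert (arw d c u) S ∨ (r, e i) ∈ insert (arw d c u) S := by
        intro r hr
        rcases inc_insert_arw.1 hr with h1 | h1 | h1
        · exact absurd h1.1 hi'
        · exact absurd h1.1 h
        · exact inc_insert_arw.2 (.inr (.inr h1))
      exact g1.inc_unique (hq2.elim id cl) (hk.elim id cl)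
  · rintro rfl
    exact huv (hiu.symm.trans hiv)
  · have h1 : l = iu ↔ e l = u := by rw [← hiu, hinj.eq_iff]
    have h2 : l = iv ↔ e l = v := by rw [← hiv, hinj.eq_iff]
    rw [h1, h2]
    refine inc_arw.trans ?_
    rw [hic, inc_insert_arw, inc_insert_arw]
    have h3 : ¬ ((c, e l) ∈ S ∨ (e l, c) ∈ S) := fun h => hc (hin h).1
    simp [h3, hcu, hcv]

theorem mem_insert_two_iff {N : ℕ} {e : Fin N → ℕ} (he : Function.Injective e)
    {S : Finset (ℕ × ℕ)} {P : Fin N → Prop} {d d' : Bool} {a b a' b' i j : Fin N} (ha : P a)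
    (hb : P b) (ha' : P a') (hb' : P b') (hij : ¬ (P i ∧ P j)) :
    (e i, e j) ∈ insert (arw d (e a) (e b)) (insert (arw d' (e a') (e b')) S) ↔
      (e i, e j) ∈ S := by
  have h : ∀ {d : Bool} {a b : Fin N}, P a → P b → (e i, e j) ≠ arw d (e a) (e b) := by
    intro d a b ha hb h
    cases d <;> simp only [arw, cond, Prod.mk.injEq, he.eq_iff] at h <;> obtain ⟨rfl, rfl⟩ := h
    · exact hij ⟨hb, ha⟩
    · exact hij ⟨ha, hb⟩
  rw [Finset.mem_insert, Finset.mem_insert, or_iff_right (h ha hb), or_iff_right (h ha' hb')]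

theorem arw_swap (d : Bool) (p q : ℕ) : arw d p q = arw (!d) q p := by cases d <;> rfl

/-- A triangle on a line. -/
theorem exists_triangle_line {N : ℕ} {e : Fin N → ℕ} {S : Finset (ℕ × ℕ)} {x y z : ℕ}
    (hS : Good S) (hx : x ∉ pts S) (hy : y ∉ pts S) (hz : z ∉ pts S) (hxy : x ≠ y) (hyz : y ≠ z)
    (hxz : x ≠ z) (he : Enum e (insert x (insert y (insert z (pts S))))) (M : ℕ → π) (T : π)
    (d : Bool) : ∃ D E F : DegRigid π N, IsTriangle D E F ∧
      D.1 = lineCirc e M T (insert (arw d x y) (insert (arw d x z) S)) ∧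
      E.1 = lineCirc e M T (insert (arw d x y) (insert (arw d y z) S)) ∧
      F.1 = lineCirc e M T (insert (arw d x z) (insert (arw d z y) S)) := by
  have he2 : Enum e (insert y (insert x (insert z (pts S)))) := by
    rwa [Finset.insert_comm]
  have he3 : Enum e (insert z (insert x (insert y (pts S)))) := by
    rwa [Finset.insert_comm, Finset.insert_comm z]
  have dE := isDeg_lineCirc (d := !d) (d' := d) hS hy hx hz hxy.symm hyz hxz he2 M T
  have dF := isDeg_lineCirc (d := !d) (d' := d) hS hz hx hy hxz.symm hyz.symm hxy he3 M T
  rw [← arw_swap] at dE dF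
  refine ⟨⟨_, isDeg_lineCirc hS hx hy hz hxy hxz hyz he M T⟩, ⟨_, dE⟩, ⟨_, dF⟩, ?_, rfl, rfl, rfl⟩
  obtain ⟨i, rfl⟩ := (he.mem x).1 (by simp)
  obtain ⟨j, rfl⟩ := (he.mem y).1 (by simp)
  obtain ⟨k, rfl⟩ := (he.mem z).1 (by simp)
  refine ⟨⟨rfl, rfl⟩, i, j, k, fun a b hab => ?_, ?_⟩
  · simp only [lineCirc]
    have hinj := he.mono.injective
    constructor <;> rw [mem_insert_two_iff hinj (P := fun a => a = i ∨ a = j ∨ a = k)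
      (by simp) (by simp) (by simp) (by simp) hab, mem_insert_two_iff hinj
      (P := fun a => a = i ∨ a = j ∨ a = k) (by simp) (by simp) (by simp) (by simp) hab]
  · cases d
    · right; simp [lineCirc, arw]
    · left; simp [lineCirc, arw]

/-- In each of the three applications of `dW_line` the direction signs compensate the reordering of
the three points, so that the cyclic orientation of `x`, `y`, `z` is a common factor and the
differences of the six-term relation appear with equal signs. -/
theorem dW_sites {w : π →* ℤˣ} (𝒜w : WArrowSeries w) {M : ℕ → π} {T : π} {S : Finset (ℕ × ℕ)}
    {x₁ x₂ y₁ y₂ z₁ z₂ : ℕ} (h : Sites M S x₁ x₂ y₁ y₂ z₁ z₂) {N : ℕ} {e : Fin N → ℕ}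
    (he : Enum e (insert x₂ (insert y₂ (insert z₂ (pts S))))) {X Y Z : DegRigid π N}
    (hX : X.1 = lineCirc e M T (insert (x₂, y₂) (insert (x₂, z₂) S)))
    (hY : Y.1 = lineCirc e M T (insert (x₂, y₂) (insert (y₂, z₂) S)))
    (hZ : Z.1 = lineCirc e M T (insert (x₂, z₂) (insert (y₂, z₂) S))) :
    (dW w 𝒜w).1 (wDegDiagram w X) + (dW w 𝒜w).1 (wDegDiagram w Y) +
      (dW w 𝒜w).1 (wDegDiagram w Z) =
    (((ordSign x₂ y₂ * ordSign y₂ z₂ * ordSign x₂ z₂ : ℤˣ) : ℤ) : ℚ) *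
      (diffX (weight (wS w 𝒜w).1) M T S x₁ x₂ y₂ z₂ + diffY (weight (wS w 𝒜w).1) M T S x₂ y₁ y₂ z₂
        + diffZ (weight (wS w 𝒜w).1) M T S x₂ y₂ z₁ z₂) := by
  obtain ⟨X, dX⟩ := X
  obtain ⟨Y, dY⟩ := Y
  obtain ⟨Z, dZ⟩ := Z
  subst hX hY hZ
  have h1 := h.x
  have h2 := h.y
  have h3 := h.z
  have h4 := h.xy
  have h5 := h.yz
  have h6 := h.xz
  have nx : x₂ ∉ pts S := h.notMem (.inl ⟨h1.le, le_rfl⟩)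
  have ny : y₂ ∉ pts S := h.notMem (.inr (.inl ⟨h2.le, le_rfl⟩))
  have nz : z₂ ∉ pts S := h.notMem (.inr (.inr ⟨h3.le, le_rfl⟩))
  have pX : pts (insert (arw true x₂ y₂) (insert (arw true x₂ z₂) S)) =
      insert x₂ (insert y₂ (insert z₂ (pts S))) := by
    ext r
    rw [mem_pts_insert_arw_two, or_self_left]
    simp only [Finset.mem_insert]
  have pY : pts (insert (arw false y₂ x₂) (insert (arw true y₂ z₂) S)) =
      insert x₂ (insert y₂ (insert z₂ (pts S))) := by
    ext r
    rw [mem_pts_insert_arw_two, or_self_left, or_left_comm]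
    simp only [Finset.mem_insert]
  have pZ : pts (insert (arw false z₂ x₂) (insert (arw false z₂ y₂) S)) =
      insert x₂ (insert y₂ (insert z₂ (pts S))) := by
    ext r
    rw [mem_pts_insert_arw_two, or_self_left, or_left_comm, or_left_comm (a := r = z₂)]
    simp only [Finset.mem_insert]
  have kX := dW_line 𝒜w (T := T) h.good h1 h.Mx h.sx (a := y₂) (b := z₂) (d := true) (d' := true)
    (by omega) (by omega) ny nz (by omega) (pX ▸ he) dX
  have kY := dW_line 𝒜w (T := T) h.good h2 h.My h.sy (a := x₂) (b := z₂) (d := false) (d' := true)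
    (by omega) (by omega) nx nz (by omega) (pY ▸ he) dY
  have kZ := dW_line 𝒜w (T := T) h.good h3 h.Mz h.sz (a := x₂) (b := y₂) (d := false) (d' := false)
    (by omega) (by omega) nx ny (by omega) (pZ ▸ he) dZ
  have o1 : ordSign y₂ x₂ = -ordSign x₂ y₂ := ordSign_swap (by omega)
  have o2 : ordSign z₂ x₂ = -ordSign x₂ z₂ := ordSign_swap (by omega)
  have o3 : ordSign z₂ y₂ = -ordSign y₂ z₂ := ordSign_swap (by omega)
  rw [o1] at kY
  rw [o2, o3] at kZ
  refine (congrArg₂ (· + ·) (congrArg₂ (· + ·) kX kY) kZ).trans ?_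
  simp only [dirSign, cond, arw, diffX, diffY, diffZ]
  push_cast
  ring

/-- A degenerate diagram on a line with three edges with decoration `1`. -/
theorem exists_sites {N : ℕ} (A : DegRigid π N) {c u v : Fin N} (huv : u ≠ v) (hu : A.1.inc c u)
    (hv : A.1.inc c v) : ∃ (M : ℕ → π) (T : π) (S : Finset (ℕ × ℕ)) (e : Fin N → ℕ) (d d' : Bool)
      (u₁ c₁ v₁ : ℕ), (d = true ↔ A.1.arr c u) ∧ (d' = true ↔ A.1.arr c v) ∧
      Sites M S u₁ (e u) c₁ (e c) v₁ (e v) ∧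
      Enum e (insert (e u) (insert (e c) (insert (e v) (pts S)))) ∧
      A.1 = lineCirc e M T (insert (arw d (e c) (e u)) (insert (arw d' (e c) (e v)) S)) := by
  classical
  obtain ⟨h1, h2⟩ := A.2.of_center huv hu hv
  have hex : ∀ i, ∃ j, A.1.inc i j := by
    intro i
    by_cases hi : i = c
    · exact ⟨u, hi ▸ hu⟩
    · exact (h1 i hi).exists
  obtain ⟨M, T, R, he, hA⟩ := exists_lineCirc A.1 hex
  -- Points are placed at odd numbers. The even number just below each of `u`, `c`, `v` becomes the
  -- other end of a new edge decorated by `1`, because `M (n / 2)` is the same at both.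
  set f : ℕ → ℕ := fun n => 2 * n + 1 with hf
  set e : Fin N → ℕ := f ∘ Fin.val with hedef
  have hfm : StrictMono f := fun a b h => by simp only [hf]; omega
  have hA2 := (lineCirc_mapArr he subset_rfl (hfm.strictMonoOn _) (M := M)
    (M' := fun n => M (n / 2)) T fun p _ => by
      simp only [hf]; congr 1; omega).symm
  rw [← hA] at hA2
  have he2 : Enum e (pts (mapArr f R)) := pts_mapArr f R ▸ he.comp (hfm.strictMonoOn _)
  set S₁ := mapArr f R with hS₁
  have hinj := he2.mono.injective
  have harr : ∀ i j, (e i, e j) ∈ S₁ ↔ A.1.arr i j := fun i j => by rw [hA2]; rfl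
  have hinc : ∀ i j, ((e i, e j) ∈ S₁ ∨ (e j, e i) ∈ S₁) ↔ A.1.inc i j := fun i j =>
    or_congr (harr i j) (harr j i)
  set S := S₁.filter fun a => a.1 ≠ e c ∧ a.2 ≠ e c with hS
  have hSe : ∀ a ∈ S, ∃ i j, a = (e i, e j) ∧ A.1.arr i j ∧ i ≠ c ∧ j ≠ c := by
    rintro ⟨p, q⟩ ha
    obtain ⟨ha, ha1, ha2⟩ := Finset.mem_filter.1 ha
    obtain ⟨i, rfl⟩ := (he2.mem p).1 (fst_mem_pts ha)
    obtain ⟨j, rfl⟩ := (he2.mem q).1 (snd_mem_pts ha)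
    exact ⟨i, j, rfl, (harr i j).1 ha, fun h => ha1 (congrArg e h), fun h => ha2 (congrArg e h)⟩
  have hcu : u ≠ c := by rintro rfl; exact A.2.1.not_inc _ hu
  have hcv : v ≠ c := by rintro rfl; exact A.2.1.not_inc _ hv
  have hpS : ∀ r ∈ pts S, ∃ k, r = e k ∧ k ≠ c ∧ k ≠ u ∧ k ≠ v := by
    have key : ∀ {i j}, A.1.inc i j → i ≠ c → j ≠ c → i ≠ u ∧ i ≠ v := by
      intro i j h hi hj
      constructor
      · rintro rfl; exact hj ((h1 _ hi).unique h hu.symm)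
      · rintro rfl; exact hj ((h1 _ hi).unique h hv.symm)
    intro r hr
    obtain ⟨a, ha, h⟩ := mem_pts.1 hr
    obtain ⟨i, j, rfl, hij, hi, hj⟩ := hSe a ha
    rcases h with rfl | rfl
    · exact ⟨i, rfl, hi, key (.inl hij) hi hj⟩
    · exact ⟨j, rfl, hj, key (.inr hij) hj hi⟩
  have hgood : Good S := by
    constructor
    · intro a ha h
      obtain ⟨i, j, rfl, hij, -⟩ := hSe a ha
      obtain rfl := hinj h
      exact A.2.1 _ _ hij hij
    · intro a ha b hb hab
      obtain ⟨i, j, rfl, hij, hi, hj⟩ := hSe a ha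
      obtain ⟨k, l, rfl, hkl, hk, hl⟩ := hSe b hb
      refine ⟨fun h => ?_, fun h => ?_, fun h => ?_, fun h => ?_⟩ <;> obtain rfl := hinj h
      · exact hab (by rw [(h1 i hi).unique (.inl hij) (.inl hkl)])
      · obtain rfl := (h1 i hi).unique (.inl hij) (.inr hkl)
        exact A.2.1 _ _ hij hkl
      · obtain rfl := (h1 j hj).unique (.inr hij) (.inl hkl)
        exact A.2.1 _ _ hij hkl
      · exact hab (by rw [(h1 j hj).unique (.inr hij) (.inr hkl)])
  have hval : ∀ {i j : Fin N}, i ≠ j → i.val ≠ j.val := fun h h' => h (Fin.ext h')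
  have hS₁S : S₁ = insert (arw (decide (A.1.arr c u)) (e c) (e u))
      (insert (arw (decide (A.1.arr c v)) (e c) (e v)) S) := by
    have hmem : ∀ x, A.1.inc c x → arw (decide (A.1.arr c x)) (e c) (e x) ∈ S₁ := by
      intro x hx
      by_cases h : A.1.arr c x
      · simp only [h, decide_true, arw, cond]; exact (harr _ _).2 h
      · simp only [h, decide_false, arw, cond]; exact (harr _ _).2 (hx.resolve_left h)
    have hout : ∀ x, A.1.arr c x → (e c, e x) = arw (decide (A.1.arr c x)) (e c) (e x) := by
      intro x h
      simp only [h, decide_true, arw, cond]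
    have hin : ∀ x, A.1.arr x c → (e x, e c) = arw (decide (A.1.arr c x)) (e c) (e x) := by
      intro x h
      simp only [A.2.1 _ _ h, decide_false, arw, cond]
    ext ⟨p, q⟩
    rw [Finset.mem_insert, Finset.mem_insert]
    constructor
    · intro h
      obtain ⟨i, rfl⟩ := (he2.mem p).1 (fst_mem_pts h)
      obtain ⟨j, rfl⟩ := (he2.mem q).1 (snd_mem_pts h)
      have h' := (harr i j).1 h
      by_cases hi : i = c
      · subst hi
        rcases (h2 j).1 (.inl h') with rfl | rfl
        · exact .inl (hout _ h')
        · exact .inr (.inl (hout _ h'))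
      · by_cases hj : j = c
        · subst hj
          rcases (h2 i).1 (.inr h') with rfl | rfl
          · exact .inl (hin _ h')
          · exact .inr (.inl (hin _ h'))
        · exact .inr (.inr (Finset.mem_filter.2 ⟨h, hinj.ne hi, hinj.ne hj⟩))
    · rintro (h | h | h)
      · rw [h]; exact hmem u hu
      · rw [h]; exact hmem v hv
      · exact (Finset.mem_filter.1 h).1
  have hsite : ∀ x, x = c ∨ x = u ∨ x = v → ∀ r ∈ pts S, r < 2 * x.val ∨ e x < r := by
    intro x hx r hr
    obtain ⟨k, rfl, hk1, hk2, hk3⟩ := hpS r hr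
    have : k ≠ x := by rcases hx with rfl | rfl | rfl <;> assumption
    have := hval this
    change 2 * k.val + 1 < 2 * x.val ∨ 2 * x.val + 1 < 2 * k.val + 1
    omega
  have hsep : ∀ x y : Fin N, x ≠ y → e x < 2 * y.val ∨ e y < 2 * x.val := by
    intro x y hxy
    have := hval hxy
    change 2 * x.val + 1 < 2 * y.val ∨ 2 * y.val + 1 < 2 * x.val
    omega
  have hM : ∀ x : Fin N, M (2 * x.val / 2) = M (e x / 2) := fun x => by
    congr 1
    change _ = (2 * x.val + 1) / 2
    omega
  have hlt : ∀ x : Fin N, 2 * x.val < e x := fun x => Nat.lt_succ_self _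
  refine ⟨fun n => M (n / 2), T, S, e, _, _, 2 * u.val, 2 * c.val, 2 * v.val, decide_eq_true_iff,
    decide_eq_true_iff, ⟨hgood, hlt u, hlt c, hlt v, hM u, hM c, hM v, hsite u (by simp),
      hsite c (by simp), hsite v (by simp), hsep u c hcu, hsep c v hcv.symm, hsep u v huv⟩, ?_,
    hS₁S ▸ hA2⟩
  convert he2 using 1
  ext r
  rw [hS₁S, mem_pts_insert_arw_two, or_self_left, or_left_comm]
  simp only [Finset.mem_insert]

/-- The triangles that contain a given monotonic diagram on a line. -/
theorem Sites.exists_triangles {M : ℕ → π} {S : Finset (ℕ × ℕ)} {x₁ x₂ y₁ y₂ z₁ z₂ : ℕ}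
    (h : Sites M S x₁ x₂ y₁ y₂ z₁ z₂) (T : π) {N : ℕ} {e : Fin N → ℕ}
    (he : Enum e (insert x₂ (insert y₂ (insert z₂ (pts S))))) :
    ∃ X Y Z F₁ F₂ : DegRigid π N,
      X.1 = lineCirc e M T (insert (x₂, y₂) (insert (x₂, z₂) S)) ∧
      Y.1 = lineCirc e M T (insert (x₂, y₂) (insert (y₂, z₂) S)) ∧
      Z.1 = lineCirc e M T (insert (x₂, z₂) (insert (y₂, z₂) S)) ∧
      IsTriangle X Y F₁ ∧ IsTriangle Z Y F₂ := by
  have h1 := h.x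
  have h2 := h.y
  have h3 := h.z
  have h4 := h.xy
  have h5 := h.yz
  have h6 := h.xz
  have nx : x₂ ∉ pts S := h.notMem (.inl ⟨h1.le, le_rfl⟩)
  have ny : y₂ ∉ pts S := h.notMem (.inr (.inl ⟨h2.le, le_rfl⟩))
  have nz : z₂ ∉ pts S := h.notMem (.inr (.inr ⟨h3.le, le_rfl⟩))
  obtain ⟨X, Y, F₁, t1, e1, e2, -⟩ := exists_triangle_line h.good nx ny nz (by omega) (by omega)
    (by omega) he M T true
  have he' : Enum e (insert z₂ (insert y₂ (insert x₂ (pts S)))) := by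
    rwa [Finset.insert_comm, Finset.insert_comm z₂ x₂, Finset.insert_comm y₂ x₂]
  obtain ⟨Z, Y', F₂, t2, e3, e4, -⟩ := exists_triangle_line h.good nz ny nx (by omega) (by omega)
    (by omega) he' M T false
  have hY : Y' = Y := Subtype.ext (by
    rw [e4, e2, Finset.insert_comm]
    rfl)
  subst hY
  refine ⟨X, Y', Z, F₁, F₂, e1, e2, ?_, t1, t2⟩
  rw [e3, Finset.insert_comm]
  rfl

/-! ### Six-term relations and the span of the triangle relators -/

theorem IsTriangle.isOut {N : ℕ} {X Y F : DegRigid π N} (h : IsTriangle X Y F) {p c q : Fin N}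
    (hp : Y.1.arr p c) (hq : Y.1.arr c q) (hX : X.1.arr p c) : IsOut X Y p c q :=
  (h.isOut_or_isIn hp hq).resolve_right fun hi => h.not_mono ⟨c, p, q, hX, hi.2.2.1⟩

theorem IsTriangle.isIn {N : ℕ} {X Y F : DegRigid π N} (h : IsTriangle X Y F) {p c q : Fin N}
    (hp : Y.1.arr p c) (hq : Y.1.arr c q) (hX : X.1.arr c q) : IsIn X Y p c q :=
  (h.isOut_or_isIn hp hq).resolve_left fun hi => h.not_mono ⟨c, p, q, hi.2.2.1, hX⟩

theorem triangleSubmodule_mem_iff {w : π →* ℤˣ} {φ : WDegSeries w} :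
    φ ∈ triangleSubmodule w ↔ ∃ c : triangleRelators w → ℚ, ∀ X, ∑ᶠ r, c r * r.1 X = φ.1 X := by
  constructor
  · rintro ⟨c, hc⟩
    exact ⟨c, fun X => congrFun hc X⟩
  · rintro ⟨c, hc⟩
    exact ⟨c, funext hc⟩

theorem sW_eq_zero_iff {w : π →* ℤˣ} {φ : WDegSeries w} :
    sW w φ = 0 ↔ φ ∈ triangleSubmodule w := by
  rw [sW, Submodule.mkQ_apply, Submodule.Quotient.mk_eq_zero]

theorem finsum_relators_add {w : π →* ℤˣ} {c : triangleRelators w → ℚ} {A B C : WDegDiagram w}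
    (h : ∀ r ∈ triangleRelators w, r A + r B + r C = 0) :
    (∑ᶠ r, c r * r.1 A) + (∑ᶠ r, c r * r.1 B) + (∑ᶠ r, c r * r.1 C) = 0 := by
  have hf : ∀ X, (Function.support fun r : triangleRelators w => c r * r.1 X).Finite := fun X =>
    (triangleRelators_finite w X).subset fun r hr => right_ne_zero_of_mul hr
  rw [← finsum_add_distrib (hf A) (hf B), ← finsum_add_distrib ?_ (hf C)]
  · refine finsum_eq_zero_of_forall_eq_zero fun r => ?_
    rw [← mul_add, ← mul_add, h r.1 r.2, mul_zero]
  · exact ((hf A).union (hf B)).subset (Function.support_add _ _)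

/-- The sum of the coefficients at `X`, `Y`, `Z` vanishes for every relator, hence also for infinite
combinations, as only finitely many relators involve a given diagram. By `dW_sites` this sum is a
six-term expression up to sign. -/
theorem sixTerm_of_sW {w : π →* ℤˣ} {𝒜w : WArrowSeries w} (h : sW w (dW w 𝒜w) = 0) :
    SixTerm (weight (wS w 𝒜w).1) := by
  obtain ⟨c, hc⟩ := triangleSubmodule_mem_iff.1 (sW_eq_zero_iff.1 h)
  intro M T S x₁ x₂ y₁ y₂ z₁ z₂ hs
  have he := enum_orderEmbOfFin (insert x₂ (insert y₂ (insert z₂ (pts S))))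
  obtain ⟨X, Y, Z, F₁, F₂, hX, hY, hZ, t1, t2⟩ := hs.exists_triangles T he
  have hd := dW_sites 𝒜w hs he hX hY hZ
  obtain ⟨i, hi⟩ := (he.mem x₂).1 (by simp)
  obtain ⟨j, hj⟩ := (he.mem y₂).1 (by simp)
  obtain ⟨k, hk⟩ := (he.mem z₂).1 (by simp)
  have a1 : Y.1.arr i j := by rw [hY]; simp only [lineCirc, hi, hj]; simp
  have a2 : Y.1.arr j k := by rw [hY]; simp only [lineCirc, hj, hk]; simp
  have a3 : X.1.arr i j := by rw [hX]; simp only [lineCirc, hi, hj]; simp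
  have a4 : Z.1.arr j k := by rw [hZ]; simp only [lineCirc, hj, hk]; simp
  have hsum : (dW w 𝒜w).1 (wDegDiagram w X) + (dW w 𝒜w).1 (wDegDiagram w Y) +
      (dW w 𝒜w).1 (wDegDiagram w Z) = 0 := by
    rw [← hc, ← hc, ← hc]
    exact finsum_relators_add fun r hr =>
      (t1.isOut a1 a2 a3).relator_sum a1 a2 (t2.isIn a1 a2 a4) t1 t2 hr
  rw [hsum, eq_comm, mul_eq_zero] at hd
  exact (hs.sum_slide _ T (.inr rfl) (.inr rfl) (.inr rfl)).symm.trans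
    (hd.resolve_left (by simp))

/-- A monotonic diagram comes from three edges on a line, so the six-term relation holds for it and
the two non monotonic diagrams that form triangles with it. -/
theorem exists_triangles_of_mono {N : ℕ} (A : DegRigid π N) {p c q : Fin N} (hp : A.1.arr p c)
    (hq : A.1.arr c q) : ∃ D₁ D₂ F₁ F₂ : DegRigid π N, IsTriangle D₁ A F₁ ∧ IsTriangle D₂ A F₂ ∧
      IsOut D₁ A p c q ∧ IsIn D₂ A p c q ∧ ∀ (w : π →* ℤˣ) (𝒜w : WArrowSeries w),
        SixTerm (weight (wS w 𝒜w).1) → (dW w 𝒜w).1 (wDegDiagram w D₁) +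
          (dW w 𝒜w).1 (wDegDiagram w A) + (dW w 𝒜w).1 (wDegDiagram w D₂) = 0 := by
  have hpq : p ≠ q := by rintro rfl; exact A.2.1 _ _ hp hq
  obtain ⟨M, T, S, e, d, d', u₁, c₁, v₁, hd, hd', hs, he, hA⟩ :=
    exists_sites A hpq (.inr hp) (.inl hq)
  obtain rfl : d = false := by
    rw [← Bool.not_eq_true, hd]; exact A.2.1 _ _ hp
  obtain rfl : d' = true := hd'.2 hq
  obtain ⟨X, Y, Z, F₁, F₂, hX, hY, hZ, t1, t2⟩ := hs.exists_triangles T he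
  obtain rfl : Y = A := Subtype.ext (hY.trans hA.symm)
  refine ⟨X, Z, F₁, F₂, t1, t2, t1.isOut hp hq ?_, t2.isIn hp hq ?_, fun w 𝒜w h6 => ?_⟩
  · rw [hX]; simp [lineCirc]
  · rw [hZ]; simp [lineCirc]
  · rw [dW_sites 𝒜w hs he hX hY hZ, h6.slide hs T (.inr rfl) (.inr rfl) (.inr rfl), mul_zero]

theorem exists_triangle_of_not_mono {N : ℕ} (A : DegRigid π N) (h : ¬ A.1.Mono) :
    ∃ E F, IsTriangle A E F := by
  obtain ⟨c, -, u, v, huv, hc⟩ := A.2.2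
  have hu := (hc u).2 (.inl rfl)
  have hv := (hc v).2 (.inr rfl)
  obtain ⟨M, T, S, e, d, d', u₁, c₁, v₁, hd, hd', hs, he, hA⟩ := exists_sites A huv hu hv
  obtain rfl : d = d' := by
    rw [Bool.eq_iff_iff, hd, hd']
    constructor
    · intro h1
      by_contra h2
      exact h ⟨c, v, u, hv.resolve_left h2, h1⟩
    · intro h1
      by_contra h2
      exact h ⟨c, u, v, hu.resolve_left h2, h1⟩
  have hxy := hs.xy
  have hyz := hs.yz
  have hxz := hs.xz
  have hx := hs.x
  have hy := hs.y
  have hz := hs.z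
  rw [Finset.insert_comm] at he
  obtain ⟨D, E, F, hT, hD, -⟩ := exists_triangle_line hs.good
    (hs.notMem (.inr (.inl ⟨hy.le, le_rfl⟩))) (hs.notMem (.inl ⟨hx.le, le_rfl⟩))
    (hs.notMem (.inr (.inr ⟨hz.le, le_rfl⟩))) (by omega) (by omega) (by omega) he M T d
  obtain rfl : D = A := Subtype.ext (hD.trans hA.symm)
  exact ⟨E, F, hT⟩

/-- The relator D - E - F is taken with the coefficient of d_w at D. This is right at the non
monotonic diagrams, since each lies in exactly one relator. At a monotonic diagram, both the
combination and d_w have the negative of the sum of the coefficients at the two non monotonic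
diagrams in triangles with it. -/
theorem sW_of_sixTerm {w : π →* ℤˣ} {𝒜w : WArrowSeries w}
    (h : SixTerm (weight (wS w 𝒜w).1)) : sW w (dW w 𝒜w) = 0 := by
  classical
  rw [sW_eq_zero_iff, triangleSubmodule_mem_iff]
  have hr : ∀ r : triangleRelators w, ∃ (X : WDegDiagram w), ∃ (N : ℕ) (D E F : DegRigid π N),
      X = wDegDiagram w D ∧ IsTriangle D E F ∧ r.1 = Finsupp.single (wDegDiagram w D) 1 -
        Finsupp.single (wDegDiagram w E) 1 - Finsupp.single (wDegDiagram w F) 1 := by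
    rintro ⟨r, N, D, E, F, hT, rfl⟩
    exact ⟨_, N, D, E, F, rfl, hT, rfl⟩
  choose X hX using hr
  refine ⟨fun r => (dW w 𝒜w).1 (X r), ?_⟩
  have hnm : ∀ {N : ℕ} (D : DegRigid π N), ¬ D.1.Mono →
      ∑ᶠ r : triangleRelators w, (dW w 𝒜w).1 (X r) * r.1 (wDegDiagram w D) =
        (dW w 𝒜w).1 (wDegDiagram w D) := by
    intro N D hD
    obtain ⟨E, F, hT⟩ := exists_triangle_of_not_mono D hD
    have hz : ∀ {L : ℕ} {A : DegRigid π L}, A.1.Mono → wDegDiagram w A ≠ wDegDiagram w D := by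
      intro L A hA he
      obtain rfl : L = N := congrArg Sigma.fst he
      exact hD (Circ.mono_of_wDegDiagram_eq he hA)
    have hval : ∀ r : triangleRelators w, r.1 (wDegDiagram w D) =
        if X r = wDegDiagram w D then 1 else 0 := by
      intro r
      obtain ⟨L, D', E', F', e1, hT', e2⟩ := hX r
      rw [e2, e1, Finsupp.sub_apply, Finsupp.sub_apply, Finsupp.single_eq_of_ne' (hz hT'.mono),
        Finsupp.single_eq_of_ne' (hz hT'.symm.mono), sub_zero, sub_zero, Finsupp.single_apply]
    set r₀ : triangleRelators w := ⟨_, N, D, E, F, hT, rfl⟩ with hr₀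
    have huniq : ∀ r : triangleRelators w, X r = wDegDiagram w D → r = r₀ := by
      intro r hXr
      obtain ⟨L, D', E', F', e1, hT', e2⟩ := hX r
      have e3 := e1.symm.trans hXr
      obtain rfl : L = N := congrArg Sigma.fst e3
      obtain ⟨ρ, D'', E'', F'', hT'', hD'', -, m1, m2, m3⟩ := hT'.transport (.inl rfl) e3
      obtain rfl := hD'' rfl
      refine Subtype.ext ?_
      rw [e2, m1.1, m2.1, m3.1, hr₀]
      rcases hT.unique hT'' with ⟨rfl, rfl⟩ | ⟨rfl, rfl⟩
      · rfl
      · exact sub_right_comm _ _ _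
    -- `X` was obtained by choice, from some presentation of the relator. The value 1 of `r₀` at `D`
    -- shows that it chose `D`.
    have h0 : X r₀ = wDegDiagram w D := by
      by_contra hne
      have h1 := hval r₀
      rw [if_neg hne, hr₀] at h1
      simp only [Finsupp.sub_apply, Finsupp.single_eq_same,
        Finsupp.single_eq_of_ne' (hz hT.mono), Finsupp.single_eq_of_ne' (hz hT.symm.mono)] at h1
      norm_num at h1
    rw [finsum_eq_single _ r₀ fun r hr => ?_]
    · rw [hval, h0, if_pos rfl, mul_one]
    · rw [hval, if_neg fun h => hr (huniq r h), mul_zero]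
  rintro ⟨N, q⟩
  induction q using Quotient.inductionOn' with
  | h q =>
  induction q using Quotient.inductionOn with
  | h A =>
  change ∑ᶠ r : triangleRelators w, (dW w 𝒜w).1 (X r) * r.1 (wDegDiagram w A) =
    (dW w 𝒜w).1 (wDegDiagram w A)
  by_cases hA : A.1.Mono
  · obtain ⟨c, p, q, hp, hq⟩ := hA
    obtain ⟨D₁, D₂, F₁, F₂, t1, t2, o1, o2, hs⟩ := exists_triangles_of_mono A hp hq
    have h1 := finsum_relators_add (c := fun r => (dW w 𝒜w).1 (X r)) fun r hr =>
      o1.relator_sum (w := w) hp hq o2 t1 t2 hr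
    rw [hnm D₁ t1.not_mono, hnm D₂ t2.not_mono] at h1
    have h2 := hs w 𝒜w h
    linarith
  · exact hnm A hA

/-! ### Arrow diagram formulas -/

/-- Virtual knot types are generated by single moves, so invariance need only be tested on these. -/
theorem isArrowDiagramFormula_iff {w : π →* ℤˣ} {𝒜 : ArrowSeries π} :
    IsArrowDiagramFormula w 𝒜 ↔ ∀ G G' : Σ N : ℕ, GaussRigid π N, Move w G G' →
      subSum (weight 𝒜.1) G.2 = subSum (weight 𝒜.1) G'.2 := by
  simp only [IsArrowDiagramFormula, pair_twistedS]
  constructor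
  · exact fun h G G' hG => h G G' (.rel _ _ hG)
  · intro h G G' hG
    induction hG with
    | rel G G' hG => exact h G G' hG
    | refl => rfl
    | symm _ _ _ ih => exact ih.symm
    | trans _ _ _ _ _ ih ih' => exact ih.trans ih'

theorem subSum_eq_of_move {w : π →* ℤˣ} {φ : ArrowDiagram π → ℚ} (hw : WInvariant w φ)
    (h1 : LineAP1 φ) (h2 : LineAP2 φ) (h6 : SixTerm φ) {G G' : Σ N : ℕ, GaussRigid π N}
    (h : Move w G G') : subSum φ G.2 = subSum φ G'.2 := by
  cases h with
  | rotation G ρ => exact (subSum_smul φ G ρ).symm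
  | conjugacy G G' h hs => exact subSum_conj hw.line h hs
  | r1 G i h hi K hK => exact subSum_r1 h1 G i h hi K hK
  | r2 G i j h hi hj hs K hK => exact subSum_r2 h2 G i j h hi hj hs K hK
  | r3 G G' i j k hd hi hj hk hij hjk hik hs hu hm τ hτ ha hsg =>
    exact subSum_r3 h6 h2 hd hi hj hk hij hjk hik hs hu hm (τ := τ)
      (by rw [hτ]; exact flips_flip hd) ha hsg

end GaussTheory

theorem mainTheorem5 {π : Type*} [Group π] (w : π →* ℤˣ) (𝒜 : GaussTheory.ArrowSeries π) :
    GaussTheory.IsArrowDiagramFormula w 𝒜 ↔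
      ∃ 𝒜w : GaussTheory.WArrowSeries w,
        GaussTheory.wS w 𝒜w = 𝒜 ∧
        GaussTheory.sW w (GaussTheory.dW w 𝒜w) = 0 ∧
        (∀ r ∈ GaussTheory.AP1 π, GaussTheory.pair 𝒜w.1 (GaussTheory.wT w r) = 0) ∧
        (∀ r ∈ GaussTheory.AP2 π, GaussTheory.pair 𝒜w.1 (GaussTheory.wT w r) = 0) := by
  open GaussTheory in
  rw [isArrowDiagramFormula_iff]
  constructor
  · intro h
    obtain ⟨𝒜w, rfl⟩ := exists_wS (lineInvariant_of_move h).wInvariant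
    refine ⟨𝒜w, rfl, sW_of_sixTerm (sixTerm_of_move h), ?_, ?_⟩
    · rintro _ ⟨N, A, i, hi, hm, rfl⟩
      rw [pair_wT rfl]
      exact lineAP1_iff.1 (lineAP1_of_move h) N A i hi hm
    · rintro _ ⟨N, A, i, j, hij, hi, hj, rfl⟩
      rw [pair_wT rfl]
      exact lineAP2_iff.1 (lineAP2_of_move h) N A i j hij hi hj
  · rintro ⟨𝒜w, rfl, h6, h1, h2⟩ G G' h
    refine subSum_eq_of_move (wInvariant_wS 𝒜w) ?_ ?_ (sixTerm_of_sW h6) h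
    · refine lineAP1_iff.2 fun N A i hi hm => ?_
      rw [← pair_wT rfl]
      exact h1 _ ⟨N, A, i, hi, hm, rfl⟩
    · refine lineAP2_iff.2 fun N A i j hij hi hj => ?_
      rw [← pair_wT rfl]
      exact h2 _ ⟨N, A, i, j, hij, hi, hj, rfl⟩
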